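/- Let $E$ be a second countable locally compact Hausdorff groupoid with unit space $E^{(0)}$, range and source maps $r,s$. An $E$-dynamical system $(A,\alpha)$ consists of an upper semicontinuous $C^*$-bundle $\mathcal A$ over $E^{(0)}$ with fibres $A(u)$, whose section algebra $A=\Gamma_0(E^{(0)},\mathcal A)$ (continuous sections vanishing at infinity) is separable, together with $*$-isomorphisms $\alpha_\gamma:A(s(\gamma))\to A(r(\gamma))$, $\gamma\in E$, such that $\alpha_{\gamma\eta}=\alpha_\gamma\alpha_\eta$ for composable $\gamma,\eta$ and $(\gamma,a)\mapsto\alpha_\gamma(a)$ is continuous on $\{(\gamma,a)\in E\times\mathcal A: a\in A(s(\gamma))\}$. Two systems $(A,\alpha)$ and $(B,\beta)$ are equivariantly Morita equivalent if there are an upper semicontinuous Banach bundle $\mathcal Z$ over $E^{(0)}$, whose fibres $Z(u)$ are $A(u)$-$B(u)$-imprimitivity bimodules such that the two module actions and the two inner products are continuous on the fibred products, and norm preserving isomorphisms $V_\gamma:Z(s(\gamma))\to Z(r(\gamma))$ with $V_{\gamma\eta}=V_\gamma V_\eta$, jointly continuous in the same sense, satisfying $$ {}_{A(r(\gamma))}\langle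 V_\gamma\xi,V_\gamma\zeta\rangle=\alpha_\gamma\bigl({}_{A(s(\gamma))}\langle\xi,\zeta\rangle\bigr),\qquad \langle V_\gamma\xi,V_\gamma\zeta\rangle_{B(r(\gamma))}=\beta_\gamma\bigl(\langle\xi,\zeta\rangle_{B(s(\gamma))}\bigr).$$ Let $S(E)$ be the set of equivalence classes $[A,\alpha]$. For systems $(A,\alpha)$, $(B,\beta)$ let $A\otimes_{E^{(0)}}B$ be the quotient of the maximal tensor product $A\otimes_{\max}B$ by the closed ideal generated by all $(\phi\cdot a)\otimes b-a\otimes(\phi\cdot b)$ with $a\in A$, $b\in B$, $\phi\in C_0(E^{(0)})$. It is a $C_0(E^{(0)})$-algebra via $\phi\cdot(a\otimes b)=(\phi\cdot a)\otimes b$, hence the section algebra of an upper semicontinuous $C^*$-bundle, and $\alpha\otimes\beta$ denotes the action on this bundle with $(\alpha\otimes\beta)_\gamma(a\otimes b)=\alpha_\gamma(a)\otimes\beta_\gamma(b)$ for $a\in A(s(\gamma))$, $b\in B(s(\gamma))$. Let $(C_0(E^{(0)}),\mathrm{lt})$ be the product bundle $E^{(0)}\times\mathbb C$ with the action $\mathrm{lt}_\gamma(s(\gamma),\kappa)=(r(\gamma),\kappa)$.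 Then equivariant Morita equivalence is an equivalence relation; for any two $E$-dynamical systems $(A,\alpha)$, $(B,\beta)$ the $E$-dynamical system $(A\otimes_{E^{(0)}}B,\alpha\otimes\beta)$ exists; and $$[A,\alpha]\,[B,\beta]:=[A\otimes_{E^{(0)}}B,\ \alpha\otimes\beta]$$ is a well defined binary operation on $S(E)$, which makes $S(E)$ a commutative monoid with identity $[C_0(E^{(0)}),\mathrm{lt}]$. -/

import Mathlib

open CategoryTheory Topology Filter TopologicalSpace
open scoped TensorProduct ZeroAtInfty

universe u v w

noncomputable section

namespace BrauerSemigroup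

/-! ### Topological groupoids

The groupoid `E` is a Mathlib groupoid with object type `X = E⁽⁰⁾`; the set of all its arrows is
`Quiver.Total X`.  An arrow `g : x ⟶ y` has source `x` and range `y`; the product `γη` of
groupoid theory (defined for `s(γ) = r(η)`) is the categorical composite `η ≫ γ`. -/

/-- `X` together with the topology on its arrows is a second countable locally compact Hausdorff
groupoid: composition and inversion are continuous, and the object space carries the topology of
the unit space, a subspace of the space of arrows. -/
class IsLCHGroupoid (X : Type u) [Groupoid.{v} X] [TopologicalSpace X]
    [TopologicalSpace (Quiver.Total X)] : Prop where
  t2 : T2Space (Quiver.Total X)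
  locallyCompact : LocallyCompactSpace (Quiver.Total X)
  secondCountable : SecondCountableTopology (Quiver.Total X)
  isInducing_unit : IsInducing (fun x : X => (⟨x, x, 𝟙 x⟩ : Quiver.Total X))
  continuous_comp : Continuous
    (fun p : {p : Quiver.Total X × Quiver.Total X // p.1.right = p.2.left} =>
      (⟨p.1.1.left, p.1.2.right, p.1.1.hom ≫ eqToHom p.2 ≫ p.1.2.hom⟩ : Quiver.Total X))
  continuous_inv : Continuous
    (fun g : Quiver.Total X => (⟨g.right, g.left, inv g.hom⟩ : Quiver.Total X))

section UnitSpace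

theorem unit_injective (X : Type u) [Groupoid.{v} X] :
    Function.Injective (fun x : X => (⟨x, x, 𝟙 x⟩ : Quiver.Total X)) := by
  intro x y h
  exact congrArg Quiver.Total.left h

variable (X : Type u) [Groupoid.{v} X] [TopologicalSpace X] [TopologicalSpace (Quiver.Total X)]
  [IsLCHGroupoid X]

theorem continuous_target : Continuous (fun g : Quiver.Total X => g.right) := by
  rw [(IsLCHGroupoid.isInducing_unit (X := X)).continuous_iff]
  have h := (IsLCHGroupoid.continuous_comp (X := X)).comp
    (f := fun g : Quiver.Total X =>
      (⟨(⟨g.right, g.left, inv g.hom⟩, g), rfl⟩ :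
        {p : Quiver.Total X × Quiver.Total X // p.1.right = p.2.left}))
    (((IsLCHGroupoid.continuous_inv (X := X)).prodMk continuous_id).subtype_mk _)
  convert h using 1
  funext g
  simp

theorem t2Space_unit : T2Space X := by
  have := IsLCHGroupoid.t2 (X := X)
  exact (IsEmbedding.mk (IsLCHGroupoid.isInducing_unit (X := X)) (unit_injective X)).t2Space

theorem secondCountable_unit : SecondCountableTopology X := by
  have := IsLCHGroupoid.secondCountable (X := X)
  exact (IsLCHGroupoid.isInducing_unit (X := X)).secondCountableTopology

theorem locallyCompact_unit : LocallyCompactSpace X := by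
  have := IsLCHGroupoid.t2 (X := X)
  have := IsLCHGroupoid.locallyCompact (X := X)
  have he := IsEmbedding.mk (IsLCHGroupoid.isInducing_unit (X := X)) (unit_injective X)
  refine (IsClosedEmbedding.mk he ?_).locallyCompactSpace
  have hc : IsClosed {g : Quiver.Total X |
      (⟨g.right, g.right, 𝟙 g.right⟩ : Quiver.Total X) = g} :=
    isClosed_eq ((IsLCHGroupoid.isInducing_unit (X := X)).continuous.comp (continuous_target X))
      continuous_id
  convert hc using 1
  ext g
  constructor
  · rintro ⟨x, rfl⟩
    rfl
  · intro h
    exact ⟨g.right, h⟩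

end UnitSpace

/-! ### Upper semicontinuous bundles -/

section Bundles

variable {X : Type u}

/-- The total space of a family of fibres. -/
structure Tot (Z : X → Type w) where
  base : X
  val : Z base

/-- The fibred product `Z * W` of two total spaces over `X`. -/
structure FibProd (Z : X → Type w) (W : X → Type w) where
  base : X
  fst : Z base
  snd : W base

/-- The relative topology of `Z * W` in the product of the total spaces. -/
instance (Z W : X → Type w) [TopologicalSpace (Tot Z)] [TopologicalSpace (Tot W)] :
    TopologicalSpace (FibProd Z W) :=
  .induced (fun p => ((⟨p.base, p.fst⟩ : Tot Z), (⟨p.base, p.snd⟩ : Tot W))) inferInstance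

variable [TopologicalSpace X]

/-- The topology on the total space makes the family `Z` of normed spaces an upper
semicontinuous Banach bundle over `X`.  The projection is surjective since fibres have a zero. -/
structure IsUSCBanachBundle (Z : X → Type w) [∀ x, NormedAddCommGroup (Z x)]
    [∀ x, NormedSpace ℂ (Z x)] [TopologicalSpace (Tot Z)] : Prop where
  complete : ∀ x, CompleteSpace (Z x)
  continuous_proj : Continuous (fun z : Tot Z => z.base)
  isOpenMap_proj : IsOpenMap (fun z : Tot Z => z.base)
  upperSemicontinuous_norm : UpperSemicontinuous (fun z : Tot Z => ‖z.val‖)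
  continuous_add : Continuous (fun p : FibProd Z Z => (⟨p.base, p.fst + p.snd⟩ : Tot Z))
  continuous_smul : ∀ k : ℂ, Continuous (fun z : Tot Z => (⟨z.base, k • z.val⟩ : Tot Z))
  tendsto_zero : ∀ (l : Filter (Tot Z)) (x : X),
    Tendsto (fun z : Tot Z => ‖z.val‖) l (𝓝 0) → Tendsto (fun z : Tot Z => z.base) l (𝓝 x) →
      l ≤ 𝓝 (⟨x, 0⟩ : Tot Z)

/-- The additional axioms of an upper semicontinuous C⋆-bundle. -/
structure IsUSCCStarBundle (A : X → Type w) [∀ x, NonUnitalCStarAlgebra (A x)]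
    [TopologicalSpace (Tot A)] : Prop extends IsUSCBanachBundle A where
  continuous_mul : Continuous (fun p : FibProd A A => (⟨p.base, p.fst * p.snd⟩ : Tot A))
  continuous_star : Continuous (fun z : Tot A => (⟨z.base, star z.val⟩ : Tot A))

variable (X) in
/-- An upper semicontinuous C⋆-bundle over `X`. -/
structure CStarBundle where
  Fiber : X → Type w
  [cstar : ∀ x, NonUnitalCStarAlgebra (Fiber x)]
  [top : TopologicalSpace (Tot Fiber)]
  isBundle : IsUSCCStarBundle Fiber

attribute [instance] CStarBundle.cstar CStarBundle.top

theorem IsUSCBanachBundle.continuous_add_section {Z : X → Type w}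
    [∀ x, NormedAddCommGroup (Z x)] [∀ x, NormedSpace ℂ (Z x)] [TopologicalSpace (Tot Z)]
    (h : IsUSCBanachBundle Z) {f g : ∀ x, Z x}
    (hf : Continuous (fun x => (⟨x, f x⟩ : Tot Z)))
    (hg : Continuous (fun x => (⟨x, g x⟩ : Tot Z))) :
    Continuous (fun x => (⟨x, f x + g x⟩ : Tot Z)) :=
  h.continuous_add.comp (f := fun x => (⟨x, f x, g x⟩ : FibProd Z Z))
    (continuous_induced_rng.2 (hf.prodMk hg))

theorem IsUSCBanachBundle.continuous_zero_section {Z : X → Type w}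
    [∀ x, NormedAddCommGroup (Z x)] [∀ x, NormedSpace ℂ (Z x)] [TopologicalSpace (Tot Z)]
    (h : IsUSCBanachBundle Z) : Continuous (fun x => (⟨x, 0⟩ : Tot Z)) := by
  refine continuous_iff_continuousAt.2 fun x => ?_
  refine h.tendsto_zero _ x ?_ ?_
  · simp [tendsto_map'_iff, Function.comp_def]
  · exact tendsto_map'_iff.2 tendsto_id

theorem IsUSCBanachBundle.continuous_smul_section {Z : X → Type w}
    [∀ x, NormedAddCommGroup (Z x)] [∀ x, NormedSpace ℂ (Z x)] [TopologicalSpace (Tot Z)]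
    (h : IsUSCBanachBundle Z) {f : ∀ x, Z x} {φ : X → ℂ} (hφ : Continuous φ)
    (hf : Continuous (fun x => (⟨x, f x⟩ : Tot Z))) :
    Continuous (fun x => (⟨x, φ x • f x⟩ : Tot Z)) := by
  refine continuous_iff_continuousAt.2 fun x => ?_
  have h1 : Tendsto (fun y => (⟨y, φ x • f y⟩ : Tot Z)) (𝓝 x) (𝓝 ⟨x, φ x • f x⟩) :=
    ((h.continuous_smul (φ x)).comp hf).tendsto x
  have h2 : Tendsto (fun y => (⟨y, (φ y - φ x) • f y⟩ : Tot Z)) (𝓝 x) (𝓝 ⟨x, 0⟩) := by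
    refine h.tendsto_zero _ x ?_ ?_
    · rw [tendsto_map'_iff]
      have hb : ∀ᶠ y in 𝓝 x, ‖f y‖ < ‖f x‖ + 1 :=
        (hf.tendsto x).eventually (h.upperSemicontinuous_norm ⟨x, f x⟩ _ (lt_add_one ‖f x‖))
      have hφ' : Tendsto (fun y => ‖φ y - φ x‖ * (‖f x‖ + 1)) (𝓝 x) (𝓝 0) := by
        have : Continuous (fun y => ‖φ y - φ x‖ * (‖f x‖ + 1)) := by fun_prop
        simpa using this.tendsto x
      refine squeeze_zero' (Eventually.of_forall fun y => norm_nonneg _) ?_ hφ'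
      filter_upwards [hb] with y hy
      simp only [Function.comp_def, norm_smul]
      gcongr
    · exact tendsto_map'_iff.2 tendsto_id
  have h3 : Tendsto (fun y => (⟨y, φ x • f y, (φ y - φ x) • f y⟩ : FibProd Z Z)) (𝓝 x)
      (𝓝 ⟨x, φ x • f x, 0⟩) := by
    rw [nhds_induced, tendsto_comap_iff]
    exact h1.prodMk_nhds h2
  have h4 := (h.continuous_add.tendsto _).comp h3
  simp only [Function.comp_def, add_zero, ← add_smul, add_sub_cancel] at h4
  exact h4

/-- The section algebra `Γ₀(X, A)`: continuous sections of the bundle that vanish at infinity,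
with the pointwise operations. -/
def CStarBundle.sections (A : CStarBundle.{u, w} X) :
    NonUnitalStarSubalgebra ℂ (∀ x, A.Fiber x) where
  carrier := {f | Continuous (fun x => (⟨x, f x⟩ : Tot A.Fiber)) ∧
    Tendsto (fun x => ‖f x‖) (cocompact X) (𝓝 0)}
  add_mem' := by
    rintro f g ⟨hf, hf'⟩ ⟨hg, hg'⟩
    refine ⟨A.isBundle.continuous_add_section hf hg, ?_⟩
    refine squeeze_zero (fun x => norm_nonneg _) (fun x => norm_add_le _ _) ?_
    simpa using hf'.add hg'
  zero_mem' := ⟨A.isBundle.continuous_zero_section, by simp [tendsto_const_nhds]⟩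
  mul_mem' := by
    rintro f g ⟨hf, hf'⟩ ⟨hg, hg'⟩
    refine ⟨A.isBundle.continuous_mul.comp (f := fun x => (⟨x, f x, g x⟩ : FibProd _ _))
      (continuous_induced_rng.2 (hf.prodMk hg)), ?_⟩
    refine squeeze_zero (fun x => norm_nonneg _) (fun x => norm_mul_le _ _) ?_
    simpa using hf'.mul hg'
  smul_mem' := by
    rintro k f ⟨hf, hf'⟩
    refine ⟨(A.isBundle.continuous_smul k).comp hf, ?_⟩
    simpa [norm_smul] using hf'.const_mul ‖k‖
  star_mem' := by
    rintro f ⟨hf, hf'⟩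
    exact ⟨A.isBundle.continuous_star.comp hf, by simpa using hf'⟩

/-- The action of `C₀(X)` on the section algebra, `(φ · f)(x) = φ(x) f(x)`. -/
instance (A : CStarBundle.{u, w} X) : SMul C₀(X, ℂ) A.sections where
  smul φ f := ⟨fun x => φ x • f.1 x,
    A.isBundle.continuous_smul_section φ.continuous f.2.1, by
      have h1 : Tendsto (fun x => ‖φ x‖) (cocompact X) (𝓝 0) := by
        simpa using φ.zero_at_infty'.norm
      simpa [norm_smul] using h1.mul f.2.2⟩

/-- The section algebra is separable for the supremum norm. -/
def CStarBundle.IsSeparable (A : CStarBundle.{u, w} X) : Prop :=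
  ∃ S : Set A.sections, S.Countable ∧
    ∀ f : A.sections, ∀ ε : ℝ, 0 < ε → ∃ g ∈ S, ∀ x, ‖f.1 x - g.1 x‖ ≤ ε

end Bundles

/-! ### Groupoid dynamical systems -/

/-- The fibred product `E * Z` of the pairs `(γ, z)` with `z` in the fibre over `s(γ)`. -/
structure ActProd {X : Type u} [Groupoid.{v} X] (Z : X → Type w) where
  src : X
  tgt : X
  hom : src ⟶ tgt
  val : Z src

/-- The relative topology of `E * Z` in the product of `E` with the total space of `Z`. -/
instance {X : Type u} [Groupoid.{v} X] [TopologicalSpace (Quiver.Total X)] (Z : X → Type w)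
    [TopologicalSpace (Tot Z)] : TopologicalSpace (ActProd Z) :=
  .induced (fun p => ((⟨p.src, p.tgt, p.hom⟩ : Quiver.Total X), (⟨p.src, p.val⟩ : Tot Z)))
    inferInstance

/-- An `E`-dynamical system `(A, α)`: an upper semicontinuous C⋆-bundle over the unit space with
separable section algebra and a continuous action of `E` by ⋆-isomorphisms of the fibres. -/
structure DynSystem (X : Type u) [Groupoid.{v} X] [TopologicalSpace X]
    [TopologicalSpace (Quiver.Total X)] extends CStarBundle.{u, w} X where
  separable : toCStarBundle.IsSeparable
  act : ∀ {x y : X}, (x ⟶ y) → (Fiber x ≃⋆ₐ[ℂ] Fiber y)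
  act_comp : ∀ {x y z : X} (h : x ⟶ y) (g : y ⟶ z) (a : Fiber x),
    act (h ≫ g) a = act g (act h a)
  continuous_act : Continuous
    (fun p : ActProd Fiber => (⟨p.tgt, act p.hom p.val⟩ : Tot Fiber))

/-! ### Imprimitivity bimodules and equivariant Morita equivalence -/

/-- An `A - B`-imprimitivity bimodule structure on the Banach space `Z` (whose norm is the one
given by the inner products).  The left inner product is linear in the first variable, the right
one in the second. -/
structure ImprimitivityBimodule (A B Z : Type w) [NonUnitalCStarAlgebra A]
    [NonUnitalCStarAlgebra B] [NormedAddCommGroup Z] [NormedSpace ℂ Z] where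
  lsmul : A →ₗ[ℂ] Z →ₗ[ℂ] Z
  rsmul : Z →ₗ[ℂ] B →ₗ[ℂ] Z
  linner : Z →ₗ[ℂ] Z →ₗ⋆[ℂ] A
  rinner : Z →ₗ⋆[ℂ] Z →ₗ[ℂ] B
  complete : CompleteSpace Z
  mul_lsmul : ∀ a a' z, lsmul (a * a') z = lsmul a (lsmul a' z)
  rsmul_mul : ∀ z b b', rsmul z (b * b') = rsmul (rsmul z b) b'
  lsmul_rsmul : ∀ a z b, rsmul (lsmul a z) b = lsmul a (rsmul z b)
  linner_lsmul : ∀ a z z', linner (lsmul a z) z' = a * linner z z'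
  rinner_rsmul : ∀ z z' b, rinner z (rsmul z' b) = rinner z z' * b
  star_linner : ∀ z z', star (linner z z') = linner z' z
  star_rinner : ∀ z z', star (rinner z z') = rinner z' z
  linner_self_nonneg : ∀ z, ∃ a, linner z z = star a * a
  rinner_self_nonneg : ∀ z, ∃ b, rinner z z = star b * b
  norm_linner_self : ∀ z, ‖linner z z‖ = ‖z‖ ^ 2
  norm_rinner_self : ∀ z, ‖rinner z z‖ = ‖z‖ ^ 2
  linner_full : Dense (Submodule.span ℂ {a | ∃ z z', a = linner z z'} : Set A)
  rinner_full : Dense (Submodule.span ℂ {b | ∃ z z', b = rinner z z'} : Set B)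
  rinner_lsmul : ∀ a z z', rinner (lsmul a z) z' = rinner z (lsmul (star a) z')
  linner_rsmul : ∀ z b z', linner (rsmul z b) z' = linner z (rsmul z' (star b))
  linner_lsmul_eq : ∀ z z' z'', lsmul (linner z z') z'' = rsmul z (rinner z' z'')

/-- An `A - B`-imprimitivity bimodule bundle. -/
structure ImprimitivityBundle {X : Type u} [TopologicalSpace X] (A B : CStarBundle.{u, w} X) where
  Fiber : X → Type w
  [normed : ∀ x, NormedAddCommGroup (Fiber x)]
  [space : ∀ x, NormedSpace ℂ (Fiber x)]
  [top : TopologicalSpace (Tot Fiber)]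
  isBundle : IsUSCBanachBundle Fiber
  bimod : ∀ x, ImprimitivityBimodule (A.Fiber x) (B.Fiber x) (Fiber x)
  continuous_lsmul : Continuous (fun p : FibProd A.Fiber Fiber =>
    (⟨p.base, (bimod p.base).lsmul p.fst p.snd⟩ : Tot Fiber))
  continuous_rsmul : Continuous (fun p : FibProd Fiber B.Fiber =>
    (⟨p.base, (bimod p.base).rsmul p.fst p.snd⟩ : Tot Fiber))
  continuous_linner : Continuous (fun p : FibProd Fiber Fiber =>
    (⟨p.base, (bimod p.base).linner p.fst p.snd⟩ : Tot A.Fiber))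
  continuous_rinner : Continuous (fun p : FibProd Fiber Fiber =>
    (⟨p.base, (bimod p.base).rinner p.fst p.snd⟩ : Tot B.Fiber))

attribute [instance] ImprimitivityBundle.normed ImprimitivityBundle.space ImprimitivityBundle.top

section Systems

variable {X : Type u} [Groupoid.{v} X] [TopologicalSpace X] [TopologicalSpace (Quiver.Total X)]

/-- An equivariant imprimitivity bimodule bundle between two `E`-dynamical systems: an
imprimitivity bimodule bundle with a continuous action `V` of `E` by norm preserving
isomorphisms of the fibres which is compatible with the inner products. -/
structure EquivariantBundle (A B : DynSystem.{u, v, w} X) extends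
    ImprimitivityBundle A.toCStarBundle B.toCStarBundle where
  V : ∀ {x y : X}, (x ⟶ y) → (Fiber x ≃ₗᵢ[ℂ] Fiber y)
  V_comp : ∀ {x y z : X} (h : x ⟶ y) (g : y ⟶ z) (ξ : Fiber x), V (h ≫ g) ξ = V g (V h ξ)
  continuous_V : Continuous
    (fun p : ActProd Fiber => (⟨p.tgt, V p.hom p.val⟩ : Tot Fiber))
  linner_V : ∀ {x y : X} (g : x ⟶ y) (ξ ζ : Fiber x),
    (bimod y).linner (V g ξ) (V g ζ) = A.act g ((bimod x).linner ξ ζ)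
  rinner_V : ∀ {x y : X} (g : x ⟶ y) (ξ ζ : Fiber x),
    (bimod y).rinner (V g ξ) (V g ζ) = B.act g ((bimod x).rinner ξ ζ)

/-- Equivariant Morita equivalence of `E`-dynamical systems. -/
def MoritaEquiv (A B : DynSystem.{u, v, w} X) : Prop := Nonempty (EquivariantBundle A B)

end Systems

/-! ### The maximal balanced tensor product -/

/-- A C⋆-seminorm on a complex ⋆-algebra. -/
def IsCStarSeminorm {R : Type w} [NonUnitalRing R] [Module ℂ R] [Star R]
    (p : Seminorm ℂ R) : Prop :=
  (∀ x y, p (x * y) ≤ p x * p y) ∧ ∀ x, p (star x * x) = p x ^ 2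

/-- The ⋆-homomorphism `ι` exhibits the C⋆-algebra `D` as the maximal tensor product
`A ⊗_max B`, i.e. as the completion of the algebraic tensor product in the largest
C⋆-seminorm. -/
def IsMaxTensorProduct {A B D : Type w} [NonUnitalRing A] [Module ℂ A] [IsScalarTower ℂ A A]
    [SMulCommClass ℂ A A] [StarRing A] [StarModule ℂ A]
    [NonUnitalRing B] [Module ℂ B] [IsScalarTower ℂ B B]
    [SMulCommClass ℂ B B] [StarRing B] [StarModule ℂ B] [NonUnitalCStarAlgebra D]
    (ι : (A ⊗[ℂ] B) →⋆ₙₐ[ℂ] D) : Prop :=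
  DenseRange ι ∧ ∀ x : A ⊗[ℂ] B,
    IsLUB {r : ℝ | ∃ p : Seminorm ℂ (A ⊗[ℂ] B), IsCStarSeminorm p ∧ r = p x} ‖ι x‖

section Tensor

variable {X : Type u} [Groupoid.{v} X] [TopologicalSpace X] [TopologicalSpace (Quiver.Total X)]

/-- The `E`-dynamical system `C` is (a realization of) the balanced tensor product
`(A ⊗_{E⁽⁰⁾} B, α ⊗ β)`.  Here `D` is `Γ₀(A) ⊗_max Γ₀(B)`, and `q` is a surjection onto the
section algebra `Γ₀(C)` whose kernel is the closed ideal generated by the differences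
`(φ · a) ⊗ b - a ⊗ (φ · b)`, so that `Γ₀(C)` is the quotient `Γ₀(A) ⊗_{E⁽⁰⁾} Γ₀(B)`; the
`C₀(E⁽⁰⁾)`-structure of `C` is `φ · (a ⊗ b) = (φ · a) ⊗ b`.  The bilinear map `τ x` sends a pair of
fibre elements to its elementary tensor in the fibre of the tensor product over `x`, and the
action is `γ ↦ α_γ ⊗ β_γ`. -/
structure BalancedTensor (A B C : DynSystem.{u, v, w} X) where
  D : Type (max u w)
  [cstar : NonUnitalCStarAlgebra D]
  ι : (A.sections ⊗[ℂ] B.sections) →⋆ₙₐ[ℂ] D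
  isMax : IsMaxTensorProduct ι
  q : D →⋆ₙₐ[ℂ] C.sections
  q_surjective : Function.Surjective q
  q_ker : ∀ d : D, q d = 0 ↔ d ∈ closure (TwoSidedIdeal.span
    {d : D | ∃ (φ : C₀(X, ℂ)) (a : A.sections) (b : B.sections),
      d = ι ((φ • a) ⊗ₜ[ℂ] b - a ⊗ₜ[ℂ] (φ • b))} : Set D)
  q_smul : ∀ (φ : C₀(X, ℂ)) (a : A.sections) (b : B.sections),
    q (ι ((φ • a) ⊗ₜ[ℂ] b)) = φ • q (ι (a ⊗ₜ[ℂ] b))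
  τ : ∀ x, A.Fiber x →ₗ[ℂ] B.Fiber x →ₗ[ℂ] C.Fiber x
  q_apply : ∀ (a : A.sections) (b : B.sections) (x : X),
    (q (ι (a ⊗ₜ[ℂ] b))).1 x = τ x (a.1 x) (b.1 x)
  act_tmul : ∀ {x y : X} (g : x ⟶ y) (a : A.Fiber x) (b : B.Fiber x),
    C.act g (τ x a b) = τ y (A.act g a) (B.act g b)

attribute [instance] BalancedTensor.cstar

/-- `C` is the balanced tensor product of `A` and `B` with the diagonal action. -/
def IsBalancedTensor (A B C : DynSystem.{u, v, w} X) : Prop := Nonempty (BalancedTensor A B C)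

end Tensor

/-! ### The system `(C₀(E⁽⁰⁾), lt)` -/

/-- The complex numbers, lifted to an arbitrary universe, as a C⋆-algebra. -/
abbrev CC : Type w := ULift.{w} ℂ

instance : NonUnitalCStarAlgebra CC.{w} where
  star z := ⟨star z.down⟩
  star_involutive z := by ext; exact star_star z.down
  star_mul z w := by ext; exact star_mul z.down w.down
  star_add z w := by ext; exact star_add z.down w.down
  norm_mul_self_le z := (CStarRing.norm_star_mul_self (x := z.down)).ge
  star_smul k z := by ext; exact star_smul k z.down
  smul_assoc k z w := by ext; exact smul_assoc k z.down w.down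
  smul_comm k z w := by ext; exact smul_comm k z.down w.down

/-- The total space of the product bundle `X × ℂ`, with the product topology. -/
instance trivialTopology (X : Type u) [TopologicalSpace X] :
    TopologicalSpace (Tot (fun _ : X => CC.{w})) :=
  .induced (fun z => (z.base, z.val.down)) inferInstance

theorem isUSCCStarBundle_trivial (X : Type u) [TopologicalSpace X] :
    IsUSCCStarBundle (fun _ : X => CC.{w}) := by
  have hind : IsInducing (fun z : Tot (fun _ : X => CC.{w}) => (z.base, z.val.down)) := ⟨rfl⟩
  have hb : Continuous (fun z : Tot (fun _ : X => CC.{w}) => z.base) :=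
    continuous_fst.comp hind.continuous
  have hv : Continuous (fun z : Tot (fun _ : X => CC.{w}) => z.val.down) :=
    continuous_snd.comp hind.continuous
  have hp : Continuous (fun p : FibProd (fun _ : X => CC.{w}) (fun _ : X => CC.{w}) =>
      ((⟨p.base, p.fst⟩ : Tot (fun _ : X => CC.{w})),
        (⟨p.base, p.snd⟩ : Tot (fun _ : X => CC.{w})))) := continuous_induced_dom
  have hp1 := continuous_fst.comp hp
  have hp2 := continuous_snd.comp hp
  let e : Tot (fun _ : X => CC.{w}) ≃ₜ X × ℂ :=
    { toFun := fun z => (z.base, z.val.down)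
      invFun := fun p => ⟨p.1, ⟨p.2⟩⟩
      left_inv := fun _ => rfl
      right_inv := fun _ => rfl
      continuous_toFun := hind.continuous
      continuous_invFun := hind.continuous_iff.2 continuous_id }
  refine
    { complete := fun x => inferInstance
      continuous_proj := hb
      isOpenMap_proj := isOpenMap_fst.comp e.isOpenMap
      upperSemicontinuous_norm := Continuous.upperSemicontinuous hv.norm
      continuous_add := hind.continuous_iff.2
        ((hb.comp hp1).prodMk ((hv.comp hp1).add (hv.comp hp2)))
      continuous_smul := fun k => hind.continuous_iff.2 (hb.prodMk (hv.const_smul k))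
      tendsto_zero := ?_
      continuous_mul := hind.continuous_iff.2
        ((hb.comp hp1).prodMk ((hv.comp hp1).mul (hv.comp hp2)))
      continuous_star := hind.continuous_iff.2 (hb.prodMk hv.star) }
  intro l x h1 h2
  rw [hind.nhds_eq_comap, ← tendsto_iff_comap]
  exact h2.prodMk_nhds (tendsto_zero_iff_norm_tendsto_zero.2 h1)

/-- The product bundle `X × ℂ`, whose section algebra is `C₀(X)`. -/
def trivialBundle (X : Type u) [TopologicalSpace X] : CStarBundle.{u, w} X where
  Fiber _ := CC.{w}
  isBundle := isUSCCStarBundle_trivial X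

theorem trivialBundle_isSeparable (X : Type u) [TopologicalSpace X] [T2Space X]
    [LocallyCompactSpace X] [SecondCountableTopology X] :
    (trivialBundle.{u, w} X).IsSeparable := by
  have hind : IsInducing (fun z : Tot (fun _ : X => CC.{w}) => (z.base, z.val.down)) := ⟨rfl⟩
  let K : CompactExhaustion X := default
  let D : ℕ → Set C(X, ℂ) := fun n => {f | ∀ x ∉ K n, f x = 0}
  have mem : ∀ n, ∀ f ∈ D n, (fun x => (⟨f x⟩ : CC.{w})) ∈ (trivialBundle.{u, w} X).sections := by
    intro n f hf
    refine ⟨hind.continuous_iff.2 (continuous_id.prodMk f.continuous), ?_⟩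
    refine tendsto_const_nhds.congr' ?_
    filter_upwards [(K.isCompact n).compl_mem_cocompact] with x hx
    change 0 = ‖f x‖
    simp [hf x hx]
  have hS : ∀ n, ∃ S : Set (D n), S.Countable ∧ Dense S := fun n => exists_countable_dense (D n)
  choose S hSc hSd using hS
  refine ⟨⋃ n, (fun f : D n => ⟨_, mem n f.1 f.2⟩) '' S n,
    Set.countable_iUnion fun n => (hSc n).image _, ?_⟩
  intro f ε hε
  have hf : Continuous (fun x => (f.1 x).down) :=
    continuous_snd.comp (hind.continuous.comp f.2.1)
  obtain ⟨L, hL, hLf⟩ := mem_cocompact.1 (f.2.2 (Iio_mem_nhds (half_pos hε)))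
  obtain ⟨φ, hφ1, -, hφc, hφ⟩ := exists_continuous_one_zero_of_isCompact hL isClosed_empty
    (Set.disjoint_empty L)
  obtain ⟨n, hn⟩ := K.exists_superset_of_isCompact hφc
  let h : D n := ⟨⟨fun x => (φ x : ℂ) * (f.1 x).down, by fun_prop⟩, by
    intro x hx
    have : φ x = 0 := image_eq_zero_of_notMem_tsupport fun hx' => hx (hn hx')
    simp [this]⟩
  have hU : {g : C(X, ℂ) | ∀ x ∈ K n, dist (h.1 x) (g x) < ε / 2} ∈ 𝓝 h.1 := by
    have ht := (ContinuousMap.tendsto_iff_forall_isCompact_tendstoUniformlyOn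
      (F := fun g : C(X, ℂ) => g) (f := h.1) (p := 𝓝 h.1)).1 tendsto_id (K n) (K.isCompact n)
    exact Metric.tendstoUniformlyOn_iff.1 ht _ (half_pos hε)
  obtain ⟨g, hgS, hg⟩ := (hSd n).inter_nhds_nonempty
    (continuous_subtype_val.continuousAt.preimage_mem_nhds hU)
  refine ⟨_, Set.mem_iUnion.2 ⟨n, g, hgS, rfl⟩, fun x => ?_⟩
  change ‖(f.1 x).down - g.1 x‖ ≤ ε
  have h1 : ‖(f.1 x).down - h.1 x‖ ≤ ε / 2 := by
    change ‖(f.1 x).down - (φ x : ℂ) * (f.1 x).down‖ ≤ ε / 2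
    by_cases hx : x ∈ L
    · have : φ x = 1 := hφ1 hx
      simp [this, (half_pos hε).le]
    · have h2 : ‖(f.1 x).down‖ < ε / 2 := hLf hx
      have h3 : (f.1 x).down - (φ x : ℂ) * (f.1 x).down
          = ((1 - φ x : ℝ) : ℂ) * (f.1 x).down := by push_cast; ring
      rw [h3, norm_mul, Complex.norm_real, Real.norm_of_nonneg (by linarith [(hφ x).2])]
      nlinarith [(hφ x).1, (hφ x).2, norm_nonneg (f.1 x).down]
  have h2 : ‖h.1 x - g.1 x‖ ≤ ε / 2 := by
    by_cases hx : x ∈ K n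
    · rw [← dist_eq_norm]
      exact (hg x hx).le
    · rw [h.2 x hx, g.2 x hx]
      simp [(half_pos hε).le]
  calc ‖(f.1 x).down - g.1 x‖ = ‖((f.1 x).down - h.1 x) + (h.1 x - g.1 x)‖ := by ring_nf
    _ ≤ ε / 2 + ε / 2 := (norm_add_le _ _).trans (add_le_add h1 h2)
    _ = ε := by ring

/-- The system `(C₀(E⁽⁰⁾), lt)`: the product bundle with the left translation action
`(s(γ), κ) ↦ (r(γ), κ)`. -/
def trivialSystem (X : Type u) [Groupoid.{v} X] [TopologicalSpace X]
    [TopologicalSpace (Quiver.Total X)] [IsLCHGroupoid X] : DynSystem.{u, v, w} X where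
  toCStarBundle := trivialBundle X
  separable := by
    have := t2Space_unit X
    have := locallyCompact_unit X
    have := secondCountable_unit X
    exact trivialBundle_isSeparable X
  act _ := StarAlgEquiv.refl ℂ CC.{w}
  act_comp _ _ _ := rfl
  continuous_act := by
    have hind : IsInducing (fun z : Tot (fun _ : X => CC.{w}) => (z.base, z.val.down)) := ⟨rfl⟩
    have hp : Continuous (fun p : ActProd (fun _ : X => CC.{w}) =>
        ((⟨p.src, p.tgt, p.hom⟩ : Quiver.Total X), (⟨p.src, p.val⟩ : Tot (fun _ : X => CC.{w})))) :=
      continuous_induced_dom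
    refine hind.continuous_iff.2 ?_
    exact ((continuous_target X).comp (continuous_fst.comp hp)).prodMk
      (continuous_snd.comp (hind.continuous.comp (continuous_snd.comp hp)))

end BrauerSemigroup

end

/-! The balanced tensor product is analysed fibre by fibre. A system `C` is a balanced tensor
product of `A` and `B` exactly when its fibre over `x` is the maximal tensor product of `A(x)` and
`B(x)`, tensors of continuous sections are continuous, and `E` acts diagonally. This notion is
`FiberTensor`; the two implications are `BalancedTensor.fiberTensor` and
`FiberTensor.isBalancedTensor`. It turns existence, commutativity, associativity and the unit law
into statements about maximal tensor products of single C⋆-algebras, plus continuity of a spanning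
family of sections.

No Hilbert space representations occur. The maximal tensor product is the enveloping C⋆-algebra of
the algebraic one, that is, its completion in the largest C⋆-seminorm (`IsEnveloping`). Every norm
estimate comes from one principle, `IsFormSeminorm.action_le`: a C⋆-algebra acting by adjointable
operators on a space whose seminorm comes from an algebra valued form acts contractively, because a
self-adjoint contraction is a combination of two unitaries with coefficients of modulus 1/2. For a
⋆-algebra that acts by bounded operators, the operator seminorm is a C⋆-seminorm, hence at most the
enveloping norm. This gives the subcross property, the existence of maximal tensor products, and
their associativity (`IsEnveloping.tensor_tensor`).

Bundles are handled through sections. Over the unit space every vector lies on a continuous section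
(`IsUSCBanachBundle.exists_section`), so continuity of operations can be tested on dense families of
sections, and a family of sections with upper semicontinuous norms and dense values determines a
bundle (`isUSCBanachBundle_fellTopology`). For the fibrewise maximal tensor product upper
semicontinuity holds because a limit of the fibre norms along an ultrafilter tending to `x₀` is
again a C⋆-seminorm, lives on the fibre at `x₀`, and so is at most the maximal norm there
(`exists_bundleTensor`).

In the comparison with the balanced tensor product the hard point is that a C⋆-seminorm which
annihilates the balancing relations is at most the supremum of the fibre norms
(`BundleTensor.balanced_le`). It is localised by cut-off functions, and the local bounds are glued
by a partition of unity; the number of pieces disappears on taking `2 ^ n`-th roots of powers of a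
self-adjoint element.

For Morita equivalence, symmetry comes from the conjugate bimodule, transitivity from the internal
tensor product over the middle algebra, and compatibility with the product from the external tensor
product. The last two are completions of algebraic bimodules
(`PreBimodule.IsBounded.exists_completion`), assembled into an equivariant bundle by
`moritaEquiv_of_tensor`. Positivity of their inner products rests on approximating a Gram matrix by
sums of matrices `star (t i) * t j` (`ImprimitivityBimodule.exists_gram`). Statements about one
inner product follow from those about the other by conjugation. An isomorphism of systems is a
special Morita equivalence, which settles reflexivity and the monoid laws. -/

noncomputable section

namespace BrauerSemigroup

set_option linter.unusedSectionVars false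

/-! ### Completions of seminorms -/

section SeminormCompletion

variable {E : Type w} [AddCommGroup E] [Module ℂ E]

/-- A complex vector space equipped with a seminorm. -/
def SemType (_ : Seminorm ℂ E) : Type w := E

variable (p : Seminorm ℂ E)

instance : SeminormedAddCommGroup (SemType p) :=
  AddGroupSeminorm.toSeminormedAddCommGroup (E := E) p.toAddGroupSeminorm

instance : Module ℂ (SemType p) := inferInstanceAs (Module ℂ E)

instance : NormedSpace ℂ (SemType p) where
  norm_smul_le k x := (map_smul_eq_mul p k x).le

/-- The Banach space completion of a complex vector space with respect to a seminorm. -/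
def SemComp : Type w := UniformSpace.Completion (SemType p)

instance : NormedAddCommGroup (SemComp p) :=
  inferInstanceAs (NormedAddCommGroup (UniformSpace.Completion (SemType p)))

instance : NormedSpace ℂ (SemComp p) :=
  inferInstanceAs (NormedSpace ℂ (UniformSpace.Completion (SemType p)))

instance : CompleteSpace (SemComp p) :=
  inferInstanceAs (CompleteSpace (UniformSpace.Completion (SemType p)))

/-- The canonical map into the completion. -/
def SemComp.mk : E →ₗ[ℂ] SemComp p :=
  (UniformSpace.Completion.toComplₗᵢ (𝕜 := ℂ) (E := SemType p)).toLinearMap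

theorem SemComp.norm_mk (x : E) : ‖SemComp.mk p x‖ = p x :=
  UniformSpace.Completion.norm_coe (E := SemType p) x

theorem SemComp.denseRange_mk : DenseRange (SemComp.mk p) :=
  UniformSpace.Completion.denseRange_coe (α := SemType p)

end SeminormCompletion

theorem exists_linear_extension {E0 E G : Type*} [AddCommGroup E0] [Module ℂ E0]
    [NormedAddCommGroup E] [NormedSpace ℂ E] [NormedAddCommGroup G] [NormedSpace ℂ G]
    [CompleteSpace G] {σ : ℂ →+* ℂ} {e : E0 →ₗ[ℂ] E} (he : DenseRange e) (b : E0 →ₛₗ[σ] G) (C : ℝ)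
    (hb : ∀ x, ‖b x‖ ≤ C * ‖e x‖) :
    ∃ B : E →SL[σ] G, (∀ x, B (e x) = b x) ∧ ∀ x, ‖B x‖ ≤ C * ‖x‖ :=
  ⟨b.extendOfNorm e, LinearMap.extendOfNorm_eq he ⟨C, hb⟩,
    LinearMap.norm_extendOfNorm_apply_le he C hb⟩

/-- One variable is extended at a time. The ring homomorphisms `σ` and `τ` allow products, module
actions and sesquilinear inner products to be completed by the same statement. -/
theorem exists_bilinear_extension {E0 F0 E F G : Type*} [AddCommGroup E0] [Module ℂ E0]
    [AddCommGroup F0] [Module ℂ F0] [NormedAddCommGroup E] [NormedSpace ℂ E]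
    [NormedAddCommGroup F] [NormedSpace ℂ F] [NormedAddCommGroup G] [NormedSpace ℂ G]
    [CompleteSpace G] {σ τ : ℂ →+* ℂ} [RingHomIsometric σ] [RingHomIsometric τ]
    {e : E0 →ₗ[ℂ] E} {f : F0 →ₗ[ℂ] F} (he : DenseRange e) (hf : DenseRange f)
    (b : E0 →ₛₗ[σ] F0 →ₛₗ[τ] G) (C : ℝ) (hC : 0 ≤ C) (hb : ∀ x y, ‖b x y‖ ≤ C * ‖e x‖ * ‖f y‖) :
    ∃ B : E →SL[σ] F →SL[τ] G, (∀ x y, B (e x) (f y) = b x y) ∧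
      ∀ x y, ‖B x y‖ ≤ C * ‖x‖ * ‖y‖ := by
  choose b1 hb1 hb1n using fun x => exists_linear_extension hf (b x) (C * ‖e x‖) (hb x)
  have ext1 : ∀ (u v : F →SL[τ] G), (∀ y, u (f y) = v (f y)) → u = v := fun u v h => by
    ext y
    exact congrFun (hf.equalizer u.continuous v.continuous (funext h)) y
  let b2 : E0 →ₛₗ[σ] F →SL[τ] G :=
    { toFun := b1
      map_add' := fun x x' => ext1 _ _ fun y => by simp [hb1]
      map_smul' := fun k x => ext1 _ _ fun y => by simp [hb1] }
  obtain ⟨B, hB, hBn⟩ := exists_linear_extension he b2 C fun x =>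
    ContinuousLinearMap.opNorm_le_bound _ (by positivity) (hb1n x)
  refine ⟨B, fun x y => by rw [hB]; exact hb1 x y, fun x y => ?_⟩
  exact ((B x).le_opNorm y).trans (by gcongr; exact hBn x)

/-! ### C⋆-seminorms -/

section CStarSeminorm

variable {R : Type w} [NonUnitalRing R] [Module ℂ R] [StarRing R]

/-- From `p y ^ 2 = p (star y * y) ≤ p (star y) * p y` one cancels `p y`; applying this to `star x`
too gives equality. -/
theorem IsCStarSeminorm.star_eq {p : Seminorm ℂ R} (hp : IsCStarSeminorm p) (x : R) :
    p (star x) = p x := by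
  have key : ∀ y : R, p y ≤ p (star y) := fun y => by
    have h1 := hp.2 y
    have h2 := hp.1 (star y) y
    rcases (apply_nonneg p y).eq_or_lt with h | h
    · rw [← h]; exact apply_nonneg p _
    · nlinarith
  exact le_antisymm (by simpa using key (star x)) (key x)

theorem isCStarSeminorm_of_starHom {D : Type*} [NonUnitalCStarAlgebra D] (f : R →⋆ₙₐ[ℂ] D) :
    IsCStarSeminorm ((normSeminorm ℂ D).comp (f : R →ₗ[ℂ] D)) := by
  refine ⟨fun x y => ?_, fun x => ?_⟩
  · simpa using norm_mul_le (f x) (f y)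
  · simpa [map_star, sq] using CStarRing.norm_star_mul_self (x := f x)

/-- One half of the C⋆-identity is enough: it forces `p y ≤ p (star y)`, so the involution is
isometric, and submultiplicativity then gives the other half. -/
theorem isCStarSeminorm_of_le_star [IsScalarTower ℂ R R] {p : Seminorm ℂ R}
    (h1 : ∀ x y, p (x * y) ≤ p x * p y)
    (h2 : ∀ x, p x ^ 2 ≤ p (star x * x)) : IsCStarSeminorm p := by
  have key : ∀ y : R, p y ≤ p (star y) := fun y => by
    have h3 := (h2 y).trans (h1 (star y) y)
    rcases (apply_nonneg p y).eq_or_lt with h | h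
    · rw [← h]; exact apply_nonneg p _
    · nlinarith
  refine ⟨h1, fun x => le_antisymm ((h1 _ _).trans ?_) (h2 x)⟩
  have := key (star x)
  rw [star_star] at this
  nlinarith [apply_nonneg p x]

theorem IsCStarSeminorm.comp {R' : Type*} [NonUnitalRing R'] [Module ℂ R'] [StarRing R']
    {p : Seminorm ℂ R} (hp : IsCStarSeminorm p) (f : R' →⋆ₙₐ[ℂ] R) :
    IsCStarSeminorm (p.comp (f : R' →ₗ[ℂ] R)) := by
  refine ⟨fun x y => ?_, fun x => ?_⟩
  · simpa using hp.1 (f x) (f y)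
  · simpa [map_star] using hp.2 (f x)

/-- A ⋆-homomorphism between dense ⋆-subalgebras extends to the completions. -/
theorem exists_starHom_extension {D Q : Type*} [NonUnitalCStarAlgebra D] [NonUnitalCStarAlgebra Q]
    {f : R →⋆ₙₐ[ℂ] D} (hf : DenseRange f) (g : R →⋆ₙₐ[ℂ] Q) (hg : ∀ x, ‖g x‖ ≤ ‖f x‖) :
    ∃ h : D →⋆ₙₐ[ℂ] Q, ∀ x, h (f x) = g x := by
  obtain ⟨B, hB, -⟩ := exists_linear_extension (e := (f : R →ₗ[ℂ] D)) hf (g : R →ₗ[ℂ] Q) 1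
    (fun x => by simpa using hg x)
  have hB' : ∀ x, B (f x) = g x := hB
  refine ⟨{ toFun := B, map_smul' := B.map_smul, map_zero' := B.map_zero, map_add' := B.map_add,
            map_mul' := ?_, map_star' := ?_ }, hB'⟩
  · intro x y
    refine hf.induction_on₂ (p := fun x y => B (x * y) = B x * B y)
      (isClosed_eq (by fun_prop) (by fun_prop)) (fun a b => ?_) x y
    rw [← map_mul, hB', hB', hB', map_mul]
  · intro x
    refine hf.induction_on (p := fun x => B (star x) = star (B x)) x
      (isClosed_eq (by fun_prop) (by fun_prop)) (fun a => ?_)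
    rw [← map_star, hB', hB', map_star]

/-- The C⋆-algebra completion of a ⋆-algebra with respect to a C⋆-seminorm. -/
theorem IsCStarSeminorm.exists_completion [IsScalarTower ℂ R R] [SMulCommClass ℂ R R]
    [StarModule ℂ R] {p : Seminorm ℂ R} (hp : IsCStarSeminorm p) :
    ∃ (D : Type w) (_ : NonUnitalCStarAlgebra D) (f : R →⋆ₙₐ[ℂ] D),
      DenseRange f ∧ ∀ x, ‖f x‖ = p x := by
  have hd := SemComp.denseRange_mk p
  obtain ⟨M, hM, hMn⟩ := exists_bilinear_extension hd hd
    ((LinearMap.mul ℂ R).compr₂ (SemComp.mk p)) 1 zero_le_one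
    (fun x y => by simpa [SemComp.norm_mk] using hp.1 x y)
  have hM : ∀ x y, M (SemComp.mk p x) (SemComp.mk p y) = SemComp.mk p (x * y) := by simpa using hM
  obtain ⟨S, hS, hSn⟩ := exists_linear_extension hd
    ((SemComp.mk p).comp (starLinearEquiv ℂ (A := R)).toLinearMap) 1
    (fun x => by simpa [SemComp.norm_mk] using (hp.star_eq x).le)
  have hS : ∀ x, S (SemComp.mk p x) = SemComp.mk p (star x) := by simpa using hS
  have ind1 : ∀ {q : SemComp p → Prop}, IsClosed {x | q x} → (∀ a, q (SemComp.mk p a)) → ∀ x, q x :=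
    fun h1 h2 x => hd.induction_on x h1 h2
  have ind2 : ∀ {q : SemComp p → SemComp p → Prop}, IsClosed {x : _ × _ | q x.1 x.2} →
      (∀ a b, q (SemComp.mk p a) (SemComp.mk p b)) → ∀ x y, q x y :=
    fun h1 h2 x y => hd.induction_on₂ h1 h2 x y
  have ind3 : ∀ {q : SemComp p → SemComp p → SemComp p → Prop},
      IsClosed {x : _ × _ × _ | q x.1 x.2.1 x.2.2} →
      (∀ a b c, q (SemComp.mk p a) (SemComp.mk p b) (SemComp.mk p c)) → ∀ x y z, q x y z :=
    fun h1 h2 x y z => hd.induction_on₃ h1 h2 x y z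
  let I : NonUnitalCStarAlgebra (SemComp p) :=
    { (inferInstance : NormedAddCommGroup (SemComp p)), (inferInstance : NormedSpace ℂ (SemComp p)),
      (inferInstance : CompleteSpace (SemComp p)) with
      mul := fun x y => M x y
      left_distrib := fun x y z => (M x).map_add y z
      right_distrib := fun x y z => M.map_add₂ x y z
      zero_mul := fun x => M.map_zero₂ x
      mul_zero := fun x => (M x).map_zero
      mul_assoc := ind3 (q := fun x y z => M (M x y) z = M x (M y z))
        (isClosed_eq (by fun_prop) (by fun_prop)) fun a b c => by
          rw [hM, hM, hM, hM, mul_assoc]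
      norm_mul_le := fun x y => by simpa using! hMn x y
      star := fun x => S x
      star_involutive := ind1 (q := fun x => S (S x) = x)
        (isClosed_eq (by fun_prop) (by fun_prop)) fun a => by rw [hS, hS, star_star]
      star_mul := ind2 (q := fun x y => S (M x y) = M (S y) (S x))
        (isClosed_eq (by fun_prop) (by fun_prop)) fun a b => by
          rw [hM, hS, hS, hS, hM, star_mul]
      star_add := fun x y => S.map_add x y
      norm_mul_self_le := ind1 (q := fun x => ‖x‖ * ‖x‖ ≤ ‖M (S x) x‖)
        (isClosed_le (by fun_prop) (by fun_prop)) fun a => by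
          rw [hS, hM, SemComp.norm_mk, SemComp.norm_mk, hp.2, sq]
      smul_assoc := fun k x y => M.map_smul₂ k x y
      smul_comm := fun k x y => ((M x).map_smul k y).symm
      star_smul := fun k x => S.map_smulₛₗ k x }
  let f : R →⋆ₙₐ[ℂ] SemComp p :=
    { toFun := SemComp.mk p
      map_smul' := map_smul _
      map_zero' := map_zero _
      map_add' := map_add _
      map_mul' := fun x y => (hM x y).symm
      map_star' := fun x => (hS x).symm }
  exact ⟨SemComp p, I, f, hd, SemComp.norm_mk p⟩

end CStarSeminorm

/-! ### Bounded actions of C⋆-algebras -/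

section Multipliers

/-- Take `k = √(1 - a²) - 1`; the function vanishes at 0, so `k` exists without a unit. The equation
says `(1 + k)² + a² = 1`, so `1 + k ± i a` are unitary in the unitization. It is phrased through `k`
because only the non-unital algebra acts in the applications. -/
theorem exists_unitary_part {A : Type*} [NonUnitalCStarAlgebra A] {a : A} (ha : IsSelfAdjoint a)
    (h1 : ‖a‖ ≤ 1) :
    ∃ k : A, IsSelfAdjoint k ∧ Commute a k ∧ k + k + k * k + a * a = 0 := by
  let g : ℝ → ℝ := fun t => √(1 - t ^ 2) - 1
  have hg : Continuous g := by fun_prop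
  have hg0 : g 0 = 0 := by simp [g]
  have ha' : a = cfcₙ (id : ℝ → ℝ) a := (cfcₙ_id ℝ a).symm
  refine ⟨cfcₙ g a, cfcₙ_predicate g a, ?_, ?_⟩
  · nth_rw 1 [ha']
    exact cfcₙ_commute_cfcₙ id g a
  · nth_rw 5 [ha']
    nth_rw 6 [ha']
    rw [← cfcₙ_mul g g a (by fun_prop) hg0 (by fun_prop) hg0,
      ← cfcₙ_mul id id a (by fun_prop) rfl (by fun_prop) rfl,
      ← cfcₙ_add g g a (by fun_prop) hg0 (by fun_prop) hg0,
      ← cfcₙ_add _ _ a (by fun_prop) (by simp [hg0]) (by fun_prop) (by simp [hg0]),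
      ← cfcₙ_add _ _ a (by fun_prop) (by simp [hg0]) (by fun_prop) (by simp)]
    rw [← cfcₙ_const_zero ℝ a]
    refine cfcₙ_congr fun t ht => ?_
    have ht1 : |t| ≤ 1 :=
      (NonUnitalIsometricContinuousFunctionalCalculus.norm_quasispectrum_le a ht).trans h1
    have ht2 : t ^ 2 ≤ 1 := by rw [← sq_abs]; nlinarith [abs_nonneg t]
    have := Real.sq_sqrt (sub_nonneg.2 ht2)
    simp only [g, id]
    nlinarith

variable {E : Type*} [AddCommGroup E] [Module ℂ E] {G : Type*} [NormedAddCommGroup G]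
  [NormedSpace ℂ G]

/-- The seminorm `p` is given by the (possibly algebra valued) sesquilinear form `N`. -/
structure IsFormSeminorm (p : Seminorm ℂ E) (N : E →ₗ⋆[ℂ] E →ₗ[ℂ] G) : Prop where
  sq : ∀ x, ‖N x x‖ = p x ^ 2
  cs : ∀ x y, ‖N x y‖ ≤ p x * p y

theorem IsFormSeminorm.le_of_form_eq {p : Seminorm ℂ E} {N : E →ₗ⋆[ℂ] E →ₗ[ℂ] G}
    (h : IsFormSeminorm p N) {x y : E} (hxy : N x x = N y y) : p x = p y := by
  have h1 := h.sq x
  rw [hxy, h.sq y] at h1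
  exact ((sq_eq_sq₀ (apply_nonneg p _) (apply_nonneg p _)).1 h1).symm

/-- A C⋆-algebra acting by adjointable operators acts contractively. -/
theorem IsFormSeminorm.action_le {p : Seminorm ℂ E} {N : E →ₗ⋆[ℂ] E →ₗ[ℂ] G}
    (h : IsFormSeminorm p N) {A : Type*} [NonUnitalCStarAlgebra A] (L : A →ₗ[ℂ] E →ₗ[ℂ] E)
    (hL : ∀ a b x, L (a * b) x = L a (L b x)) (hN : ∀ a x y, N (L a x) y = N x (L (star a) y))
    (a : A) (x : E) : p (L a x) ≤ ‖a‖ * p x := by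
  have key : ∀ a : A, IsSelfAdjoint a → ‖a‖ ≤ 1 → ∀ x, p (L a x) ≤ p x := by
    intro a ha h1 x
    obtain ⟨k, hk, hak, hk0⟩ := exists_unitary_part ha h1
    have h0 : ∀ y, L k y + L k y + L k (L k y) + L a (L a y) = 0 := fun y => by
      have := congrArg (fun b => L b y) hk0
      simpa [hL] using this
    have hc : ∀ y, L a (L k y) = L k (L a y) := fun y => by rw [← hL, ← hL, hak.eq]
    -- The two conditions on `c` mean `c = ± i`. The operator `1 + k + c a` has the form-adjoint `1
    -- + k + c̄ a`, and their product is the identity by `h0`; so it preserves the form, hence the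
    -- seminorm. Positivity of the form is not needed.
    have hu : ∀ c : ℂ, star c * c = 1 → c * c = -1 →
        p (x + L k x + c • L a x) = p x := fun c hc1 hc2 => by
      have hsc : star c = -c := by
        have : star c * c * c = c := by rw [hc1, one_mul]
        rw [mul_assoc, hc2] at this
        linear_combination -this
      refine h.le_of_form_eq ?_
      have e1 : ∀ y, N (x + L k x + c • L a x) y = N x (y + L k y + star c • L a y) := by
        intro y
        simp only [map_add, LinearMap.add_apply, hN, hk.star_eq, ha.star_eq, map_smul,
          LinearMap.map_smulₛₗ, LinearMap.smul_apply]
        rfl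
      rw [e1]
      congr 1
      simp only [map_add, map_smul, smul_add, smul_smul, hc, hsc, neg_mul, hc2, neg_neg, one_smul,
        neg_smul]
      have := h0 x
      rw [← sub_eq_zero, ← this]
      abel
    -- With `u± = 1 + k ± i a` this is `a = -(i/2) (u₊ - u₋)`, a combination of two isometries with
    -- coefficients of modulus 1/2.
    have e2 : L a x = (-(Complex.I / 2)) • ((x + L k x + Complex.I • L a x) -
        (x + L k x + (-Complex.I) • L a x)) := by
      have : (x + L k x + Complex.I • L a x) - (x + L k x + (-Complex.I) • L a x) =
        (2 * Complex.I) • L a x := by module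
      rw [this, smul_smul]
      have : -(Complex.I / 2) * (2 * Complex.I) = 1 := by
        linear_combination -Complex.I_mul_I
      rw [this, one_smul]
    rw [e2, map_smul_eq_mul]
    have e3 := map_sub_le_add p (x + L k x + Complex.I • L a x) (x + L k x + (-Complex.I) • L a x)
    rw [hu Complex.I (by simp) (by simp), hu (-Complex.I) (by simp) (by simp)] at e3
    have e4 : ‖-(Complex.I / 2)‖ = 1 / 2 := by simp
    rw [e4]
    linarith
  have key2 : ∀ a : A, IsSelfAdjoint a → ∀ x, p (L a x) ≤ ‖a‖ * p x := by
    intro a ha x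
    rcases eq_or_ne a 0 with rfl | h0
    · simp
    have hn : 0 < ‖a‖ := norm_pos_iff.2 h0
    have h1 := key (((‖a‖⁻¹ : ℝ) : ℂ) • a) (by
      rw [IsSelfAdjoint, star_smul, ha.star_eq]; simp) (by
      rw [norm_smul]; simp [hn.ne']) x
    rw [map_smul, LinearMap.smul_apply, map_smul_eq_mul] at h1
    simp only [Complex.ofReal_inv, norm_inv, Complex.norm_real, norm_norm] at h1
    rwa [inv_mul_le_iff₀ hn] at h1
  -- The general case reduces to the self-adjoint element `star a * a`: `p (a x) ^ 2 = ‖N x (a⋆a x)‖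
  -- ≤ p x * (‖a‖ ^ 2 * p x)`.
  have h1 : p (L a x) ^ 2 ≤ (‖a‖ * p x) ^ 2 := by
    rw [← h.sq, hN, ← hL]
    refine (h.cs _ _).trans ?_
    have := key2 (star a * a) (IsSelfAdjoint.star_mul_self a) x
    rw [CStarRing.norm_star_mul_self] at this
    nlinarith [apply_nonneg p x]
  exact le_of_sq_le_sq h1 (by positivity)

variable {R : Type w} [NonUnitalRing R] [Module ℂ R] [StarRing R]

/-- The operator seminorm of an adjointable action by bounded operators. -/
theorem IsFormSeminorm.exists_opSeminorm [IsScalarTower ℂ R R] {p : Seminorm ℂ E}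
    {N : E →ₗ⋆[ℂ] E →ₗ[ℂ] G}
    (h : IsFormSeminorm p N) (L : R →ₗ[ℂ] E →ₗ[ℂ] E)
    (hL : ∀ a b x, L (a * b) x = L a (L b x)) (hN : ∀ a x y, N (L a x) y = N x (L (star a) y))
    (hb : ∀ a, ∃ C, ∀ x, p (L a x) ≤ C * p x) :
    ∃ P : Seminorm ℂ R, IsCStarSeminorm P ∧ ∀ a x, p (L a x) ≤ P a * p x := by
  let Φ : R →ₗ[ℂ] (SemType p →L[ℂ] SemType p) :=
    { toFun := fun a => LinearMap.mkContinuousOfExistsBound (σ := RingHom.id ℂ)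
        (E := SemType p) (F := SemType p) (L a) (hb a)
      map_add' := fun a b => by ext x; exact congrArg (fun f => f x) (L.map_add a b)
      map_smul' := fun k a => by ext x; exact congrArg (fun f => f x) (L.map_smul k a) }
  have hle : ∀ a (x : E), p (L a x) ≤ ‖Φ a‖ * p x := fun a x => (Φ a).le_opNorm x
  refine ⟨(normSeminorm ℂ _).comp Φ, isCStarSeminorm_of_le_star (fun a b => ?_) (fun a => ?_), hle⟩
  · have : Φ (a * b) = (Φ a).comp (Φ b) := by ext x; exact hL a b x
    change ‖Φ (a * b)‖ ≤ ‖Φ a‖ * ‖Φ b‖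
    rw [this]
    exact ContinuousLinearMap.opNorm_comp_le _ _
  · change ‖Φ a‖ ^ 2 ≤ ‖Φ (star a * a)‖
    -- The usual proof of the C⋆-identity for operators: adjointability moves `a` across the form,
    -- and the Cauchy-Schwarz bound leaves the norm of `Φ (star a * a)`.
    have : ‖Φ a‖ ≤ √‖Φ (star a * a)‖ := by
      suffices H : ∀ x : E, p (L a x) ≤ √‖Φ (star a * a)‖ * p x from
        ContinuousLinearMap.opNorm_le_bound _ (by positivity) H
      intro x
      have h1 : p (L a x) ^ 2 ≤ (√‖Φ (star a * a)‖ * p x) ^ 2 := by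
        rw [← h.sq, hN, ← hL, mul_pow, Real.sq_sqrt (norm_nonneg _)]
        refine (h.cs _ _).trans ?_
        have := hle (star a * a) x
        nlinarith [apply_nonneg p x]
      exact le_of_sq_le_sq h1 (mul_nonneg (by positivity) (apply_nonneg p x))
    calc ‖Φ a‖ ^ 2 ≤ √‖Φ (star a * a)‖ ^ 2 := by gcongr
      _ = _ := Real.sq_sqrt (norm_nonneg _)

end Multipliers

/-! ### Enveloping C⋆-algebras -/

section Enveloping

theorem continuous_starHom {D Q : Type*} [NonUnitalCStarAlgebra D] [NonUnitalCStarAlgebra Q]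
    (g : D →⋆ₙₐ[ℂ] Q) : Continuous g :=
  AddMonoidHomClass.continuous_of_bound g 1 fun x => by
    simpa using NonUnitalStarAlgHom.norm_apply_le g x

theorem starHom_ext_of_denseRange {D Q : Type*} [NonUnitalCStarAlgebra D] [NonUnitalCStarAlgebra Q]
    {T : Type*}
    {f : T → D} (hf : DenseRange f) {g h : D →⋆ₙₐ[ℂ] Q} (H : ∀ x, g (f x) = h (f x)) (d : D) :
    g d = h d := by
  exact congrFun (hf.equalizer (continuous_starHom g) (continuous_starHom h) (funext H)) d

variable {R : Type w} [NonUnitalRing R] [Module ℂ R] [StarRing R]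

/-- The ⋆-homomorphism `f` exhibits `D` as the enveloping C⋆-algebra of `R`. -/
def IsEnveloping {D : Type*} [NonUnitalCStarAlgebra D] (f : R →⋆ₙₐ[ℂ] D) : Prop :=
  DenseRange f ∧
    ∀ x : R, IsLUB {r : ℝ | ∃ p : Seminorm ℂ R, IsCStarSeminorm p ∧ r = p x} ‖f x‖

theorem IsEnveloping.le {D : Type*} [NonUnitalCStarAlgebra D] {f : R →⋆ₙₐ[ℂ] D}
    (hf : IsEnveloping f) {p : Seminorm ℂ R} (hp : IsCStarSeminorm p) (x : R) : p x ≤ ‖f x‖ :=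
  (hf.2 x).1 ⟨p, hp, rfl⟩

/-- Only the upper bound has to be shown: `x ↦ ‖f x‖` is itself a C⋆-seminorm, so no smaller bound
exists. -/
theorem isEnveloping_of_le {D : Type*} [NonUnitalCStarAlgebra D] {f : R →⋆ₙₐ[ℂ] D}
    (hd : DenseRange f) (h : ∀ p : Seminorm ℂ R, IsCStarSeminorm p → ∀ x, p x ≤ ‖f x‖) :
    IsEnveloping f := by
  refine ⟨hd, fun x => ⟨?_, fun r hr => hr ⟨_, isCStarSeminorm_of_starHom f, rfl⟩⟩⟩
  rintro r ⟨p, hp, rfl⟩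
  exact h p hp x

/-- The counterpart of `IsFormSeminorm.action_le` for a mere ⋆-algebra. Boundedness of each operator
must now be assumed; the operator seminorm is then a C⋆-seminorm and the enveloping norm dominates
it. -/
theorem IsFormSeminorm.action_le_of_isEnveloping [IsScalarTower ℂ R R] {E : Type*}
    [AddCommGroup E] [Module ℂ E] {G : Type*} [NormedAddCommGroup G] [NormedSpace ℂ G]
    {p : Seminorm ℂ E} {N : E →ₗ⋆[ℂ] E →ₗ[ℂ] G} (h : IsFormSeminorm p N) {D : Type*}
    [NonUnitalCStarAlgebra D] {f : R →⋆ₙₐ[ℂ] D} (hf : IsEnveloping f) (L : R →ₗ[ℂ] E →ₗ[ℂ] E)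
    (hL : ∀ a b x, L (a * b) x = L a (L b x)) (hN : ∀ a x y, N (L a x) y = N x (L (star a) y))
    (hb : ∀ a, ∃ C, ∀ x, p (L a x) ≤ C * p x) (a : R) (x : E) : p (L a x) ≤ ‖f a‖ * p x := by
  obtain ⟨P, hP, hle⟩ := h.exists_opSeminorm L hL hN hb
  exact (hle a x).trans (mul_le_mul_of_nonneg_right (hf.le hP a) (apply_nonneg p x))

/-- The pointwise supremum of all C⋆-seminorms, finite by hypothesis, is again a C⋆-seminorm, since
submultiplicativity and `p x ^ 2 ≤ p (star x * x)` survive suprema. Its completion is the enveloping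
algebra. -/
theorem exists_isEnveloping [IsScalarTower ℂ R R] [SMulCommClass ℂ R R] [StarModule ℂ R]
    (h : ∀ x : R, ∃ C, ∀ p : Seminorm ℂ R, IsCStarSeminorm p → p x ≤ C) :
    ∃ (D : Type w) (_ : NonUnitalCStarAlgebra D) (f : R →⋆ₙₐ[ℂ] D), IsEnveloping f := by
  let S : Set (Seminorm ℂ R) := {p | IsCStarSeminorm p}
  choose C hC using h
  have hb : BddAbove S := Seminorm.bddAbove_iff.2 ⟨C, by
    rintro _ ⟨p, hp, rfl⟩ x
    exact hC x p hp⟩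
  have h0 : (0 : Seminorm ℂ R) ∈ S := ⟨fun x y => by simp, fun x => by simp⟩
  have hbx : ∀ x, BddAbove (Set.range fun p : S => p.1 x) := fun x =>
    ⟨C x, by rintro _ ⟨p, rfl⟩; exact hC x _ p.2⟩
  have hle : ∀ p ∈ S, ∀ x, p x ≤ sSup S x := fun p hp x => by
    rw [Seminorm.sSup_apply hb]
    exact le_ciSup (hbx x) ⟨p, hp⟩
  have hsup : ∀ x r, (∀ p ∈ S, p x ≤ r) → sSup S x ≤ r := fun x r hr => by
    rw [Seminorm.sSup_apply hb]
    have : Nonempty S := ⟨⟨0, h0⟩⟩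
    exact ciSup_le fun p => hr _ p.2
  have hS : IsCStarSeminorm (sSup S) := by
    refine isCStarSeminorm_of_le_star (fun x y => hsup _ _ fun p hp => ?_) fun x => ?_
    · refine (hp.1 x y).trans ?_
      exact mul_le_mul (hle p hp x) (hle p hp y) (apply_nonneg _ _) (apply_nonneg _ _)
    · have : sSup S x ≤ √(sSup S (star x * x)) := hsup _ _ fun p hp => by
        refine Real.le_sqrt_of_sq_le ?_
        rw [← hp.2]
        exact hle p hp _
      calc sSup S x ^ 2 ≤ √(sSup S (star x * x)) ^ 2 := by gcongr
        _ = _ := Real.sq_sqrt (apply_nonneg _ _)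
  obtain ⟨D, _, f, hf, hfn⟩ := hS.exists_completion
  exact ⟨D, _, f, isEnveloping_of_le hf fun p hp x => by rw [hfn]; exact hle p hp x⟩

/-- The universal property of enveloping C⋆-algebras. -/
theorem IsEnveloping.exists_lift {D Q : Type*} [NonUnitalCStarAlgebra D] [NonUnitalCStarAlgebra Q]
    {f : R →⋆ₙₐ[ℂ] D} (hf : IsEnveloping f) (g : R →⋆ₙₐ[ℂ] Q) :
    ∃ h : D →⋆ₙₐ[ℂ] Q, ∀ x, h (f x) = g x :=
  exists_starHom_extension hf.1 g fun x => hf.le (isCStarSeminorm_of_starHom g) x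

theorem IsEnveloping.comp_equiv {R' : Type*} [NonUnitalRing R'] [Module ℂ R'] [StarRing R']
    {D : Type*} [NonUnitalCStarAlgebra D] {f : R →⋆ₙₐ[ℂ] D} (hf : IsEnveloping f)
    (e : R' ≃⋆ₐ[ℂ] R) {f' : R' →⋆ₙₐ[ℂ] D} (hf' : ∀ x, f' x = f (e x)) : IsEnveloping f' := by
  refine isEnveloping_of_le ?_ fun p hp x => ?_
  · have : (f' : R' → D) = f ∘ e := funext hf'
    rw [this, DenseRange, (EquivLike.surjective e).range_comp]
    exact hf.1
  · have := hf.le (hp.comp (e.symm : R →⋆ₙₐ[ℂ] R')) (e x)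
    rw [hf']
    simpa using this

/-- Enveloping C⋆-algebras of isomorphic ⋆-algebras are isomorphic. -/
theorem IsEnveloping.exists_equiv {R' : Type*} [NonUnitalRing R'] [Module ℂ R'] [StarRing R']
    {D D' : Type*} [NonUnitalCStarAlgebra D] [NonUnitalCStarAlgebra D']
    {f : R →⋆ₙₐ[ℂ] D} (hf : IsEnveloping f) {f' : R' →⋆ₙₐ[ℂ] D'} (hf' : IsEnveloping f')
    (e : R ≃⋆ₐ[ℂ] R') : ∃ φ : D ≃⋆ₐ[ℂ] D', ∀ x, φ (f x) = f' (e x) := by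
  obtain ⟨g, hg⟩ := hf.exists_lift (f'.comp (e : R →⋆ₙₐ[ℂ] R'))
  obtain ⟨h, hh⟩ := hf'.exists_lift (f.comp (e.symm : R' →⋆ₙₐ[ℂ] R))
  refine ⟨StarAlgEquiv.ofBijective g (Function.bijective_iff_has_inverse.2 ⟨h, fun d => ?_, fun d => ?_⟩), hg⟩
  · exact starHom_ext_of_denseRange hf.1 (g := h.comp g) (h := NonUnitalStarAlgHom.id ℂ D)
      (fun x => by simp [hg, hh]) d
  · exact starHom_ext_of_denseRange hf'.1 (g := g.comp h) (h := NonUnitalStarAlgHom.id ℂ D')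
      (fun x => by simp [hg, hh]) d

end Enveloping

/-! ### Tensor products of ⋆-algebras -/

section TensorAlgebra

variable {A B C R : Type*}
  [NonUnitalRing A] [Module ℂ A] [IsScalarTower ℂ A A] [SMulCommClass ℂ A A] [StarRing A]
  [StarModule ℂ A]
  [NonUnitalRing B] [Module ℂ B] [IsScalarTower ℂ B B] [SMulCommClass ℂ B B] [StarRing B]
  [StarModule ℂ B]
  [NonUnitalRing C] [Module ℂ C] [IsScalarTower ℂ C C] [SMulCommClass ℂ C C] [StarRing C]
  [StarModule ℂ C]
  [NonUnitalRing R] [Module ℂ R] [IsScalarTower ℂ R R] [SMulCommClass ℂ R R] [StarRing R]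
  [StarModule ℂ R]

theorem tensor_mul_hom_of_tmul (f : A ⊗[ℂ] B →ₗ[ℂ] R)
    (h : ∀ a b a' b', f ((a ⊗ₜ b) * (a' ⊗ₜ b')) = f (a ⊗ₜ b) * f (a' ⊗ₜ b')) (s t : A ⊗[ℂ] B) :
    f (s * t) = f s * f t := by
  induction s with
  | zero => simp
  | add x y hx hy => rw [add_mul, map_add, hx, hy, map_add, add_mul]
  | tmul a b =>
    induction t with
    | zero => simp
    | add x y hx hy => rw [mul_add, map_add, hx, hy, map_add, mul_add]
    | tmul a' b' => exact h a b a' b'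

theorem tensor_star_hom_of_tmul (f : A ⊗[ℂ] B →ₗ[ℂ] R)
    (h : ∀ a b, f (star a ⊗ₜ star b) = star (f (a ⊗ₜ b))) (s : A ⊗[ℂ] B) :
    f (star s) = star (f s) := by
  induction s with
  | zero => simp
  | add x y hx hy => rw [star_add, map_add, hx, hy, map_add, star_add]
  | tmul a b => rw [TensorProduct.star_tmul, h]

/-- The ⋆-homomorphism on the tensor product given by a multiplicative bilinear map. -/
def tensorLift (β : A →ₗ[ℂ] B →ₗ[ℂ] R) (hmul : ∀ a b a' b', β (a * a') (b * b') = β a b * β a' b')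
    (hstar : ∀ a b, β (star a) (star b) = star (β a b)) : A ⊗[ℂ] B →⋆ₙₐ[ℂ] R where
  toFun := TensorProduct.lift β
  map_smul' := map_smul _
  map_zero' := map_zero _
  map_add' := map_add _
  map_mul' := tensor_mul_hom_of_tmul _ (by simpa using hmul)
  map_star' := tensor_star_hom_of_tmul _ (by simpa using hstar)

variable {A' B' : Type*}
  [NonUnitalRing A'] [Module ℂ A'] [IsScalarTower ℂ A' A'] [SMulCommClass ℂ A' A'] [StarRing A']
  [StarModule ℂ A']
  [NonUnitalRing B'] [Module ℂ B'] [IsScalarTower ℂ B' B'] [SMulCommClass ℂ B' B'] [StarRing B']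
  [StarModule ℂ B']

/-- The tensor product of two ⋆-homomorphisms. -/
def tensorMap (f : A →⋆ₙₐ[ℂ] A') (g : B →⋆ₙₐ[ℂ] B') : A ⊗[ℂ] B →⋆ₙₐ[ℂ] A' ⊗[ℂ] B' :=
  tensorLift ((TensorProduct.mk ℂ A' B').compl₁₂ (f : A →ₗ[ℂ] A') (g : B →ₗ[ℂ] B'))
    (by simp) (by simp [map_star])

@[simp]
theorem tensorMap_tmul (f : A →⋆ₙₐ[ℂ] A') (g : B →⋆ₙₐ[ℂ] B') (a : A) (b : B) :
    tensorMap f g (a ⊗ₜ b) = f a ⊗ₜ g b := rfl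

theorem tensorMap_surjective {f : A →⋆ₙₐ[ℂ] A'} {g : B →⋆ₙₐ[ℂ] B'} (hf : Function.Surjective f)
    (hg : Function.Surjective g) : Function.Surjective (tensorMap f g) :=
  TensorProduct.map_surjective (g := (f : A →ₗ[ℂ] A')) (g' := (g : B →ₗ[ℂ] B')) hf hg

/-- The tensor product of two ⋆-isomorphisms. -/
def tensorCongr (f : A ≃⋆ₐ[ℂ] A') (g : B ≃⋆ₐ[ℂ] B') : A ⊗[ℂ] B ≃⋆ₐ[ℂ] A' ⊗[ℂ] B' where
  toFun := tensorMap (f : A →⋆ₙₐ[ℂ] A') (g : B →⋆ₙₐ[ℂ] B')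
  invFun := tensorMap (f.symm : A' →⋆ₙₐ[ℂ] A) (g.symm : B' →⋆ₙₐ[ℂ] B)
  left_inv t := by
    induction t with
    | zero => simp
    | add x y hx hy => rw [map_add, map_add, hx, hy]
    | tmul a b => simp
  right_inv t := by
    induction t with
    | zero => simp
    | add x y hx hy => rw [map_add, map_add, hx, hy]
    | tmul a b => simp
  map_mul' := map_mul _
  map_add' := map_add _
  map_star' := map_star _
  map_smul' := map_smul _

@[simp]
theorem tensorCongr_tmul (f : A ≃⋆ₐ[ℂ] A') (g : B ≃⋆ₐ[ℂ] B') (a : A) (b : B) :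
    tensorCongr f g (a ⊗ₜ b) = f a ⊗ₜ g b := rfl

variable (A B C) in
/-- The flip of a tensor product of ⋆-algebras. -/
def tensorComm : A ⊗[ℂ] B ≃⋆ₐ[ℂ] B ⊗[ℂ] A where
  __ := TensorProduct.comm ℂ A B
  map_mul' := tensor_mul_hom_of_tmul (TensorProduct.comm ℂ A B).toLinearMap (by simp)
  map_star' := tensor_star_hom_of_tmul (TensorProduct.comm ℂ A B).toLinearMap (by simp)
  map_smul' := map_smul (TensorProduct.comm ℂ A B)

variable (A B C) in
/-- The associator of a tensor product of ⋆-algebras. -/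
def tensorAssoc : (A ⊗[ℂ] B) ⊗[ℂ] C ≃⋆ₐ[ℂ] A ⊗[ℂ] (B ⊗[ℂ] C) where
  __ := TensorProduct.assoc ℂ A B C
  map_mul' := by
    refine tensor_mul_hom_of_tmul (A := A ⊗[ℂ] B) (B := C) (R := A ⊗[ℂ] (B ⊗[ℂ] C))
      (TensorProduct.assoc ℂ A B C).toLinearMap fun s c t c' => ?_
    induction s with
    | zero => simp
    | add x y hx hy => simp only [TensorProduct.add_tmul, add_mul, map_add] at hx hy ⊢; rw [hx, hy]
    | tmul a b =>
      induction t with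
      | zero => simp
      | add x y hx hy =>
        simp only [TensorProduct.add_tmul, mul_add, map_add] at hx hy ⊢; rw [hx, hy]
      | tmul a' b' => simp
  map_star' := by
    refine tensor_star_hom_of_tmul (A := A ⊗[ℂ] B) (B := C) (R := A ⊗[ℂ] (B ⊗[ℂ] C))
      (TensorProduct.assoc ℂ A B C).toLinearMap fun s c => ?_
    induction s with
    | zero => simp
    | add x y hx hy => simp only [TensorProduct.add_tmul, star_add, map_add] at hx hy ⊢; rw [hx, hy]
    | tmul a b => simp
  map_smul' := map_smul (TensorProduct.assoc ℂ A B C)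

/-- A C⋆-seminorm descends along the tensor product of two surjections if it vanishes on the
elementary tensors with a factor in one of the kernels. -/
theorem IsCStarSeminorm.exists_descend {p : Seminorm ℂ (A ⊗[ℂ] B)} (hp : IsCStarSeminorm p)
    {f : A →⋆ₙₐ[ℂ] A'} {g : B →⋆ₙₐ[ℂ] B'} (hf : Function.Surjective f)
    (hg : Function.Surjective g) (h1 : ∀ a b, f a = 0 → p (a ⊗ₜ b) = 0)
    (h2 : ∀ a b, g b = 0 → p (a ⊗ₜ b) = 0) :
    ∃ q : Seminorm ℂ (A' ⊗[ℂ] B'), IsCStarSeminorm q ∧ ∀ t, q (tensorMap f g t) = p t := by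
  -- `σ` and `τ` are only linear sections, so multiplicativity of `p ∘ (σ ⊗ τ)` is not automatic. It
  -- follows because every `t` differs from the lift of its image by a vector that is null for `p`
  -- (`h0`).
  obtain ⟨σ, hσ⟩ := (f : A →ₗ[ℂ] A').exists_rightInverse_of_surjective
    (LinearMap.range_eq_top.2 hf)
  obtain ⟨τ, hτ⟩ := (g : B →ₗ[ℂ] B').exists_rightInverse_of_surjective
    (LinearMap.range_eq_top.2 hg)
  have hσ' : ∀ x, f (σ x) = x := fun x => congrArg (fun k => k x) hσ
  have hτ' : ∀ x, g (τ x) = x := fun x => congrArg (fun k => k x) hτ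
  let q := p.comp (TensorProduct.map σ τ)
  have h0 : ∀ t, p (t - TensorProduct.map σ τ (tensorMap f g t)) = 0 := by
    intro t
    refine le_antisymm ?_ (apply_nonneg _ _)
    induction t with
    | zero => simp
    | add x y hx hy =>
      rw [map_add, map_add, add_sub_add_comm]
      exact (map_add_le_add p _ _).trans (by linarith)
    | tmul a b =>
      have : a ⊗ₜ[ℂ] b - TensorProduct.map σ τ (tensorMap f g (a ⊗ₜ b)) =
          (a - σ (f a)) ⊗ₜ b + σ (f a) ⊗ₜ (b - τ (g b)) := by
        simp [TensorProduct.sub_tmul, TensorProduct.tmul_sub]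
      rw [this]
      refine (map_add_le_add p _ _).trans ?_
      rw [h1 _ _ (by simp [hσ']), h2 _ _ (by simp [hτ']), add_zero]
  have hq : ∀ t, q (tensorMap f g t) = p t := fun t => by
    have e1 := map_sub_le_add p t (t - TensorProduct.map σ τ (tensorMap f g t))
    have e2 := map_add_le_add p (TensorProduct.map σ τ (tensorMap f g t))
      (t - TensorProduct.map σ τ (tensorMap f g t))
    rw [h0, add_zero, sub_sub_cancel] at e1
    rw [h0, add_zero, add_sub_cancel] at e2
    exact le_antisymm e1 e2
  refine ⟨q, ⟨fun x y => ?_, fun x => ?_⟩, hq⟩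
  · obtain ⟨s, rfl⟩ := tensorMap_surjective hf hg x
    obtain ⟨t, rfl⟩ := tensorMap_surjective hf hg y
    rw [← map_mul, hq, hq, hq]
    exact hp.1 s t
  · obtain ⟨s, rfl⟩ := tensorMap_surjective hf hg x
    rw [← map_star, ← map_mul, hq, hq]
    exact hp.2 s

end TensorAlgebra

/-! ### C⋆-seminorms on tensor products of C⋆-algebras, and iterated maximal tensor products -/

section MaxTensor

/-- The algebra becomes a form module over its own completion through `N s t = f (star s * t)`. The
last clause allows adjointness of operators to be checked inside `R`. -/
theorem IsCStarSeminorm.exists_form {R : Type w} [NonUnitalRing R] [Module ℂ R] [StarRing R]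
    [IsScalarTower ℂ R R] [SMulCommClass ℂ R R] [StarModule ℂ R] {p : Seminorm ℂ R}
    (hp : IsCStarSeminorm p) :
    ∃ (D : Type w) (_ : NonUnitalCStarAlgebra D) (N : R →ₗ⋆[ℂ] R →ₗ[ℂ] D), IsFormSeminorm p N ∧
      ∀ s t s' t', star s * t = star s' * t' → N s t = N s' t' := by
  obtain ⟨D, _, f, -, hf⟩ := hp.exists_completion
  let N : R →ₗ⋆[ℂ] R →ₗ[ℂ] D := LinearMap.mk₂'ₛₗ (starRingEnd ℂ) (RingHom.id ℂ)
    (fun s t => f (star s * t)) (fun a b c => by simp [add_mul]) (fun k a b => by simp [smul_mul_assoc])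
    (fun a b c => by simp [mul_add]) (fun k a b => by simp [mul_smul_comm])
  have hN : ∀ s t, N s t = f (star s * t) := fun _ _ => rfl
  refine ⟨D, _, N, ⟨fun x => ?_, fun x y => ?_⟩, fun s t s' t' h => by rw [hN, hN, h]⟩
  · rw [hN, hf, hp.2]
  · rw [hN, hf]
    exact (hp.1 _ _).trans (by rw [hp.star_eq])

/-- Left multiplication of `A` on itself is contractive for any C⋆-seminorm `p`, so `p a ^ 2 = p
(star a * a) ≤ ‖a‖ * p a`. -/
theorem isEnveloping_id (A : Type*) [NonUnitalCStarAlgebra A] :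
    IsEnveloping (NonUnitalStarAlgHom.id ℂ A) := by
  refine isEnveloping_of_le Function.surjective_id.denseRange fun p hp a => ?_
  obtain ⟨D, _, N, h, hN⟩ := hp.exists_form
  have h1 := h.action_le (LinearMap.mul ℂ A) (fun a b x => by simp [mul_assoc])
    (fun a x y => hN _ _ _ _ (by simp [mul_assoc])) (star a) a
  rw [LinearMap.mul_apply', hp.2, norm_star] at h1
  change p a ≤ ‖a‖
  rcases (apply_nonneg p a).eq_or_lt with h0 | h0
  · rw [← h0]; positivity
  · nlinarith

variable {A : Type w} {B : Type w} [NonUnitalCStarAlgebra A] [NonUnitalCStarAlgebra B]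
variable {R : Type w} [NonUnitalRing R] [Module ℂ R] [IsScalarTower ℂ R R] [SMulCommClass ℂ R R]
  [StarRing R] [StarModule ℂ R] {C : Type w} [NonUnitalCStarAlgebra C]

variable (R C) in
/-- The action of the left factor on a tensor product. -/
def leftAction : R →ₗ[ℂ] R ⊗[ℂ] C →ₗ[ℂ] R ⊗[ℂ] C :=
  (LinearMap.rTensorHom C).comp (LinearMap.mul ℂ R)

@[simp]
theorem leftAction_tmul (r s : R) (c : C) : leftAction R C r (s ⊗ₜ c) = (r * s) ⊗ₜ c := rfl

variable (R C) in
/-- The action of the right factor on a tensor product. -/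
def rightAction : C →ₗ[ℂ] R ⊗[ℂ] C →ₗ[ℂ] R ⊗[ℂ] C :=
  (LinearMap.lTensorHom R).comp (LinearMap.mul ℂ C)

@[simp]
theorem rightAction_tmul (r : R) (b c : C) : rightAction R C b (r ⊗ₜ c) = r ⊗ₜ (b * c) := rfl

theorem leftAction_mul (a b : R) (x : R ⊗[ℂ] C) :
    leftAction R C (a * b) x = leftAction R C a (leftAction R C b x) := by
  induction x with
  | zero => simp
  | add x y hx hy => simp only [map_add, hx, hy]
  | tmul r c => simp [mul_assoc]

theorem rightAction_mul (a b : C) (x : R ⊗[ℂ] C) :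
    rightAction R C (a * b) x = rightAction R C a (rightAction R C b x) := by
  induction x with
  | zero => simp
  | add x y hx hy => simp only [map_add, hx, hy]
  | tmul r c => simp [mul_assoc]

theorem rTensor_star {T T' : R →ₗ[ℂ] R} (h : ∀ x y, star (T x) * y = star x * T' y)
    (x y : R ⊗[ℂ] C) : star (T.rTensor C x) * y = star x * T'.rTensor C y := by
  induction x with
  | zero => simp
  | add x z hx hz => simp only [map_add, star_add, add_mul, hx, hz]
  | tmul r c =>
    induction y with
    | zero => simp
    | add x z hx hz => simp only [map_add, mul_add, hx, hz]
    | tmul r c => simp [h]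

theorem leftAction_star (a : R) (x y : R ⊗[ℂ] C) :
    star (leftAction R C a x) * y = star x * leftAction R C (star a) y := by
  induction x with
  | zero => simp
  | add x z hx hz => simp only [map_add, star_add, add_mul, hx, hz]
  | tmul r c =>
    induction y with
    | zero => simp
    | add x z hx hz => simp only [map_add, mul_add, hx, hz]
    | tmul r c => simp [mul_assoc]

theorem rightAction_star (a : C) (x y : R ⊗[ℂ] C) :
    star (rightAction R C a x) * y = star x * rightAction R C (star a) y := by
  induction x with
  | zero => simp
  | add x z hx hz => simp only [map_add, star_add, add_mul, hx, hz]
  | tmul r c =>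
    induction y with
    | zero => simp
    | add x z hx hz => simp only [map_add, mul_add, hx, hz]
    | tmul r c => simp [mul_assoc]

theorem IsCStarSeminorm.rightAction_le {p : Seminorm ℂ (R ⊗[ℂ] C)} (hp : IsCStarSeminorm p) (c : C)
    (x : R ⊗[ℂ] C) : p (rightAction R C c x) ≤ ‖c‖ * p x := by
  obtain ⟨D, _, N, h, hN⟩ := hp.exists_form
  exact h.action_le (rightAction R C) rightAction_mul
    (fun a x y => hN _ _ _ _ (rightAction_star a x y)) c x

theorem IsCStarSeminorm.leftAction_le {p : Seminorm ℂ (R ⊗[ℂ] C)} (hp : IsCStarSeminorm p)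
    {D : Type*} [NonUnitalCStarAlgebra D] {ι : R →⋆ₙₐ[ℂ] D} (hι : IsEnveloping ι)
    (hb : ∀ r, ∃ K, ∀ x, p (leftAction R C r x) ≤ K * p x) (r : R)
    (x : R ⊗[ℂ] C) : p (leftAction R C r x) ≤ ‖ι r‖ * p x := by
  obtain ⟨D, _, N, h, hN⟩ := hp.exists_form
  exact h.action_le_of_isEnveloping hι (leftAction R C) leftAction_mul
    (fun a x y => hN _ _ _ _ (leftAction_star a x y)) hb r x

/-- The element `star (r ⊗ c) * (r ⊗ c)` arises from `r ⊗ c` by letting `star c` act on the right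
factor and `star r` on the left one. Hence `p (r ⊗ c) ^ 2 ≤ ‖ι r‖ * ‖c‖ * p (r ⊗ c)`, and one factor
cancels. -/
theorem IsCStarSeminorm.tmul_le {p : Seminorm ℂ (R ⊗[ℂ] C)} (hp : IsCStarSeminorm p)
    {D : Type*} [NonUnitalCStarAlgebra D] {ι : R →⋆ₙₐ[ℂ] D} (hι : IsEnveloping ι)
    (hb : ∀ r, ∃ K, ∀ x, p (leftAction R C r x) ≤ K * p x) (r : R)
    (c : C) : p (r ⊗ₜ c) ≤ ‖ι r‖ * ‖c‖ := by
  have h1 : p (r ⊗ₜ c) ^ 2 ≤ ‖ι r‖ * ‖c‖ * p (r ⊗ₜ c) := by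
    have h2 := hp.leftAction_le hι hb (star r) (rightAction R C (star c) (r ⊗ₜ c))
    have h3 := hp.rightAction_le (star c) (r ⊗ₜ c)
    rw [← hp.2]
    simp only [rightAction_tmul, leftAction_tmul, map_star, norm_star,
      TensorProduct.star_tmul, Algebra.TensorProduct.tmul_mul_tmul] at h2 h3 ⊢
    nlinarith [norm_nonneg (ι r)]
  rcases (apply_nonneg p (r ⊗ₜ c)).eq_or_lt with h0 | h0
  · rw [← h0]; positivity
  · nlinarith

theorem IsCStarSeminorm.leftAction_bounded {p : Seminorm ℂ (A ⊗[ℂ] C)} (hp : IsCStarSeminorm p)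
    (a : A) : ∃ K, ∀ x, p (leftAction A C a x) ≤ K * p x := by
  obtain ⟨D, _, N, h, hN⟩ := hp.exists_form
  exact ⟨‖a‖, h.action_le (leftAction A C) leftAction_mul
    (fun a x y => hN _ _ _ _ (leftAction_star a x y)) a⟩

/-- Every C⋆-seminorm on the tensor product of two C⋆-algebras is subcross. -/
theorem IsCStarSeminorm.tmul_le_norm {p : Seminorm ℂ (A ⊗[ℂ] B)} (hp : IsCStarSeminorm p)
    (a : A) (b : B) : p (a ⊗ₜ b) ≤ ‖a‖ * ‖b‖ :=
  hp.tmul_le (isEnveloping_id A) hp.leftAction_bounded a b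

theorem norm_starHom_tmul_le {D : Type*} [NonUnitalCStarAlgebra D] (f : A ⊗[ℂ] B →⋆ₙₐ[ℂ] D)
    (a : A) (b : B) : ‖f (a ⊗ₜ b)‖ ≤ ‖a‖ * ‖b‖ :=
  (isCStarSeminorm_of_starHom f).tmul_le_norm a b

variable (A B) in
theorem exists_maxTensor : ∃ (D : Type w) (_ : NonUnitalCStarAlgebra D) (f : A ⊗[ℂ] B →⋆ₙₐ[ℂ] D),
    IsEnveloping f := by
  refine exists_isEnveloping fun x => ?_
  induction x with
  | zero => exact ⟨0, fun p _ => by simp⟩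
  | add x y hx hy =>
    obtain ⟨C, hC⟩ := hx
    obtain ⟨C', hC'⟩ := hy
    exact ⟨C + C', fun p hp => (map_add_le_add p x y).trans (add_le_add (hC p hp) (hC' p hp))⟩
  | tmul a b => exact ⟨‖a‖ * ‖b‖, fun p hp => hp.tmul_le_norm a b⟩

theorem denseRange_of_tensorMap {D1 D2 : Type w} [NonUnitalCStarAlgebra D1]
    [NonUnitalCStarAlgebra D2] {ι₁ : R →⋆ₙₐ[ℂ] D1} (h1 : DenseRange ι₁)
    {ι₂ : D1 ⊗[ℂ] C →⋆ₙₐ[ℂ] D2} (h2 : DenseRange ι₂) {f : R ⊗[ℂ] C →⋆ₙₐ[ℂ] D2}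
    (hf : ∀ r c, f (r ⊗ₜ c) = ι₂ (ι₁ r ⊗ₜ c)) : DenseRange f := by
  have key : ∀ t, ι₂ t ∈ closure (Set.range f) := by
    let S := (LinearMap.range (f : R ⊗[ℂ] C →ₗ[ℂ] D2)).topologicalClosure
    have hS : (S : Set D2) = closure (Set.range f) := rfl
    intro t
    rw [← hS]
    induction t with
    | zero => rw [map_zero]; exact S.zero_mem
    | add x y hx hy => rw [map_add]; exact S.add_mem hx hy
    | tmul d c =>
      have hc : Continuous fun d => ι₂ (d ⊗ₜ c) :=
        (((ι₂ : D1 ⊗[ℂ] C →ₗ[ℂ] D2).comp ((TensorProduct.mk ℂ D1 C).flip c)).mkContinuous ‖c‖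
          fun d => by
            rw [mul_comm]
            exact norm_starHom_tmul_le ι₂ d c).continuous
      refine h1.induction_on (p := fun d => ι₂ (d ⊗ₜ c) ∈ S) d
        ((Submodule.isClosed_topologicalClosure _).preimage hc) fun r => ?_
      rw [← hf]
      exact subset_closure ⟨_, rfl⟩
  exact dense_closure.1 (h2.mono (Set.range_subset_iff.2 key))

/-- Completing the first factor before tensoring does not change the enveloping algebra. For a
C⋆-seminorm `p` with completion `Q`, the subcross estimate lets `r ↦ r ⊗ c` extend from `R` to `D1`,
which gives a ⋆-homomorphism from `D1 ⊗ C` to `Q`; its norm is at most that of `ι₂`. -/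
theorem IsEnveloping.tensor_of_bounded {D1 D2 : Type w} [NonUnitalCStarAlgebra D1]
    [NonUnitalCStarAlgebra D2] {ι₁ : R →⋆ₙₐ[ℂ] D1} (h1 : IsEnveloping ι₁)
    {ι₂ : D1 ⊗[ℂ] C →⋆ₙₐ[ℂ] D2} (h2 : IsEnveloping ι₂)
    (hb : ∀ p : Seminorm ℂ (R ⊗[ℂ] C), IsCStarSeminorm p →
      ∀ r, ∃ K, ∀ x, p (leftAction R C r x) ≤ K * p x)
    {f : R ⊗[ℂ] C →⋆ₙₐ[ℂ] D2} (hf : ∀ r c, f (r ⊗ₜ c) = ι₂ (ι₁ r ⊗ₜ c)) :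
    IsEnveloping f := by
  refine isEnveloping_of_le (denseRange_of_tensorMap h1.1 h2.1 hf) fun p hp x => ?_
  obtain ⟨Q, _, g, hg, hgn⟩ := hp.exists_completion
  obtain ⟨β, hβ, -⟩ := exists_bilinear_extension (e := (ι₁ : R →ₗ[ℂ] D1)) h1.1
    (f := (LinearMap.id : C →ₗ[ℂ] C)) Function.surjective_id.denseRange
    ((TensorProduct.mk ℂ R C).compr₂ (g : R ⊗[ℂ] C →ₗ[ℂ] Q)) 1 zero_le_one
    (fun s c => by
      rw [one_mul]
      exact (hgn _).le.trans (hp.tmul_le h1 (hb p hp) s c))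
  have hβ' : ∀ s c, β (ι₁ s) c = g (s ⊗ₜ c) := hβ
  let h : D1 ⊗[ℂ] C →⋆ₙₐ[ℂ] Q := tensorLift
    ((ContinuousLinearMap.coeLM ℂ).comp (β : D1 →ₗ[ℂ] C →L[ℂ] Q))
    (fun d c d' c' => h1.1.induction_on₂
      (p := fun d d' => β (d * d') (c * c') = β d c * β d' c')
      (isClosed_eq (by fun_prop) (by fun_prop)) (fun s t => by
        rw [← map_mul, hβ', hβ', hβ', ← map_mul, Algebra.TensorProduct.tmul_mul_tmul]) d d')
    (fun d c => h1.1.induction_on (p := fun d => β (star d) (star c) = star (β d c)) d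
      (isClosed_eq (by fun_prop) (by fun_prop)) (fun s => by
        rw [← map_star, hβ', hβ', ← map_star, TensorProduct.star_tmul]))
  have hh : ∃ u, h u = g x ∧ ι₂ u = f x := by
    induction x with
    | zero => exact ⟨0, by simp⟩
    | add x y hx hy =>
      obtain ⟨u, hu⟩ := hx
      obtain ⟨v, hv⟩ := hy
      exact ⟨u + v, by simp [hu, hv]⟩
    | tmul s c => exact ⟨ι₁ s ⊗ₜ c, hβ' s c, (hf s c).symm⟩
  obtain ⟨u, hu, hu'⟩ := hh
  rw [← hgn, ← hu, ← hu']
  exact h2.le (isCStarSeminorm_of_starHom h) _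

/-- Iterated maximal tensor products. -/
theorem IsEnveloping.tensor_tensor {D1 D2 : Type w} [NonUnitalCStarAlgebra D1]
    [NonUnitalCStarAlgebra D2] {ι₁ : A ⊗[ℂ] B →⋆ₙₐ[ℂ] D1} (h1 : IsEnveloping ι₁)
    {ι₂ : D1 ⊗[ℂ] C →⋆ₙₐ[ℂ] D2} (h2 : IsEnveloping ι₂)
    {f : (A ⊗[ℂ] B) ⊗[ℂ] C →⋆ₙₐ[ℂ] D2} (hf : ∀ r c, f (r ⊗ₜ c) = ι₂ (ι₁ r ⊗ₜ c)) :
    IsEnveloping (R := (A ⊗[ℂ] B) ⊗[ℂ] C) (D := D2) f := by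
  refine h1.tensor_of_bounded h2 (fun p hp => ?_) hf
  obtain ⟨D, _, N, h, hN⟩ := IsCStarSeminorm.exists_form (R := (A ⊗[ℂ] B) ⊗[ℂ] C) hp
  intro r
  induction r with
  | zero => exact ⟨0, fun x => by simp⟩
  | add r s hr hs =>
    obtain ⟨K, hK⟩ := hr
    obtain ⟨K', hK'⟩ := hs
    refine ⟨K + K', fun x => ?_⟩
    rw [map_add, LinearMap.add_apply, add_mul]
    exact (map_add_le_add p _ _).trans (add_le_add (hK x) (hK' x))
  | tmul a b =>
    -- The actions of `A` and `B` on the triple tensor product are actions of C⋆-algebras, hence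
    -- contractive. The left action of `a ⊗ b` is their composite, so it is bounded by `‖a‖ * ‖b‖`.
    let La : A →ₗ[ℂ] (A ⊗[ℂ] B) ⊗[ℂ] C →ₗ[ℂ] (A ⊗[ℂ] B) ⊗[ℂ] C :=
      (LinearMap.rTensorHom C).comp (leftAction A B)
    let Lb : B →ₗ[ℂ] (A ⊗[ℂ] B) ⊗[ℂ] C →ₗ[ℂ] (A ⊗[ℂ] B) ⊗[ℂ] C :=
      (LinearMap.rTensorHom C).comp (rightAction A B)
    have hLa : ∀ a s c, La a (s ⊗ₜ c) = leftAction A B a s ⊗ₜ c := fun _ _ _ => rfl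
    have hLb : ∀ a s c, Lb a (s ⊗ₜ c) = rightAction A B a s ⊗ₜ c := fun _ _ _ => rfl
    have ha := h.action_le La (fun a a' x => by
        induction x with
        | zero => simp
        | add x y hx hy => simp only [map_add, hx, hy]
        | tmul s c => simp [hLa, leftAction_mul])
      (fun a x y => hN _ _ _ _ (rTensor_star (leftAction_star a) x y)) a
    have hb := h.action_le Lb (fun a a' x => by
        induction x with
        | zero => simp
        | add x y hx hy => simp only [map_add, hx, hy]
        | tmul s c => simp [hLb, rightAction_mul])
      (fun a x y => hN _ _ _ _ (rTensor_star (rightAction_star a) x y)) b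
    refine ⟨‖a‖ * ‖b‖, fun x => ?_⟩
    have : leftAction (A ⊗[ℂ] B) C (a ⊗ₜ b) x = La a (Lb b x) := by
      induction x with
      | zero => simp
      | add x y hx hy => simp only [map_add, hx, hy]
      | tmul s c =>
        rw [hLb, hLa, leftAction_tmul]
        congr 1
        induction s with
        | zero => simp
        | add x y hx hy => simp only [map_add, mul_add, hx, hy]
        | tmul a' b' => simp
    rw [this, mul_assoc]
    exact (ha _).trans (mul_le_mul_of_nonneg_left (hb x) (norm_nonneg a))

end MaxTensor

/-! ### Sections of upper semicontinuous Banach bundles -/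

section BundleTopology

variable {X : Type u} [TopologicalSpace X] {Z : X → Type w} [∀ x, NormedAddCommGroup (Z x)]
  [∀ x, NormedSpace ℂ (Z x)] [TopologicalSpace (Tot Z)]

theorem tendsto_fibProd_iff {W W' : X → Type w} [TopologicalSpace (Tot W)]
    [TopologicalSpace (Tot W')] {α : Type*} {l : Filter α} {f : α → FibProd W W'}
    {p : FibProd W W'} :
    Tendsto f l (𝓝 p) ↔ Tendsto (fun a => (⟨(f a).base, (f a).fst⟩ : Tot W)) l (𝓝 ⟨p.base, p.fst⟩) ∧
      Tendsto (fun a => (⟨(f a).base, (f a).snd⟩ : Tot W')) l (𝓝 ⟨p.base, p.snd⟩) := by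
  rw [nhds_induced, tendsto_comap_iff, nhds_prod_eq, tendsto_prod_iff']
  rfl

namespace IsUSCBanachBundle

variable (h : IsUSCBanachBundle Z)

include h

theorem tendsto_base {α : Type*} {l : Filter α} {f : α → Tot Z} {z : Tot Z}
    (hf : Tendsto f l (𝓝 z)) : Tendsto (fun a => (f a).base) l (𝓝 z.base) :=
  (h.continuous_proj.tendsto z).comp hf

theorem tendsto_add {α : Type*} {l : Filter α} {b : α → X} {f g : ∀ a, Z (b a)} {x : X} {v w : Z x}
    (hf : Tendsto (fun a => (⟨b a, f a⟩ : Tot Z)) l (𝓝 ⟨x, v⟩))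
    (hg : Tendsto (fun a => (⟨b a, g a⟩ : Tot Z)) l (𝓝 ⟨x, w⟩)) :
    Tendsto (fun a => (⟨b a, f a + g a⟩ : Tot Z)) l (𝓝 ⟨x, v + w⟩) :=
  (h.continuous_add.tendsto ⟨x, v, w⟩).comp
    (tendsto_fibProd_iff.2 ⟨hf, hg⟩ : Tendsto (fun a => (⟨b a, f a, g a⟩ : FibProd Z Z)) l _)

theorem tendsto_const_smul {α : Type*} {l : Filter α} {b : α → X} {f : ∀ a, Z (b a)} {x : X} {v : Z x}
    (k : ℂ) (hf : Tendsto (fun a => (⟨b a, f a⟩ : Tot Z)) l (𝓝 ⟨x, v⟩)) :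
    Tendsto (fun a => (⟨b a, k • f a⟩ : Tot Z)) l (𝓝 ⟨x, k • v⟩) :=
  ((h.continuous_smul k).tendsto _).comp hf

theorem tendsto_neg {α : Type*} {l : Filter α} {b : α → X} {f : ∀ a, Z (b a)} {x : X} {v : Z x}
    (hf : Tendsto (fun a => (⟨b a, f a⟩ : Tot Z)) l (𝓝 ⟨x, v⟩)) :
    Tendsto (fun a => (⟨b a, -f a⟩ : Tot Z)) l (𝓝 ⟨x, -v⟩) := by
  simpa using h.tendsto_const_smul (-1) hf

theorem tendsto_sub {α : Type*} {l : Filter α} {b : α → X} {f g : ∀ a, Z (b a)} {x : X} {v w : Z x}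
    (hf : Tendsto (fun a => (⟨b a, f a⟩ : Tot Z)) l (𝓝 ⟨x, v⟩))
    (hg : Tendsto (fun a => (⟨b a, g a⟩ : Tot Z)) l (𝓝 ⟨x, w⟩)) :
    Tendsto (fun a => (⟨b a, f a - g a⟩ : Tot Z)) l (𝓝 ⟨x, v - w⟩) := by
  simpa only [sub_eq_add_neg] using h.tendsto_add hf (h.tendsto_neg hg)

theorem eventually_norm_lt {α : Type*} {l : Filter α} {b : α → X} {f : ∀ a, Z (b a)} {x : X}
    {v : Z x} (hf : Tendsto (fun a => (⟨b a, f a⟩ : Tot Z)) l (𝓝 ⟨x, v⟩)) {r : ℝ} (hr : ‖v‖ < r) :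
    ∀ᶠ a in l, ‖f a‖ < r :=
  hf.eventually (h.upperSemicontinuous_norm ⟨x, v⟩ r hr)

theorem tendsto_zero_of_norm {α : Type*} {l : Filter α} {b : α → X} {f : ∀ a, Z (b a)} {x : X}
    (hb : Tendsto b l (𝓝 x)) (hf : Tendsto (fun a => ‖f a‖) l (𝓝 0)) :
    Tendsto (fun a => (⟨b a, f a⟩ : Tot Z)) l (𝓝 ⟨x, 0⟩) :=
  h.tendsto_zero _ _ (tendsto_map'_iff.2 hf) (tendsto_map'_iff.2 hb)

theorem tendsto_smul {α : Type*} {l : Filter α} {b : α → X} {f : ∀ a, Z (b a)} {x : X} {v : Z x}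
    {φ : α → ℂ} {k : ℂ} (hφ : Tendsto φ l (𝓝 k))
    (hf : Tendsto (fun a => (⟨b a, f a⟩ : Tot Z)) l (𝓝 ⟨x, v⟩)) :
    Tendsto (fun a => (⟨b a, φ a • f a⟩ : Tot Z)) l (𝓝 ⟨x, k • v⟩) := by
  have h1 := h.tendsto_const_smul k hf
  have h2 : Tendsto (fun a => (⟨b a, (φ a - k) • f a⟩ : Tot Z)) l (𝓝 ⟨x, 0⟩) := by
    refine h.tendsto_zero_of_norm (h.tendsto_base hf) ?_
    have hb := h.eventually_norm_lt hf (lt_add_one ‖v‖)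
    have hφ' : Tendsto (fun a => ‖φ a - k‖ * (‖v‖ + 1)) l (𝓝 0) := by
      simpa using ((tendsto_sub_nhds_zero_iff.2 hφ).norm).mul_const (‖v‖ + 1)
    refine squeeze_zero' (Eventually.of_forall fun y => norm_nonneg _) ?_ hφ'
    filter_upwards [hb] with y hy
    rw [norm_smul]
    gcongr
  simpa [← add_smul] using h.tendsto_add h1 h2

theorem nhds_le_map_base {x : X} (v : Z x) : 𝓝 x ≤ map Tot.base (𝓝 (⟨x, v⟩ : Tot Z)) :=
  h.isOpenMap_proj.nhds_le ⟨x, v⟩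

theorem eventually_exists_mem {x : X} {v : Z x} {N : Set (Tot Z)} (hN : N ∈ 𝓝 (⟨x, v⟩ : Tot Z)) :
    ∀ᶠ y in 𝓝 x, ∃ t : Z y, (⟨y, t⟩ : Tot Z) ∈ N := by
  have := h.nhds_le_map_base v (image_mem_map hN)
  filter_upwards [this]
  rintro _ ⟨⟨y, t⟩, ht, rfl⟩
  exact ⟨t, ht⟩

/-- Every point of the total space has a neighbourhood which is thin in all fibres. -/
theorem exists_thin_nhds (z : Tot Z) {ε : ℝ} (hε : 0 < ε) :
    ∃ N : Set (Tot Z), IsOpen N ∧ z ∈ N ∧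
      ∀ y (a b : Z y), (⟨y, a⟩ : Tot Z) ∈ N → (⟨y, b⟩ : Tot Z) ∈ N → ‖a - b‖ < ε := by
  have h1 : Tendsto (fun p : FibProd Z Z => (⟨p.base, p.fst - p.snd⟩ : Tot Z))
      (𝓝 ⟨z.base, z.val, z.val⟩) (𝓝 ⟨z.base, z.val - z.val⟩) := by
    have := tendsto_fibProd_iff.1 (tendsto_id (x := 𝓝 (⟨z.base, z.val, z.val⟩ : FibProd Z Z)))
    exact h.tendsto_sub this.1 this.2
  -- Subtraction is continuous and sends the diagonal point to a zero vector, so by upper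
  -- semicontinuity the differences near it have norm below `ε`; a neighbourhood of the form `N × N`
  -- is then extracted.
  have h2 := h.eventually_norm_lt h1 (r := ε) (by simpa)
  rw [nhds_induced, eventually_comap, nhds_prod_eq] at h2
  obtain ⟨N, ⟨hN, hN'⟩, h3⟩ := ((nhds_basis_opens z).prod_self.eventually_iff).1 h2
  exact ⟨N, hN', hN, fun y a b ha hb => h3 (x := (⟨y, a⟩, ⟨y, b⟩)) ⟨ha, hb⟩ ⟨y, a, b⟩ rfl⟩

end IsUSCBanachBundle

/-- A section of a Banach bundle which is continuous up to an error of `ε`. -/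
def ApproxContAt (f : ∀ x, Z x) (ε : ℝ) (x : X) : Prop :=
  ∀ N ∈ 𝓝 (⟨x, f x⟩ : Tot Z), ∀ᶠ y in 𝓝 x, ∃ t : Z y, (⟨y, t⟩ : Tot Z) ∈ N ∧ ‖f y - t‖ ≤ ε

namespace IsUSCBanachBundle

variable (h : IsUSCBanachBundle Z)

include h

theorem approxContAt_sum {ι : Type*} (I : Finset ι) {φ : ι → X → ℂ} {s : ι → ∀ x, Z x} {ε : ℝ}
    {x : X} (hφ : ∀ i ∈ I, ContinuousAt (φ i) x) (hs : ∀ i ∈ I, ApproxContAt (s i) ε x)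
    {N : Set (Tot Z)} (hN : N ∈ 𝓝 (⟨x, ∑ i ∈ I, φ i x • s i x⟩ : Tot Z)) :
    ∀ᶠ y in 𝓝 x, ∃ t : Z y, (⟨y, t⟩ : Tot Z) ∈ N ∧
      ‖∑ i ∈ I, φ i y • s i y - t‖ ≤ ∑ i ∈ I, ‖φ i y‖ * ε := by
  classical
  induction I using Finset.induction_on generalizing N with
  | empty =>
    have : ∀ᶠ y in 𝓝 x, (⟨y, 0⟩ : Tot Z) ∈ N := (h.continuous_zero_section.tendsto x) hN
    filter_upwards [this] with y hy
    exact ⟨0, hy, by simp⟩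
  | insert i I hi ih =>
    rw [Finset.sum_insert hi] at hN
    have hadd : Tendsto (fun p : FibProd Z Z => (⟨p.base, φ i p.base • p.fst + p.snd⟩ : Tot Z))
        (𝓝 ⟨x, s i x, ∑ i ∈ I, φ i x • s i x⟩)
        (𝓝 ⟨x, φ i x • s i x + ∑ i ∈ I, φ i x • s i x⟩) := by
      have := tendsto_fibProd_iff.1 (tendsto_id (x := 𝓝 (⟨x, s i x, ∑ i ∈ I, φ i x • s i x⟩ :
        FibProd Z Z)))
      exact h.tendsto_add (h.tendsto_smul ((hφ i (by simp)).tendsto.comp (h.tendsto_base this.1))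
        this.1) this.2
    have h2 := hadd hN
    rw [mem_map, ← eventually_mem_set, nhds_induced, eventually_comap, nhds_prod_eq] at h2
    obtain ⟨N1, hN1, N2, hN2, h3⟩ := eventually_prod_iff.1 h2
    filter_upwards [hs i (by simp) _ hN1, ih (fun j hj => hφ j (by simp [hj]))
      (fun j hj => hs j (by simp [hj])) hN2] with y ⟨t, ht, htn⟩ ⟨t', ht', htn'⟩
    refine ⟨φ i y • t + t', h3 ht ht' ⟨y, t, t'⟩ rfl, ?_⟩
    rw [Finset.sum_insert hi, Finset.sum_insert hi, add_sub_add_comm, ← smul_sub]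
    refine (norm_add_le _ _).trans (add_le_add ?_ htn')
    rw [norm_smul]
    gcongr

/-- Around each `(x, f x)` take a neighbourhood `N x` that is `δ`-thin in every fibre, and near `x`
choose values in `N x` at distance at most `ε` from `f`. Whatever the choice, such a local section
is continuous up to `δ` because of the thinness. A partition of unity glues these sections, and
convexity preserves both estimates. -/
theorem exists_approxContAt_improve [NormalSpace X] [ParacompactSpace X] [T2Space X]
    {f : ∀ x, Z x} {ε δ : ℝ} (hδ : 0 < δ) (hf : ∀ x, ApproxContAt f ε x) (x₀ : X) :
    ∃ g : ∀ x, Z x, (∀ x, ApproxContAt g δ x) ∧ (∀ y, ‖g y - f y‖ ≤ ε) ∧ g x₀ = f x₀ := by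
  choose N hNo hN hNt using fun x => h.exists_thin_nhds (⟨x, f x⟩ : Tot Z) hδ
  -- To keep the value at `x₀`, only the set indexed by `x₀` may contain `x₀`, and the value chosen
  -- there is `f x₀` itself.
  have hU : ∀ x, ∃ U : Set X, IsOpen U ∧ x ∈ U ∧ (x₀ ∈ U → x = x₀) ∧
      ∀ y ∈ U, ∃ t : Z y, (⟨y, t⟩ : Tot Z) ∈ N x ∧ ‖f y - t‖ ≤ ε ∧ (y = x₀ → t = f y) := by
    intro x
    have h1 := hf x (N x) ((hNo x).mem_nhds (hN x))
    by_cases hx : x = x₀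
    · subst hx
      obtain ⟨U, hU, hUo, hxU⟩ := eventually_nhds_iff.1 h1
      refine ⟨U, hUo, hxU, fun _ => rfl, fun y hy => ?_⟩
      by_cases hyx : y = x
      · subst hyx
        obtain ⟨t, -, ht⟩ := hU y hy
        exact ⟨f y, hN y, by simpa using (norm_nonneg _).trans ht, fun _ => rfl⟩
      · obtain ⟨t, ht, ht'⟩ := hU y hy
        exact ⟨t, ht, ht', fun h => (hyx h).elim⟩
    · obtain ⟨U, hU, hUo, hxU⟩ := eventually_nhds_iff.1 (h1.and (isOpen_ne.mem_nhds hx))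
      refine ⟨U, hUo, hxU, fun h => ((hU x₀ h).2 rfl).elim, fun y hy => ?_⟩
      obtain ⟨t, ht, ht'⟩ := (hU y hy).1
      exact ⟨t, ht, ht', fun h => ((hU y hy).2 h).elim⟩
  choose U hUo hxU hUx₀ hUt using hU
  have hs : ∀ x y, ∃ t : Z y, y ∈ U x →
      (⟨y, t⟩ : Tot Z) ∈ N x ∧ ‖f y - t‖ ≤ ε ∧ (y = x₀ → t = f y) := by
    intro x y
    by_cases hy : y ∈ U x
    · obtain ⟨t, ht⟩ := hUt x y hy
      exact ⟨t, fun _ => ht⟩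
    · exact ⟨0, fun h => (hy h).elim⟩
  choose s hs using hs
  obtain ⟨ρ, hρ⟩ := PartitionOfUnity.exists_isSubordinate isClosed_univ U hUo
    (fun x _ => Set.mem_iUnion.2 ⟨x, hxU x⟩)
  let g : ∀ y, Z y := fun y => ∑ i ∈ ρ.finsupport y, (ρ i y : ℂ) • s i y
  have hsum : ∀ x y, ρ.finsupport y ⊆ ρ.fintsupport x →
      g y = ∑ i ∈ ρ.fintsupport x, (ρ i y : ℂ) • s i y := fun x y hy => by
    refine Finset.sum_subset hy fun i _ hi => ?_
    have : ρ i y = 0 := by simpa [ρ.mem_finsupport] using hi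
    simp [this]
  have hmem : ∀ i y, ρ i y ≠ 0 → y ∈ U i := fun i y hi => hρ i (subset_tsupport _ hi)
  have hone : ∀ y, ∑ i ∈ ρ.finsupport y, ρ i y = 1 := fun y =>
    ρ.sum_finsupport (Set.mem_univ y)
  have hconv : ∀ (y : X) (v : Z y), ∑ i ∈ ρ.finsupport y, (ρ i y : ℂ) • v = v := fun y v => by
    rw [← Finset.sum_smul, ← Complex.ofReal_sum, hone, Complex.ofReal_one, one_smul]
  refine ⟨g, fun x M hM => ?_, fun y => ?_, ?_⟩
  · have hsu := ρ.eventually_finsupport_subset x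
    rw [hsum x x hsu.self_of_nhds] at hM
    have := h.approxContAt_sum (ρ.fintsupport x) (φ := fun i y => (ρ i y : ℂ)) (s := s) (ε := δ)
      (fun i _ => (Complex.continuous_ofReal.comp (ρ i).continuous).continuousAt) (fun i hi => by
        have hxi : x ∈ U i := hρ i ((ρ.mem_fintsupport_iff _ _).1 hi)
        intro M hM
        filter_upwards [h.eventually_exists_mem (inter_mem hM ((hNo i).mem_nhds (hs i x hxi).1)),
          (hUo i).mem_nhds hxi] with y ⟨t, ht1, ht2⟩ hy
        exact ⟨t, ht1, (hNt i y _ _ (hs i y hy).1 ht2).le⟩) hM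
    filter_upwards [this, hsu] with y ⟨t, ht, htn⟩ hy
    refine ⟨t, ht, ?_⟩
    rw [hsum x y hy]
    refine htn.trans ?_
    rw [← Finset.sum_mul]
    have : ∑ i ∈ ρ.fintsupport x, ‖(ρ i y : ℂ)‖ = 1 := by
      rw [← hone y]
      symm
      rw [Finset.sum_subset hy fun i _ hi => by simpa [ρ.mem_finsupport] using hi]
      refine Finset.sum_congr rfl fun i _ => ?_
      rw [Complex.norm_real, Real.norm_of_nonneg (ρ.nonneg i y)]
    rw [this, one_mul]
  · have : g y - f y = ∑ i ∈ ρ.finsupport y, (ρ i y : ℂ) • (s i y - f y) := by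
      simp only [smul_sub, Finset.sum_sub_distrib]
      rw [hconv]
    rw [this]
    calc _ ≤ ∑ i ∈ ρ.finsupport y, ρ i y * ε := by
          refine norm_sum_le_of_le _ fun i hi => ?_
          rw [norm_smul, Complex.norm_real, Real.norm_of_nonneg (ρ.nonneg i y)]
          have hy := hmem i y (by simpa [ρ.mem_finsupport] using hi)
          exact mul_le_mul_of_nonneg_left (by rw [norm_sub_rev]; exact (hs i y hy).2.1)
            (ρ.nonneg i y)
      _ = ε := by rw [← Finset.sum_mul, hone, one_mul]
  · rw [← hconv x₀ (f x₀)]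
    refine Finset.sum_congr rfl fun i hi => ?_
    rw [(hs i x₀ (hmem i x₀ (by simpa [ρ.mem_finsupport] using hi))).2.2 rfl]

theorem continuousAt_of_approxContAt {f : ∀ x, Z x} {x : X} (hf : ∀ ε > 0, ApproxContAt f ε x) :
    Tendsto (fun y => (⟨y, f y⟩ : Tot Z)) (𝓝 x) (𝓝 ⟨x, f x⟩) := by
  intro O hO
  have hadd : Tendsto (fun p : FibProd Z Z => (⟨p.base, p.fst + p.snd⟩ : Tot Z))
      (𝓝 ⟨x, f x, 0⟩) (𝓝 ⟨x, f x⟩) := by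
    simpa using h.continuous_add.tendsto (⟨x, f x, 0⟩ : FibProd Z Z)
  have h2 := hadd hO
  rw [mem_map, ← eventually_mem_set, nhds_induced, eventually_comap, nhds_prod_eq] at h2
  obtain ⟨N1, hN1, N2, hN2, h3⟩ := eventually_prod_iff.1 h2
  have h4 := h.tendsto_zero (comap (fun z : Tot Z => ‖z.val‖) (𝓝 0) ⊓ comap Tot.base (𝓝 x)) x
    (tendsto_comap.mono_left inf_le_left) (tendsto_comap.mono_left inf_le_right) hN2
  obtain ⟨S, hS, T, hT, hST⟩ := mem_inf_iff_superset.1 h4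
  obtain ⟨S', hS', hSS⟩ := mem_comap.1 hS
  obtain ⟨T', hT', hTT⟩ := mem_comap.1 hT
  obtain ⟨ε, hε, hεS⟩ := Metric.mem_nhds_iff.1 hS'
  change ∀ᶠ y in 𝓝 x, (⟨y, f y⟩ : Tot Z) ∈ O
  filter_upwards [hf (ε / 2) (half_pos hε) _ hN1, hT'] with y ⟨t, ht, htn⟩ hy
  have h5 : N2 (⟨y, f y - t⟩ : Tot Z) := hST
    ⟨hSS (hεS (by simpa using htn.trans_lt (half_lt_self hε))), hTT hy⟩
  simpa using h3 ht h5 ⟨y, t, f y - t⟩ rfl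

/-- An upper semicontinuous Banach bundle over a paracompact space has a continuous section through
every point of the total space. -/
theorem exists_section [NormalSpace X] [ParacompactSpace X] [T2Space X] (x₀ : X) (v : Z x₀) :
    ∃ f : ∀ x, Z x, Continuous (fun x => (⟨x, f x⟩ : Tot Z)) ∧ f x₀ = v := by
  classical
  let c := ‖v‖ + 1
  have hc : 0 < c := by positivity
  -- The rate `c / 2 / 2 ^ n` makes the successive improvements a Cauchy sequence whose limit is
  -- within `c / 2 ^ n` of the `n`-th term, uniformly in the base point.
  let ε : ℕ → ℝ := fun n => c / 2 / 2 ^ n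
  have hε : ∀ n, 0 < ε n := fun n => by positivity
  -- The iteration starts from the section that is `v` at `x₀` and zero elsewhere. It is
  -- discontinuous, but continuous up to `c = ‖v‖ + 1`, since vectors near `v` have norm below `c`.
  let f₀ : ∀ x, Z x := fun x => if hx : x = x₀ then hx ▸ v else 0
  have hf₀ : f₀ x₀ = v := by simp [f₀]
  have hf₀' : ∀ x, ApproxContAt f₀ c x := by
    intro x N hN
    by_cases hx : x = x₀
    · subst hx
      rw [hf₀] at hN
      have : ∀ᶠ z in 𝓝 (⟨x, v⟩ : Tot Z), ‖z.val‖ < c :=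
        h.upperSemicontinuous_norm ⟨x, v⟩ c (lt_add_one _)
      filter_upwards [h.eventually_exists_mem (inter_mem hN this)] with y ⟨t, ht, htn⟩
      by_cases hy : y = x
      · subst hy
        exact ⟨v, mem_of_mem_nhds hN, by rw [hf₀]; simpa using hc.le⟩
      · exact ⟨t, ht, by simpa [f₀, hy] using (show ‖t‖ < c from htn).le⟩
    · have : f₀ x = 0 := by simp [f₀, hx]
      rw [this] at hN
      filter_upwards [(h.continuous_zero_section.tendsto x) hN, isOpen_ne.mem_nhds hx] with y hy hyx
      refine ⟨0, hy, ?_⟩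
      simpa [f₀, show y ≠ x₀ from hyx] using hc.le
  obtain ⟨f₁, hf₁, -, hf₁'⟩ := h.exists_approxContAt_improve (hε 0) hf₀' x₀
  let S (n : ℕ) := {f : ∀ x, Z x // (∀ x, ApproxContAt f (ε n) x) ∧ f x₀ = v}
  have step : ∀ n (f : S n), ∃ g : S (n + 1), ∀ y, ‖g.1 y - f.1 y‖ ≤ ε n := fun n f => by
    obtain ⟨g, hg, hgn, hg0⟩ := h.exists_approxContAt_improve (hε (n + 1)) f.2.1 x₀
    exact ⟨⟨g, hg, hg0.trans f.2.2⟩, hgn⟩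
  choose next hnext using step
  let F : ∀ n, S n := fun n => Nat.rec ⟨f₁, hf₁, hf₁'.trans hf₀⟩ (fun n f => next n f) n
  have hF : ∀ n y, dist ((F n).1 y) ((F (n + 1)).1 y) ≤ ε n := fun n y => by
    rw [dist_comm, dist_eq_norm]
    exact hnext n (F n) y
  have hlim : ∀ y, ∃ a, Tendsto (fun n => (F n).1 y) atTop (𝓝 a) := fun y => by
    have := h.complete y
    exact cauchySeq_tendsto_of_complete (cauchySeq_of_le_geometric_two fun n => hF n y)
  choose G hG using hlim
  have hGF : ∀ n y, ‖G y - (F n).1 y‖ ≤ c / 2 ^ n := fun n y => by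
    rw [← dist_eq_norm, dist_comm]
    exact dist_le_of_le_geometric_two_of_tendsto (fun n => hF n y) (hG y) n
  refine ⟨G, continuous_iff_continuousAt.2 fun x => h.continuousAt_of_approxContAt ?_, ?_⟩
  · intro η hη N hN
    obtain ⟨n, hn⟩ : ∃ n : ℕ, c / 2 ^ n < η / 4 := by
      have : Tendsto (fun n : ℕ => c / 2 ^ n) atTop (𝓝 0) := by
        simpa [div_eq_mul_inv] using
          (tendsto_pow_atTop_nhds_zero_of_lt_one (r := (1 / 2 : ℝ)) (by norm_num)
            (by norm_num)).const_mul c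
      exact (this.eventually (gt_mem_nhds (by positivity))).exists
    -- Write `G x = F n x + (G x - F n x)`. The first summand is nearly continuous, and the second
    -- is small, so nearby fibres contain small vectors close to it in the total space.
    have hadd : Tendsto (fun p : FibProd Z Z => (⟨p.base, p.fst + p.snd⟩ : Tot Z))
        (𝓝 ⟨x, (F n).1 x, G x - (F n).1 x⟩) (𝓝 ⟨x, G x⟩) := by
      simpa using h.continuous_add.tendsto (⟨x, (F n).1 x, G x - (F n).1 x⟩ : FibProd Z Z)
    have h2 := hadd hN
    rw [mem_map, ← eventually_mem_set, nhds_induced, eventually_comap, nhds_prod_eq] at h2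
    obtain ⟨N1, hN1, N2, hN2, h3⟩ := eventually_prod_iff.1 h2
    have hN3 : ∀ᶠ z in 𝓝 (⟨x, G x - (F n).1 x⟩ : Tot Z), ‖z.val‖ < η / 4 :=
      h.upperSemicontinuous_norm _ _ ((hGF n x).trans_lt hn)
    filter_upwards [(F n).2.1 x _ hN1, h.eventually_exists_mem (inter_mem hN2 hN3)] with
      y ⟨t, ht, htn⟩ ⟨t', ht', htn'⟩
    refine ⟨t + t', h3 ht ht' ⟨y, t, t'⟩ rfl, ?_⟩
    have e1 : G y - (t + t') = (G y - (F n).1 y) + ((F n).1 y - t) - t' := by abel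
    have e2 : ‖t'‖ < η / 4 := htn'
    have e3 : ε n ≤ c / 2 ^ n := by
      simp only [ε]
      gcongr
      linarith
    rw [e1]
    refine (norm_sub_le _ _).trans ?_
    have := norm_add_le (G y - (F n).1 y) ((F n).1 y - t)
    linarith [hGF n y]
  · refine tendsto_nhds_unique (hG x₀) ?_
    simp only [fun n => (F n).2.2]
    exact tendsto_const_nhds

end IsUSCBanachBundle

end BundleTopology

/-! ### Convergence in the total space, tested on sections -/

section BundleContinuity

variable {X : Type u} [TopologicalSpace X]

/-- A family of continuous sections with dense values in all fibres. -/
structure DenseSections (Z : X → Type w) [∀ x, NormedAddCommGroup (Z x)] [TopologicalSpace (Tot Z)]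
    (Γ : Set (∀ x, Z x)) : Prop where
  continuous : ∀ f ∈ Γ, Continuous (fun x => (⟨x, f x⟩ : Tot Z))
  exists_near : ∀ x (v : Z x) (ε : ℝ), 0 < ε → ∃ f ∈ Γ, ‖v - f x‖ < ε

variable {Z W Y : X → Type w} [∀ x, NormedAddCommGroup (Z x)]
  [∀ x, NormedSpace ℂ (Z x)] [TopologicalSpace (Tot Z)] [∀ x, NormedAddCommGroup (W x)]
  [∀ x, NormedSpace ℂ (W x)] [TopologicalSpace (Tot W)] [∀ x, NormedAddCommGroup (Y x)]
  [∀ x, NormedSpace ℂ (Y x)] [TopologicalSpace (Tot Y)]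

/-- Along a continuous section convergence in the total space becomes a norm condition: upper
semicontinuity gives one direction, and the axiom on nets with norms tending to zero gives the
other. -/
theorem IsUSCBanachBundle.tendsto_iff_of_section (h : IsUSCBanachBundle Z) {α : Type*}
    {l : Filter α} {b : α → X} {F : ∀ a, Z (b a)} {x : X} {v : Z x} {f : ∀ x, Z x}
    (hf : Continuous (fun x => (⟨x, f x⟩ : Tot Z))) (hfx : f x = v) :
    Tendsto (fun a => (⟨b a, F a⟩ : Tot Z)) l (𝓝 ⟨x, v⟩) ↔
      Tendsto b l (𝓝 x) ∧ ∀ ε > 0, ∀ᶠ a in l, ‖F a - f (b a)‖ < ε := by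
  subst hfx
  constructor
  · intro hF
    have hb := h.tendsto_base hF
    refine ⟨hb, fun ε hε => h.eventually_norm_lt (h.tendsto_sub hF ((hf.tendsto x).comp hb)) ?_⟩
    simpa
  · rintro ⟨hb, hn⟩
    have h1 := h.tendsto_zero_of_norm (f := fun a => F a - f (b a)) hb
      (tendsto_order.2 ⟨fun r hr => Eventually.of_forall fun a => hr.trans_le (norm_nonneg _), hn⟩)
    simpa using h.tendsto_add h1 ((hf.tendsto x).comp hb)

variable [T2Space X] [LocallyCompactSpace X] [SecondCountableTopology X]

/-- Uniform approximation preserves convergence. A continuous section through the limit serves as a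
reference and reduces the claim to three norm estimates. -/
theorem IsUSCBanachBundle.tendsto_of_approx (h : IsUSCBanachBundle Z) {α : Type*}
    {l : Filter α} {b : α → X} {F : ∀ a, Z (b a)} {x : X} {v : Z x} (hb : Tendsto b l (𝓝 x))
    (H : ∀ ε > 0, ∃ (G : ∀ a, Z (b a)) (w : Z x),
      Tendsto (fun a => (⟨b a, G a⟩ : Tot Z)) l (𝓝 ⟨x, w⟩) ∧ ‖v - w‖ ≤ ε ∧
      ∀ᶠ a in l, ‖F a - G a‖ ≤ ε) :
    Tendsto (fun a => (⟨b a, F a⟩ : Tot Z)) l (𝓝 ⟨x, v⟩) := by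
  obtain ⟨f, hf, hfx⟩ := h.exists_section x v
  refine (h.tendsto_iff_of_section hf hfx).2 ⟨hb, fun ε hε => ?_⟩
  obtain ⟨G, w, hG, hw, hFG⟩ := H (ε / 3) (by positivity)
  have h1 := h.eventually_norm_lt (h.tendsto_sub hG ((hf.tendsto x).comp hb)) (r := ε / 2) (by
    rw [hfx, norm_sub_rev]; linarith)
  filter_upwards [h1, hFG] with a h1 h2
  have e : F a - f (b a) = (F a - G a) + (G a - f (b a)) := by abel
  rw [e]
  exact (norm_add_le _ _).trans_lt (by linarith)

/-- Continuity of a family of contractions can be checked on a dense family of sections. -/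
theorem IsUSCBanachBundle.tendsto_map (hZ : IsUSCBanachBundle Z) (hW : IsUSCBanachBundle W)
    {α : Type*} {l : Filter α} {s t : α → X} {ζ : ∀ a, Z (s a)} {x y : X} {z : Z x}
    (hζ : Tendsto (fun a => (⟨s a, ζ a⟩ : Tot Z)) l (𝓝 ⟨x, z⟩))
    (T : ∀ a, Z (s a) → W (t a)) (T0 : Z x → W y) (hT : ∀ a u v, ‖T a u - T a v‖ ≤ ‖u - v‖)
    (hT0 : ∀ u v, ‖T0 u - T0 v‖ ≤ ‖u - v‖) {Γ : Set (∀ x, Z x)} (hΓ : DenseSections Z Γ)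
    (H : ∀ f ∈ Γ, Tendsto (fun a => (⟨t a, T a (f (s a))⟩ : Tot W)) l (𝓝 ⟨y, T0 (f x)⟩)) :
    Tendsto (fun a => (⟨t a, T a (ζ a)⟩ : Tot W)) l (𝓝 ⟨y, T0 z⟩) := by
  obtain ⟨f, hf, -⟩ := hΓ.exists_near x z 1 one_pos
  refine hW.tendsto_of_approx (hW.tendsto_base (H f hf)) fun ε hε => ?_
  obtain ⟨f, hf, hfz⟩ := hΓ.exists_near x z ε hε
  refine ⟨_, _, H f hf, (hT0 _ _).trans hfz.le, ?_⟩
  filter_upwards [hZ.eventually_norm_lt (hZ.tendsto_sub hζ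
    (((hΓ.continuous f hf).tendsto x).comp (hZ.tendsto_base hζ))) hfz] with a ha
  exact (hT a _ _).trans ha.le

/-- Continuity of a contractive bilinear operation on bundles can be checked on dense families of
sections. -/
theorem IsUSCBanachBundle.continuous_bilinear (hZ : IsUSCBanachBundle Z) (hW : IsUSCBanachBundle W)
    (hY : IsUSCBanachBundle Y) (m : ∀ x, Z x → W x → Y x)
    (hm1 : ∀ x z z' w, m x (z - z') w = m x z w - m x z' w)
    (hm2 : ∀ x z w w', m x z (w - w') = m x z w - m x z w')
    (hmn : ∀ x z w, ‖m x z w‖ ≤ ‖z‖ * ‖w‖) {Γ : Set (∀ x, Z x)} (hΓ : DenseSections Z Γ)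
    {Δ : Set (∀ x, W x)} (hΔ : DenseSections W Δ)
    (H : ∀ f ∈ Γ, ∀ g ∈ Δ, Continuous (fun x => (⟨x, m x (f x) (g x)⟩ : Tot Y))) :
    Continuous (fun p : FibProd Z W => (⟨p.base, m p.base p.fst p.snd⟩ : Tot Y)) := by
  have key : ∀ {x} (z z' : Z x) (w w' : W x), ‖m x z w - m x z' w'‖ ≤
      ‖z - z'‖ * ‖w‖ + ‖z'‖ * ‖w - w'‖ := fun z z' w w' => by
    have : m _ z w - m _ z' w' = m _ (z - z') w + m _ z' (w - w') := by rw [hm1, hm2]; abel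
    rw [this]
    exact (norm_add_le _ _).trans (add_le_add (hmn _ _ _) (hmn _ _ _))
  refine continuous_iff_continuousAt.2 fun ⟨x, z, w⟩ => ?_
  obtain ⟨h1, h2⟩ := tendsto_fibProd_iff.1 (tendsto_id (x := 𝓝 (⟨x, z, w⟩ : FibProd Z W)))
  have hb := hZ.tendsto_base h1
  refine hY.tendsto_of_approx hb fun ε hε => ?_
  -- In the estimate `key`, `‖w‖ + 1` bounds the nearby second arguments and `‖z‖ + 2` the values of
  -- `f`; with both approximation errors at most `δ ≤ ε / c` the total error is at most `ε`.
  let c := ‖w‖ + 1 + (‖z‖ + 2)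
  have hc : 0 < c := by positivity
  let δ := min 1 (ε / c)
  have hδ : 0 < δ := lt_min one_pos (by positivity)
  have hδ1 : δ ≤ 1 := min_le_left _ _
  have hδc : δ * c ≤ ε := by
    calc δ * c ≤ ε / c * c := by gcongr; exact min_le_right _ _
      _ = ε := by field_simp
  obtain ⟨f, hf, hfz⟩ := hΓ.exists_near x z δ hδ
  obtain ⟨g, hg, hgw⟩ := hΔ.exists_near x w δ hδ
  have hfn : ‖f x‖ < ‖z‖ + 2 := by
    have : f x = z - (z - f x) := by abel
    rw [this]
    exact (norm_sub_le _ _).trans_lt (by linarith)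
  have est : ∀ {a b c' d : ℝ}, a ≤ δ → 0 ≤ a → b ≤ ‖w‖ + 1 → 0 ≤ b → c' ≤ ‖z‖ + 2 → 0 ≤ c' →
      d ≤ δ → 0 ≤ d → a * b + c' * d ≤ ε := fun {a b c' d} ha ha0 hb hb0 hc hc0 hd hd0 => by
    refine le_trans ?_ hδc
    have e1 : a * b ≤ δ * (‖w‖ + 1) := mul_le_mul ha hb hb0 hδ.le
    have e2 : c' * d ≤ (‖z‖ + 2) * δ := mul_le_mul hc hd hd0 (by positivity)
    simp only [c]
    linarith
  refine ⟨fun p => m p.base (f p.base) (g p.base), m x (f x) (g x), ((H f hf g hg).tendsto x).comp hb,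
    ?_, ?_⟩
  · exact (key _ _ _ _).trans (est hfz.le (norm_nonneg _) (by linarith) (norm_nonneg _) hfn.le
      (norm_nonneg _) hgw.le (norm_nonneg _))
  · have hcf := ((hΓ.continuous f hf).tendsto x).comp hb
    filter_upwards [hZ.eventually_norm_lt (hZ.tendsto_sub h1 hcf) hfz,
      hW.eventually_norm_lt h2 (lt_add_one _), hZ.eventually_norm_lt hcf hfn,
      hW.eventually_norm_lt (hW.tendsto_sub h2 (((hΔ.continuous g hg).tendsto x).comp hb)) hgw]
      with p e1 e2 e3 e4
    exact (key _ _ _ _).trans (est e1.le (norm_nonneg _) e2.le (norm_nonneg _) e3.le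
      (norm_nonneg _) e4.le (norm_nonneg _))

end BundleContinuity

/-! ### Construction of bundles from sections -/

section FellTopology

variable {X : Type u} [TopologicalSpace X] {Z : X → Type w} [∀ x, NormedAddCommGroup (Z x)]
  [∀ x, NormedSpace ℂ (Z x)]

/-- The topology on the total space determined by a family of sections. -/
@[reducible] def fellTopology (Γ : Submodule ℂ (∀ x, Z x)) : TopologicalSpace (Tot Z) :=
  .generateFrom {S | ∃ f ∈ Γ, ∃ U : Set X, IsOpen U ∧ ∃ ε : ℝ,
    S = {z | z.base ∈ U ∧ ‖z.val - f z.base‖ < ε}}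

theorem tendsto_fellTopology_iff (Γ : Submodule ℂ (∀ x, Z x)) {α : Type*} {l : Filter α}
    {F : α → Tot Z} {z : Tot Z} : Tendsto F l (@nhds _ (fellTopology Γ) z) ↔
      ∀ f ∈ Γ, ∀ U : Set X, IsOpen U → z.base ∈ U → ∀ ε : ℝ, ‖z.val - f z.base‖ < ε →
        ∀ᶠ a in l, (F a).base ∈ U ∧ ‖(F a).val - f (F a).base‖ < ε := by
  rw [fellTopology, tendsto_nhds_generateFrom_iff]
  constructor
  · intro h f hf U hU hz ε hε
    exact h _ ⟨f, hf, U, hU, ε, rfl⟩ ⟨hz, hε⟩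
  · rintro h _ ⟨f, hf, U, hU, ε, rfl⟩ ⟨hz, hε⟩
    exact h f hf U hU hz ε hε

/-- The basic sets are `ε`-tubes around members of `Γ` over open sets. Since `Γ` is a linear space,
a difference of members is again a member, and upper semicontinuity of its norm lets tube conditions
propagate to nearby fibres. Each bundle axiom follows by first moving to a nearby section value. -/
theorem isUSCBanachBundle_fellTopology (hc : ∀ x, CompleteSpace (Z x))
    (Γ : Submodule ℂ (∀ x, Z x)) (hu : ∀ f ∈ Γ, UpperSemicontinuous (fun x => ‖f x‖))
    (hd : ∀ x (v : Z x) (ε : ℝ), 0 < ε → ∃ f ∈ Γ, ‖v - f x‖ < ε) :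
    letI := fellTopology Γ
    IsUSCBanachBundle Z ∧ DenseSections Z (Γ : Set (∀ x, Z x)) := by
  let := fellTopology Γ
  have hev : ∀ f ∈ Γ, ∀ (z : Tot Z) (U : Set X), IsOpen U → z.base ∈ U → ∀ ε : ℝ,
      ‖z.val - f z.base‖ < ε → ∀ᶠ a in 𝓝 z, a.base ∈ U ∧ ‖a.val - f a.base‖ < ε := fun f hf z =>
    (tendsto_fellTopology_iff Γ).1 (tendsto_id (x := 𝓝 z)) f hf
  have hproj : Continuous (fun z : Tot Z => z.base) := by
    refine continuous_iff_continuousAt.2 fun z => ?_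
    intro U hU
    obtain ⟨V, hV, hVo, hzV⟩ := mem_nhds_iff.1 hU
    change ∀ᶠ a in 𝓝 z, a.base ∈ U
    filter_upwards [hev 0 Γ.zero_mem z V hVo hzV _ (lt_add_one _)] with a ha
    exact hV ha.1
  have hnorm : ∀ f ∈ Γ, ∀ (z : Tot Z) (ε : ℝ), ‖z.val - f z.base‖ < ε →
      ∀ᶠ a in 𝓝 z, ‖a.val - f a.base‖ < ε := fun f hf z ε hε =>
    (hev f hf z Set.univ isOpen_univ trivial ε hε).mono fun a ha => ha.2
  have htend : ∀ {α : Type (max u w)} {l : Filter α} {F : α → Tot Z} {z : Tot Z},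
      Tendsto (fun a => (F a).base) l (𝓝 z.base) →
      (∀ f ∈ Γ, ∀ ε : ℝ, ‖z.val - f z.base‖ < ε →
        ∀ᶠ a in l, ‖(F a).val - f (F a).base‖ < ε) → Tendsto F l (𝓝 z) := by
    intro α l F z h1 h2
    refine (tendsto_fellTopology_iff Γ).2 fun f hf U hU hz ε hε => ?_
    exact (h1.eventually (hU.mem_nhds hz)).and (h2 f hf ε hε)
  have hsec : ∀ f ∈ Γ, Continuous (fun x => (⟨x, f x⟩ : Tot Z)) := fun f hf => by
    refine continuous_iff_continuousAt.2 fun x => ?_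
    refine (tendsto_fellTopology_iff Γ).2 fun g hg U hU hz ε hε => ?_
    exact Filter.Eventually.and (hU.mem_nhds hz) (hu _ (Γ.sub_mem hf hg) x ε hε)
  refine ⟨?_, ⟨hsec, hd⟩⟩
  refine
    { complete := hc
      continuous_proj := hproj
      isOpenMap_proj := ?_
      upperSemicontinuous_norm := ?_
      continuous_add := ?_
      continuous_smul := ?_
      tendsto_zero := ?_ }
  -- The inclusion of a fibre is continuous, so an open set around `(x, v)` contains some value `f
  -- x` of a section in `Γ`; that section stays in the open set over a neighbourhood of `x`.
  · refine IsOpenMap.of_nhds_le fun z => ?_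
    intro N hN
    obtain ⟨O, hO, hOo, hzO⟩ := mem_nhds_iff.1 (mem_map.1 hN)
    obtain ⟨x, v⟩ := z
    have hfib : Tendsto (fun u : Z x => (⟨x, u⟩ : Tot Z)) (𝓝 v) (𝓝 ⟨x, v⟩) := by
      refine (tendsto_fellTopology_iff Γ).2 fun g hg U hU hz ε hε => ?_
      have : Continuous fun u : Z x => ‖u - g x‖ := by fun_prop
      filter_upwards [this.continuousAt.eventually (gt_mem_nhds hε)] with u hu
      exact ⟨hz, hu⟩
    obtain ⟨ε, hε, hball⟩ := Metric.mem_nhds_iff.1 (hfib (hOo.mem_nhds hzO))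
    obtain ⟨f, hf, hfv⟩ := hd x v ε hε
    have hfO : (⟨x, f x⟩ : Tot Z) ∈ O := hball (by
      rw [Metric.mem_ball, dist_comm, dist_eq_norm]; exact hfv)
    filter_upwards [((hsec f hf).tendsto x) (hOo.mem_nhds hfO)] with y hy
    exact hO hy
  · intro z r hr
    obtain ⟨f, hf, hfz⟩ := hd z.base z.val ((r - ‖z.val‖) / 2) (by
      have : ‖z.val‖ < r := hr
      linarith)
    have hfr : ‖f z.base‖ < (r + ‖z.val‖) / 2 := by
      have e : f z.base = z.val - (z.val - f z.base) := by abel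
      rw [e]
      exact (norm_sub_le _ _).trans_lt (by linarith)
    filter_upwards [hnorm f hf z _ hfz, hproj.continuousAt.eventually (hu f hf z.base _ hfr)]
      with a h1 h2
    have e : a.val = (a.val - f a.base) + f a.base := by abel
    rw [e]
    exact (norm_add_le _ _).trans_lt (by linarith)
  · refine continuous_iff_continuousAt.2 fun ⟨x, v, w⟩ => ?_
    have hp := tendsto_fibProd_iff.1 (tendsto_id (x := 𝓝 (⟨x, v, w⟩ : FibProd Z Z)))
    have hb : Tendsto (fun p : FibProd Z Z => p.base) (𝓝 ⟨x, v, w⟩) (𝓝 x) :=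
      (hproj.tendsto (⟨x, v⟩ : Tot Z)).comp hp.1
    refine htend hb fun f hf ε hε => ?_
    have hpos : 0 < ε - ‖v + w - f x‖ := sub_pos.2 hε
    -- The slack in the strict inequality is cut into fifths: two are spent on approximating `v` and
    -- `w` at `x`, two on the corresponding errors at nearby points, and one is left over.
    obtain ⟨g, hg, hgv⟩ := hd x v ((ε - ‖v + w - f x‖) / 5) (by linarith)
    obtain ⟨k, hk, hkw⟩ := hd x w ((ε - ‖v + w - f x‖) / 5) (by linarith)
    have h1 : ‖g x + k x - f x‖ < ‖v + w - f x‖ + 2 * ((ε - ‖v + w - f x‖) / 5) := by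
      have e : g x + k x - f x = (v + w - f x) - (v - g x) - (w - k x) := by abel
      rw [e]
      have e1 := norm_sub_le ((v + w - f x) - (v - g x)) (w - k x)
      have e2 := norm_sub_le (v + w - f x) (v - g x)
      linarith
    filter_upwards [hp.1.eventually (hnorm g hg _ _ hgv), hp.2.eventually (hnorm k hk _ _ hkw),
      hb.eventually (hu (g + k - f) (Γ.sub_mem (Γ.add_mem hg hk) hf) x _ h1)] with p e1 e2 e3
    simp only [id] at e1 e2 e3
    have e : p.fst + p.snd - f p.base =
        (p.fst - g p.base) + (p.snd - k p.base) + (g + k - f) p.base := by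
      simp only [Pi.sub_apply, Pi.add_apply]; abel
    rw [e]
    have e4 := norm_add_le ((p.fst - g p.base) + (p.snd - k p.base)) ((g + k - f) p.base)
    have e5 := norm_add_le (p.fst - g p.base) (p.snd - k p.base)
    linarith
  · intro c
    refine continuous_iff_continuousAt.2 fun z => ?_
    refine htend hproj.continuousAt fun f hf ε hε => ?_
    simp only at hε ⊢
    have hpos : 0 < ε - ‖c • z.val - f z.base‖ := sub_pos.2 hε
    set η := (ε - ‖c • z.val - f z.base‖) / (3 * (‖c‖ + 1)) with hη
    have hcη : ‖c‖ * η ≤ (ε - ‖c • z.val - f z.base‖) / 3 := by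
      rw [hη, mul_div_assoc', div_le_div_iff₀ (by positivity) (by positivity)]
      nlinarith [norm_nonneg c]
    obtain ⟨g, hg, hgv⟩ := hd z.base z.val η (by positivity)
    have h1 : ‖c • g z.base - f z.base‖ < ‖c • z.val - f z.base‖ +
        (ε - ‖c • z.val - f z.base‖) / 2 := by
      have e : c • g z.base - f z.base = (c • z.val - f z.base) - c • (z.val - g z.base) := by
        rw [smul_sub]; abel
      rw [e]
      refine (norm_sub_le _ _).trans_lt ?_
      rw [norm_smul]
      have := mul_le_mul_of_nonneg_left hgv.le (norm_nonneg c)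
      linarith
    filter_upwards [hnorm g hg _ _ hgv, hproj.continuousAt.eventually
      (hu (c • g - f) (Γ.sub_mem (Γ.smul_mem c hg) hf) z.base _ h1)] with a e1 e2
    have e : c • a.val - f a.base = c • (a.val - g a.base) + (c • g - f) a.base := by
      simp only [Pi.sub_apply, Pi.smul_apply, smul_sub]; abel
    rw [e]
    refine (norm_add_le _ _).trans_lt ?_
    rw [norm_smul]
    have := mul_le_mul_of_nonneg_left e1.le (norm_nonneg c)
    linarith
  · intro l x h1 h2
    change Tendsto id l _
    refine htend h2 fun f hf ε hε => ?_
    simp only [zero_sub, norm_neg] at hε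
    filter_upwards [h2.eventually (hu f hf x ((‖f x‖ + ε) / 2) (by simp only; linarith)),
      h1.eventually (gt_mem_nhds (show 0 < (ε - ‖f x‖) / 2 by linarith))] with a e1 e2
    exact (norm_sub_le _ _).trans_lt (by simp only [id] at *; linarith)

end FellTopology

/-! ### The section algebra -/

section Partition

variable {X : Type u} [TopologicalSpace X]

/-- A compactly supported real function as an element of `C₀(X)`. -/
def ofCompactSupport (φ : C(X, ℝ)) (h : HasCompactSupport φ) : C₀(X, ℂ) where
  toFun x := (φ x : ℂ)
  continuous_toFun := by fun_prop
  zero_at_infty' := by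
    have : HasCompactSupport fun x => (φ x : ℂ) := h.comp_left (g := fun t : ℝ => (t : ℂ)) (by simp)
    exact this.is_zero_at_infty

@[simp]
theorem ofCompactSupport_apply (φ : C(X, ℝ)) (h : HasCompactSupport φ) (x : X) :
    ofCompactSupport φ h x = (φ x : ℂ) := rfl

variable [T2Space X] [LocallyCompactSpace X]

theorem exists_finite_partition {K : Set X} (hK : IsCompact K) {V : X → Set X}
    (hV : ∀ x, IsOpen (V x)) (hxV : ∀ x, x ∈ V x) :
    ∃ (t : Finset X) (ρ : t → C₀(X, ℂ)) (r : t → X → ℝ), (∀ i x, ρ i x = r i x) ∧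
      (∀ i x, 0 ≤ r i x) ∧ (∀ i, HasCompactSupport (r i)) ∧ (∀ i, tsupport (r i) ⊆ V i) ∧
      (∀ x, ∑ i, r i x ≤ 1) ∧ ∀ x ∈ K, ∑ i, r i x = 1 := by
  obtain ⟨t, -, ht⟩ := hK.elim_nhds_subcover V fun x _ => (hV x).mem_nhds (hxV x)
  obtain ⟨ρ, hρ, hρc⟩ := PartitionOfUnity.exists_isSubordinate_of_locallyFinite_t2space hK
    (fun i : t => V i) (fun i => hV i) (locallyFinite_of_finite _) (by
      rwa [Set.iUnion_subtype])
  refine ⟨t, fun i => ofCompactSupport (ρ i) (hρc i), fun i => ρ i, fun i x => rfl,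
    fun i x => ρ.nonneg i x, hρc, hρ, fun x => ?_, fun x hx => ?_⟩
  · rw [← finsum_eq_sum_of_fintype]
    exact ρ.sum_le_one x
  · rw [← finsum_eq_sum_of_fintype]
    exact ρ.sum_eq_one hx

theorem exists_bump {x : X} {U : Set X} (hU : U ∈ 𝓝 x) :
    ∃ φ : C₀(X, ℂ), φ x = 1 ∧ (∀ y, ‖φ y‖ ≤ 1) ∧ ∀ y ∉ U, φ y = 0 := by
  obtain ⟨φ, h1, h0, hc, h⟩ := exists_continuous_one_zero_of_isCompact (isCompact_singleton (x := x))
    (isOpen_interior (s := U)).isClosed_compl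
    (Set.disjoint_singleton_left.2 (by simpa using mem_interior_iff_mem_nhds.2 hU))
  refine ⟨ofCompactSupport φ hc, ?_, fun y => ?_, fun y hy => ?_⟩
  · simp [h1 (Set.mem_singleton x)]
  · rw [ofCompactSupport_apply, Complex.norm_real, Real.norm_of_nonneg (h y).1]
    exact (h y).2
  · have : y ∈ (interior U)ᶜ := fun hy' => hy (interior_subset hy')
    simp [h0 this]

end Partition

/-! ### The C⋆-algebra of continuous sections vanishing at infinity -/

section SectionAlgebra

variable {X : Type u} [TopologicalSpace X] (A : CStarBundle.{u, w} X)

namespace CStarBundle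

/-- An upper semicontinuous function is locally bounded above, hence bounded on a compact set
outside which the norm is below 1. -/
theorem bddAbove_section (f : A.sections) : BddAbove (Set.range fun x => ‖f.1 x‖) := by
  obtain ⟨K, hK, hK1⟩ := mem_cocompact.1 (f.2.2 (Iio_mem_nhds one_pos))
  have : ∃ C, ∀ x ∈ K, ‖f.1 x‖ ≤ C := by
    refine hK.induction_on (p := fun s => ∃ C, ∀ x ∈ s, ‖f.1 x‖ ≤ C) ⟨0, by simp⟩
      (fun s t hst ⟨C, hC⟩ => ⟨C, fun x hx => hC x (hst hx)⟩)
      (fun s t ⟨C, hC⟩ ⟨C', hC'⟩ => ⟨max C C', fun x hx => hx.elim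
        (fun h => (hC x h).trans (le_max_left _ _)) fun h => (hC' x h).trans (le_max_right _ _)⟩)
      fun x _ => ?_
    have h1 := A.isBundle.eventually_norm_lt (f.2.1.tendsto x) (lt_add_one _)
    exact ⟨_, mem_nhdsWithin_of_mem_nhds h1, ‖f.1 x‖ + 1, fun y hy => le_of_lt hy⟩
  obtain ⟨C, hC⟩ := this
  refine ⟨max C 1, ?_⟩
  rintro _ ⟨x, rfl⟩
  by_cases hx : x ∈ K
  · exact (hC x hx).trans (le_max_left _ _)
  · have h1 : ‖f.1 x‖ < 1 := hK1 hx
    exact h1.le.trans (le_max_right _ _)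

/-- The embedding of the section algebra into the bounded families. -/
def toLp : A.sections →⋆ₙₐ[ℂ] lp A.Fiber ⊤ where
  toFun f := ⟨f.1, memℓp_infty (A.bddAbove_section f)⟩
  map_smul' _ _ := rfl
  map_zero' := rfl
  map_add' _ _ := rfl
  map_mul' _ _ := rfl
  map_star' _ := rfl

theorem toLp_injective : Function.Injective A.toLp := fun f g h => by
  ext x
  exact congrArg (fun k : lp A.Fiber ⊤ => k x) h

instance : NonUnitalNormedRing A.sections :=
  NonUnitalNormedRing.induced A.sections (lp A.Fiber ⊤) A.toLp A.toLp_injective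

/-- This fixes the uniformity of the supremum norm. As a subtype of a product of fibres, the section
algebra could otherwise be given the uniformity of pointwise convergence. -/
instance : UniformSpace A.sections :=
  (inferInstance : NonUnitalNormedRing A.sections).toMetricSpace.toPseudoMetricSpace.toUniformSpace

instance : TopologicalSpace A.sections := UniformSpace.toTopologicalSpace

theorem norm_apply_le (f : A.sections) (x : X) : ‖f.1 x‖ ≤ ‖f‖ :=
  lp.norm_apply_le_norm ENNReal.top_ne_zero (A.toLp f) x

variable {A} in
theorem norm_le_of_forall {f : A.sections} {C : ℝ} (hC : 0 ≤ C) (h : ∀ x, ‖f.1 x‖ ≤ C) : ‖f‖ ≤ C :=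
  lp.norm_le_of_forall_le (f := A.toLp f) hC h

variable {A} in
/-- Multiplication of a continuous section by a function in `C₀(X)`. -/
theorem exists_section_smul [T2Space X] [LocallyCompactSpace X] {f : ∀ x, A.Fiber x}
    (hf : Continuous (fun x => (⟨x, f x⟩ : Tot A.Fiber))) (x : X) :
    ∃ g : A.sections, g.1 x = f x := by
  obtain ⟨φ, h1, -, hc, h⟩ := exists_continuous_one_zero_of_isCompact (isCompact_singleton (x := x))
    isClosed_empty (Set.disjoint_empty _)
  refine ⟨⟨fun y => (φ y : ℂ) • f y,
    A.isBundle.continuous_smul_section (by fun_prop) hf, ?_⟩, ?_⟩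
  · have : HasCompactSupport fun y => ‖(φ y : ℂ) • f y‖ := by
      refine hc.mono fun y hy => ?_
      intro h0
      simp [show φ y = 0 from h0] at hy
    exact this.is_zero_at_infty
  · simp [h1 (Set.mem_singleton x)]

theorem smul_apply (φ : C₀(X, ℂ)) (f : A.sections) (x : X) : (φ • f).1 x = φ x • f.1 x := rfl

theorem norm_smul_section_le {φ : C₀(X, ℂ)} (f : A.sections) {C : ℝ} (hC : 0 ≤ C)
    (h : ∀ x, ‖φ x‖ ≤ C) : ‖φ • f‖ ≤ C * ‖f‖ := by
  refine norm_le_of_forall (by positivity) fun x => ?_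
  rw [smul_apply, norm_smul]
  exact mul_le_mul (h x) (A.norm_apply_le f x) (norm_nonneg _) hC

/-- The action of `C₀(X)` on the section algebra as a bilinear map. -/
def smulHom : C₀(X, ℂ) →ₗ[ℂ] A.sections →ₗ[ℂ] A.sections :=
  LinearMap.mk₂ ℂ (fun φ f => φ • f) (fun _ _ _ => by ext x; exact add_smul _ _ _)
    (fun k φ f => by ext x; exact smul_assoc k (φ x) (f.1 x))
    (fun _ _ _ => by ext x; exact smul_add _ _ _)
    (fun k φ f => by ext x; exact smul_comm (φ x) k (f.1 x))

@[simp]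
theorem smulHom_apply (φ : C₀(X, ℂ)) (f : A.sections) : A.smulHom φ f = φ • f := rfl

variable [T2Space X] [LocallyCompactSpace X] [SecondCountableTopology X]

instance : NonUnitalCStarAlgebra A.sections where
  norm_mul_self_le f := CStarRing.norm_mul_self_le (x := A.toLp f)
  norm_smul_le k f := norm_smul_le k (A.toLp f)
  complete := by
    have hiso : Isometry A.toLp := AddMonoidHomClass.isometry_of_norm A.toLp fun f => rfl
    -- Completeness reduces to closedness among bounded families: a uniform limit of continuous
    -- sections is continuous by `tendsto_of_approx`, and it still vanishes at infinity.
    have : IsClosed (Set.range A.toLp) := by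
      refine isClosed_of_closure_subset fun g hg => ?_
      have hg' : ∀ ε > 0, ∃ f : A.sections, ∀ x, ‖g x - f.1 x‖ < ε := fun ε hε => by
        obtain ⟨_, ⟨f, rfl⟩, hf⟩ := Metric.mem_closure_iff.1 hg ε hε
        refine ⟨f, fun x => (lp.norm_apply_le_norm ENNReal.top_ne_zero (g - A.toLp f) x).trans_lt ?_⟩
        rwa [← dist_eq_norm]
      refine ⟨⟨fun x => g x, continuous_iff_continuousAt.2 fun x => ?_, ?_⟩, ?_⟩
      · refine A.isBundle.tendsto_of_approx (b := fun x => x) tendsto_id fun ε hε => ?_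
        obtain ⟨f, hf⟩ := hg' ε hε
        exact ⟨f.1, f.1 x, f.2.1.tendsto x, (hf x).le, Eventually.of_forall fun y => (hf y).le⟩
      · refine tendsto_order.2 ⟨fun r hr => Eventually.of_forall fun x =>
          hr.trans_le (norm_nonneg _), fun r hr => ?_⟩
        obtain ⟨f, hf⟩ := hg' (r / 2) (half_pos hr)
        filter_upwards [f.2.2.eventually (gt_mem_nhds (half_pos hr))] with x hx
        have := norm_add_le (g x - f.1 x) (f.1 x)
        rw [sub_add_cancel] at this
        linarith [hf x]
      · ext x
        rfl
    have h := (completeSpace_iff_isComplete_range hiso.isUniformInducing).2 this.isComplete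
    intro F hF
    exact h.complete hF

/-- Evaluation of sections at a point. -/
def evalHom (x : X) : A.sections →⋆ₙₐ[ℂ] A.Fiber x where
  toFun f := f.1 x
  map_smul' _ _ := rfl
  map_zero' := rfl
  map_add' _ _ := rfl
  map_mul' _ _ := rfl
  map_star' _ := rfl

@[simp]
theorem evalHom_apply (x : X) (f : A.sections) : A.evalHom x f = f.1 x := rfl

/-- A continuous section through the given vector is cut off by a compactly supported function.
Every fibre is thus a quotient of the section algebra, which is how facts about sections are
transferred to fibres. -/
theorem evalHom_surjective (x : X) : Function.Surjective (A.evalHom x) := fun v => by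
  obtain ⟨f, hf, hfx⟩ := A.isBundle.exists_section x v
  obtain ⟨g, hg⟩ := exists_section_smul hf x
  exact ⟨g, hg.trans hfx⟩

theorem denseSections : DenseSections A.Fiber (A.sections : Set (∀ x, A.Fiber x)) where
  continuous f hf := hf.1
  exists_near x v ε hε := by
    obtain ⟨f, hf⟩ := A.evalHom_surjective x v
    exact ⟨f.1, f.2, by simpa [← hf] using hε⟩

variable {A} in
/-- A `C₀(X)`-invariant space of sections with dense values is dense. -/
theorem dense_of_smul_mem {S : Submodule ℂ A.sections} (hS : ∀ (φ : C₀(X, ℂ)), ∀ f ∈ S, φ • f ∈ S)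
    (hd : ∀ x (v : A.Fiber x) (ε : ℝ), 0 < ε → ∃ f ∈ S, ‖v - f.1 x‖ < ε) :
    Dense (S : Set A.sections) := by
  intro f
  refine Metric.mem_closure_iff.2 fun ε' hε' => ?_
  set ε := ε' / 2 with hεdef
  have hε : 0 < ε := half_pos hε'
  obtain ⟨K, hK, hKf⟩ := mem_cocompact.1 (f.2.2 (Iio_mem_nhds hε))
  choose s hsS hs using fun x => hd x (f.1 x) ε hε
  have hV : ∀ x, ∃ V : Set X, IsOpen V ∧ x ∈ V ∧ ∀ y ∈ V, ‖f.1 y - (s x).1 y‖ < ε := fun x => by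
    have := A.isBundle.eventually_norm_lt (A.isBundle.tendsto_sub (f.2.1.tendsto x)
      ((s x).2.1.tendsto x)) (hs x)
    obtain ⟨V, hV, hVo, hx⟩ := eventually_nhds_iff.1 this
    exact ⟨V, hVo, hx, hV⟩
  choose V hVo hxV hV using hV
  obtain ⟨t, ρ, r, hρr, hr0, -, hrV, hr1, hrK⟩ := exists_finite_partition hK hVo hxV
  refine ⟨∑ i, ρ i • s i, S.sum_mem fun i _ => hS _ _ (hsS _), ?_⟩
  rw [dist_eq_norm]
  refine (norm_le_of_forall hε.le fun x => ?_).trans_lt (half_lt_self hε')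
  have hval : (f - ∑ i, ρ i • s i).1 x = f.1 x - ∑ i, (r i x : ℂ) • (s i).1 x := by
    have : (∑ i, ρ i • s i).1 x = ∑ i, (ρ i • s i).1 x := map_sum (A.evalHom x) _ _
    change f.1 x - (∑ i, ρ i • s i).1 x = _
    rw [this]
    simp only [smul_apply, hρr]
  rw [hval]
  -- The error is a combination of `f` and the local errors with weights `1 - ∑ r i` and `r i`. The
  -- first weight vanishes on `K`, outside which `f` is small, and each local error is small on the
  -- support of its weight.
  have e : f.1 x - ∑ i, (r i x : ℂ) • (s i).1 x =
      ((1 - ∑ i, r i x : ℝ) : ℂ) • f.1 x + ∑ i, (r i x : ℂ) • (f.1 x - (s i).1 x) := by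
    simp only [smul_sub, Finset.sum_sub_distrib, ← Finset.sum_smul, Complex.ofReal_sub,
      Complex.ofReal_sum, Complex.ofReal_one, sub_smul, one_smul]
    abel
  rw [e]
  have h1 : ‖((1 - ∑ i, r i x : ℝ) : ℂ) • f.1 x‖ ≤ (1 - ∑ i, r i x) * ε := by
    rw [norm_smul, Complex.norm_real, Real.norm_of_nonneg (sub_nonneg.2 (hr1 x))]
    by_cases hx : x ∈ K
    · rw [hrK x hx]; simp
    · have : ‖f.1 x‖ < ε := hKf hx
      exact mul_le_mul_of_nonneg_left this.le (sub_nonneg.2 (hr1 x))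
  have h2 : ‖∑ i, (r i x : ℂ) • (f.1 x - (s i).1 x)‖ ≤ (∑ i, r i x) * ε := by
    rw [Finset.sum_mul]
    refine norm_sum_le_of_le _ fun i _ => ?_
    rw [norm_smul, Complex.norm_real, Real.norm_of_nonneg (hr0 i x)]
    rcases eq_or_ne (r i x) 0 with h0 | h0
    · simp [h0]
    · exact mul_le_mul_of_nonneg_left (hV i x (hrV i (subset_tsupport _ h0))).le (hr0 i x)
  refine (norm_add_le _ _).trans ((add_le_add h1 h2).trans ?_)
  rw [← add_mul, sub_add_cancel, one_mul]

theorem isSeparable_iff : A.IsSeparable ↔ SeparableSpace A.sections := by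
  constructor
  · rintro ⟨S, hS, h⟩
    refine ⟨⟨S, hS, fun f => Metric.mem_closure_iff.2 fun ε hε => ?_⟩⟩
    obtain ⟨g, hg, hfg⟩ := h f (ε / 2) (half_pos hε)
    refine ⟨g, hg, ?_⟩
    rw [dist_eq_norm]
    exact (norm_le_of_forall (half_pos hε).le hfg).trans_lt (half_lt_self hε)
  · rintro ⟨S, hS, hd⟩
    refine ⟨S, hS, fun f ε hε => ?_⟩
    obtain ⟨g, hg, hfg⟩ := Metric.mem_closure_iff.1 (hd f) ε hε
    refine ⟨g, hg, fun x => (A.norm_apply_le (f - g) x).trans ?_⟩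
    rw [← dist_eq_norm]
    exact hfg.le

end CStarBundle

end SectionAlgebra

/-! ### Fibrewise maximal tensor products of bundles -/

section BundleTensor

variable {X : Type u} [TopologicalSpace X]

/-- The bundle `C` is fibrewise the maximal tensor product of `A` and `B`, with continuous
elementary tensors. -/
structure BundleTensor (A B C : CStarBundle.{u, w} X) where
  ι : ∀ x, (A.Fiber x ⊗[ℂ] B.Fiber x) →⋆ₙₐ[ℂ] C.Fiber x
  isEnveloping : ∀ x, IsEnveloping (ι x)
  continuous_tmul : Continuous (fun p : FibProd A.Fiber B.Fiber =>
    (⟨p.base, ι p.base (p.fst ⊗ₜ p.snd)⟩ : Tot C.Fiber))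

variable {A B C : CStarBundle.{u, w} X}

namespace BundleTensor

theorem tendsto_tmul (T : BundleTensor A B C) {α : Type*} {l : Filter α} {b : α → X}
    {f : ∀ a, A.Fiber (b a)} {g : ∀ a, B.Fiber (b a)} {x : X} {v : A.Fiber x} {w : B.Fiber x}
    (hf : Tendsto (fun a => (⟨b a, f a⟩ : Tot A.Fiber)) l (𝓝 ⟨x, v⟩))
    (hg : Tendsto (fun a => (⟨b a, g a⟩ : Tot B.Fiber)) l (𝓝 ⟨x, w⟩)) :
    Tendsto (fun a => (⟨b a, T.ι _ (f a ⊗ₜ g a)⟩ : Tot C.Fiber)) l (𝓝 ⟨x, T.ι x (v ⊗ₜ w)⟩) :=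
  (T.continuous_tmul.tendsto ⟨x, v, w⟩).comp (tendsto_fibProd_iff.2 ⟨hf, hg⟩ :
    Tendsto (fun a => (⟨b a, f a, g a⟩ : FibProd A.Fiber B.Fiber)) l _)

theorem continuous_tmul_section (T : BundleTensor A B C) {f : ∀ x, A.Fiber x}
    {g : ∀ x, B.Fiber x} (hf : Continuous (fun x => (⟨x, f x⟩ : Tot A.Fiber)))
    (hg : Continuous (fun x => (⟨x, g x⟩ : Tot B.Fiber))) :
    Continuous (fun x => (⟨x, T.ι x (f x ⊗ₜ g x)⟩ : Tot C.Fiber)) :=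
  continuous_iff_continuousAt.2 fun x => T.tendsto_tmul (hf.tendsto x) (hg.tendsto x)

/-- The tensor product of two sections. -/
def tmulSection (T : BundleTensor A B C) (a : A.sections) (b : B.sections) : C.sections :=
  ⟨fun x => T.ι x (a.1 x ⊗ₜ b.1 x), T.continuous_tmul_section a.2.1 b.2.1, by
    refine squeeze_zero (fun x => norm_nonneg _) (fun x => norm_starHom_tmul_le _ _ _) ?_
    simpa using a.2.2.mul b.2.2⟩

/-- The ⋆-homomorphism from the tensor product of the section algebras to the section algebra. -/
def sectionHom (T : BundleTensor A B C) : A.sections ⊗[ℂ] B.sections →⋆ₙₐ[ℂ] C.sections :=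
  tensorLift (LinearMap.mk₂ ℂ T.tmulSection
    (fun a a' b => by ext x; simp [tmulSection, TensorProduct.add_tmul])
    (fun k a b => by ext x; simp [tmulSection, ← TensorProduct.smul_tmul'])
    (fun a b b' => by ext x; simp [tmulSection, TensorProduct.tmul_add])
    (fun k a b => by ext x; simp [tmulSection]))
    (fun a b a' b' => by
      ext x
      change T.ι x ((a.1 x * a'.1 x) ⊗ₜ (b.1 x * b'.1 x)) =
        T.ι x (a.1 x ⊗ₜ b.1 x) * T.ι x (a'.1 x ⊗ₜ b'.1 x)
      rw [← map_mul, Algebra.TensorProduct.tmul_mul_tmul])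
    (fun a b => by
      ext x
      change T.ι x (star (a.1 x) ⊗ₜ star (b.1 x)) = star (T.ι x (a.1 x ⊗ₜ b.1 x))
      rw [← map_star, TensorProduct.star_tmul])

variable [T2Space X] [LocallyCompactSpace X] [SecondCountableTopology X]

theorem sectionHom_apply (T : BundleTensor A B C) (t : A.sections ⊗[ℂ] B.sections) (x : X) :
    (T.sectionHom t).1 x = T.ι x (tensorMap (A.evalHom x) (B.evalHom x) t) := by
  induction t with
  | zero => simp
  | add s t hs ht =>
    rw [map_add, map_add, map_add, ← hs, ← ht]
    rfl
  | tmul a b => rfl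

theorem exists_section_near (T : BundleTensor A B C) (x : X) (v : C.Fiber x) {ε : ℝ} (hε : 0 < ε) :
    ∃ t, ‖v - (T.sectionHom t).1 x‖ < ε := by
  obtain ⟨_, ⟨s, rfl⟩, hs⟩ := Metric.mem_closure_iff.1 ((T.isEnveloping x).1 v) ε hε
  obtain ⟨t, rfl⟩ := tensorMap_surjective (A.evalHom_surjective x) (B.evalHom_surjective x) s
  exact ⟨t, by rwa [sectionHom_apply, ← dist_eq_norm]⟩

theorem denseRange_sectionHom (T : BundleTensor A B C) : DenseRange T.sectionHom := by
  refine CStarBundle.dense_of_smul_mem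
    (S := LinearMap.range (T.sectionHom : A.sections ⊗[ℂ] B.sections →ₗ[ℂ] C.sections)) ?_ ?_
  · rintro φ _ ⟨t, rfl⟩
    refine ⟨(A.smulHom φ).rTensor _ t, ?_⟩
    induction t with
    | zero =>
      ext x
      simp [CStarBundle.smul_apply]
    | add s t hs ht =>
      rw [map_add, map_add, map_add, hs, ht]
      exact (map_add (C.smulHom φ) _ _).symm
    | tmul a b =>
      ext x
      change T.ι x ((φ x • a.1 x) ⊗ₜ b.1 x) = φ x • T.ι x (a.1 x ⊗ₜ b.1 x)
      rw [← TensorProduct.smul_tmul', map_smul]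
  · intro x v ε hε
    obtain ⟨t, ht⟩ := T.exists_section_near x v hε
    exact ⟨_, ⟨t, rfl⟩, ht⟩

theorem isSeparable (T : BundleTensor A B C) (hA : A.IsSeparable) (hB : B.IsSeparable) :
    C.IsSeparable := by
  rw [CStarBundle.isSeparable_iff] at *
  have hc : Continuous fun p : A.sections × B.sections => T.sectionHom (p.1 ⊗ₜ p.2) := by
    let β : A.sections →L[ℂ] B.sections →L[ℂ] C.sections :=
      LinearMap.mkContinuous₂ ((TensorProduct.mk ℂ A.sections B.sections).compr₂
        (T.sectionHom : A.sections ⊗[ℂ] B.sections →ₗ[ℂ] C.sections)) 1 fun a b => by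
          rw [one_mul]
          exact norm_starHom_tmul_le T.sectionHom a b
    exact β.continuous₂
  have h1 : IsSeparable (Set.range fun p : A.sections × B.sections => T.sectionHom (p.1 ⊗ₜ p.2)) :=
    isSeparable_range hc
  have h2 := (h1.span (R := ℂ)).closure
  have h3 : closure (Submodule.span ℂ (Set.range fun p : A.sections × B.sections =>
      T.sectionHom (p.1 ⊗ₜ p.2)) : Set C.sections) = Set.univ := by
    refine Dense.closure_eq (T.denseRange_sectionHom.mono ?_)
    rintro _ ⟨t, rfl⟩
    induction t with
    | zero => rw [map_zero]; exact Submodule.zero_mem _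
    | add s t hs ht => rw [map_add]; exact Submodule.add_mem _ hs ht
    | tmul a b => exact Submodule.subset_span ⟨(a, b), rfl⟩
  rw [h3] at h2
  exact isSeparable_univ_iff.1 h2

end BundleTensor

variable (A B) in
/-- Fibrewise maximal tensor products exist. -/
theorem exists_bundleTensor [T2Space X] [LocallyCompactSpace X] [SecondCountableTopology X] :
    ∃ C : CStarBundle.{u, w} X, Nonempty (BundleTensor A B C) := by
  choose D inst ι hι using fun x => exists_maxTensor (A.Fiber x) (B.Fiber x)
  let ev (x : X) := tensorMap (A.evalHom x) (B.evalHom x)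
  let Φ : A.sections ⊗[ℂ] B.sections →ₗ[ℂ] (∀ x, D x) :=
    LinearMap.pi fun x => ((ι x).comp (ev x) : A.sections ⊗[ℂ] B.sections →ₗ[ℂ] D x)
  have hΦ : ∀ t x, Φ t x = ι x (ev x t) := fun _ _ => rfl
  -- If semicontinuity failed at `x₀`, an ultrafilter `𝒰` converging to `x₀` would exist along which
  -- the norms stay at least `r`, although the norm at `x₀` is below `r`.
  have hu : ∀ t, UpperSemicontinuous (fun x => ‖Φ t x‖) := by
    intro t x₀ r hr
    by_contra hcon
    rw [not_eventually] at hcon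
    have : NeBot (𝓝 x₀ ⊓ 𝓟 {x | ¬ ‖Φ t x‖ < r}) := frequently_mem_iff_neBot.1 hcon
    let 𝒰 := Ultrafilter.of (𝓝 x₀ ⊓ 𝓟 {x | ¬ ‖Φ t x‖ < r})
    have h𝒰 : (𝒰 : Filter X) ≤ 𝓝 x₀ := (Ultrafilter.of_le _).trans inf_le_left
    have h𝒰r : ∀ᶠ x in (𝒰 : Filter X), ¬ ‖Φ t x‖ < r :=
      ((Ultrafilter.of_le _).trans inf_le_right) (mem_principal_self _)
    have hbd : ∀ s, ∃ K, ∀ x, ‖Φ s x‖ ≤ K := fun s => by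
      induction s with
      | zero => exact ⟨0, by simp⟩
      | add s s' hs hs' =>
        obtain ⟨K, hK⟩ := hs
        obtain ⟨K', hK'⟩ := hs'
        refine ⟨K + K', fun x => ?_⟩
        rw [map_add]
        exact (norm_add_le _ _).trans (add_le_add (hK x) (hK' x))
      | tmul a b =>
        exact ⟨‖a‖ * ‖b‖, fun x => (norm_starHom_tmul_le (ι x) _ _).trans
          (mul_le_mul (A.norm_apply_le a x) (B.norm_apply_le b x) (norm_nonneg _) (norm_nonneg _))⟩
    have hlim : ∀ s, ∃ q, Tendsto (fun x => ‖Φ s x‖) 𝒰 (𝓝 q) := fun s => by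
      obtain ⟨K, hK⟩ := hbd s
      obtain ⟨q, -, hq⟩ := (isCompact_Icc (a := 0) (b := K)).ultrafilter_le_nhds
        (𝒰.map fun x => ‖Φ s x‖) (le_principal_iff.2 (mem_map.2
          (Eventually.of_forall fun x => ⟨norm_nonneg _, hK x⟩)))
      exact ⟨q, hq⟩
    choose q hq using hlim
    -- The fibre norms of a fixed tensor are bounded, so they converge along `𝒰`. Products, sums and
    -- the C⋆-identity pass to the limit, and the result is a C⋆-seminorm on the tensor product of
    -- the section algebras.
    let p : Seminorm ℂ (A.sections ⊗[ℂ] B.sections) := Seminorm.of q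
      (fun s s' => le_of_tendsto_of_tendsto' (hq _) ((hq s).add (hq s')) fun x => by
        rw [map_add]; exact norm_add_le _ _)
      (fun k s => tendsto_nhds_unique (hq _) (by
        simpa [norm_smul] using (hq s).const_mul ‖k‖))
    have hpq : ∀ s, p s = q s := fun _ => rfl
    have hp : IsCStarSeminorm p := by
      refine ⟨fun s s' => ?_, fun s => ?_⟩
      · refine le_of_tendsto_of_tendsto' (hq _) ((hq s).mul (hq s')) fun x => ?_
        rw [hΦ, map_mul, map_mul]
        exact norm_mul_le _ _
      · refine tendsto_nhds_unique (hq _) (((hq s).pow 2).congr fun x => ?_)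
        rw [hΦ, hΦ, map_mul, map_mul, map_star, map_star, CStarRing.norm_star_mul_self, sq]
    -- By upper semicontinuity in `A` and `B` the limit seminorm vanishes on elementary tensors with
    -- a factor vanishing at `x₀`. It therefore descends to the fibres over `x₀`, where the maximal
    -- norm dominates it: this contradicts the choice of `𝒰`.
    have hz : ∀ (a : A.sections) (b : B.sections), (a.1 x₀ = 0 ∨ b.1 x₀ = 0) → p (a ⊗ₜ b) = 0 := by
      intro a b hab
      refine tendsto_nhds_unique (hq (a ⊗ₜ b)) (tendsto_order.2 ⟨fun r hr =>
        Eventually.of_forall fun x => hr.trans_le (norm_nonneg _), fun r hr => ?_⟩)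
      have ha := fun r' (hr' : ‖a.1 x₀‖ < r') =>
        h𝒰 (A.isBundle.eventually_norm_lt (a.2.1.tendsto x₀) hr')
      have hb := fun r' (hr' : ‖b.1 x₀‖ < r') =>
        h𝒰 (B.isBundle.eventually_norm_lt (b.2.1.tendsto x₀) hr')
      have hle : ∀ x, ‖Φ (a ⊗ₜ b) x‖ ≤ ‖a.1 x‖ * ‖b.1 x‖ := fun x => norm_starHom_tmul_le (ι x) _ _
      rcases hab with h0 | h0
      · have hc : 0 < ‖b‖ + 1 := by positivity
        filter_upwards [ha (r / (‖b‖ + 1)) (by rw [h0, norm_zero]; positivity)] with x hx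
        refine (hle x).trans_lt ?_
        calc ‖a.1 x‖ * ‖b.1 x‖ ≤ ‖a.1 x‖ * (‖b‖ + 1) := by
              gcongr
              linarith [B.norm_apply_le b x]
          _ < r := by rwa [← lt_div_iff₀ hc]
      · have hc : 0 < ‖a‖ + 1 := by positivity
        filter_upwards [hb (r / (‖a‖ + 1)) (by rw [h0, norm_zero]; positivity)] with x hx
        refine (hle x).trans_lt ?_
        calc ‖a.1 x‖ * ‖b.1 x‖ ≤ (‖a‖ + 1) * ‖b.1 x‖ := by
              gcongr
              linarith [A.norm_apply_le a x]
          _ < r := by rwa [mul_comm, ← lt_div_iff₀ hc]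
    obtain ⟨q', hq', hqp⟩ := hp.exists_descend (A.evalHom_surjective x₀) (B.evalHom_surjective x₀)
      (fun a b h => hz a b (Or.inl h)) (fun a b h => hz a b (Or.inr h))
    have h1 : q t ≤ ‖Φ t x₀‖ := by
      rw [← hpq, ← hqp]
      exact (hι x₀).le hq' _
    have h2 : r ≤ q t := ge_of_tendsto (hq t) (h𝒰r.mono fun x hx => not_lt.1 hx)
    exact absurd hr (not_lt.2 (h2.trans h1))
  let Γ := LinearMap.range Φ
  let _ := fellTopology Γ
  obtain ⟨hB, hΓ⟩ := isUSCBanachBundle_fellTopology (fun x => inferInstance) Γ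
    (by rintro _ ⟨t, rfl⟩; exact hu t) (fun x v ε hε => by
      obtain ⟨_, ⟨s, rfl⟩, hs⟩ := Metric.mem_closure_iff.1 ((hι x).1 v) ε hε
      obtain ⟨t, rfl⟩ := tensorMap_surjective (A.evalHom_surjective x) (B.evalHom_surjective x) s
      exact ⟨Φ t, ⟨t, rfl⟩, by rwa [hΦ, ← dist_eq_norm]⟩)
  have hcont : ∀ t, Continuous fun x => (⟨x, Φ t x⟩ : Tot D) := fun t => hΓ.continuous _ ⟨t, rfl⟩
  have hC : IsUSCCStarBundle D :=
    { toIsUSCBanachBundle := hB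
      continuous_mul := hB.continuous_bilinear hB hB (fun x a b => a * b)
        (fun x a b c => sub_mul a b c) (fun x a b c => mul_sub a b c) (fun x a b => norm_mul_le a b)
        hΓ hΓ (by
          rintro _ ⟨s, rfl⟩ _ ⟨t, rfl⟩
          have := hcont (s * t)
          simpa only [hΦ, map_mul] using this)
      continuous_star := continuous_iff_continuousAt.2 fun z =>
        hB.tendsto_map hB (tendsto_id (x := 𝓝 z)) (fun a => star) star
          (fun a u v => by rw [← star_sub, norm_star]) (fun u v => by rw [← star_sub, norm_star]) hΓ
          (by
            rintro _ ⟨s, rfl⟩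
            have := ((hcont (star s)).comp hB.continuous_proj).tendsto z
            simpa only [hΦ, map_star, Function.comp_def] using this) }
  refine ⟨{ Fiber := D, isBundle := hC }, ⟨{ ι := ι, isEnveloping := hι, continuous_tmul := ?_ }⟩⟩
  exact A.isBundle.continuous_bilinear B.isBundle.toIsUSCBanachBundle hB (fun x a b => ι x (a ⊗ₜ b))
    (fun x a b c => by rw [TensorProduct.sub_tmul, map_sub])
    (fun x a b c => by rw [TensorProduct.tmul_sub, map_sub])
    (fun x a b => norm_starHom_tmul_le (ι x) a b) A.denseSections B.denseSections
    (fun f hf g hg => hcont ((⟨f, hf⟩ : A.sections) ⊗ₜ (⟨g, hg⟩ : B.sections)))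

end BundleTensor

/-! ### Isomorphisms of systems -/

section CStarIso

variable {A B : Type*} [NonUnitalCStarAlgebra A] [NonUnitalCStarAlgebra B]

theorem norm_starEquiv (φ : A ≃⋆ₐ[ℂ] B) (a : A) : ‖φ a‖ = ‖a‖ := by
  refine le_antisymm (NonUnitalStarAlgHom.norm_apply_le (φ : A →⋆ₙₐ[ℂ] B) a) ?_
  simpa using NonUnitalStarAlgHom.norm_apply_le (φ.symm : B →⋆ₙₐ[ℂ] A) (φ a)

theorem norm_starEquiv_sub (φ : A ≃⋆ₐ[ℂ] B) (a a' : A) : ‖φ a - φ a'‖ = ‖a - a'‖ := by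
  rw [← map_sub, norm_starEquiv]

/-- A ⋆-isomorphism of C⋆-algebras as a linear isometry. -/
def starEquivIsometry (φ : A ≃⋆ₐ[ℂ] B) : A ≃ₗᵢ[ℂ] B where
  toFun := φ
  invFun := φ.symm
  left_inv := φ.left_inv
  right_inv := φ.right_inv
  map_add' := map_add φ
  map_smul' := map_smul φ
  norm_map' := norm_starEquiv φ

variable (A) in
theorem exists_approximateUnit :
    ∃ l : Filter A, l.IsApproximateUnit ∧ ∀ᶠ e in l, ‖e‖ ≤ 1 ∧ ∃ s, e = star s * s := by
  let := CStarAlgebra.spectralOrder A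
  have := CStarAlgebra.spectralOrderedRing A
  have h := CStarAlgebra.increasingApproximateUnit A
  exact ⟨_, h.toIsApproximateUnit, h.eventually_norm.and
    (h.eventually_nonneg.mono fun e he => CStarAlgebra.nonneg_iff_eq_star_mul_self.1 he)⟩

theorem dense_span_mul (S : Set A) (hS : ∀ a b, a * b ∈ S) : Dense (Submodule.span ℂ S : Set A) := by
  obtain ⟨l, hl, -⟩ := exists_approximateUnit A
  have := hl.neBot
  intro a
  exact mem_closure_of_tendsto (hl.tendsto_mul_left a)
    (Eventually.of_forall fun e => Submodule.subset_span (hS a e))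

/-- The imprimitivity bimodule of a ⋆-isomorphism. -/
def isoBimodule {A B : Type w} [NonUnitalCStarAlgebra A] [NonUnitalCStarAlgebra B]
    (φ : A ≃⋆ₐ[ℂ] B) : ImprimitivityBimodule A B A where
  lsmul := LinearMap.mul ℂ A
  rsmul := LinearMap.mk₂ ℂ (fun z b => z * φ.symm b) (by simp [add_mul])
    (by simp [smul_mul_assoc]) (by simp [mul_add]) (by simp [mul_smul_comm])
  linner := LinearMap.mk₂'ₛₗ (RingHom.id ℂ) (starRingEnd ℂ) (fun z z' => z * star z')
    (by simp [add_mul]) (by simp [smul_mul_assoc]) (by simp [mul_add]) (by simp [mul_smul_comm])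
  rinner := LinearMap.mk₂'ₛₗ (starRingEnd ℂ) (RingHom.id ℂ) (fun z z' => φ (star z * z'))
    (by simp [add_mul]) (by simp [smul_mul_assoc]) (by simp [mul_add]) (by simp [mul_smul_comm])
  complete := inferInstance
  mul_lsmul := by simp [mul_assoc]
  rsmul_mul := by simp [mul_assoc]
  lsmul_rsmul := by simp [mul_assoc]
  linner_lsmul := by simp [mul_assoc]
  rinner_rsmul := by simp [mul_assoc]
  star_linner := by simp
  star_rinner := by simp [← map_star]
  linner_self_nonneg z := ⟨star z, by simp⟩
  rinner_self_nonneg z := ⟨φ z, by simp [map_star]⟩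
  norm_linner_self z := by simp [CStarRing.norm_self_mul_star, sq]
  norm_rinner_self z := by
    change ‖φ (star z * z)‖ = _
    rw [norm_starEquiv, CStarRing.norm_star_mul_self, sq]
  linner_full := dense_span_mul _ fun a b => ⟨a, star b, by simp⟩
  rinner_full := dense_span_mul _ fun a b => ⟨φ.symm (star a), φ.symm b, by simp [← map_star]⟩
  rinner_lsmul := by simp [mul_assoc]
  linner_rsmul z b z' := by simp [mul_assoc, ← map_star]
  linner_lsmul_eq := by simp [mul_assoc]

end CStarIso

section FibProd

variable {X : Type u} [TopologicalSpace X]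

theorem continuous_fibProd_fst (Z W : X → Type w) [TopologicalSpace (Tot Z)]
    [TopologicalSpace (Tot W)] :
    Continuous (fun p : FibProd Z W => (⟨p.base, p.fst⟩ : Tot Z)) :=
  continuous_iff_continuousAt.2 fun p =>
    (tendsto_fibProd_iff.1 (tendsto_id (x := 𝓝 p))).1

theorem continuous_fibProd_snd (Z W : X → Type w) [TopologicalSpace (Tot Z)]
    [TopologicalSpace (Tot W)] :
    Continuous (fun p : FibProd Z W => (⟨p.base, p.snd⟩ : Tot W)) :=
  continuous_iff_continuousAt.2 fun p =>
    (tendsto_fibProd_iff.1 (tendsto_id (x := 𝓝 p))).2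

end FibProd

section Systems

variable {X : Type u} [Groupoid.{v} X] [TopologicalSpace X] [TopologicalSpace (Quiver.Total X)]

theorem tendsto_actProd_iff {Z : X → Type w} [TopologicalSpace (Tot Z)] {α : Type*}
    {l : Filter α} {f : α → ActProd Z} {p : ActProd Z} :
    Tendsto f l (𝓝 p) ↔
      Tendsto (fun a => (⟨(f a).src, (f a).tgt, (f a).hom⟩ : Quiver.Total X)) l
        (𝓝 ⟨p.src, p.tgt, p.hom⟩) ∧
      Tendsto (fun a => (⟨(f a).src, (f a).val⟩ : Tot Z)) l (𝓝 ⟨p.src, p.val⟩) := by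
  rw [nhds_induced, tendsto_comap_iff, nhds_prod_eq, tendsto_prod_iff']
  rfl

/-- The continuity of an action by contractions can be checked on a dense family of sections. -/
theorem IsUSCBanachBundle.continuous_action [T2Space X] [LocallyCompactSpace X]
    [SecondCountableTopology X] {Z : X → Type w} [∀ x, NormedAddCommGroup (Z x)]
    [∀ x, NormedSpace ℂ (Z x)] [TopologicalSpace (Tot Z)] (hZ : IsUSCBanachBundle Z)
    (V : ∀ {x y : X}, (x ⟶ y) → Z x → Z y)
    (hV : ∀ {x y : X} (g : x ⟶ y) (u v : Z x), ‖V g u - V g v‖ ≤ ‖u - v‖)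
    {Γ : Set (∀ x, Z x)} (hΓ : DenseSections Z Γ)
    (H : ∀ f ∈ Γ, Continuous (fun p : ActProd Z => (⟨p.tgt, V p.hom (f p.src)⟩ : Tot Z))) :
    Continuous (fun p : ActProd Z => (⟨p.tgt, V p.hom p.val⟩ : Tot Z)) :=
  continuous_iff_continuousAt.2 fun p => hZ.tendsto_map hZ (l := 𝓝 p)
    (tendsto_actProd_iff.1 (tendsto_id (x := 𝓝 p))).2 (fun p => V p.hom) (V p.hom)
    (fun p => hV p.hom) (hV p.hom) hΓ fun f hf => (H f hf).tendsto p

namespace DynSystem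

variable (A : DynSystem.{u, v, w} X)

theorem tendsto_act {α : Type*} {l : Filter α} {s t : α → X} {g : ∀ a, s a ⟶ t a}
    {f : ∀ a, A.Fiber (s a)} {x y : X} {g₀ : x ⟶ y} {v : A.Fiber x}
    (hg : Tendsto (fun a => (⟨s a, t a, g a⟩ : Quiver.Total X)) l (𝓝 ⟨x, y, g₀⟩))
    (hf : Tendsto (fun a => (⟨s a, f a⟩ : Tot A.Fiber)) l (𝓝 ⟨x, v⟩)) :
    Tendsto (fun a => (⟨t a, A.act (g a) (f a)⟩ : Tot A.Fiber)) l (𝓝 ⟨y, A.act g₀ v⟩) :=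
  (A.continuous_act.tendsto ⟨x, y, g₀, v⟩).comp (tendsto_actProd_iff.2 ⟨hg, hf⟩ :
    Tendsto (fun a => (⟨s a, t a, g a, f a⟩ : ActProd A.Fiber)) l _)

end DynSystem

/-- An isomorphism of `E`-dynamical systems. -/
structure SystemIso (A B : DynSystem.{u, v, w} X) where
  toEquiv : ∀ x, A.Fiber x ≃⋆ₐ[ℂ] B.Fiber x
  continuous_toEquiv : Continuous
    (fun z : Tot A.Fiber => (⟨z.base, toEquiv z.base z.val⟩ : Tot B.Fiber))
  map_act : ∀ {x y : X} (g : x ⟶ y) (a : A.Fiber x),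
    toEquiv y (A.act g a) = B.act g (toEquiv x a)

variable [T2Space X] [LocallyCompactSpace X] [SecondCountableTopology X]
  {A B : DynSystem.{u, v, w} X}

/-- The fibre maps are isometric. A section through the preimage is carried to a continuous section
of `B`, and the norm criterion for convergence along a section can be read in either bundle. -/
theorem SystemIso.continuous_symm (e : SystemIso A B) : Continuous
    (fun z : Tot B.Fiber => (⟨z.base, (e.toEquiv z.base).symm z.val⟩ : Tot A.Fiber)) := by
  refine continuous_iff_continuousAt.2 fun ⟨x, v⟩ => ?_
  obtain ⟨f, hf, hfx⟩ := A.isBundle.exists_section x ((e.toEquiv x).symm v)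
  have hg : Continuous (fun x => (⟨x, e.toEquiv x (f x)⟩ : Tot B.Fiber)) :=
    e.continuous_toEquiv.comp hf
  have h := (B.isBundle.tendsto_iff_of_section (l := 𝓝 (⟨x, v⟩ : Tot B.Fiber)) (F := Tot.val)
    (v := v) hg (by simp [hfx])).1 tendsto_id
  refine (A.isBundle.tendsto_iff_of_section hf hfx).2 ⟨h.1, fun ε hε => ?_⟩
  filter_upwards [h.2 ε hε] with z hz
  rwa [← norm_starEquiv_sub (e.toEquiv z.base), StarAlgEquiv.apply_symm_apply]

/-- Isomorphic systems are equivariantly Morita equivalent. -/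
theorem SystemIso.moritaEquiv (e : SystemIso A B) : MoritaEquiv A B := by
  have hf := continuous_fibProd_fst A.Fiber A.Fiber
  have hs := continuous_fibProd_snd A.Fiber A.Fiber
  refine ⟨
    { Fiber := A.Fiber
      isBundle := A.isBundle.toIsUSCBanachBundle
      bimod := fun x => isoBimodule (e.toEquiv x)
      continuous_lsmul := A.isBundle.continuous_mul
      continuous_rsmul := ?_
      continuous_linner := ?_
      continuous_rinner := ?_
      V := fun g => starEquivIsometry (A.act g)
      V_comp := A.act_comp
      continuous_V := A.continuous_act
      linner_V := fun g ξ ζ => by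
        change A.act g ξ * star (A.act g ζ) = A.act g (ξ * star ζ)
        rw [map_mul, map_star]
      rinner_V := fun {x y} g ξ ζ => by
        change e.toEquiv y (star (A.act g ξ) * A.act g ζ) = B.act g (e.toEquiv x (star ξ * ζ))
        rw [← e.map_act, map_mul (A.act g), map_star (A.act g)] }⟩
  · refine A.isBundle.continuous_mul.comp (f := fun p : FibProd A.Fiber B.Fiber =>
      (⟨p.base, p.fst, (e.toEquiv p.base).symm p.snd⟩ : FibProd A.Fiber A.Fiber)) ?_
    exact continuous_induced_rng.2 ((continuous_fibProd_fst _ _).prodMk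
      (e.continuous_symm.comp (continuous_fibProd_snd _ _)))
  · exact A.isBundle.continuous_mul.comp (f := fun p : FibProd A.Fiber A.Fiber =>
      (⟨p.base, p.fst, star p.snd⟩ : FibProd A.Fiber A.Fiber))
      (continuous_induced_rng.2 (hf.prodMk (A.isBundle.continuous_star.comp hs)))
  · exact e.continuous_toEquiv.comp (A.isBundle.continuous_mul.comp
      (f := fun p : FibProd A.Fiber A.Fiber =>
      (⟨p.base, star p.fst, p.snd⟩ : FibProd A.Fiber A.Fiber))
      (continuous_induced_rng.2 ((A.isBundle.continuous_star.comp hf).prodMk hs)))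

theorem MoritaEquiv.refl (A : DynSystem.{u, v, w} X) : MoritaEquiv A A :=
  SystemIso.moritaEquiv
    { toEquiv := fun _ => StarAlgEquiv.refl ℂ _
      continuous_toEquiv := continuous_id
      map_act := fun _ _ => rfl }

/-- Continuity of an isomorphism of systems can be checked on a dense family of sections. -/
def SystemIso.ofDenseSections (φ : ∀ x, A.Fiber x ≃⋆ₐ[ℂ] B.Fiber x)
    (hφ : ∀ {x y : X} (g : x ⟶ y) (a : A.Fiber x), φ y (A.act g a) = B.act g (φ x a))
    {Γ : Set (∀ x, A.Fiber x)} (hΓ : DenseSections A.Fiber Γ)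
    (H : ∀ f ∈ Γ, Continuous (fun x => (⟨x, φ x (f x)⟩ : Tot B.Fiber))) : SystemIso A B where
  toEquiv := φ
  map_act := hφ
  continuous_toEquiv := continuous_iff_continuousAt.2 fun z =>
    A.isBundle.tendsto_map B.isBundle.toIsUSCBanachBundle (l := 𝓝 z) (s := Tot.base) (t := Tot.base)
      (ζ := Tot.val) (x := z.base) (z := z.val)
      tendsto_id (fun z => φ z.base) (φ z.base) (fun _ u v => (norm_starEquiv_sub _ u v).le)
      (fun u v => (norm_starEquiv_sub _ u v).le) hΓ fun f hf =>
        ((H f hf).tendsto _).comp (A.isBundle.continuous_proj.tendsto z)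

end Systems

/-! ### Fibrewise maximal tensor products of systems -/

section FiberTensor

variable {X : Type u} [Groupoid.{v} X] [TopologicalSpace X] [TopologicalSpace (Quiver.Total X)]

/-- The two iterated tensor products of three C⋆-algebras are enveloping algebras of the same
⋆-algebra. -/
theorem exists_iterated_tensor {A B C D E F G : Type w} [NonUnitalCStarAlgebra A]
    [NonUnitalCStarAlgebra B] [NonUnitalCStarAlgebra C] [NonUnitalCStarAlgebra D]
    [NonUnitalCStarAlgebra E] [NonUnitalCStarAlgebra F] [NonUnitalCStarAlgebra G]
    {ι₁ : A ⊗[ℂ] B →⋆ₙₐ[ℂ] D} (h₁ : IsEnveloping ι₁) {ι₂ : D ⊗[ℂ] C →⋆ₙₐ[ℂ] E}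
    (h₂ : IsEnveloping ι₂) {ι₃ : B ⊗[ℂ] C →⋆ₙₐ[ℂ] F} (h₃ : IsEnveloping ι₃)
    {ι₄ : A ⊗[ℂ] F →⋆ₙₐ[ℂ] G} (h₄ : IsEnveloping ι₄) :
    ∃ (R : Type w) (_ : NonUnitalRing R) (_ : Module ℂ R) (_ : StarRing R) (t : A → B → C → R)
      (f : R →⋆ₙₐ[ℂ] E) (g : R →⋆ₙₐ[ℂ] G), IsEnveloping f ∧ IsEnveloping g ∧
      (∀ r, r ∈ Submodule.span ℂ {r | ∃ a b c, r = t a b c}) ∧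
      (∀ a b c, f (t a b c) = ι₂ (ι₁ (a ⊗ₜ b) ⊗ₜ c)) ∧
      ∀ a b c, g (t a b c) = ι₄ (a ⊗ₜ ι₃ (b ⊗ₜ c)) := by
  -- Iterated tensor products are only known to be enveloping when bracketed to the left. The other
  -- bracketing is brought to that form by moving `A` to the end: `A ⊗ (B ⊗ C)` becomes `(B ⊗ C) ⊗
  -- A`.
  let e := (tensorAssoc A B C).trans (tensorComm A (B ⊗[ℂ] C))
  let j : F ⊗[ℂ] A →⋆ₙₐ[ℂ] G := ι₄.comp (tensorComm F A : F ⊗[ℂ] A →⋆ₙₐ[ℂ] A ⊗[ℂ] F)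
  have hj : IsEnveloping j := h₄.comp_equiv (tensorComm F A) fun _ => rfl
  let k : (B ⊗[ℂ] C) ⊗[ℂ] A →⋆ₙₐ[ℂ] G := j.comp (tensorMap ι₃ (NonUnitalStarAlgHom.id ℂ A))
  have hk : IsEnveloping (R := (B ⊗[ℂ] C) ⊗[ℂ] A) (D := G) k :=
    h₃.tensor_tensor hj fun _ _ => rfl
  refine ⟨(A ⊗[ℂ] B) ⊗[ℂ] C, inferInstance, inferInstance, inferInstance,
    fun a b c => (a ⊗ₜ b) ⊗ₜ c, ι₂.comp (tensorMap ι₁ (NonUnitalStarAlgHom.id ℂ C)),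
    k.comp (e : (A ⊗[ℂ] B) ⊗[ℂ] C →⋆ₙₐ[ℂ] (B ⊗[ℂ] C) ⊗[ℂ] A),
    h₁.tensor_tensor h₂ fun _ _ => rfl,
    IsEnveloping.comp_equiv (R := (B ⊗[ℂ] C) ⊗[ℂ] A) hk e fun _ => rfl, fun r => ?_,
    fun _ _ _ => rfl, fun _ _ _ => rfl⟩
  induction r with
  | zero => exact Submodule.zero_mem _
  | add s t hs ht => exact Submodule.add_mem _ hs ht
  | tmul s c =>
    induction s with
    | zero => rw [TensorProduct.zero_tmul]; exact Submodule.zero_mem _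
    | add s t hs ht => rw [TensorProduct.add_tmul]; exact Submodule.add_mem _ hs ht
    | tmul a b => exact Submodule.subset_span ⟨a, b, c, rfl⟩

/-- The system `C` is fibrewise the maximal tensor product of `A` and `B`, with the diagonal
action. -/
structure FiberTensor (A B C : DynSystem.{u, v, w} X) extends
    BundleTensor A.toCStarBundle B.toCStarBundle C.toCStarBundle where
  act_tmul : ∀ {x y : X} (g : x ⟶ y) (t : A.Fiber x ⊗[ℂ] B.Fiber x),
    C.act g (ι x t) = ι y (tensorCongr (A.act g) (B.act g) t)

theorem denseRange_ext {D Q T : Type*} [TopologicalSpace D] [TopologicalSpace Q] [T2Space Q]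
    {f : T → D} (hf : DenseRange f) {g h : D → Q} (hg : Continuous g) (hh : Continuous h)
    (H : ∀ x, g (f x) = h (f x)) (d : D) : g d = h d :=
  congrFun (hf.equalizer hg hh (funext H)) d

theorem continuous_starEquiv {D Q : Type*} [NonUnitalCStarAlgebra D] [NonUnitalCStarAlgebra Q]
    (φ : D ≃⋆ₐ[ℂ] Q) : Continuous φ := continuous_starHom (φ : D →⋆ₙₐ[ℂ] Q)

variable [T2Space X] [LocallyCompactSpace X] [SecondCountableTopology X]

namespace FiberTensor

variable {A B C C' : DynSystem.{u, v, w} X}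

-- The maps `α_γ ⊗ β_γ` extend to the maximal tensor products by their universal property;
-- functoriality is checked on the dense algebraic tensor products and continuity on tensors of
-- sections.
variable (A B) in
theorem exists_fiberTensor : ∃ C : DynSystem.{u, v, w} X, Nonempty (FiberTensor A B C) := by
  obtain ⟨C, ⟨T⟩⟩ := exists_bundleTensor A.toCStarBundle B.toCStarBundle
  choose act hact using fun {x y : X} (g : x ⟶ y) => (T.isEnveloping x).exists_equiv
    (T.isEnveloping y) (tensorCongr (A.act g) (B.act g))
  have hΓ : DenseSections C.Fiber (Set.range fun t => (T.sectionHom t).1) :=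
    { continuous := by
        rintro _ ⟨t, rfl⟩
        exact (T.sectionHom t).2.1
      exists_near := fun x v ε hε => by
        obtain ⟨t, ht⟩ := T.exists_section_near x v hε
        exact ⟨_, ⟨t, rfl⟩, ht⟩ }
  refine ⟨{ toCStarBundle := C, separable := T.isSeparable A.separable B.separable, act := act,
            act_comp := ?_, continuous_act := ?_ }, ⟨{ toBundleTensor := T, act_tmul := hact }⟩⟩
  · intro x y z h g c
    refine denseRange_ext (T.isEnveloping x).1 (continuous_starEquiv _)
      ((continuous_starEquiv (act g)).comp (continuous_starEquiv (act h))) (fun t => ?_) c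
    change act (h ≫ g) (T.ι x t) = act g (act h (T.ι x t))
    rw [hact, hact, hact]
    congr 1
    induction t with
    | zero => simp
    | add s t hs ht => rw [map_add, map_add, map_add, hs, ht]
    | tmul a b => simp [A.act_comp, B.act_comp]
  · refine C.isBundle.continuous_action (fun g => act g)
      (fun g u v => (norm_starEquiv_sub (act g) u v).le) hΓ ?_
    rintro _ ⟨t, rfl⟩
    refine continuous_iff_continuousAt.2 fun p => ?_
    have hp := (tendsto_actProd_iff.1 (tendsto_id (x := 𝓝 p)))
    have hs := C.isBundle.tendsto_base hp.2
    have e : ∀ (x y : X) (g : x ⟶ y), act g ((T.sectionHom t).1 x) = T.ι y (tensorCongr (A.act g)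
        (B.act g) (tensorMap (A.evalHom x) (B.evalHom x) t)) := fun x y g => by
      rw [T.sectionHom_apply, hact]
    simp only [ContinuousAt, e]
    induction t with
    | zero =>
      simp only [map_zero]
      refine (C.isBundle.continuous_zero_section.tendsto p.tgt).comp ?_
      have h0 := A.tendsto_act hp.1 ((A.isBundle.continuous_zero_section.tendsto _).comp hs)
      exact A.isBundle.tendsto_base h0
    | add s t hs ht =>
      simp only [map_add]
      exact C.isBundle.tendsto_add (hs fun x y g => by rw [T.sectionHom_apply, hact])
        (ht fun x y g => by rw [T.sectionHom_apply, hact])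
    | tmul a b =>
      exact T.tendsto_tmul (A.tendsto_act hp.1 ((a.2.1.tendsto _).comp hs))
        (B.tendsto_act hp.1 ((b.2.1.tendsto _).comp hs))

omit [T2Space X] [LocallyCompactSpace X] [SecondCountableTopology X] in
theorem mem_span_image_eval {Z : X → Type*} [∀ x, AddCommGroup (Z x)] [∀ x, Module ℂ (Z x)]
    {S : Set (∀ x, Z x)} {x : X} {r : Z x}
    (hr : r ∈ Submodule.span ℂ ((fun f => f x) '' S)) : ∃ f ∈ Submodule.span ℂ S, f x = r := by
  have : (fun f : ∀ x, Z x => f x) '' S = (LinearMap.proj x : (∀ x, Z x) →ₗ[ℂ] Z x) '' S := rfl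
  rw [this, ← Submodule.map_span] at hr
  exact hr

/-- Systems whose fibres are enveloping algebras of the same ⋆-algebras are equivalent. -/
theorem moritaEquiv_of_isEnveloping {C₁ C₂ : DynSystem.{u, v, w} X} {R : X → Type w}
    [∀ x, NonUnitalRing (R x)] [∀ x, Module ℂ (R x)] [∀ x, StarRing (R x)]
    {ι₁ : ∀ x, R x →⋆ₙₐ[ℂ] C₁.Fiber x} (h₁ : ∀ x, IsEnveloping (ι₁ x))
    {ι₂ : ∀ x, R x →⋆ₙₐ[ℂ] C₂.Fiber x} (h₂ : ∀ x, IsEnveloping (ι₂ x)) (S : Set (∀ x, R x))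
    (hS : ∀ x r, r ∈ Submodule.span ℂ ((fun f => f x) '' S))
    (hc₁ : ∀ f ∈ S, Continuous (fun x => (⟨x, ι₁ x (f x)⟩ : Tot C₁.Fiber)))
    (hc₂ : ∀ f ∈ S, Continuous (fun x => (⟨x, ι₂ x (f x)⟩ : Tot C₂.Fiber)))
    (hact : ∀ {x y : X} (g : x ⟶ y), ∀ f ∈ S, ∃ r, C₁.act g (ι₁ x (f x)) = ι₁ y r ∧
      C₂.act g (ι₂ x (f x)) = ι₂ y r) :
    MoritaEquiv C₁ C₂ := by
  -- Both fibres are enveloping algebras of the same `R x`, which determines the isomorphism `φ x`.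
  -- Equivariance and continuity are then checked on the spanning family `S` and pass to spans and
  -- closures.
  choose φ hφ using fun x => (h₁ x).exists_equiv (h₂ x) (StarAlgEquiv.refl ℂ _)
  replace hφ : ∀ x r, φ x (ι₁ x r) = ι₂ x r := hφ
  let Φ : (∀ x, R x) →ₗ[ℂ] (∀ x, C₁.Fiber x) := LinearMap.pi fun x =>
    (ι₁ x : R x →ₗ[ℂ] C₁.Fiber x).comp (LinearMap.proj x)
  refine SystemIso.moritaEquiv (SystemIso.ofDenseSections φ (fun {x y} g c => ?_)
    (Γ := Φ '' (Submodule.span ℂ S : Set (∀ x, R x)))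
    { continuous := ?_
      exists_near := fun x v ε hε => by
        obtain ⟨_, ⟨r, rfl⟩, hr⟩ := Metric.mem_closure_iff.1 ((h₁ x).1 v) ε hε
        obtain ⟨f, hf, rfl⟩ := mem_span_image_eval (hS x r)
        exact ⟨_, ⟨f, hf, rfl⟩, by rwa [← dist_eq_norm]⟩ } ?_)
  · refine denseRange_ext (h₁ x).1
      ((continuous_starEquiv (φ y)).comp (continuous_starEquiv (C₁.act g)))
      ((continuous_starEquiv (C₂.act g)).comp (continuous_starEquiv (φ x))) (fun t => ?_) c
    change φ y (C₁.act g (ι₁ x t)) = C₂.act g (φ x (ι₁ x t))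
    refine Submodule.span_induction ?_ ?_ ?_ ?_ (hS x t)
    · rintro _ ⟨f, hf, rfl⟩
      obtain ⟨r, hr1, hr2⟩ := hact g f hf
      rw [hr1, hφ, hφ, hr2]
    · simp only [map_zero]
    · intro s t _ _ hs ht
      simp only [map_add, hs, ht]
    · intro k t _ ht
      simp only [map_smul, ht]
  · rintro _ ⟨f, hf, rfl⟩
    change Continuous (fun x => (⟨x, ι₁ x (f x)⟩ : Tot C₁.Fiber))
    refine Submodule.span_induction hc₁ ?_ ?_ ?_ hf
    · simpa using C₁.isBundle.continuous_zero_section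
    · intro s t _ _ hs ht
      simpa using C₁.isBundle.continuous_add_section hs ht
    · intro k t _ ht
      simpa [Function.comp_def] using (C₁.isBundle.continuous_smul k).comp ht
  · rintro _ ⟨f, hf, rfl⟩
    have e1 : ∀ x, φ x (Φ f x) = ι₂ x (f x) := fun x => hφ x _
    simp only [e1]
    refine Submodule.span_induction hc₂ ?_ ?_ ?_ hf
    · simpa using C₂.isBundle.continuous_zero_section
    · intro s t _ _ hs ht
      simpa using C₂.isBundle.continuous_add_section hs ht
    · intro k t _ ht
      simpa [Function.comp_def] using (C₂.isBundle.continuous_smul k).comp ht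

theorem moritaEquiv_of_isEnveloping_tensor (T : FiberTensor A B C)
    {ι₂ : ∀ x, A.Fiber x ⊗[ℂ] B.Fiber x →⋆ₙₐ[ℂ] C'.Fiber x} (h₂ : ∀ x, IsEnveloping (ι₂ x))
    (hc : ∀ (a : A.sections) (b : B.sections),
      Continuous (fun x => (⟨x, ι₂ x (a.1 x ⊗ₜ b.1 x)⟩ : Tot C'.Fiber)))
    (hact : ∀ {x y : X} (g : x ⟶ y) (a : A.Fiber x) (b : B.Fiber x),
      C'.act g (ι₂ x (a ⊗ₜ b)) = ι₂ y (A.act g a ⊗ₜ B.act g b)) :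
    MoritaEquiv C C' := by
  refine moritaEquiv_of_isEnveloping T.isEnveloping h₂
    (Set.range fun p : A.sections × B.sections => fun x => p.1.1 x ⊗ₜ p.2.1 x) ?_ ?_ ?_ ?_
  · intro x r
    induction r with
    | zero => exact Submodule.zero_mem _
    | add s t hs ht => exact Submodule.add_mem _ hs ht
    | tmul a b =>
      obtain ⟨f, rfl⟩ := A.evalHom_surjective x a
      obtain ⟨g, rfl⟩ := B.evalHom_surjective x b
      exact Submodule.subset_span ⟨_, ⟨(f, g), rfl⟩, rfl⟩
  · rintro _ ⟨p, rfl⟩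
    exact T.continuous_tmul_section p.1.2.1 p.2.2.1
  · rintro _ ⟨p, rfl⟩
    exact hc p.1 p.2
  · rintro x y g _ ⟨p, rfl⟩
    exact ⟨_, T.act_tmul g _, hact g _ _⟩

/-- Fibrewise tensor products are unique. -/
theorem moritaEquiv (T : FiberTensor A B C) (T' : FiberTensor A B C') : MoritaEquiv C C' :=
  T.moritaEquiv_of_isEnveloping_tensor T'.isEnveloping
    (fun a b => T'.continuous_tmul_section a.2.1 b.2.1) fun g a b => T'.act_tmul g (a ⊗ₜ b)

theorem moritaEquiv_comm (T : FiberTensor A B C) (T' : FiberTensor B A C') : MoritaEquiv C C' :=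
  T.moritaEquiv_of_isEnveloping_tensor
    (ι₂ := fun x => (T'.ι x).comp (tensorComm (A.Fiber x) (B.Fiber x) :
      A.Fiber x ⊗[ℂ] B.Fiber x →⋆ₙₐ[ℂ] B.Fiber x ⊗[ℂ] A.Fiber x))
    (fun x => (T'.isEnveloping x).comp_equiv (tensorComm _ _) fun _ => rfl)
    (fun a b => T'.continuous_tmul_section b.2.1 a.2.1) fun g a b => T'.act_tmul g (b ⊗ₜ a)

/-- Fibrewise tensor products are associative. -/
theorem moritaEquiv_assoc {C D E F G : DynSystem.{u, v, w} X} (T₁ : FiberTensor A B D)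
    (T₂ : FiberTensor D C E) (T₃ : FiberTensor B C F) (T₄ : FiberTensor A F G) :
    MoritaEquiv E G := by
  choose R i₁ i₂ i₃ t ι₁ ι₂ h₁ h₂ ht e₁ e₂ using fun x => exists_iterated_tensor
    (T₁.isEnveloping x) (T₂.isEnveloping x) (T₃.isEnveloping x) (T₄.isEnveloping x)
  refine moritaEquiv_of_isEnveloping h₁ h₂
    (Set.range fun p : A.sections × B.sections × C.sections =>
      fun x => t x (p.1.1 x) (p.2.1.1 x) (p.2.2.1 x)) ?_ ?_ ?_ ?_
  · intro x r
    refine Submodule.span_mono ?_ (ht x r)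
    rintro _ ⟨a, b, c, rfl⟩
    obtain ⟨f, rfl⟩ := A.evalHom_surjective x a
    obtain ⟨g, rfl⟩ := B.evalHom_surjective x b
    obtain ⟨h, rfl⟩ := C.evalHom_surjective x c
    exact ⟨_, ⟨(f, g, h), rfl⟩, rfl⟩
  · rintro _ ⟨⟨a, b, c⟩, rfl⟩
    simp only [e₁]
    exact T₂.continuous_tmul_section (T₁.continuous_tmul_section a.2.1 b.2.1) c.2.1
  · rintro _ ⟨⟨a, b, c⟩, rfl⟩
    simp only [e₂]
    exact T₄.continuous_tmul_section a.2.1 (T₃.continuous_tmul_section b.2.1 c.2.1)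
  · rintro x y g _ ⟨⟨a, b, c⟩, rfl⟩
    refine ⟨t y (A.act g (a.1 x)) (B.act g (b.1 x)) (C.act g (c.1 x)), ?_, ?_⟩
    · rw [e₁, e₁, T₂.act_tmul, tensorCongr_tmul, T₁.act_tmul, tensorCongr_tmul]
    · rw [e₂, e₂, T₄.act_tmul, tensorCongr_tmul, T₃.act_tmul, tensorCongr_tmul]

end FiberTensor

/-- The isomorphism of `ℂ ⊗ A` with `A`. -/
def unitTensor (A : Type w) [NonUnitalCStarAlgebra A] : CC.{w} ⊗[ℂ] A →⋆ₙₐ[ℂ] A :=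
  tensorLift (LinearMap.mk₂ ℂ (fun (k : CC.{w}) a => k.down • a) (fun _ _ _ => add_smul _ _ _)
    (fun _ _ _ => smul_assoc _ _ _) (fun _ _ _ => smul_add _ _ _) (fun _ _ _ => smul_comm _ _ _))
    (fun k a k' a' => (smul_mul_smul_comm k.down a k'.down a').symm)
    (fun k a => (star_smul k.down a).symm)

theorem unitTensor_tmul (A : Type w) [NonUnitalCStarAlgebra A] (k : CC.{w}) (a : A) :
    unitTensor A (k ⊗ₜ a) = k.down • a := rfl

/-- The map has an algebraic inverse `j a = 1 ⊗ a`. Pulling a C⋆-seminorm back along `j` gives one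
on the C⋆-algebra `A`, where the norm dominates it. -/
theorem isEnveloping_unitTensor (A : Type w) [NonUnitalCStarAlgebra A] :
    IsEnveloping (unitTensor A) := by
  have hs : ∀ a, unitTensor A ((⟨1⟩ : CC.{w}) ⊗ₜ a) = a := fun a => one_smul _ _
  refine isEnveloping_of_le (fun a => subset_closure ⟨_, hs a⟩) fun p hp t => ?_
  let j : A →⋆ₙₐ[ℂ] CC.{w} ⊗[ℂ] A :=
    { toFun := fun a => (⟨1⟩ : CC.{w}) ⊗ₜ a
      map_smul' := fun k a => TensorProduct.tmul_smul _ _ _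
      map_zero' := TensorProduct.tmul_zero _ _
      map_add' := TensorProduct.tmul_add _
      map_mul' := fun a b => by
        rw [Algebra.TensorProduct.tmul_mul_tmul]
        congr 1
        exact congrArg ULift.up (one_mul 1).symm
      map_star' := fun a => by
        rw [TensorProduct.star_tmul]
        congr 1
        exact congrArg ULift.up (star_one ℂ).symm }
  have ht : t = j (unitTensor A t) := by
    induction t with
    | zero => simp
    | add s t hs ht => rw [map_add, map_add, ← hs, ← ht]
    | tmul k a =>
      rw [unitTensor_tmul, map_smul]
      change k ⊗ₜ a = k.down • ((⟨1⟩ : CC.{w}) ⊗ₜ a)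
      rw [TensorProduct.smul_tmul']
      congr 1
      exact congrArg ULift.up (mul_one k.down).symm
  have := (isEnveloping_id A).le (hp.comp j) (unitTensor A t)
  rw [ht]
  simpa [← ht] using this

/-- The trivial system is a unit for the fibrewise tensor product. -/
def trivialFiberTensor [IsLCHGroupoid X] (A : DynSystem.{u, v, w} X) :
    FiberTensor (trivialSystem X) A A where
  ι x := unitTensor (A.Fiber x)
  isEnveloping x := isEnveloping_unitTensor (A.Fiber x)
  continuous_tmul := by
    refine continuous_iff_continuousAt.2 fun p => ?_
    have h := tendsto_fibProd_iff.1 (tendsto_id (x := 𝓝 p))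
    have hc : Continuous (fun z : Tot (fun _ : X => CC.{w}) => z.val.down) :=
      continuous_snd.comp (continuous_induced_dom (f := fun z : Tot (fun _ : X => CC.{w}) =>
        (z.base, z.val.down)))
    exact A.isBundle.tendsto_smul ((hc.tendsto _).comp h.1) h.2
  act_tmul {x y} g t := by
    let u (x : X) : (trivialSystem.{u, v, w} X).Fiber x ⊗[ℂ] A.Fiber x →⋆ₙₐ[ℂ] A.Fiber x :=
      unitTensor (A.Fiber x)
    change A.act g (u x t) = u y _
    induction t with
    | zero => simp
    | add s t hs ht => simp only [map_add, hs, ht]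
    | tmul k a => exact map_smul (A.act g) k.down a

end FiberTensor

/-! ### Balanced tensor products are fibrewise tensor products -/

theorem exists_starHom_factor {D C Q : Type*} [NonUnitalCStarAlgebra D] [NonUnitalCStarAlgebra C]
    [NonUnitalCStarAlgebra Q] {q : D →⋆ₙₐ[ℂ] C} (hq : Function.Surjective q) (h : D →⋆ₙₐ[ℂ] Q)
    (hk : ∀ d, q d = 0 → h d = 0) : ∃ k : C →⋆ₙₐ[ℂ] Q, ∀ d, k (q d) = h d := by
  have key : ∀ d d', q d = q d' → h d = h d' := fun d d' hd => by
    rw [← sub_eq_zero, ← map_sub]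
    exact hk _ (by rw [map_sub, hd, sub_self])
  obtain ⟨σ, hσ⟩ := hq.hasRightInverse
  have e : ∀ d, h (σ (q d)) = h d := fun d => key _ _ (hσ _)
  refine ⟨{ toFun := fun c => h (σ c), map_smul' := fun r c => ?_, map_zero' := ?_,
            map_add' := fun c c' => ?_, map_mul' := fun c c' => ?_, map_star' := fun c => ?_ }, e⟩
  · rw [MonoidHom.id_apply, ← map_smul]
    exact key _ _ (by rw [hσ, map_smul, hσ])
  · rw [← map_zero q, e, map_zero]
  · rw [← map_add]
    exact key _ _ (by rw [hσ, map_add, hσ, hσ])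
  · rw [← map_mul]
    exact key _ _ (by rw [hσ, map_mul, hσ, hσ])
  · rw [← map_star]
    exact key _ _ (by rw [hσ, map_star, hσ])

section Balanced

variable {X : Type u} [Groupoid.{v} X] [TopologicalSpace X] [TopologicalSpace (Quiver.Total X)]
  [T2Space X] [LocallyCompactSpace X] [SecondCountableTopology X]

/-- A `C₀(X)`-linear ⋆-homomorphism into a fibre is controlled by the norm in that fibre. -/
theorem norm_le_of_smul {C : CStarBundle.{u, w} X} {Q : Type*} [NonUnitalCStarAlgebra Q]
    (k : C.sections →⋆ₙₐ[ℂ] Q) (x : X) (hk : ∀ (φ : C₀(X, ℂ)) c, k (φ • c) = φ x • k c)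
    (c : C.sections) : ‖k c‖ ≤ ‖c.1 x‖ := by
  refine le_of_forall_gt fun r hr => ?_
  obtain ⟨r', hr', hr'r⟩ := exists_between hr
  -- Since `φ x = 1`, linearity over `C₀(X)` gives `k c = k (φ • c)`, and `φ • c` has supremum norm
  -- at most `r'` because `φ` lives where `c` is below `r'`.
  obtain ⟨φ, h1, hφ, h0⟩ := exists_bump (C.isBundle.eventually_norm_lt (c.2.1.tendsto x) hr')
  have h2 := hk φ c
  rw [h1, one_smul] at h2
  rw [← h2]
  refine ((NonUnitalStarAlgHom.norm_apply_le k _).trans ?_).trans_lt hr'r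
  refine CStarBundle.norm_le_of_forall ((norm_nonneg _).trans hr'.le) fun y => ?_
  rw [CStarBundle.smul_apply, norm_smul]
  by_cases hy : ‖c.1 y‖ < r'
  · exact (mul_le_of_le_one_left (norm_nonneg _) (hφ y)).trans hy.le
  · rw [h0 y hy, norm_zero, zero_mul]
    exact (norm_nonneg _).trans hr'.le

variable {A B C : DynSystem.{u, v, w} X}

namespace BalancedTensor

variable (T : BalancedTensor A B C)

/-- The ⋆-homomorphism from the algebraic tensor product of the fibres. -/
def fiberHom (x : X) : A.Fiber x ⊗[ℂ] B.Fiber x →⋆ₙₐ[ℂ] C.Fiber x :=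
  tensorLift (T.τ x)
    -- The structure only postulates that `τ x` is bilinear. Compatibility with products, and below
    -- with adjoints, is derived by lifting the fibre elements to sections, where `q ∘ ι` is a
    -- ⋆-homomorphism.
    (fun a b a' b' => by
      obtain ⟨a, rfl⟩ := A.evalHom_surjective x a
      obtain ⟨b, rfl⟩ := B.evalHom_surjective x b
      obtain ⟨a', rfl⟩ := A.evalHom_surjective x a'
      obtain ⟨b', rfl⟩ := B.evalHom_surjective x b'
      rw [← map_mul, ← map_mul]
      simp only [CStarBundle.evalHom_apply, ← T.q_apply]
      rw [← Algebra.TensorProduct.tmul_mul_tmul, map_mul, map_mul]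
      rfl)
    (fun a b => by
      obtain ⟨a, rfl⟩ := A.evalHom_surjective x a
      obtain ⟨b, rfl⟩ := B.evalHom_surjective x b
      rw [← map_star, ← map_star]
      simp only [CStarBundle.evalHom_apply, ← T.q_apply]
      rw [← TensorProduct.star_tmul, map_star, map_star]
      rfl)

theorem fiberHom_eval (x : X) (t : A.sections ⊗[ℂ] B.sections) :
    T.fiberHom x (tensorMap (A.evalHom x) (B.evalHom x) t) = (T.q (T.ι t)).1 x := by
  induction t with
  | zero => simp
  | add s t hs ht =>
    simp only [map_add, hs, ht]
    rfl
  | tmul a b => exact (T.q_apply a b x).symm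

theorem denseRange_q_ι : DenseRange fun t => T.q (T.ι t) :=
  T.q_surjective.denseRange.comp T.isMax.1 (continuous_starHom T.q)

/-- A C⋆-seminorm on the tensor product of the fibres, pulled back to the sections, gives a
⋆-homomorphism on `T.D`. It annihilates the balancing relations, so it factors through `T.q`; the
factor is `C₀(X)`-linear with scalars evaluated at `x`, hence controlled by the norm in the fibre at
`x`. -/
theorem isEnveloping_fiberHom (x : X) : IsEnveloping (T.fiberHom x) := by
  refine isEnveloping_of_le ?_ fun p hp t => ?_
  · have h := (C.evalHom_surjective x).denseRange.comp T.denseRange_q_ι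
      (continuous_starHom (C.evalHom x))
    refine h.mono ?_
    rintro _ ⟨t, rfl⟩
    exact ⟨_, T.fiberHom_eval x t⟩
  · obtain ⟨Q, _, f, -, hf⟩ := hp.exists_completion
    obtain ⟨h, hh⟩ := (show IsEnveloping T.ι from T.isMax).exists_lift
      (f.comp (tensorMap (A.evalHom x) (B.evalHom x)))
    have hk : ∀ d, T.q d = 0 → h d = 0 := by
      intro d hd
      rw [T.q_ker] at hd
      have h1 : closure (TwoSidedIdeal.span {d : T.D | ∃ (φ : C₀(X, ℂ)) (a : A.sections)
          (b : B.sections), d = T.ι ((φ • a) ⊗ₜ[ℂ] b - a ⊗ₜ[ℂ] (φ • b))} : Set T.D) ⊆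
          {d | h d = 0} := by
        refine closure_minimal ?_ (isClosed_eq (continuous_starHom h) continuous_const)
        have : TwoSidedIdeal.span {d : T.D | ∃ (φ : C₀(X, ℂ)) (a : A.sections)
          (b : B.sections), d = T.ι ((φ • a) ⊗ₜ[ℂ] b - a ⊗ₜ[ℂ] (φ • b))} ≤
            TwoSidedIdeal.ker h := by
          refine TwoSidedIdeal.span_le.2 ?_
          rintro _ ⟨φ, a, b, rfl⟩
          refine (TwoSidedIdeal.mem_ker h).2 ?_
          rw [hh, NonUnitalStarAlgHom.comp_apply, map_sub (tensorMap (A.evalHom x) (B.evalHom x)), tensorMap_tmul, tensorMap_tmul]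
          simp only [CStarBundle.evalHom_apply, CStarBundle.smul_apply]
          rw [← TensorProduct.smul_tmul', TensorProduct.tmul_smul, sub_self, map_zero]
        exact fun d hd => (TwoSidedIdeal.mem_ker h).1 (this hd)
      exact h1 hd
    obtain ⟨k, hk⟩ := exists_starHom_factor T.q_surjective h hk
    obtain ⟨t, rfl⟩ := tensorMap_surjective (A.evalHom_surjective x) (B.evalHom_surjective x) t
    have hkx : ∀ t, k (T.q (T.ι t)) = f (tensorMap (A.evalHom x) (B.evalHom x) t) := fun t =>
      (hk _).trans (hh t)
    rw [← hf, T.fiberHom_eval, ← hkx]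
    refine norm_le_of_smul k x (fun φ c => ?_) _
    -- The structure gives the `C₀(X)`-linearity of `q` on elementary tensors only; additivity and
    -- density of the image of `q ∘ ι` extend it to all sections.
    have hcont : Continuous fun c : C.sections => φ • c :=
      ((C.smulHom φ).mkContinuous ‖φ.toBCF‖ fun c =>
        CStarBundle.norm_smul_section_le _ c (norm_nonneg _) φ.toBCF.norm_coe_le_norm).continuous
    refine denseRange_ext T.denseRange_q_ι ((continuous_starHom k).comp hcont)
      ((continuous_starHom k).const_smul (φ x)) (fun t => ?_) c
    change k (φ • T.q (T.ι t)) = φ x • k (T.q (T.ι t))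
    induction t with
    | zero =>
      have : φ • (0 : C.sections) = 0 := map_zero (C.smulHom φ)
      simp [this]
    | add s t hs ht =>
      have : ∀ c d : C.sections, φ • (c + d) = φ • c + φ • d := map_add (C.smulHom φ)
      simp only [map_add, this, smul_add, hs, ht]
    | tmul a b =>
      rw [← T.q_smul, hkx, hkx, tensorMap_tmul, tensorMap_tmul, ← map_smul,
        TensorProduct.smul_tmul']
      rfl

/-- Balanced tensor products are fibrewise maximal tensor products. -/
def fiberTensor : FiberTensor A B C where
  ι := T.fiberHom
  isEnveloping := T.isEnveloping_fiberHom
  continuous_tmul := A.isBundle.continuous_bilinear B.isBundle.toIsUSCBanachBundle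
    C.isBundle.toIsUSCBanachBundle (fun x a b => T.fiberHom x (a ⊗ₜ b))
    (fun x a b c => by rw [TensorProduct.sub_tmul, map_sub])
    (fun x a b c => by rw [TensorProduct.tmul_sub, map_sub])
    (fun x a b => norm_starHom_tmul_le (T.fiberHom x) a b) A.denseSections B.denseSections
    (fun f hf g hg => by
      have := (T.q (T.ι ((⟨f, hf⟩ : A.sections) ⊗ₜ (⟨g, hg⟩ : B.sections)))).2.1
      simp only [T.q_apply] at this
      exact this)
  act_tmul {x y} g t := by
    induction t with
    | zero => simp
    | add s t hs ht => simp only [map_add, hs, ht]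
    | tmul a b => exact T.act_tmul g a b

end BalancedTensor

end Balanced

/-! ### Quotient seminorms -/

section QuotientSeminorm

variable {D : Type*} [NonUnitalCStarAlgebra D]

/-- In the unitization `e = star s * s` satisfies `0 ≤ e ≤ 1`, so `1 - e` is a contraction. -/
theorem norm_sub_mul_le {s : D} (hs : ‖star s * s‖ ≤ 1) (z : D) :
    ‖z - z * (star s * s)‖ ≤ ‖z‖ := by
  let := CStarAlgebra.spectralOrder (Unitization ℂ D)
  have := CStarAlgebra.spectralOrderedRing (Unitization ℂ D)
  let e : Unitization ℂ D := ((star s * s : D) : Unitization ℂ D)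
  have he : e = star (s : Unitization ℂ D) * s := by simp [e]
  have h0 : 0 ≤ e := he ▸ star_mul_self_nonneg _
  have h1 : e ≤ 1 := by
    rw [← CStarAlgebra.norm_le_one_iff_of_nonneg e h0]
    simpa only [e, Unitization.norm_inr] using hs
  have h2 : ‖1 - e‖ ≤ 1 := by
    rw [CStarAlgebra.norm_le_one_iff_of_nonneg (1 - e) (sub_nonneg.2 h1)]
    exact sub_le_self _ h0
  have h3 : ((z - z * (star s * s) : D) : Unitization ℂ D) = z * (1 - e) := by
    simp [e, mul_sub]
  rw [← Unitization.norm_inr (𝕜 := ℂ), h3, ← Unitization.norm_inr (𝕜 := ℂ) (a := z)]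
  exact (norm_mul_le _ _).trans (mul_le_of_le_one_right (norm_nonneg _) h2)

theorem norm_sub_mul_le' {s : D} (hs : ‖star s * s‖ ≤ 1) (z : D) :
    ‖z - (star s * s) * z‖ ≤ ‖z‖ := by
  have := norm_sub_mul_le hs (star z)
  rwa [← norm_star, star_sub, star_mul, star_mul, star_star, star_star, norm_star] at this

theorem le_mul_of_forall_pos {a b c : ℝ} (h : ∀ ε > 0, c ≤ (a + ε) * (b + ε)) : c ≤ a * b := by
  have h1 : Tendsto (fun ε : ℝ => (a + ε) * (b + ε)) (𝓝[>] 0) (𝓝 ((a + 0) * (b + 0))) :=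
    ((Continuous.tendsto (by fun_prop) 0).mono_left nhdsWithin_le_nhds)
  rw [add_zero, add_zero] at h1
  exact ge_of_tendsto h1 (eventually_mem_nhdsWithin.mono h)

/-- The quotient seminorm of a closed ideal is a C⋆-seminorm. -/
theorem exists_quotient_seminorm (J : NonUnitalStarSubalgebra ℂ D) [hJ : IsClosed (J : Set D)]
    (hl : ∀ x, ∀ j ∈ J, x * j ∈ J) (hr : ∀ x, ∀ j ∈ J, j * x ∈ J) :
    ∃ p : Seminorm ℂ D, IsCStarSeminorm p ∧ (∀ d, ∀ j ∈ J, p d ≤ ‖d - j‖) ∧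
      ∀ d, ∀ ε > 0, ∃ j ∈ J, ‖d - j‖ < p d + ε := by
  let S : Submodule ℂ D := J.toNonUnitalSubalgebra.toSubmodule
  let p : Seminorm ℂ D := (normSeminorm ℂ (D ⧸ S)).comp S.mkQ
  have h1 : ∀ d, ∀ j ∈ J, p d ≤ ‖d - j‖ := fun d j hj => by
    have hj0 : S.mkQ j = 0 := (Submodule.Quotient.mk_eq_zero S).2 hj
    have : S.mkQ d = S.mkQ (d - j) := by rw [map_sub, hj0, sub_zero]
    change ‖S.mkQ d‖ ≤ _
    rw [this]
    exact Submodule.Quotient.norm_mk_le S _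
  have h2 : ∀ d, ∀ ε > 0, ∃ j ∈ J, ‖d - j‖ < p d + ε := fun d ε hε => by
    obtain ⟨m, hm, hm'⟩ := Submodule.Quotient.norm_mk_lt (S := S) (S.mkQ d) hε
    refine ⟨d - m, ?_, by rwa [sub_sub_cancel]⟩
    exact (Submodule.Quotient.eq S).1 hm.symm
  refine ⟨p, isCStarSeminorm_of_le_star (fun x y => ?_) (fun x => ?_), h1, h2⟩
  · refine le_mul_of_forall_pos fun ε hε => ?_
    obtain ⟨j, hj, hxj⟩ := h2 x ε hε
    obtain ⟨k, hk, hyk⟩ := h2 y ε hε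
    have := h1 (x * y) (j * y + x * k - j * k)
      (J.sub_mem (J.add_mem (hr _ _ hj) (hl _ _ hk)) (hl _ _ hk))
    have e : x * y - (j * y + x * k - j * k) = (x - j) * (y - k) := by
      simp only [mul_sub, sub_mul]; abel
    rw [e] at this
    exact this.trans ((norm_mul_le _ _).trans
      (mul_le_mul hxj.le hyk.le (norm_nonneg _) (by positivity)))
  · refine le_of_forall_pos_le_add fun ε hε => ?_
    obtain ⟨j, hj, hxj⟩ := h2 (star x * x) (ε / 2) (half_pos hε)
    -- For `e` far out in an approximate unit of `J`, `‖x - x e‖ ^ 2 = ‖(1 - e) x⋆x (1 - e)‖ ≤ ‖x⋆x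
    -- - j‖ + ‖j - j e‖`. The first term nearly realises the quotient seminorm of `x⋆x`, and the
    -- second tends to zero.
    obtain ⟨l, hl', hl''⟩ := exists_approximateUnit J
    have := hl'.neBot
    have hlim : ∀ᶠ e : J in l, ‖j - j * e‖ < ε / 2 := by
      have := hl'.tendsto_mul_left ⟨j, hj⟩
      filter_upwards [Metric.tendsto_nhds.1 this _ (half_pos hε)] with e he
      rw [dist_comm, dist_eq_norm] at he
      exact he
    obtain ⟨e, he1, hen, s, hs⟩ := (hlim.and hl'').exists
    have hes : (e : D) = star (s : D) * s := congrArg Subtype.val hs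
    have hen' : ‖star (s : D) * s‖ ≤ 1 := by
      rw [← hes]
      exact hen
    have hsa : star (e : D) = e := by rw [hes, star_mul, star_star]
    have e1 : star (x - x * e) * (x - x * e) =
        (star x * x - star x * x * e) - e * (star x * x - star x * x * e) := by
      rw [star_sub, star_mul, hsa]
      simp only [mul_sub, sub_mul, mul_assoc]
      abel
    have e2 : star x * x - star x * x * e =
        ((star x * x - j) - (star x * x - j) * e) + (j - j * e) := by
      simp only [sub_mul]; abel
    calc p x ^ 2 ≤ ‖x - x * e‖ ^ 2 := by
          gcongr
          exact h1 x _ (hl _ _ e.2)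
      _ = ‖star (x - x * e) * (x - x * e)‖ := by rw [CStarRing.norm_star_mul_self, sq]
      _ ≤ ‖star x * x - star x * x * e‖ := by
          rw [e1, hes]
          exact norm_sub_mul_le' hen' _
      _ ≤ ‖star x * x - j‖ + ‖j - j * e‖ := by
          rw [e2]
          refine (norm_add_le _ _).trans (add_le_add_left ?_ _)
          rw [hes]
          exact norm_sub_mul_le hen' _
      _ ≤ p (star x * x) + ε := by linarith

/-- The quotient seminorm of the closed ideal generated by a set. -/
theorem exists_seminorm_span {S : Set D} (hk : ∀ (k : ℂ), ∀ s ∈ S, k • s ∈ S)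
    (hs : ∀ s ∈ S, star s ∈ S) :
    ∃ p : Seminorm ℂ D, IsCStarSeminorm p ∧ (∀ d, p d ≤ ‖d‖) ∧
      (∀ d, d ∈ closure (TwoSidedIdeal.span S : Set D) ↔ p d = 0) ∧
      ∀ d, ∀ ε > 0, ∃ j, p j = 0 ∧ ‖d - j‖ < p d + ε := by
  let I := TwoSidedIdeal.span S
  -- `TwoSidedIdeal.span` is an ideal of the ring only; stability under scalars and under the
  -- involution is inherited from the generators.
  have hIk : ∀ (k : ℂ), ∀ x ∈ I, k • x ∈ I := fun k x hx => by
    induction hx using TwoSidedIdeal.span_induction with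
    | mem s h => exact TwoSidedIdeal.subset_span (hk k s h)
    | zero => rw [smul_zero]; exact I.zero_mem
    | add x y _ _ hx hy => rw [smul_add]; exact I.add_mem hx hy
    | neg x _ hx => rw [smul_neg]; exact I.neg_mem hx
    | left_absorb a x _ hx => rw [← mul_smul_comm]; exact I.mul_mem_left _ _ hx
    | right_absorb a x _ hx => rw [← smul_mul_assoc]; exact I.mul_mem_right _ _ hx
  have hIs : ∀ x ∈ I, star x ∈ I := fun x hx => by
    induction hx using TwoSidedIdeal.span_induction with
    | mem s h => exact TwoSidedIdeal.subset_span (hs s h)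
    | zero => rw [star_zero]; exact I.zero_mem
    | add x y _ _ hx hy => rw [star_add]; exact I.add_mem hx hy
    | neg x _ hx => rw [star_neg]; exact I.neg_mem hx
    | left_absorb a x _ hx => rw [star_mul]; exact I.mul_mem_right _ _ hx
    | right_absorb a x _ hx => rw [star_mul]; exact I.mul_mem_left _ _ hx
  have hl : ∀ x : D, ∀ j ∈ closure (I : Set D), x * j ∈ closure (I : Set D) := fun x j hj =>
    map_mem_closure (by fun_prop : Continuous fun j => x * j) hj fun j hj => I.mul_mem_left _ _ hj
  have hr : ∀ x : D, ∀ j ∈ closure (I : Set D), j * x ∈ closure (I : Set D) := fun x j hj =>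
    map_mem_closure (f := fun j => j * x) (by fun_prop) hj fun j hj => I.mul_mem_right _ _ hj
  let J : NonUnitalStarSubalgebra ℂ D :=
    { carrier := closure I
      add_mem' := fun ha hb => map_mem_closure₂ continuous_add ha hb fun a ha b hb => I.add_mem ha hb
      zero_mem' := subset_closure I.zero_mem
      mul_mem' := fun _ hb => hl _ _ hb
      smul_mem' := fun k x hx =>
        map_mem_closure (continuous_const_smul k) hx fun x hx => hIk k x hx
      star_mem' := fun hx => map_mem_closure continuous_star hx fun x hx => hIs x hx }
  have hJ : IsClosed (J : Set D) := isClosed_closure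
  obtain ⟨p, hp, h1, h2⟩ := exists_quotient_seminorm J hl hr
  have h0 : ∀ d, d ∈ J ↔ p d = 0 := fun d => by
    refine ⟨fun hd => le_antisymm ?_ (apply_nonneg _ _), fun hd => ?_⟩
    · simpa using h1 d d hd
    · have : d ∈ closure (J : Set D) := Metric.mem_closure_iff.2 fun ε hε => by
        obtain ⟨j, hj, hdj⟩ := h2 d ε hε
        rw [hd, zero_add] at hdj
        exact ⟨j, hj, by rwa [dist_eq_norm]⟩
      rwa [hJ.closure_eq] at this
  refine ⟨p, hp, fun d => ?_, h0, fun d ε hε => ?_⟩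
  · simpa using h1 d 0 J.zero_mem
  · obtain ⟨j, hj, hdj⟩ := h2 d ε hε
    exact ⟨j, (h0 j).1 hj, hdj⟩

/-- The infimum of a C⋆-seminorm over a commuting family of contractions. -/
theorem IsCStarSeminorm.exists_iInf {R : Type*} [NonUnitalRing R] [Module ℂ R]
    [IsScalarTower ℂ R R] [StarRing R] {s : Seminorm ℂ R} (hs : IsCStarSeminorm s)
    {M : Type*} {F : Set M} (hF : F.Nonempty) (L : M → R →ₗ[ℂ] R)
    (hc : ∀ φ ∈ F, ∀ x, s (L φ x) ≤ s x)
    (hF2 : ∀ φ ∈ F, ∀ ψ ∈ F, ∃ χ ∈ F, (∀ x, L χ x = L φ (L ψ x)) ∧ (∀ x, L χ x = L ψ (L φ x)) ∧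
      ∀ x y, L χ (x * y) = L φ x * L ψ y)
    (hF3 : ∀ φ ∈ F, ∃ χ ∈ F, ∀ x, star (L φ x) * L φ x = L χ (L φ (star x * x))) :
    ∃ p : Seminorm ℂ R, IsCStarSeminorm p ∧ (∀ φ ∈ F, ∀ x, p x ≤ s (L φ x)) ∧
      ∀ x r, p x < r → ∃ φ ∈ F, s (L φ x) < r := by
  have : Nonempty F := hF.to_subtype
  let q : R → ℝ := fun x => ⨅ φ : F, s (L φ x)
  have hb : ∀ x, BddBelow (Set.range fun φ : F => s (L φ x)) := fun x =>
    ⟨0, by rintro _ ⟨φ, rfl⟩; exact apply_nonneg _ _⟩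
  have h1 : ∀ φ ∈ F, ∀ x, q x ≤ s (L φ x) := fun φ hφ x => ciInf_le (hb x) ⟨φ, hφ⟩
  have h2 : ∀ x r, q x < r → ∃ φ ∈ F, s (L φ x) < r := fun x r h => by
    obtain ⟨φ, hφ⟩ := exists_lt_of_ciInf_lt h
    exact ⟨φ, φ.2, hφ⟩
  have h0 : ∀ x, 0 ≤ q x := fun x => le_ciInf fun φ => apply_nonneg _ _
  let p : Seminorm ℂ R := Seminorm.of q
    -- Subadditivity needs one `χ` that is nearly optimal for both `x` and `y`: the composite of a
    -- nearly optimal choice for each serves, since the operators commute and are contractive for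
    -- `s`.
    (fun x y => by
      refine le_of_forall_pos_le_add fun ε hε => ?_
      obtain ⟨φ, hφ, hx⟩ := h2 x (q x + ε / 2) (by linarith)
      obtain ⟨ψ, hψ, hy⟩ := h2 y (q y + ε / 2) (by linarith)
      obtain ⟨χ, hχ, e1, e2, -⟩ := hF2 φ hφ ψ hψ
      have h3 := h1 χ hχ (x + y)
      rw [map_add] at h3
      have h4 := map_add_le_add s (L χ x) (L χ y)
      have h5 := hc ψ hψ (L φ x)
      have h6 := hc φ hφ (L ψ y)
      rw [← e2] at h5
      rw [← e1] at h6
      linarith)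
    (fun k x => by
      simp only [q, map_smul, map_smul_eq_mul]
      exact (Real.mul_iInf_of_nonneg (norm_nonneg k) _).symm)
  refine ⟨p, isCStarSeminorm_of_le_star (fun x y => ?_) (fun x => ?_), h1, h2⟩
  · refine le_mul_of_forall_pos fun ε hε => ?_
    obtain ⟨φ, hφ, hx⟩ := h2 x (p x + ε) (lt_add_of_pos_right _ hε)
    obtain ⟨ψ, hψ, hy⟩ := h2 y (p y + ε) (lt_add_of_pos_right _ hε)
    obtain ⟨χ, hχ, -, -, e⟩ := hF2 φ hφ ψ hψ
    refine (h1 χ hχ (x * y)).trans ?_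
    rw [e]
    exact (hs.1 _ _).trans (mul_le_mul hx.le hy.le (apply_nonneg _ _)
      (add_nonneg (apply_nonneg _ _) hε.le))
  · refine le_ciInf fun φ => ?_
    obtain ⟨χ, hχ, e⟩ := hF3 φ φ.2
    have h3 : p x ^ 2 ≤ s (L φ x) ^ 2 := by
      have := h1 φ φ.2 x
      gcongr
      exact this
    refine h3.trans ?_
    rw [← hs.2, e]
    exact hc χ hχ _

end QuotientSeminorm

/-! ### Fibrewise tensor products are balanced tensor products -/

section IteratedSquare

/-- The power `x ^ 2 ^ n`. -/
def powTwo {R : Type*} [Mul R] (n : ℕ) (x : R) : R := (fun y => y * y)^[n] x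

theorem powTwo_zero {R : Type*} [Mul R] (x : R) : powTwo 0 x = x := rfl

theorem powTwo_succ {R : Type*} [Mul R] (n : ℕ) (x : R) :
    powTwo (n + 1) x = powTwo n x * powTwo n x := Function.iterate_succ_apply' _ _ _

theorem powTwo_apply {X : Type*} [TopologicalSpace X] (n : ℕ) (φ : C₀(X, ℂ)) (x : X) :
    powTwo n φ x = φ x ^ 2 ^ n := by
  induction n with
  | zero => simp [powTwo_zero]
  | succ n ih => rw [powTwo_succ, ZeroAtInftyContinuousMap.mul_apply, ih]; ring

variable {R : Type*} [NonUnitalRing R] [Module ℂ R] [StarRing R] {s : Seminorm ℂ R}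

theorem IsCStarSeminorm.powTwo_le (hs : IsCStarSeminorm s) (n : ℕ) (x : R) :
    s (powTwo n x) ≤ s x ^ 2 ^ n := by
  induction n with
  | zero => simp [powTwo_zero]
  | succ n ih =>
    rw [powTwo_succ, pow_succ, pow_mul, sq]
    exact (hs.1 _ _).trans (mul_le_mul ih ih (apply_nonneg _ _) (by positivity))

theorem IsCStarSeminorm.powTwo_eq (hs : IsCStarSeminorm s) {x : R} (hx : star x = x) (n : ℕ) :
    star (powTwo n x) = powTwo n x ∧ s (powTwo n x) = s x ^ 2 ^ n := by
  induction n with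
  | zero => simp [powTwo_zero, hx]
  | succ n ih =>
    rw [powTwo_succ]
    refine ⟨by rw [star_mul, ih.1], ?_⟩
    have := hs.2 (powTwo n x)
    rw [ih.1, ih.2] at this
    rw [this, ← pow_mul, ← pow_succ]

/-- The constant `N` disappears on taking `2 ^ n`-th roots: if `a / c` exceeded 1, its powers would
be unbounded. -/
theorem le_of_pow_two_le {a c N : ℝ} (hc : 0 < c) (h : ∀ n : ℕ, a ^ 2 ^ n ≤ N * c ^ 2 ^ n) :
    a ≤ c := by
  by_contra hac
  rw [not_le] at hac
  have h1 : 1 < a / c := (one_lt_div hc).2 hac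
  have h2 : Tendsto (fun n : ℕ => (a / c) ^ 2 ^ n) atTop atTop :=
    (tendsto_pow_atTop_atTop_of_one_lt h1).comp (tendsto_pow_atTop_atTop_of_one_lt one_lt_two)
  obtain ⟨n, hn⟩ := (h2.eventually_gt_atTop N).exists
  rw [div_pow, lt_div_iff₀ (by positivity)] at hn
  exact absurd (h n) (not_le.2 hn)

end IteratedSquare

/-! ### Norms and cut-off functions in `C₀(X)` -/

section Functions

variable {X : Type u} [TopologicalSpace X]

theorem norm_le_of_apply_le {φ : C₀(X, ℂ)} {C : ℝ} (hC : 0 ≤ C) (h : ∀ x, ‖φ x‖ ≤ C) : ‖φ‖ ≤ C :=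
  (BoundedContinuousFunction.norm_le hC).2 h

theorem norm_apply_le_norm (φ : C₀(X, ℂ)) (x : X) : ‖φ x‖ ≤ ‖φ‖ :=
  BoundedContinuousFunction.norm_coe_le_norm φ.toBCF x

variable [T2Space X] [LocallyCompactSpace X]

/-- The function equals 1 on a whole neighbourhood of `x`. Being 1 at the point alone would not
allow local estimates to be glued by a subordinate partition of unity. -/
theorem exists_bump_eventually {x : X} {U : Set X} (hU : U ∈ 𝓝 x) :
    ∃ φ : C₀(X, ℂ), (∀ᶠ y in 𝓝 x, φ y = 1) ∧ ‖φ‖ ≤ 1 ∧ ∀ y ∉ U, φ y = 0 := by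
  obtain ⟨K, hK, hKU, hKc⟩ := local_compact_nhds (interior_mem_nhds.2 hU)
  obtain ⟨φ, h1, h0, hc, h⟩ := exists_continuous_one_zero_of_isCompact hKc
    (isOpen_interior (s := U)).isClosed_compl (Set.disjoint_compl_right_iff_subset.2 hKU)
  refine ⟨ofCompactSupport φ hc, ?_, norm_le_of_apply_le zero_le_one fun y => ?_, fun y hy => ?_⟩
  · filter_upwards [hK] with y hy
    simp [h1 hy]
  · rw [ofCompactSupport_apply, Complex.norm_real, Real.norm_of_nonneg (h y).1]
    exact (h y).2
  · have : y ∈ (interior U)ᶜ := fun hy' => hy (interior_subset hy')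
    simp [h0 this]

theorem exists_cutoff {K : Set X} (hK : IsCompact K) : ∃ (χ : C₀(X, ℂ)) (K' : Set X),
    (∀ y ∈ K, χ y = 1) ∧ ‖χ‖ ≤ 1 ∧ IsCompact K' ∧ ∀ y ∉ K', χ y = 0 := by
  obtain ⟨φ, h1, -, hc, h⟩ := exists_continuous_one_zero_of_isCompact hK isClosed_empty
    (Set.disjoint_empty _)
  refine ⟨ofCompactSupport φ hc, tsupport φ, fun y hy => by simp [h1 hy],
    norm_le_of_apply_le zero_le_one fun y => ?_, hc, fun y hy => ?_⟩
  · rw [ofCompactSupport_apply, Complex.norm_real, Real.norm_of_nonneg (h y).1]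
    exact (h y).2
  · simp [image_eq_zero_of_notMem_tsupport hy]

end Functions

/-! ### Balanced C⋆-seminorms on the tensor product of two section algebras -/

section FunctionAction

variable {X : Type u} [TopologicalSpace X] [T2Space X] [LocallyCompactSpace X]
  [SecondCountableTopology X] {A B C : CStarBundle.{u, w} X}

variable (A B) in
/-- The action of `C₀(X)` on the first factor of the tensor product of two section algebras. -/
def functionAction : C₀(X, ℂ) →ₗ[ℂ] A.sections ⊗[ℂ] B.sections →ₗ[ℂ] A.sections ⊗[ℂ] B.sections :=
  (LinearMap.rTensorHom B.sections).comp A.smulHom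

@[simp]
theorem functionAction_tmul (φ : C₀(X, ℂ)) (a : A.sections) (b : B.sections) :
    functionAction A B φ (a ⊗ₜ b) = (φ • a) ⊗ₜ b := rfl

theorem functionAction_mul (φ ψ : C₀(X, ℂ)) (t : A.sections ⊗[ℂ] B.sections) :
    functionAction A B (φ * ψ) t = functionAction A B φ (functionAction A B ψ t) := by
  induction t with
  | zero => simp
  | add s t hs ht => simp only [map_add, hs, ht]
  | tmul a b =>
    have : (φ * ψ) • a = φ • ψ • a := by ext x; exact mul_smul _ _ _
    simp [this]

theorem functionAction_mul_mul (φ ψ : C₀(X, ℂ)) (s t : A.sections ⊗[ℂ] B.sections) :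
    functionAction A B (φ * ψ) (s * t) = functionAction A B φ s * functionAction A B ψ t := by
  induction s with
  | zero => simp
  | add s s' hs hs' => simp only [map_add, add_mul, hs, hs']
  | tmul a b =>
    induction t with
    | zero => simp
    | add t t' ht ht' => simp only [map_add, mul_add, ht, ht']
    | tmul a' b' =>
      have : (φ * ψ) • (a * a') = (φ • a) * (ψ • a') := by
        ext x
        exact (smul_mul_smul_comm (φ x) (a.1 x) (ψ x) (a'.1 x)).symm
      simp [this]

theorem functionAction_star (φ : C₀(X, ℂ)) (t : A.sections ⊗[ℂ] B.sections) :
    star (functionAction A B φ t) = functionAction A B (star φ) (star t) := by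
  induction t with
  | zero => simp
  | add s t hs ht => simp only [map_add, star_add, hs, ht]
  | tmul a b =>
    have : star (φ • a) = star φ • star a := by ext x; exact star_smul (φ x) (a.1 x)
    simp [this]

theorem functionAction_powTwo (n : ℕ) (φ : C₀(X, ℂ)) (t : A.sections ⊗[ℂ] B.sections) :
    powTwo n (functionAction A B φ t) = functionAction A B (powTwo n φ) (powTwo n t) := by
  induction n with
  | zero => rfl
  | succ n ih => rw [powTwo_succ, powTwo_succ, powTwo_succ, functionAction_mul_mul, ih]

/-- The C⋆-algebra `C₀(X)` acts on the first factor by adjointable operators, the adjoint of `φ`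
being `star φ`, so it acts contractively. -/
theorem IsCStarSeminorm.functionAction_le {s : Seminorm ℂ (A.sections ⊗[ℂ] B.sections)}
    (hs : IsCStarSeminorm s) (φ : C₀(X, ℂ)) (t : A.sections ⊗[ℂ] B.sections) :
    s (functionAction A B φ t) ≤ ‖φ‖ * s t := by
  obtain ⟨D, _, N, h, hN⟩ := hs.exists_form
  refine h.action_le (functionAction A B) functionAction_mul (fun φ x y => hN _ _ _ _ ?_) φ t
  refine rTensor_star (T := A.smulHom φ) (T' := A.smulHom (star φ)) (fun a b => ?_) x y
  ext x
  change star (φ x • a.1 x) * b.1 x = star (a.1 x) * (star (φ x) • b.1 x)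
  rw [star_smul, smul_mul_assoc, mul_smul_comm]

theorem functionAction_congr {φ ψ : C₀(X, ℂ)} (h : ∀ x, φ x = ψ x)
    (t : A.sections ⊗[ℂ] B.sections) : functionAction A B φ t = functionAction A B ψ t := by
  rw [show φ = ψ from DFunLike.ext _ _ h]

theorem BundleTensor.sectionHom_functionAction (F : BundleTensor A B C) (φ : C₀(X, ℂ))
    (t : A.sections ⊗[ℂ] B.sections) :
    F.sectionHom (functionAction A B φ t) = φ • F.sectionHom t := by
  induction t with
  | zero => simpa using (map_zero (C.smulHom φ)).symm
  | add s t hs ht =>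
    simp only [map_add, hs, ht]
    exact (map_add (C.smulHom φ) _ _).symm
  | tmul a b =>
    ext x
    change F.ι x ((φ x • a.1 x) ⊗ₜ b.1 x) = φ x • F.ι x (a.1 x ⊗ₜ b.1 x)
    rw [← TensorProduct.smul_tmul', map_smul]

variable {s : Seminorm ℂ (A.sections ⊗[ℂ] B.sections)}

/-- The local estimate for balanced C⋆-seminorms. -/
theorem BundleTensor.exists_local_le (F : BundleTensor A B C) (hs : IsCStarSeminorm s)
    (hb : ∀ (φ : C₀(X, ℂ)) a b, s ((φ • a) ⊗ₜ b - a ⊗ₜ (φ • b)) = 0)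
    (t : A.sections ⊗[ℂ] B.sections) (x : X) {r : ℝ} (hr : ‖(F.sectionHom t).1 x‖ < r) :
    ∃ φ : C₀(X, ℂ), (∀ᶠ y in 𝓝 x, φ y = 1) ∧ s (functionAction A B φ t) < r := by
  let S : Set C₀(X, ℂ) := {φ | (∀ᶠ y in 𝓝 x, φ y = 1) ∧ ‖φ‖ ≤ 1}
  have hS : S.Nonempty := by
    obtain ⟨φ, h1, h2, -⟩ := exists_bump_eventually (x := x) univ_mem
    exact ⟨φ, h1, h2⟩
  have hSm : ∀ φ ∈ S, ∀ ψ ∈ S, φ * ψ ∈ S := fun φ hφ ψ hψ => by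
    refine ⟨?_, (norm_mul_le _ _).trans (mul_le_one₀ hφ.2 (norm_nonneg _) hψ.2)⟩
    filter_upwards [hφ.1, hψ.1] with y h1 h2
    rw [ZeroAtInftyContinuousMap.mul_apply, h1, h2, one_mul]
  have hSs : ∀ φ ∈ S, star φ ∈ S := fun φ hφ => by
    refine ⟨?_, (norm_star φ).le.trans hφ.2⟩
    filter_upwards [hφ.1] with y h1
    rw [ZeroAtInftyContinuousMap.star_apply, h1, star_one]
  -- The infimum of `s (φ t)` over contractions `φ` equal to 1 near `x` is a C⋆-seminorm: it is the
  -- localisation of `s` at `x`.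
  obtain ⟨p, hp, h1, h2⟩ := hs.exists_iInf hS (functionAction A B)
    (fun φ hφ t => (hs.functionAction_le φ t).trans
      (mul_le_of_le_one_left (apply_nonneg _ _) hφ.2))
    (fun φ hφ ψ hψ => ⟨φ * ψ, hSm φ hφ ψ hψ, functionAction_mul φ ψ, fun t => by
      rw [mul_comm, functionAction_mul], functionAction_mul_mul φ ψ⟩)
    (fun φ hφ => ⟨star φ, hSs φ hφ, fun t => by
      rw [functionAction_star, ← functionAction_mul_mul, functionAction_mul]⟩)
  have hbump : ∀ {Z : CStarBundle.{u, w} X} (c : Z.sections), c.1 x = 0 → ∀ ε > 0,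
      ∃ φ ∈ S, ‖φ • c‖ ≤ ε := fun {Z} c hc ε hε => by
    obtain ⟨φ, h1, h2, h3⟩ := exists_bump_eventually (Z.isBundle.eventually_norm_lt (r := ε)
      (c.2.1.tendsto x) (by rwa [hc, norm_zero]))
    refine ⟨φ, ⟨h1, h2⟩, CStarBundle.norm_le_of_forall hε.le fun y => ?_⟩
    rw [CStarBundle.smul_apply, norm_smul]
    by_cases hy : ‖c.1 y‖ < ε
    · exact (mul_le_of_le_one_left (norm_nonneg _) ((norm_apply_le_norm φ y).trans h2)).trans hy.le
    · rw [h3 y hy, norm_zero, zero_mul]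
      exact hε.le
  have hz : ∀ {k K : ℝ}, 0 ≤ K → (∀ ε > 0, k ≤ ε * K) → k ≤ 0 := fun {k K} hK h => by
    refine le_of_forall_pos_le_add fun ε hε => ?_
    have := h (ε / (K + 1)) (by positivity)
    rw [zero_add]
    refine this.trans ?_
    rw [div_mul_eq_mul_div, div_le_iff₀ (by positivity)]
    nlinarith
  obtain ⟨p', hp', hpp⟩ := hp.exists_descend (A.evalHom_surjective x) (B.evalHom_surjective x)
    (fun a b ha => le_antisymm (hz (norm_nonneg b) fun ε hε => by
      obtain ⟨φ, hφ, hn⟩ := hbump a ha ε hε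
      refine (h1 φ hφ _).trans ((hs.tmul_le_norm _ _).trans ?_)
      exact mul_le_mul_of_nonneg_right hn (norm_nonneg _)) (apply_nonneg _ _))
    -- The relations are used here: the functions act on the first factor, and `(φ • a) ⊗ b` may be
    -- replaced by `a ⊗ (φ • b)`, which is small when `b` vanishes at `x`. Hence the localisation
    -- descends to the fibres at `x`.
    (fun a b hb' => le_antisymm (hz (norm_nonneg a) fun ε hε => by
      obtain ⟨φ, hφ, hn⟩ := hbump b hb' ε hε
      refine (h1 φ hφ _).trans ?_
      have h3 := map_add_le_add s ((φ • a) ⊗ₜ b - a ⊗ₜ (φ • b)) (a ⊗ₜ (φ • b))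
      rw [hb, sub_add_cancel, zero_add] at h3
      refine h3.trans ((hs.tmul_le_norm _ _).trans ?_)
      rw [mul_comm]
      exact mul_le_mul_of_nonneg_right hn (norm_nonneg _)) (apply_nonneg _ _))
  have h3 : p t < r := by
    rw [← hpp]
    refine ((F.isEnveloping x).le hp' _).trans_lt ?_
    rwa [← F.sectionHom_apply]
  obtain ⟨φ, hφ, h4⟩ := h2 t r h3
  exact ⟨φ, hφ.1, h4⟩

theorem IsCStarSeminorm.exists_compact_cutoff (hs : IsCStarSeminorm s)
    (t : A.sections ⊗[ℂ] B.sections) {ε : ℝ} (hε : 0 < ε) : ∃ K : Set X, IsCompact K ∧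
      ∀ χ : C₀(X, ℂ), (∀ y ∈ K, χ y = 1) → ‖χ‖ ≤ 1 → s (t - functionAction A B χ t) ≤ ε := by
  induction t generalizing ε with
  | zero => exact ⟨∅, isCompact_empty, fun χ _ _ => by simpa using hε.le⟩
  | add t t' ht ht' =>
    obtain ⟨K, hK, h⟩ := ht (half_pos hε)
    obtain ⟨K', hK', h'⟩ := ht' (half_pos hε)
    refine ⟨K ∪ K', hK.union hK', fun χ h1 h2 => ?_⟩
    rw [map_add, add_sub_add_comm]
    have e1 := h χ (fun y hy => h1 y (Or.inl hy)) h2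
    have e2 := h' χ (fun y hy => h1 y (Or.inr hy)) h2
    exact (map_add_le_add s _ _).trans (by linarith)
  | tmul a b =>
    let δ := ε / (2 * (‖b‖ + 1))
    have hδ : 0 < δ := by positivity
    obtain ⟨K, hK, hKf⟩ := mem_cocompact.1 (a.2.2 (Iio_mem_nhds hδ))
    refine ⟨K, hK, fun χ h1 h2 => ?_⟩
    rw [functionAction_tmul, ← TensorProduct.sub_tmul]
    have h3 : ‖a - χ • a‖ ≤ 2 * δ := by
      refine CStarBundle.norm_le_of_forall (by positivity) fun y => ?_
      have e : (a - χ • a).1 y = (1 - χ y) • a.1 y := by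
        rw [sub_smul, one_smul]; rfl
      rw [e, norm_smul]
      by_cases hy : y ∈ K
      · rw [h1 y hy, sub_self, norm_zero, zero_mul]
        positivity
      · have h4 : ‖a.1 y‖ < δ := hKf hy
        have h5 : ‖1 - χ y‖ ≤ 2 := by
          refine (norm_sub_le _ _).trans ?_
          have := (norm_apply_le_norm χ y).trans h2
          rw [norm_one]
          linarith
        exact mul_le_mul h5 h4.le (norm_nonneg _) zero_le_two
    refine (hs.tmul_le_norm _ _).trans ((mul_le_mul_of_nonneg_right h3 (norm_nonneg _)).trans ?_)
    have e : 2 * δ * ‖b‖ = ε * (‖b‖ / (‖b‖ + 1)) := by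
      simp only [δ]; field_simp
    rw [e]
    refine mul_le_of_le_one_right hε.le ?_
    rw [div_le_one (by positivity)]
    linarith

/-- A balanced C⋆-seminorm on the tensor product of the section algebras is dominated by the
supremum of the fibre norms. -/
theorem BundleTensor.balanced_le (F : BundleTensor A B C) (hs : IsCStarSeminorm s)
    (hb : ∀ (φ : C₀(X, ℂ)) a b, s ((φ • a) ⊗ₜ b - a ⊗ₜ (φ • b)) = 0)
    (t : A.sections ⊗[ℂ] B.sections) : s t ≤ ‖F.sectionHom t‖ := by
  refine le_of_forall_gt fun M hM => ?_
  obtain ⟨M', hM', hM'M⟩ := exists_between hM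
  have hM0 : 0 < M' := (norm_nonneg _).trans_lt hM'
  suffices H : ∀ ε > 0, s t ≤ M' + ε from (le_of_forall_pos_le_add H).trans_lt hM'M
  intro ε hε
  obtain ⟨K, hK, hcut⟩ := hs.exists_compact_cutoff t hε
  obtain ⟨χ, K', hχ1, hχ, hK', hχ0⟩ := exists_cutoff hK
  have hst := map_add_le_add s (functionAction A B χ t) (t - functionAction A B χ t)
  rw [add_sub_cancel] at hst
  refine hst.trans (add_le_add ?_ (hcut χ hχ1 hχ))
  -- Passing to `t⋆t` makes the element self-adjoint, so that the seminorm of its `2 ^ n`-th power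
  -- is exactly the `2 ^ n`-th power of its seminorm.
  let t₁ := star t * t
  let ψ := star χ * χ
  have hh : star (functionAction A B χ t) * functionAction A B χ t = functionAction A B ψ t₁ := by
    rw [functionAction_star, ← functionAction_mul_mul]
  have hψ0 : ∀ y ∉ K', ψ y = 0 := fun y hy => by
    simp only [ψ, ZeroAtInftyContinuousMap.mul_apply, hχ0 y hy, mul_zero]
  have hψ1 : ‖ψ‖ ≤ 1 := (norm_mul_le _ _).trans
    (mul_le_one₀ ((norm_star χ).le.trans hχ) (norm_nonneg _) hχ)
  have hloc : ∀ x, ∃ φ : C₀(X, ℂ), (∀ᶠ y in 𝓝 x, φ y = 1) ∧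
      s (functionAction A B φ t₁) < M' ^ 2 := fun x => by
    refine F.exists_local_le hs hb t₁ x ?_
    have e : (F.sectionHom t₁).1 x = star ((F.sectionHom t).1 x) * (F.sectionHom t).1 x := by
      rw [map_mul, map_star]; rfl
    rw [e, CStarRing.norm_star_mul_self, ← sq]
    have := (C.norm_apply_le (F.sectionHom t) x).trans_lt hM'
    gcongr
  choose φ hφ1 hφs using hloc
  have hV : ∀ x, ∃ V : Set X, (∀ y ∈ V, φ x y = 1) ∧ IsOpen V ∧ x ∈ V := fun x =>
    eventually_nhds_iff.1 (hφ1 x)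
  choose V hVφ hVo hxV using hV
  obtain ⟨I, ρ, r, hρr, hr0, -, hrV, hr1, hrK⟩ := exists_finite_partition hK' hVo hxV
  have hρ1 : ∀ i, ‖ρ i‖ ≤ 1 := fun i => norm_le_of_apply_le zero_le_one fun y => by
    rw [hρr, Complex.norm_real, Real.norm_of_nonneg (hr0 i y)]
    exact (Finset.single_le_sum (fun j _ => hr0 j y) (Finset.mem_univ i)).trans (hr1 y)
  have key : s (functionAction A B ψ t₁) ≤ M' ^ 2 := by
    -- A direct partition of unity argument would cost a factor equal to the number of pieces.
    -- Applied to `2 ^ n`-th powers, the factor stays the same for all `n`, and `le_of_pow_two_le`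
    -- removes it.
    refine le_of_pow_two_le (N := Fintype.card I) (by positivity) fun n => ?_
    have hsa : star (functionAction A B ψ t₁) = functionAction A B ψ t₁ := by
      rw [← hh, star_mul, star_star]
    rw [← (hs.powTwo_eq hsa n).2, functionAction_powTwo]
    have e1 : powTwo n ψ = ∑ i, ρ i * powTwo n ψ := by
      refine DFunLike.ext _ _ fun y => ?_
      rw [← Finset.sum_mul, ZeroAtInftyContinuousMap.mul_apply]
      have e : (∑ i, ρ i : C₀(X, ℂ)) y = ∑ i, ρ i y :=
        map_sum (⟨⟨fun φ => φ y, rfl⟩, fun _ _ => rfl⟩ : C₀(X, ℂ) →+ ℂ) ρ _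
      rw [e]
      simp only [hρr]
      by_cases hy : y ∈ K'
      · rw [← Complex.ofReal_sum, hrK y hy, Complex.ofReal_one, one_mul]
      · rw [powTwo_apply, hψ0 y hy, zero_pow (by positivity), mul_zero]
    -- On the support of `ρ i` the function `φ i` is 1, so it may be inserted with any exponent;
    -- this brings the local bound at the point `i` to the power `2 ^ n`.
    have e2 : ∀ i : I, functionAction A B (ρ i * powTwo n ψ) (powTwo n t₁) =
        functionAction A B (ρ i * powTwo n ψ) (powTwo n (functionAction A B (φ i) t₁)) := by
      intro i
      rw [functionAction_powTwo, ← functionAction_mul]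
      refine functionAction_congr (fun y => ?_) _
      simp only [ZeroAtInftyContinuousMap.mul_apply, powTwo_apply]
      by_cases hy : y ∈ V i
      · rw [hVφ i y hy, one_pow, mul_one]
      · have : r i y = 0 := image_eq_zero_of_notMem_tsupport fun h => hy (hrV i h)
        rw [hρr, this]
        simp
    rw [e1, map_sum, LinearMap.sum_apply]
    refine (Finset.le_sum_of_subadditive s (map_zero s).le (map_add_le_add s) _ _).trans ?_
    rw [← nsmul_eq_mul, ← Finset.card_univ]
    refine Finset.sum_le_card_nsmul _ _ _ fun i _ => ?_
    rw [e2]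
    refine (hs.functionAction_le _ _).trans ?_
    have hpow : ∀ n, ‖powTwo n ψ‖ ≤ 1 := fun n => by
      induction n with
      | zero => exact hψ1
      | succ n ih =>
        rw [powTwo_succ]
        exact (norm_mul_le _ _).trans (mul_le_one₀ ih (norm_nonneg _) ih)
    have h1 : ‖ρ i * powTwo n ψ‖ ≤ 1 :=
      (norm_mul_le _ _).trans (mul_le_one₀ (hρ1 i) (norm_nonneg _) (hpow n))
    refine (mul_le_of_le_one_left (apply_nonneg _ _) h1).trans ((hs.powTwo_le n _).trans ?_)
    exact pow_le_pow_left₀ (apply_nonneg _ _) (hφs i).le _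
  rw [← hh, hs.2] at key
  exact le_of_sq_le_sq key hM0.le

end FunctionAction

/-! ### The section algebra as the quotient of the maximal tensor product by the balancing ideal -/

section FiberToBalanced

variable {X : Type u} [Groupoid.{v} X] [TopologicalSpace X] [TopologicalSpace (Quiver.Total X)]
  [T2Space X] [LocallyCompactSpace X] [SecondCountableTopology X] {A B C : DynSystem.{u, v, w} X}

/-- A contraction which is a quotient map on a dense subspace is surjective. -/
theorem surjective_of_denseRange {D C : Type*} [NonUnitalCStarAlgebra D] [NonUnitalCStarAlgebra C]
    (q : D →⋆ₙₐ[ℂ] C) (hq : DenseRange q)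
    (h : ∀ d, ∀ ε > 0, ∃ d', q d' = q d ∧ ‖d'‖ < ‖q d‖ + ε) : Function.Surjective q := by
  let f : NormedAddGroupHom D C :=
    { toFun := q
      map_add' := map_add q
      bound' := ⟨1, fun d => by simpa using NonUnitalStarAlgHom.norm_apply_le q d⟩ }
  -- Taking `ε = ‖c‖` yields preimages of norm at most `2 * ‖c‖` over the dense range. Such uniform
  -- control extends to its closure, which is everything.
  have hf : f.SurjectiveOnWith f.range 2 := by
    rintro c ⟨d, hd⟩
    have hd : q d = c := hd
    by_cases hc : c = 0
    · exact ⟨0, by simp [hc]⟩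
    · obtain ⟨d', h1, h2⟩ := h d ‖c‖ (norm_pos_iff.2 hc)
      refine ⟨d', h1.trans hd, ?_⟩
      rw [hd] at h2
      linarith
  intro c
  obtain ⟨d, hd, -⟩ := controlled_closure_of_complete two_pos one_pos hf c (hq c)
  exact ⟨d, hd⟩

/-- Fibrewise maximal tensor products are balanced tensor products. -/
theorem FiberTensor.isBalancedTensor (F : FiberTensor A B C) : IsBalancedTensor A B C := by
  obtain ⟨D, _, ι, hι⟩ := exists_maxTensor A.sections B.sections
  obtain ⟨q, hq⟩ := hι.exists_lift F.sectionHom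
  let S : Set D := {d : D | ∃ (φ : C₀(X, ℂ)) (a : A.sections) (b : B.sections),
      d = ι ((φ • a) ⊗ₜ[ℂ] b - a ⊗ₜ[ℂ] (φ • b))}
  obtain ⟨p, hp, hp1, hpS, hpq⟩ := exists_seminorm_span (S := S)
    (by
      rintro k _ ⟨φ, a, b, rfl⟩
      refine ⟨φ, k • a, b, ?_⟩
      have : φ • k • a = k • φ • a := map_smul (A.smulHom φ) k a
      rw [this, ← map_smul, smul_sub, TensorProduct.smul_tmul', TensorProduct.smul_tmul'])
    (by
      rintro _ ⟨φ, a, b, rfl⟩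
      refine ⟨star φ, star a, star b, ?_⟩
      have h1 : star (φ • a) = star φ • star a := by ext x; exact star_smul (φ x) (a.1 x)
      have h2 : star (φ • b) = star φ • star b := by ext x; exact star_smul (φ x) (b.1 x)
      rw [← map_star, star_sub, TensorProduct.star_tmul, TensorProduct.star_tmul, h1, h2])
  -- The quotient seminorm `p`, pulled back to the algebraic tensor product, is a C⋆-seminorm
  -- annihilating the balancing relations, so `balanced_le` applies; density and continuity extend
  -- the bound to `D`.
  have hle : ∀ d, p d ≤ ‖q d‖ := by
    have hcp : Continuous p := Seminorm.continuous_of_le (q := normSeminorm ℂ D) continuous_norm hp1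
    intro d
    refine hι.1.induction_on (p := fun d => p d ≤ ‖q d‖) d
      (isClosed_le hcp (continuous_starHom q).norm) fun t => ?_
    rw [hq]
    exact F.balanced_le (hp.comp ι) (fun φ a b =>
      (hpS _).1 (subset_closure (TwoSidedIdeal.subset_span ⟨φ, a, b, rfl⟩))) t
  have hker : ∀ d, q d = 0 ↔ p d = 0 := by
    refine fun d => ⟨fun hd => le_antisymm ?_ (apply_nonneg _ _), fun hd => ?_⟩
    · simpa [hd] using hle d
    · rw [← hpS] at hd
      have h1 : closure (TwoSidedIdeal.span S : Set D) ⊆ {d | q d = 0} := by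
        refine closure_minimal ?_ (isClosed_eq (continuous_starHom q) continuous_const)
        have : TwoSidedIdeal.span S ≤ TwoSidedIdeal.ker q := by
          refine TwoSidedIdeal.span_le.2 ?_
          rintro _ ⟨φ, a, b, rfl⟩
          refine (TwoSidedIdeal.mem_ker q).2 ?_
          rw [hq, map_sub, sub_eq_zero]
          ext x
          change F.ι x ((φ x • a.1 x) ⊗ₜ b.1 x) = F.ι x (a.1 x ⊗ₜ (φ x • b.1 x))
          rw [← TensorProduct.smul_tmul', TensorProduct.tmul_smul]
        exact fun d hd => (TwoSidedIdeal.mem_ker q).1 (this hd)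
      exact h1 hd
  refine ⟨
    { D := D
      ι := ι
      isMax := hι
      q := q
      q_surjective := surjective_of_denseRange q ?_ fun d ε hε => ?_
      q_ker := fun d => (hker d).trans (hpS d).symm
      q_smul := fun φ a b => ?_
      τ := fun x => (TensorProduct.mk ℂ _ _).compr₂ (F.ι x : A.Fiber x ⊗[ℂ] B.Fiber x →ₗ[ℂ] C.Fiber x)
      q_apply := fun a b x => by rw [hq]; rfl
      act_tmul := fun g a b => F.act_tmul g (a ⊗ₜ b) }⟩
  · refine F.denseRange_sectionHom.mono ?_
    rintro _ ⟨t, rfl⟩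
    exact ⟨ι t, hq t⟩
  -- Subtracting a suitable `j` in the closed ideal does not change the image and lowers the norm to
  -- nearly `p d ≤ ‖q d‖`, as `surjective_of_denseRange` requires.
  · obtain ⟨j, hj, hdj⟩ := hpq d ε hε
    refine ⟨d - j, ?_, hdj.trans_le ?_⟩
    · rw [map_sub, (hker j).2 hj, sub_zero]
    · have := hle d
      linarith
  · rw [hq, hq]
    exact F.sectionHom_functionAction φ (a ⊗ₜ b)

theorem exists_isBalancedTensor (A B : DynSystem.{u, v, w} X) :
    ∃ C : DynSystem.{u, v, w} X, IsBalancedTensor A B C := by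
  obtain ⟨C, ⟨F⟩⟩ := FiberTensor.exists_fiberTensor A B
  exact ⟨C, F.isBalancedTensor⟩

end FiberToBalanced

/-! ### Positive elements -/

section Positive

variable {A : Type*} [NonUnitalCStarAlgebra A]

/-- Positivity is expressed as `a = star b * b`, so no order has to be carried by the algebras; the
spectral order is introduced only inside proofs. This is additivity of the positive cone. -/
theorem exists_star_mul_self_sum {ι : Type*} (s : Finset ι) (f : ι → A)
    (h : ∀ i ∈ s, ∃ b, f i = star b * b) : ∃ b, ∑ i ∈ s, f i = star b * b := by
  let := CStarAlgebra.spectralOrder A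
  have := CStarAlgebra.spectralOrderedRing A
  exact CStarAlgebra.nonneg_iff_eq_star_mul_self.1
    (Finset.sum_nonneg fun i hi => CStarAlgebra.nonneg_iff_eq_star_mul_self.2 (h i hi))

theorem exists_star_mul_self_of_approx {a : A}
    (h : ∀ ε : ℝ, 0 < ε → ∃ b, ‖a - star b * b‖ ≤ ε) : ∃ b, a = star b * b := by
  let := CStarAlgebra.spectralOrder A
  have := CStarAlgebra.spectralOrderedRing A
  refine CStarAlgebra.nonneg_iff_eq_star_mul_self.1 ?_
  have hc : IsClosed {x : A | 0 ≤ x} := CStarAlgebra.isClosed_nonneg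
  refine hc.closure_subset (Metric.mem_closure_iff.2 fun ε hε => ?_)
  obtain ⟨b, hb⟩ := h (ε / 2) (by positivity)
  exact ⟨star b * b, star_mul_self_nonneg b, by rw [dist_eq_norm]; linarith⟩

theorem norm_le_of_sum_star_mul_self {ι : Type*} (s : Finset ι) (f : ι → A)
    (h : ∀ i ∈ s, ∃ b, f i = star b * b) {i : ι} (hi : i ∈ s) : ‖f i‖ ≤ ‖∑ i ∈ s, f i‖ := by
  let := CStarAlgebra.spectralOrder A
  have := CStarAlgebra.spectralOrderedRing A
  have hn : ∀ i ∈ s, 0 ≤ f i := fun i hi => CStarAlgebra.nonneg_iff_eq_star_mul_self.2 (h i hi)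
  exact CStarAlgebra.norm_le_norm_of_nonneg_of_le (hn i hi) (Finset.single_le_sum hn hi)

/-- The Cauchy-Schwarz inequality for positive `2 × 2`-matrices. -/
theorem norm_sq_le_of_forall {x c y : A} (hx : ∃ b, x = star b * b)
    (h : ∀ t : ℝ, ∃ b, (t : ℂ) ^ 2 • (star c * x * c) - (2 * t : ℂ) • (star c * c) + y = star b * b) :
    ‖c‖ ^ 2 ≤ ‖x‖ * ‖y‖ := by
  let := CStarAlgebra.spectralOrder A
  have := CStarAlgebra.spectralOrderedRing A
  have hx0 : 0 ≤ x := CStarAlgebra.nonneg_iff_eq_star_mul_self.2 hx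
  refine le_of_forall_pos_le_add fun ε hε => ?_
  have hy : 0 ≤ ‖y‖ := norm_nonneg y
  obtain ⟨δ, hδ, hδε⟩ : ∃ δ : ℝ, 0 < δ ∧ δ * ‖y‖ ≤ ε :=
    ⟨ε / (‖y‖ + 1), by positivity, by
      rw [div_mul_eq_mul_div, div_le_iff₀ (by positivity)]; nlinarith⟩
  -- The optimal parameter would be `t = 1 / ‖x‖`; adding `δ` covers `x = 0`. Since `c⋆xc ≤ k c⋆c`,
  -- positivity at `t = 1 / k` gives `c⋆c / k ≤ y`.
  let k := ‖x‖ + δ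
  have hk : 0 < k := by positivity
  obtain ⟨b, hb⟩ := h k⁻¹
  have h1 : 0 ≤ ((k⁻¹ : ℝ) : ℂ) ^ 2 • (star c * x * c) - (2 * (k⁻¹ : ℝ) : ℂ) • (star c * c) + y := by
    rw [hb]; exact star_mul_self_nonneg b
  have e1 : ((k⁻¹ : ℝ) : ℂ) ^ 2 • (star c * x * c) = (k⁻¹ ^ 2) • (star c * x * c) := by
    rw [← Complex.ofReal_pow]; exact Complex.coe_smul _ _
  have e2 : (2 * (k⁻¹ : ℝ) : ℂ) • (star c * c) = (2 * k⁻¹) • (star c * c) := by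
    rw [← Complex.coe_smul]; push_cast; rfl
  rw [e1, e2] at h1
  have h2 : star c * x * c ≤ k • (star c * c) := by
    have h3 := CStarAlgebra.star_left_conjugate_le_norm_smul (a := c) (b := x)
      (IsSelfAdjoint.of_nonneg hx0)
    refine h3.trans ?_
    have := star_mul_self_nonneg c
    exact smul_le_smul_of_nonneg_right (by simp only [k]; linarith) this
  have h3 : k⁻¹ ^ 2 • (star c * x * c) ≤ k⁻¹ • (star c * c) := by
    have := smul_le_smul_of_nonneg_left h2 (sq_nonneg k⁻¹)
    rwa [smul_smul, show k⁻¹ ^ 2 * k = k⁻¹ by field_simp] at this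
  have h4 : k⁻¹ • (star c * c) ≤ y := by
    have h5 : (2 * k⁻¹) • (star c * c) = k⁻¹ • (star c * c) + k⁻¹ • (star c * c) := by
      rw [← add_smul]; ring_nf
    rw [h5] at h1
    rw [← sub_nonneg]
    refine h1.trans ?_
    rw [← sub_nonneg] at h3 ⊢
    convert h3 using 1
    abel
  have h6 := CStarAlgebra.norm_le_norm_of_nonneg_of_le
    (smul_nonneg (inv_nonneg.2 hk.le) (star_mul_self_nonneg c)) h4
  rw [norm_smul, CStarRing.norm_star_mul_self, Real.norm_of_nonneg (inv_nonneg.2 hk.le),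
    inv_mul_le_iff₀ hk] at h6
  calc ‖c‖ ^ 2 = ‖c‖ * ‖c‖ := sq _
    _ ≤ (‖x‖ + δ) * ‖y‖ := h6
    _ ≤ ‖x‖ * ‖y‖ + ε := by linarith

/-- Positive elements are approximately fixed by the hereditary approximate unit they generate. -/
theorem exists_approx_unit_factor {h : A} (hh : ∃ b, h = star b * b) {δ : ℝ} (hδ : 0 < δ) :
    ∃ g : A, IsSelfAdjoint g ∧
      ‖h - g * h * g * h - h * (g * h * g) + g * h * g * h * (g * h * g)‖ ≤ δ := by
  let := CStarAlgebra.spectralOrder A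
  have := CStarAlgebra.spectralOrderedRing A
  have h0 : 0 ≤ h := CStarAlgebra.nonneg_iff_eq_star_mul_self.2 hh
  have hsa : IsSelfAdjoint h := IsSelfAdjoint.of_nonneg h0
  -- With `g = G(h)` the element `g h g` is the function `(t / (t + δ))²` of `h`, so the expression
  -- to be bounded is `t (1 - (t / (t + δ))²)²`. This is at most `δ` because `4 t δ ≤ (t + δ)²`. The
  -- absolute value makes `G` continuous on all of `ℝ`.
  let G : ℝ → ℝ := fun t => √t / (|t| + δ)
  have hG : Continuous G := by
    refine Continuous.div (by fun_prop) (by fun_prop) fun t => by positivity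
  have hG0 : G 0 = 0 := by simp [G]
  have hid : cfcₙ (fun t : ℝ => t) h = h := cfcₙ_id' ℝ h
  have hm : cfcₙ G h * h * cfcₙ G h = cfcₙ (fun t => G t * t * G t) h := by
    rw [cfcₙ_mul (fun t => G t * t) G h (by fun_prop) (by simp) (by fun_prop) hG0,
      cfcₙ_mul G (fun t => t) h (by fun_prop) hG0 (by fun_prop) rfl, hid]
  refine ⟨cfcₙ G h, cfcₙ_predicate G h, ?_⟩
  rw [hm]
  let M : ℝ → ℝ := fun t => G t * t * G t
  have hM : Continuous M := by fun_prop
  have hM0 : M 0 = 0 := by simp [M]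
  have e : h - cfcₙ M h * h - h * cfcₙ M h + cfcₙ M h * h * cfcₙ M h =
      cfcₙ (fun t => t - M t * t - t * M t + M t * t * M t) h := by
    rw [cfcₙ_add (fun t => t - M t * t - t * M t) (fun t => M t * t * M t) h (by fun_prop) (by simp)
      (by fun_prop) (by simp), cfcₙ_sub (fun t => t - M t * t) (fun t => t * M t) h (by fun_prop)
      (by simp) (by fun_prop) (by simp), cfcₙ_sub (fun t => t) (fun t => M t * t) h (by fun_prop)
      rfl (by fun_prop) (by simp), cfcₙ_mul (fun t => M t * t) M h (by fun_prop) (by simp)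
      (by fun_prop) hM0, cfcₙ_mul M (fun t => t) h (by fun_prop) hM0 (by fun_prop) rfl,
      cfcₙ_mul (fun t => t) M h (by fun_prop) rfl (by fun_prop) hM0, hid]
  rw [e]
  refine norm_cfcₙ_le fun t ht => ?_
  have ht0 : 0 ≤ t := quasispectrum_nonneg_of_nonneg h h0 t ht
  have hq : M t = (t / (t + δ)) ^ 2 := by
    simp only [M, G, abs_of_nonneg ht0]
    rw [div_mul_eq_mul_div, div_mul_div_comm, div_pow, mul_right_comm, Real.mul_self_sqrt ht0]
    ring_nf
  have e2 : t - M t * t - t * M t + M t * t * M t = t * (1 - M t) ^ 2 := by ring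
  rw [e2, Real.norm_of_nonneg (by positivity), hq]
  have e3 : t * (1 - (t / (t + δ)) ^ 2) ^ 2 = t * (δ * (2 * t + δ)) ^ 2 / (t + δ) ^ 4 := by
    field_simp
    ring
  rw [e3, div_le_iff₀ (by positivity)]
  have e4 : t * (δ * (2 * t + δ)) ^ 2 ≤ t * (δ * (2 * (t + δ))) ^ 2 := by gcongr; linarith
  have e5 : 4 * t * δ ≤ (t + δ) ^ 2 := by nlinarith [sq_nonneg (t - δ)]
  calc _ ≤ _ := e4
    _ = δ * (4 * t * δ) * (t + δ) ^ 2 := by ring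
    _ ≤ δ * (t + δ) ^ 2 * (t + δ) ^ 2 := by gcongr
    _ = δ * (t + δ) ^ 4 := by ring

end Positive

/-! ### Pre-imprimitivity bimodules and their completions -/

theorem isClosed_star_mul_self (A : Type*) [NonUnitalCStarAlgebra A] :
    IsClosed {a : A | ∃ b, a = star b * b} := by
  refine isClosed_of_closure_subset fun a ha => exists_star_mul_self_of_approx fun ε hε => ?_
  obtain ⟨_, ⟨b, rfl⟩, hb⟩ := Metric.mem_closure_iff.1 ha ε hε
  exact ⟨b, by rw [← dist_eq_norm]; exact hb.le⟩

theorem exists_isFormSeminorm {E G : Type*} [AddCommGroup E] [Module ℂ E] [NormedAddCommGroup G]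
    [NormedSpace ℂ G] (N : E →ₗ⋆[ℂ] E →ₗ[ℂ] G)
    (h : ∀ x y, ‖N x y‖ ^ 2 ≤ ‖N x x‖ * ‖N y y‖) : ∃ p : Seminorm ℂ E, IsFormSeminorm p N := by
  have hcs : ∀ x y, ‖N x y‖ ≤ √‖N x x‖ * √‖N y y‖ := fun x y => by
    rw [← Real.sqrt_mul (norm_nonneg _)]
    exact Real.le_sqrt_of_sq_le (h x y)
  refine ⟨Seminorm.of (fun x => √‖N x x‖) (fun x y => ?_) (fun k x => ?_),
    fun x => (Real.sq_sqrt (norm_nonneg _)).symm, hcs⟩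
  · refine Real.sqrt_le_iff.2 ⟨by positivity, ?_⟩
    have h1 := hcs x y
    have h2 := hcs y x
    have e : N (x + y) (x + y) = N x x + N x y + (N y x + N y y) := by
      simp only [map_add, LinearMap.add_apply]; abel
    rw [e]
    refine (norm_add₃_le.trans (add_le_add_right (norm_add_le (N y x) (N y y)) _)).trans ?_
    nlinarith [Real.sq_sqrt (norm_nonneg (N x x)), Real.sq_sqrt (norm_nonneg (N y y))]
  · have e : ‖N (k • x) (k • x)‖ = ‖k‖ ^ 2 * ‖N x x‖ := by
      simp [norm_smul]; ring
    rw [e, Real.sqrt_mul (by positivity), Real.sqrt_sq (norm_nonneg _)]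

/-- The algebraic part of the structure of an imprimitivity bimodule over ⋆-algebras. -/
structure PreBimodule (A B E : Type*) [NonUnitalRing A] [Module ℂ A] [StarRing A]
    [NonUnitalRing B] [Module ℂ B] [StarRing B] [AddCommGroup E] [Module ℂ E] where
  lsmul : A →ₗ[ℂ] E →ₗ[ℂ] E
  rsmul : E →ₗ[ℂ] B →ₗ[ℂ] E
  linner : E →ₗ[ℂ] E →ₗ⋆[ℂ] A
  rinner : E →ₗ⋆[ℂ] E →ₗ[ℂ] B
  mul_lsmul : ∀ a a' z, lsmul (a * a') z = lsmul a (lsmul a' z)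
  rsmul_mul : ∀ z b b', rsmul z (b * b') = rsmul (rsmul z b) b'
  lsmul_rsmul : ∀ a z b, rsmul (lsmul a z) b = lsmul a (rsmul z b)
  linner_lsmul : ∀ a z z', linner (lsmul a z) z' = a * linner z z'
  rinner_rsmul : ∀ z z' b, rinner z (rsmul z' b) = rinner z z' * b
  star_linner : ∀ z z', star (linner z z') = linner z' z
  star_rinner : ∀ z z', star (rinner z z') = rinner z' z
  rinner_lsmul : ∀ a z z', rinner (lsmul a z) z' = rinner z (lsmul (star a) z')
  linner_rsmul : ∀ z b z', linner (rsmul z b) z' = linner z (rsmul z' (star b))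
  -- The identity relating the two inner products is demanded only after pairing with a vector:
  -- before completion it may fail by a null vector.
  rinner_lsmul_linner : ∀ v z z' z'',
    rinner v (lsmul (linner z z') z'') = rinner v (rsmul z (rinner z' z''))
  linner_lsmul_linner : ∀ z z' z'' v,
    linner (lsmul (linner z z') z'') v = linner (rsmul z (rinner z' z'')) v

namespace PreBimodule

variable {A₀ B₀ E A B : Type*} [NonUnitalRing A₀] [Module ℂ A₀] [StarRing A₀]
  [NonUnitalRing B₀] [Module ℂ B₀] [StarRing B₀] [AddCommGroup E] [Module ℂ E]
  [NonUnitalCStarAlgebra A] [NonUnitalCStarAlgebra B]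

variable (P : PreBimodule A₀ B₀ E) (f : A₀ →⋆ₙₐ[ℂ] A) (g : B₀ →⋆ₙₐ[ℂ] B)

/-- The right inner product with values in a C⋆-algebra. -/
def rform : E →ₗ⋆[ℂ] E →ₗ[ℂ] B :=
  LinearMap.mk₂'ₛₗ _ _ (fun z z' => g (P.rinner z z')) (by simp) (by simp) (by simp) (by simp)

/-- The left inner product, flipped, with values in a C⋆-algebra. -/
def lform : E →ₗ⋆[ℂ] E →ₗ[ℂ] A :=
  LinearMap.mk₂'ₛₗ _ _ (fun z z' => f (P.linner z' z)) (by simp) (by simp) (by simp) (by simp)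

@[simp]
theorem rform_apply (z z' : E) : P.rform g z z' = g (P.rinner z z') := rfl

@[simp]
theorem lform_apply (z z' : E) : P.lform f z z' = f (P.linner z' z) := rfl

theorem rinner_rsmul_left (b : B₀) (z z' : E) :
    P.rinner (P.rsmul z b) z' = star b * P.rinner z z' := by
  rw [← P.star_rinner, P.rinner_rsmul, star_mul, P.star_rinner]

theorem linner_lsmul_right (a : A₀) (z z' : E) :
    P.linner z (P.lsmul a z') = P.linner z z' * star a := by
  rw [← P.star_linner, P.linner_lsmul, star_mul, P.star_linner]

/-- Positivity of the inner square of `t z⟨z, z'⟩ - z'` for all real `t` is the hypothesis of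
`norm_sq_le_of_forall` with `c = ⟨z, z'⟩`; this gives the Cauchy-Schwarz inequality. -/
theorem exists_rform_seminorm (h : ∀ z, ∃ b, g (P.rinner z z) = star b * b) :
    ∃ p : Seminorm ℂ E, IsFormSeminorm p (P.rform g) := by
  refine exists_isFormSeminorm _ fun z z' => norm_sq_le_of_forall (h z) fun t => ?_
  obtain ⟨b, hb⟩ := h ((t : ℂ) • P.rsmul z (P.rinner z z') - z')
  refine ⟨b, hb.symm.trans ?_ |>.symm⟩
  have e : ((2 * t : ℂ)) = t + t := two_mul _
  simp only [rform_apply, map_sub, map_smulₛₗ, LinearMap.sub_apply, LinearMap.smul_apply,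
    P.rinner_rsmul, P.rinner_rsmul_left, e, add_smul, map_mul, P.star_rinner, ← map_star,
    Complex.conj_ofReal, RingHom.id_apply, smul_sub, smul_smul, sq]
  abel

theorem exists_lform_seminorm (h : ∀ z, ∃ b, f (P.linner z z) = star b * b) :
    ∃ p : Seminorm ℂ E, IsFormSeminorm p (P.lform f) := by
  refine exists_isFormSeminorm _ fun z' z => ?_
  rw [mul_comm]
  refine norm_sq_le_of_forall (h z) fun t => ?_
  obtain ⟨b, hb⟩ := h ((t : ℂ) • P.lsmul (P.linner z' z) z - z')
  refine ⟨b, hb.symm.trans ?_ |>.symm⟩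
  have e : ((2 * t : ℂ)) = t + t := two_mul _
  simp only [lform_apply, map_sub, map_smulₛₗ, LinearMap.sub_apply, LinearMap.smul_apply,
    P.linner_lsmul, P.linner_lsmul_right, mul_assoc, e, add_smul, map_mul, P.star_linner, ← map_star,
    Complex.conj_ofReal, RingHom.id_apply, smul_sub, smul_smul, sq]
  abel

/-- The analytic conditions under which a pre-imprimitivity bimodule has a completion. -/
structure IsBounded : Prop where
  dense_left : DenseRange f
  dense_right : DenseRange g
  linner_pos : ∀ z, ∃ a, f (P.linner z z) = star a * a
  rinner_pos : ∀ z, ∃ b, g (P.rinner z z) = star b * b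
  linner_full : Dense (Submodule.span ℂ {a | ∃ z z', a = f (P.linner z z')} : Set A)
  rinner_full : Dense (Submodule.span ℂ {b | ∃ z z', b = g (P.rinner z z')} : Set B)
  lsmul_le : ∀ p : Seminorm ℂ E, IsFormSeminorm p (P.rform g) →
    ∀ a z, p (P.lsmul a z) ≤ ‖f a‖ * p z
  rsmul_le : ∀ p : Seminorm ℂ E, IsFormSeminorm p (P.lform f) →
    ∀ z b, p (P.rsmul z b) ≤ ‖g b‖ * p z

variable {P f g}

/-- The seminorms `q` and `p` of the left and right inner products agree. The square of the left
inner product of `z` with itself is the left inner product of `z⟨z, z⟩` with `z`, so boundedness of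
the right action gives `q z ^ 4 ≤ q z ^ 2 * p z ^ 2`, hence `q ≤ p`; the other inequality is
symmetric. -/
theorem IsBounded.exists_seminorm (h : P.IsBounded f g) :
    ∃ p : Seminorm ℂ E, IsFormSeminorm p (P.rform g) ∧ IsFormSeminorm p (P.lform f) := by
  obtain ⟨p, hp⟩ := P.exists_rform_seminorm g h.rinner_pos
  obtain ⟨q, hq⟩ := P.exists_lform_seminorm f h.linner_pos
  have key : ∀ {a b : ℝ}, 0 ≤ a → 0 ≤ b → a ^ 4 ≤ b ^ 2 * a ^ 2 → a ≤ b := fun {a b} ha hb hab => by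
    rcases ha.eq_or_lt with rfl | ha
    · exact hb
    · refine (sq_le_sq₀ ha.le hb).1 (le_of_mul_le_mul_right ?_ (by positivity : 0 < a ^ 2))
      rwa [← pow_add]
  have h1 : ∀ z, q z ≤ p z := fun z => by
    refine key (apply_nonneg _ _) (apply_nonneg _ _) ?_
    have e : f (P.linner z z) * f (P.linner z z) =
        P.lform f z (P.rsmul z (P.rinner z z)) := by
      rw [lform_apply, ← P.linner_lsmul_linner, P.linner_lsmul, map_mul]
    have e2 : ‖f (P.linner z z) * f (P.linner z z)‖ = q z ^ 4 := by
      have hs : star (f (P.linner z z)) = f (P.linner z z) := by rw [← map_star, P.star_linner]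
      nth_rw 1 [← hs]
      rw [CStarRing.norm_star_mul_self, ← P.lform_apply f, hq.sq]
      ring
    rw [← e2, e]
    refine (hq.cs _ _).trans ?_
    have := h.rsmul_le q hq z (P.rinner z z)
    rw [← P.rform_apply g, hp.sq] at this
    nlinarith [apply_nonneg q z]
  have h2 : ∀ z, p z ≤ q z := fun z => by
    refine key (apply_nonneg _ _) (apply_nonneg _ _) ?_
    have e : g (P.rinner z z) * g (P.rinner z z) =
        P.rform g z (P.lsmul (P.linner z z) z) := by
      rw [rform_apply, P.rinner_lsmul_linner, P.rinner_rsmul, map_mul]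
    have e2 : ‖g (P.rinner z z) * g (P.rinner z z)‖ = p z ^ 4 := by
      have hs : star (g (P.rinner z z)) = g (P.rinner z z) := by rw [← map_star, P.star_rinner]
      nth_rw 1 [← hs]
      rw [CStarRing.norm_star_mul_self, ← P.rform_apply g, hp.sq]
      ring
    rw [← e2, e]
    refine (hp.cs _ _).trans ?_
    have := h.lsmul_le p hp (P.linner z z) z
    rw [← P.lform_apply f, hq.sq] at this
    nlinarith [apply_nonneg p z]
  obtain rfl : p = q := Seminorm.ext fun z => le_antisymm (h2 z) (h1 z)
  exact ⟨p, hp, hq⟩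

end PreBimodule

theorem denseRange_ext₃ {α β γ X Y Z T : Type*} [TopologicalSpace X] [TopologicalSpace Y]
    [TopologicalSpace Z] [TopologicalSpace T] [T2Space T] {f : α → X} {g : β → Y} {h : γ → Z}
    (hf : DenseRange f) (hg : DenseRange g) (hh : DenseRange h) {F G : X → Y → Z → T}
    (hF : Continuous (fun p : X × Y × Z => F p.1 p.2.1 p.2.2))
    (hG : Continuous (fun p : X × Y × Z => G p.1 p.2.1 p.2.2))
    (H : ∀ a b c, F (f a) (g b) (h c) = G (f a) (g b) (h c)) (x : X) (y : Y) (z : Z) :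
    F x y z = G x y z :=
  congrFun ((hf.prodMap (hg.prodMap hh)).equalizer hF hG (funext fun p => H p.1 p.2.1 p.2.2)) (x, y, z)

theorem denseRange_ext₂ {α β X Y T : Type*} [TopologicalSpace X] [TopologicalSpace Y]
    [TopologicalSpace T] [T2Space T] {f : α → X} {g : β → Y}
    (hf : DenseRange f) (hg : DenseRange g) {F G : X → Y → T}
    (hF : Continuous (fun p : X × Y => F p.1 p.2))
    (hG : Continuous (fun p : X × Y => G p.1 p.2))
    (H : ∀ a b, F (f a) (g b) = G (f a) (g b)) (x : X) (y : Y) : F x y = G x y :=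
  congrFun ((hf.prodMap hg).equalizer hF hG (funext fun p => H p.1 p.2)) (x, y)

theorem PreBimodule.IsBounded.exists_completion {A₀ B₀ : Type*} {E : Type w} [NonUnitalRing A₀]
    [Module ℂ A₀] [StarRing A₀] [NonUnitalRing B₀] [Module ℂ B₀] [StarRing B₀] [AddCommGroup E]
    [Module ℂ E] {A B : Type w} [NonUnitalCStarAlgebra A] [NonUnitalCStarAlgebra B]
    {P : PreBimodule A₀ B₀ E} {f : A₀ →⋆ₙₐ[ℂ] A} {g : B₀ →⋆ₙₐ[ℂ] B} (h : P.IsBounded f g) :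
    ∃ (Y : Type w) (_ : NormedAddCommGroup Y) (_ : NormedSpace ℂ Y)
      (M : ImprimitivityBimodule A B Y) (ι : E →ₗ[ℂ] Y), DenseRange ι ∧
      (∀ z z', M.linner (ι z) (ι z') = f (P.linner z z')) ∧
      ∀ z z', M.rinner (ι z) (ι z') = g (P.rinner z z') := by
  obtain ⟨p, hp, hq⟩ := h.exists_seminorm
  have hι : DenseRange (SemComp.mk p) := SemComp.denseRange_mk p
  have hn : ∀ z, ‖SemComp.mk p z‖ = p z := SemComp.norm_mk p
  have hf : DenseRange (f : A₀ →ₗ[ℂ] A) := h.dense_left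
  have hg : DenseRange (g : B₀ →ₗ[ℂ] B) := h.dense_right
  generalize hY : SemComp.mk p = ι at hι hn
  obtain ⟨l, hl, -⟩ := exists_bilinear_extension hf hι (P.lsmul.compr₂ ι) 1 zero_le_one
    (fun a z => by simpa [hn] using h.lsmul_le p hp a z)
  obtain ⟨r, hr, -⟩ := exists_bilinear_extension hι hg (P.rsmul.compr₂ ι) 1 zero_le_one
    (fun z b => by simpa [hn, mul_comm] using h.rsmul_le p hq z b)
  obtain ⟨R, hR, -⟩ := exists_bilinear_extension hι hι (P.rform g) 1 zero_le_one
    (fun z z' => by simpa [hn] using hp.cs z z')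
  obtain ⟨L, hL, -⟩ := exists_bilinear_extension hι hι (P.lform f) 1 zero_le_one
    (fun z z' => by simpa [hn] using hq.cs z z')
  simp only [LinearMap.compr₂_apply, P.rform_apply, P.lform_apply, LinearMap.coe_coe] at hl hr hR hL
  change DenseRange f at hf
  change DenseRange g at hg
  let M : ImprimitivityBimodule A B (SemComp p) :=
    { lsmul := LinearMap.mk₂ ℂ (fun a z => l a z) (by simp) (by simp) (by simp) (by simp)
      rsmul := LinearMap.mk₂ ℂ (fun z b => r z b) (by simp) (by simp) (by simp) (by simp)
      linner := LinearMap.mk₂'ₛₗ _ _ (fun z z' => L z' z) (by simp) (by simp) (by simp) (by simp)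
      rinner := LinearMap.mk₂'ₛₗ _ _ (fun z z' => R z z') (by simp) (by simp) (by simp) (by simp)
      complete := inferInstance
      mul_lsmul := denseRange_ext₃ hf hf hι (F := fun a a' z => l (a * a') z)
        (G := fun a a' z => l a (l a' z)) (by fun_prop) (by fun_prop) fun a a' z => by
          simp only [← map_mul, hl, P.mul_lsmul]
      rsmul_mul := denseRange_ext₃ hι hg hg (F := fun z b b' => r z (b * b'))
        (G := fun z b b' => r (r z b) b') (by fun_prop) (by fun_prop) fun z b b' => by
          simp only [← map_mul, hr, P.rsmul_mul]
      lsmul_rsmul := denseRange_ext₃ hf hι hg (F := fun a z b => r (l a z) b)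
        (G := fun a z b => l a (r z b)) (by fun_prop) (by fun_prop) fun a z b => by
          simp only [hl, hr, P.lsmul_rsmul]
      linner_lsmul := denseRange_ext₃ hf hι hι (F := fun a z z' => L z' (l a z))
        (G := fun a z z' => a * L z' z) (by fun_prop) (by fun_prop) fun a z z' => by
          simp only [hl, hL, P.linner_lsmul, map_mul]
      rinner_rsmul := denseRange_ext₃ hι hι hg (F := fun z z' b => R z (r z' b))
        (G := fun z z' b => R z z' * b) (by fun_prop) (by fun_prop) fun z z' b => by
          simp only [hr, hR, P.rinner_rsmul, map_mul]
      star_linner := denseRange_ext₂ hι hι (F := fun z z' => star (L z' z))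
        (G := fun z z' => L z z') (by fun_prop) (by fun_prop) fun z z' => by
          simp only [hL, ← map_star, P.star_linner]
      star_rinner := denseRange_ext₂ hι hι (F := fun z z' => star (R z z'))
        (G := fun z z' => R z' z) (by fun_prop) (by fun_prop) fun z z' => by
          simp only [hR, ← map_star, P.star_rinner]
      linner_self_nonneg := fun z => hι.induction_on z
        ((isClosed_star_mul_self A).preimage (f := fun z => L z z) (by fun_prop)) fun z => by
          obtain ⟨a, ha⟩ := h.linner_pos z
          exact ⟨a, (hL z z).trans ha⟩
      rinner_self_nonneg := fun z => hι.induction_on z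
        ((isClosed_star_mul_self B).preimage (f := fun z => R z z) (by fun_prop)) fun z => by
          obtain ⟨b, hb⟩ := h.rinner_pos z
          exact ⟨b, (hR z z).trans hb⟩
      norm_linner_self := fun z => hι.induction_on z (isClosed_eq (f := fun z => ‖L z z‖)
        (by fun_prop) (by fun_prop)) fun z => by
          change ‖L _ _‖ = _
          rw [hL, hn, ← hq.sq, lform_apply]
      norm_rinner_self := fun z => hι.induction_on z (isClosed_eq (f := fun z => ‖R z z‖)
        (by fun_prop) (by fun_prop)) fun z => by
          change ‖R _ _‖ = _
          rw [hR, hn, ← hp.sq, rform_apply]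
      linner_full := h.linner_full.mono (Submodule.span_mono (by
        rintro _ ⟨z, z', rfl⟩
        exact ⟨ι z, ι z', (hL z' z).symm⟩))
      rinner_full := h.rinner_full.mono (Submodule.span_mono (by
        rintro _ ⟨z, z', rfl⟩
        exact ⟨ι z, ι z', (hR z z').symm⟩))
      rinner_lsmul := denseRange_ext₃ hf hι hι (F := fun a z z' => R (l a z) z')
        (G := fun a z z' => R z (l (star a) z')) (by fun_prop) (by fun_prop) fun a z z' => by
          simp only [hl, hR, P.rinner_lsmul, ← map_star]
      linner_rsmul := denseRange_ext₃ hι hg hι (F := fun z b z' => L z' (r z b))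
        (G := fun z b z' => L (r z' (star b)) z) (by fun_prop) (by fun_prop) fun z b z' => by
          simp only [hr, hL, P.linner_rsmul, ← map_star]
      -- The difference of the two sides has zero inner product with every vector, in particular
      -- with itself, so it is null for `p` and vanishes in the completion.
      linner_lsmul_eq := denseRange_ext₃ hι hι hι (F := fun z z' z'' => l (L z' z) z'')
        (G := fun z z' z'' => r z (R z' z'')) (by fun_prop) (by fun_prop) fun z z' z'' => by
          simp only [hl, hr, hL, hR]
          refine sub_eq_zero.1 (norm_eq_zero.1 ?_)
          rw [← map_sub, hn]
          refine pow_eq_zero_iff two_ne_zero |>.1 ?_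
          rw [← hp.sq, rform_apply, map_sub, P.rinner_lsmul_linner, sub_self, map_zero, norm_zero] }
  exact ⟨SemComp p, inferInstance, inferInstance, M, ι, hι, fun z z' => hL z' z, hR⟩

/-! ### The conjugate bimodule -/

/-- The complex vector space conjugate to `Z`. -/
def Conj (Z : Type w) : Type w := Z

namespace Conj

variable (Z : Type w)

instance [AddCommGroup Z] : AddCommGroup (Conj Z) := inferInstanceAs (AddCommGroup Z)

instance [NormedAddCommGroup Z] : NormedAddCommGroup (Conj Z) :=
  inferInstanceAs (NormedAddCommGroup Z)

instance [AddCommGroup Z] [Module ℂ Z] : Module ℂ (Conj Z) := Module.compHom Z (starRingEnd ℂ)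

variable {Z}

/-- The identity map, as a conjugate linear equivalence. -/
def mk [AddCommGroup Z] [Module ℂ Z] : Z ≃ₗ⋆[ℂ] Conj Z where
  toFun z := z
  invFun z := z
  map_add' _ _ := rfl
  map_smul' k z := by
    change k • z = (starRingEnd ℂ (starRingEnd ℂ k)) • z
    rw [Complex.conj_conj]
  left_inv _ := rfl
  right_inv _ := rfl

@[simp]
theorem mk_symm_smul [AddCommGroup Z] [Module ℂ Z] (k : ℂ) (z : Conj Z) :
    mk.symm (k • z) = starRingEnd ℂ k • mk.symm z := rfl

@[simp]
theorem mk_conj_smul [AddCommGroup Z] [Module ℂ Z] (k : ℂ) (z : Z) :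
    mk (starRingEnd ℂ k • z) = k • mk z := rfl

instance [NormedAddCommGroup Z] [NormedSpace ℂ Z] : NormedSpace ℂ (Conj Z) where
  norm_smul_le k z := by
    change ‖starRingEnd ℂ k • mk.symm z‖ ≤ ‖k‖ * ‖mk.symm z‖
    rw [norm_smul, RCLike.norm_conj]

end Conj

/-- The bimodule conjugate to a pre-imprimitivity bimodule. -/
def PreBimodule.conj {A B E : Type*} [NonUnitalRing A] [Module ℂ A] [StarRing A] [StarModule ℂ A]
    [NonUnitalRing B] [Module ℂ B] [StarRing B] [StarModule ℂ B] [AddCommGroup E] [Module ℂ E]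
    (P : PreBimodule A B E) : PreBimodule B A (Conj E) where
  lsmul := LinearMap.mk₂ ℂ (fun b z => Conj.mk (P.rsmul (Conj.mk.symm z) (star b)))
    (by simp) (by simp) (by simp) (by simp)
  rsmul := LinearMap.mk₂ ℂ (fun z a => Conj.mk (P.lsmul (star a) (Conj.mk.symm z)))
    (by simp) (by simp) (by simp) (by simp)
  linner := LinearMap.mk₂'ₛₗ _ _ (fun z z' => P.rinner (Conj.mk.symm z) (Conj.mk.symm z'))
    (by simp) (by simp) (by simp) (by simp)
  rinner := LinearMap.mk₂'ₛₗ _ _ (fun z z' => P.linner (Conj.mk.symm z) (Conj.mk.symm z'))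
    (by simp) (by simp) (by simp) (by simp)
  mul_lsmul := by simp [P.rsmul_mul]
  rsmul_mul := by simp [P.mul_lsmul]
  lsmul_rsmul := by simp [P.lsmul_rsmul]
  linner_lsmul := by simp [P.rinner_rsmul_left]
  rinner_rsmul := by simp [P.linner_lsmul_right]
  star_linner := by simp [P.star_rinner]
  star_rinner := by simp [P.star_linner]
  rinner_lsmul := by simp [P.linner_rsmul]
  linner_rsmul := by simp [P.rinner_lsmul]
  rinner_lsmul_linner v z z' z'' := by
    change P.linner (Conj.mk.symm v)
      (P.rsmul (Conj.mk.symm z'') (star (P.rinner (Conj.mk.symm z) (Conj.mk.symm z')))) =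
        P.linner (Conj.mk.symm v)
          (P.lsmul (star (P.linner (Conj.mk.symm z') (Conj.mk.symm z''))) (Conj.mk.symm z))
    rw [P.star_rinner, P.star_linner, ← P.star_linner, ← P.linner_lsmul_linner, P.star_linner]
  linner_lsmul_linner z z' z'' v := by
    change P.rinner
      (P.rsmul (Conj.mk.symm z'') (star (P.rinner (Conj.mk.symm z) (Conj.mk.symm z'))))
        (Conj.mk.symm v) = P.rinner
          (P.lsmul (star (P.linner (Conj.mk.symm z') (Conj.mk.symm z''))) (Conj.mk.symm z))
            (Conj.mk.symm v)
    rw [P.star_rinner, P.star_linner, ← P.star_rinner, ← P.rinner_lsmul_linner, P.star_rinner]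

namespace ImprimitivityBimodule

variable {A B Z : Type w} [NonUnitalCStarAlgebra A] [NonUnitalCStarAlgebra B]
  [NormedAddCommGroup Z] [NormedSpace ℂ Z] (M : ImprimitivityBimodule A B Z)

/-- The underlying pre-imprimitivity bimodule. -/
def toPre : PreBimodule A B Z where
  lsmul := M.lsmul
  rsmul := M.rsmul
  linner := M.linner
  rinner := M.rinner
  mul_lsmul := M.mul_lsmul
  rsmul_mul := M.rsmul_mul
  lsmul_rsmul := M.lsmul_rsmul
  linner_lsmul := M.linner_lsmul
  rinner_rsmul := M.rinner_rsmul
  star_linner := M.star_linner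
  star_rinner := M.star_rinner
  rinner_lsmul := M.rinner_lsmul
  linner_rsmul := M.linner_rsmul
  rinner_lsmul_linner v z z' z'' := by rw [M.linner_lsmul_eq]
  linner_lsmul_linner z z' z'' v := by rw [M.linner_lsmul_eq]

/-- The imprimitivity bimodule conjugate to `Z`. -/
def conj : ImprimitivityBimodule B A (Conj Z) where
  lsmul := M.toPre.conj.lsmul
  rsmul := M.toPre.conj.rsmul
  linner := M.toPre.conj.linner
  rinner := M.toPre.conj.rinner
  complete := M.complete
  mul_lsmul := M.toPre.conj.mul_lsmul
  rsmul_mul := M.toPre.conj.rsmul_mul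
  lsmul_rsmul := M.toPre.conj.lsmul_rsmul
  linner_lsmul := M.toPre.conj.linner_lsmul
  rinner_rsmul := M.toPre.conj.rinner_rsmul
  star_linner := M.toPre.conj.star_linner
  star_rinner := M.toPre.conj.star_rinner
  linner_self_nonneg := M.rinner_self_nonneg
  rinner_self_nonneg := M.linner_self_nonneg
  norm_linner_self := M.norm_rinner_self
  norm_rinner_self := M.norm_linner_self
  linner_full := M.rinner_full
  rinner_full := M.linner_full
  rinner_lsmul := M.toPre.conj.rinner_lsmul
  linner_rsmul := M.toPre.conj.linner_rsmul
  linner_lsmul_eq z z' z'' := by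
    change Conj.mk (M.rsmul (Conj.mk.symm z'')
      (star (M.rinner (Conj.mk.symm z) (Conj.mk.symm z')))) =
        Conj.mk (M.lsmul (star (M.linner (Conj.mk.symm z') (Conj.mk.symm z''))) (Conj.mk.symm z))
    rw [M.star_rinner, M.star_linner, M.linner_lsmul_eq]

theorem conj_lsmul (b : B) (z : Conj Z) :
    M.conj.lsmul b z = Conj.mk (M.rsmul (Conj.mk.symm z) (star b)) := rfl

theorem conj_rsmul (z : Conj Z) (a : A) :
    M.conj.rsmul z a = Conj.mk (M.lsmul (star a) (Conj.mk.symm z)) := rfl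

theorem conj_linner (z z' : Conj Z) :
    M.conj.linner z z' = M.rinner (Conj.mk.symm z) (Conj.mk.symm z') := rfl

theorem conj_rinner (z z' : Conj Z) :
    M.conj.rinner z z' = M.linner (Conj.mk.symm z) (Conj.mk.symm z') := rfl

theorem norm_rinner_le (z z' : Z) : ‖M.rinner z z'‖ ≤ ‖z‖ * ‖z'‖ := by
  obtain ⟨p, hp⟩ := M.toPre.exists_rform_seminorm (NonUnitalStarAlgHom.id ℂ B) M.rinner_self_nonneg
  have h : ∀ z, p z = ‖z‖ := fun z =>
    (sq_eq_sq₀ (apply_nonneg p z) (norm_nonneg z)).1 ((hp.sq z).symm.trans (M.norm_rinner_self z))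
  rw [← h, ← h]
  exact hp.cs z z'

theorem norm_linner_le (z z' : Z) : ‖M.linner z z'‖ ≤ ‖z‖ * ‖z'‖ :=
  M.conj.norm_rinner_le (Conj.mk z) (Conj.mk z')

theorem linner_lsmul_right (a : A) (z z' : Z) :
    M.linner z (M.lsmul a z') = M.linner z z' * star a := M.toPre.linner_lsmul_right a z z'

theorem norm_lsmul_le (a : A) (z : Z) : ‖M.lsmul a z‖ ≤ ‖a‖ * ‖z‖ := by
  refine (sq_le_sq₀ (norm_nonneg _) (by positivity)).1 ?_
  rw [← M.norm_linner_self, M.linner_lsmul, M.linner_lsmul_right]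
  refine (norm_mul_le _ _).trans ((mul_le_mul_of_nonneg_left (norm_mul_le _ _)
    (norm_nonneg _)).trans ?_)
  rw [norm_star, M.norm_linner_self]
  exact le_of_eq (by ring)

theorem norm_rsmul_le (z : Z) (b : B) : ‖M.rsmul z b‖ ≤ ‖z‖ * ‖b‖ := by
  have := M.conj.norm_lsmul_le (star b) (Conj.mk z)
  rw [M.conj_lsmul, star_star, norm_star, mul_comm] at this
  exact this

/-! ### Finite frames and positivity of Gram matrices -/

/-- Finitely many elements are approximately reproduced by a finite frame. -/
theorem exists_frame {ι : Type*} (s : Finset ι) (z : ι → Z) {ε : ℝ} (hε : 0 < ε) :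
    ∃ u : ι → Z, ∀ i ∈ s, ‖z i - ∑ k ∈ s, M.rsmul (u k) (M.rinner (u k) (z i))‖ ≤ ε := by
  have hpos := fun i (_ : i ∈ s) => M.linner_self_nonneg (z i)
  obtain ⟨g, hg, hgn⟩ := exists_approx_unit_factor
    (exists_star_mul_self_sum s (fun i => M.linner (z i) (z i)) hpos) (pow_pos hε 2)
  -- With `u k = g z_k` the frame operator `z ↦ ∑ u_k⟨u_k, z⟩` is left multiplication by `m = g h
  -- g`. The sum over `j` of the inner squares of `(1 - m) z_j` is `(1 - m) h (1 - m)`, of norm at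
  -- most `ε ^ 2`, and each positive summand is dominated by the sum.
  set h := ∑ i ∈ s, M.linner (z i) (z i) with hh
  set m := g * h * g with hm
  have hms : star m = m := by
    have hhs : star h = h := by rw [hh, star_sum]; simp [M.star_linner]
    rw [hm, star_mul, star_mul, hhs, hg.star_eq, mul_assoc]
  refine ⟨fun k => M.lsmul g (z k), fun i hi => ?_⟩
  have e : ∑ k ∈ s, M.rsmul (M.lsmul g (z k)) (M.rinner (M.lsmul g (z k)) (z i)) =
      M.lsmul m (z i) := by
    simp only [← M.linner_lsmul_eq, M.linner_lsmul, M.linner_lsmul_right, hg.star_eq]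
    rw [hm, hh, Finset.mul_sum, Finset.sum_mul, map_sum, LinearMap.sum_apply]
    simp only [mul_assoc]
  rw [e]
  have key : ∀ j, M.linner (z j - M.lsmul m (z j)) (z j - M.lsmul m (z j)) =
      M.linner (z j) (z j) - m * M.linner (z j) (z j) - M.linner (z j) (z j) * m +
        m * M.linner (z j) (z j) * m := fun j => by
    simp only [map_sub, LinearMap.sub_apply, M.linner_lsmul, M.linner_lsmul_right, hms, mul_assoc]
    abel
  have hsum : ∑ j ∈ s, M.linner (z j - M.lsmul m (z j)) (z j - M.lsmul m (z j)) =
      h - m * h - h * m + m * h * m := by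
    simp only [key, Finset.sum_add_distrib, Finset.sum_sub_distrib, ← Finset.mul_sum,
      ← Finset.sum_mul, ← hh]
  refine (sq_le_sq₀ (norm_nonneg _) hε.le).1 ?_
  rw [← M.norm_linner_self]
  refine (norm_le_of_sum_star_mul_self s
    (fun j => M.linner (z j - M.lsmul m (z j)) (z j - M.lsmul m (z j)))
    (fun j _ => M.linner_self_nonneg _) hi).trans ?_
  rwa [hsum]

/-- Gram matrices are positive. -/
theorem exists_gram {ι : Type*} (s : Finset ι) (z : ι → Z) {ε : ℝ} (hε : 0 < ε) :
    ∃ t : ι → ι → B, ∀ i ∈ s, ∀ j ∈ s,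
      ‖M.rinner (z i) (z j) - ∑ k ∈ s, star (t k i) * t k j‖ ≤ ε := by
  let c := ∑ i ∈ s, ‖z i‖ + 1
  have hc : 0 < c := by positivity
  obtain ⟨u, hu⟩ := M.exists_frame s z (div_pos hε hc)
  -- Inserting the frame expansion of `z_j` into `⟨z_i, z_j⟩` gives `∑ k, ⟨u_k, z_i⟩⋆ ⟨u_k, z_j⟩`,
  -- so the matrix entries are the coefficients `⟨u_k, z_i⟩`.
  refine ⟨fun k i => M.rinner (u k) (z i), fun i hi j hj => ?_⟩
  have e : M.rinner (z i) (z j) - ∑ k ∈ s, star (M.rinner (u k) (z i)) * M.rinner (u k) (z j) =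
      M.rinner (z i) (z j - ∑ k ∈ s, M.rsmul (u k) (M.rinner (u k) (z j))) := by
    simp only [map_sub, map_sum, M.rinner_rsmul, M.star_rinner]
  rw [e]
  have hi' : ‖z i‖ ≤ c :=
    (Finset.single_le_sum (f := fun i => ‖z i‖) (fun _ _ => norm_nonneg _) hi).trans
      (le_add_of_nonneg_right zero_le_one)
  calc _ ≤ ‖z i‖ * ‖z j - ∑ k ∈ s, M.rsmul (u k) (M.rinner (u k) (z j))‖ := M.norm_rinner_le _ _
    _ ≤ c * (ε / c) := mul_le_mul hi' (hu j hj) (norm_nonneg _) hc.le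
    _ = ε := by field_simp

end ImprimitivityBimodule

/-! ### Symmetry of Morita equivalence -/

section Bundles

variable {X : Type u} [TopologicalSpace X]

theorem IsUSCCStarBundle.tendsto_mul {A : X → Type w} [∀ x, NonUnitalCStarAlgebra (A x)]
    [TopologicalSpace (Tot A)] (h : IsUSCCStarBundle A) {α : Type*} {l : Filter α} {b : α → X}
    {f g : ∀ a, A (b a)} {x : X} {v w : A x}
    (hf : Tendsto (fun a => (⟨b a, f a⟩ : Tot A)) l (𝓝 ⟨x, v⟩))
    (hg : Tendsto (fun a => (⟨b a, g a⟩ : Tot A)) l (𝓝 ⟨x, w⟩)) :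
    Tendsto (fun a => (⟨b a, f a * g a⟩ : Tot A)) l (𝓝 ⟨x, v * w⟩) :=
  (h.continuous_mul.tendsto ⟨x, v, w⟩).comp
    (tendsto_fibProd_iff.2 ⟨hf, hg⟩ : Tendsto (fun a => (⟨b a, f a, g a⟩ : FibProd A A)) l _)

theorem IsUSCCStarBundle.tendsto_star {A : X → Type w} [∀ x, NonUnitalCStarAlgebra (A x)]
    [TopologicalSpace (Tot A)] (h : IsUSCCStarBundle A) {α : Type*} {l : Filter α} {b : α → X}
    {f : ∀ a, A (b a)} {x : X} {v : A x}
    (hf : Tendsto (fun a => (⟨b a, f a⟩ : Tot A)) l (𝓝 ⟨x, v⟩)) :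
    Tendsto (fun a => (⟨b a, star (f a)⟩ : Tot A)) l (𝓝 ⟨x, star v⟩) :=
  (h.continuous_star.tendsto ⟨x, v⟩).comp hf

instance (Z : X → Type w) [h : TopologicalSpace (Tot Z)] :
    TopologicalSpace (Tot fun x => Conj (Z x)) := h

theorem IsUSCBanachBundle.conj {Z : X → Type w} [∀ x, NormedAddCommGroup (Z x)]
    [∀ x, NormedSpace ℂ (Z x)] [TopologicalSpace (Tot Z)] (h : IsUSCBanachBundle Z) :
    IsUSCBanachBundle (fun x => Conj (Z x)) where
  complete := h.complete
  continuous_proj := h.continuous_proj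
  isOpenMap_proj := h.isOpenMap_proj
  upperSemicontinuous_norm := h.upperSemicontinuous_norm
  continuous_add := h.continuous_add
  continuous_smul k := h.continuous_smul (starRingEnd ℂ k)
  tendsto_zero := h.tendsto_zero

/-- The conjugate of an imprimitivity bimodule bundle. -/
def ImprimitivityBundle.conj {A B : CStarBundle.{u, w} X} (Z : ImprimitivityBundle A B) :
    ImprimitivityBundle B A where
  Fiber x := Conj (Z.Fiber x)
  isBundle := Z.isBundle.conj
  bimod x := (Z.bimod x).conj
  continuous_lsmul := Z.continuous_rsmul.comp
    (f := fun p : FibProd B.Fiber fun x => Conj (Z.Fiber x) =>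
      (⟨p.base, Conj.mk.symm p.snd, star p.fst⟩ : FibProd Z.Fiber B.Fiber))
    (continuous_induced_rng.2 ((continuous_fibProd_snd _ _).prodMk
      (B.isBundle.continuous_star.comp (continuous_fibProd_fst _ _))))
  continuous_rsmul := Z.continuous_lsmul.comp
    (f := fun p : FibProd (fun x => Conj (Z.Fiber x)) A.Fiber =>
      (⟨p.base, star p.snd, Conj.mk.symm p.fst⟩ : FibProd A.Fiber Z.Fiber))
    (continuous_induced_rng.2 ((A.isBundle.continuous_star.comp (continuous_fibProd_snd _ _)).prodMk
      (continuous_fibProd_fst _ _)))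
  continuous_linner := Z.continuous_rinner
  continuous_rinner := Z.continuous_linner

end Bundles

section Symmetry

variable {X : Type u} [Groupoid.{v} X] [TopologicalSpace X] [TopologicalSpace (Quiver.Total X)]

/-- The conjugate of an equivariant imprimitivity bimodule bundle. -/
def EquivariantBundle.conj {A B : DynSystem.{u, v, w} X} (Z : EquivariantBundle A B) :
    EquivariantBundle B A where
  toImprimitivityBundle := Z.toImprimitivityBundle.conj
  V g :=
    { toLinearEquiv := (Conj.mk (Z := Z.Fiber _)).symm.trans
        ((Z.V g).toLinearEquiv.trans (Conj.mk (Z := Z.Fiber _)))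
      norm_map' := (Z.V g).norm_map }
  V_comp := Z.V_comp
  continuous_V := Z.continuous_V
  linner_V := Z.rinner_V
  rinner_V := Z.linner_V

theorem MoritaEquiv.symm {A B : DynSystem.{u, v, w} X} (h : MoritaEquiv A B) : MoritaEquiv B A :=
  h.map EquivariantBundle.conj

end Symmetry

/-! ### Equivariant bundles from tensor products of sections -/

theorem exists_isometry_extension {E E' Y Y' : Type*} [AddCommGroup E] [Module ℂ E]
    [AddCommGroup E'] [Module ℂ E'] [NormedAddCommGroup Y] [NormedSpace ℂ Y] [CompleteSpace Y]
    [NormedAddCommGroup Y'] [NormedSpace ℂ Y'] [CompleteSpace Y'] {ι : E →ₗ[ℂ] Y} {ι' : E' →ₗ[ℂ] Y'}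
    (hι : DenseRange ι) (hι' : DenseRange ι') (T : E ≃ₗ[ℂ] E') (hT : ∀ e, ‖ι' (T e)‖ = ‖ι e‖) :
    ∃ V : Y ≃ₗᵢ[ℂ] Y', ∀ e, V (ι e) = ι' (T e) := by
  obtain ⟨V, hV, -⟩ := exists_linear_extension hι (ι' ∘ₗ T.toLinearMap) 1 (by simp [hT])
  obtain ⟨U, hU, -⟩ := exists_linear_extension hι' (ι ∘ₗ T.symm.toLinearMap) 1
    (fun e => by simpa using (hT (T.symm e)).symm.le)
  refine ⟨⟨LinearEquiv.ofLinearMap V.toLinearMap U.toLinearMap ?_ ?_, ?_⟩, hV⟩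
  · exact LinearMap.ext fun y => denseRange_ext hι' (g := fun y => V (U y)) (h := id) (by fun_prop)
      continuous_id (fun e => by simp [hU, hV]) y
  · exact LinearMap.ext fun y => denseRange_ext hι (g := fun y => U (V y)) (h := id) (by fun_prop)
      continuous_id (fun e => by simp [hU, hV]) y
  · exact fun y => denseRange_ext hι (g := fun y => ‖V y‖) (h := fun y => ‖y‖) (by fun_prop)
      (by fun_prop) (fun e => by simp [hV, hT]) y

/-! ### Continuity of module actions from continuity of inner products -/

section TensorBundle

variable {X : Type u} [TopologicalSpace X] [T2Space X] [LocallyCompactSpace X]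
  [SecondCountableTopology X]

theorem IsUSCBanachBundle.tendsto_of_sections {Y : X → Type w} [∀ x, NormedAddCommGroup (Y x)]
    [∀ x, NormedSpace ℂ (Y x)] [TopologicalSpace (Tot Y)] (hY : IsUSCBanachBundle Y)
    {Γ : Set (∀ x, Y x)} (hΓ : DenseSections Y Γ) {α : Type*} {l : Filter α} {b : α → X}
    {F : ∀ a, Y (b a)} {x : X} {v : Y x} (hb : Tendsto b l (𝓝 x))
    (H : ∀ ξ ∈ Γ, ∀ ε > 0, ‖v - ξ x‖ < ε → ∀ᶠ a in l, ‖F a - ξ (b a)‖ < ε) :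
    Tendsto (fun a => (⟨b a, F a⟩ : Tot Y)) l (𝓝 ⟨x, v⟩) := by
  refine hY.tendsto_of_approx hb fun ε hε => ?_
  obtain ⟨ξ, hξ, hn⟩ := hΓ.exists_near x v ε hε
  exact ⟨fun a => ξ (b a), ξ x, ((hΓ.continuous ξ hξ).tendsto x).comp hb, hn.le,
    (H ξ hξ ε hε hn).mono fun a ha => ha.le⟩

theorem IsUSCBanachBundle.dense_continuous_sections {Y : X → Type w}
    [∀ x, NormedAddCommGroup (Y x)] [∀ x, NormedSpace ℂ (Y x)] [TopologicalSpace (Tot Y)]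
    (hY : IsUSCBanachBundle Y) :
    DenseSections Y {f | Continuous (fun x => (⟨x, f x⟩ : Tot Y))} where
  continuous _ hf := hf
  exists_near x v ε hε := by
    obtain ⟨f, hf, hv⟩ := hY.exists_section x v
    exact ⟨f, hf, by simpa [hv]⟩

variable {A B : CStarBundle.{u, w} X} {Y : X → Type w} [∀ x, NormedAddCommGroup (Y x)]
  [∀ x, NormedSpace ℂ (Y x)] [TopologicalSpace (Tot Y)]

/-- Continuity of the left action follows from continuity of the left inner product. -/
theorem continuous_lsmul_of_linner (hY : IsUSCBanachBundle Y)
    (M : ∀ x, ImprimitivityBimodule (A.Fiber x) (B.Fiber x) (Y x))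
    (hL : Continuous (fun p : FibProd Y Y => (⟨p.base, (M p.base).linner p.fst p.snd⟩ : Tot A.Fiber))) :
    Continuous (fun p : FibProd A.Fiber Y => (⟨p.base, (M p.base).lsmul p.fst p.snd⟩ : Tot Y)) := by
  have hA := A.isBundle.toIsUSCBanachBundle
  refine continuous_iff_continuousAt.2 fun ⟨x, a, y⟩ => ?_
  obtain ⟨h1, h2⟩ := tendsto_fibProd_iff.1 (tendsto_id (x := 𝓝 (⟨x, a, y⟩ : FibProd A.Fiber Y)))
  have hb := hA.tendsto_base h1
  have hLt : ∀ {s t : ∀ p : FibProd A.Fiber Y, Y p.base} {s' t' : Y x},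
      Tendsto (fun p => (⟨p.base, s p⟩ : Tot Y)) (𝓝 ⟨x, a, y⟩) (𝓝 ⟨x, s'⟩) →
      Tendsto (fun p => (⟨p.base, t p⟩ : Tot Y)) (𝓝 ⟨x, a, y⟩) (𝓝 ⟨x, t'⟩) →
      Tendsto (fun p => (⟨p.base, (M p.base).linner (s p) (t p)⟩ : Tot A.Fiber)) (𝓝 ⟨x, a, y⟩)
        (𝓝 ⟨x, (M x).linner s' t'⟩) := fun {s t s' t'} hs ht =>
    (hL.tendsto ⟨x, s', t'⟩).comp (tendsto_fibProd_iff.2 ⟨hs, ht⟩ :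
      Tendsto (fun p => (⟨p.base, s p, t p⟩ : FibProd Y Y)) _ _)
  refine hY.tendsto_of_sections hY.dense_continuous_sections hb fun ξ hξ ε hε hn => ?_
  have hξ' := (Continuous.tendsto hξ x).comp hb
  -- The squared distance of `a y` from `ξ` is the norm of an expression in `a` and the inner
  -- products of `y` and `ξ` alone. That expression is continuous into `A`, where the norm is upper
  -- semicontinuous.
  have e : ∀ (x : X) (a : A.Fiber x) (y ξ : Y x),
      (M x).linner ((M x).lsmul a y - ξ) ((M x).lsmul a y - ξ) =
        a * (M x).linner y y * star a - a * (M x).linner y ξ - ((M x).linner ξ y * star a -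
          (M x).linner ξ ξ) := fun x a y ξ => by
    simp only [map_sub, LinearMap.sub_apply, (M x).linner_lsmul, (M x).linner_lsmul_right, mul_assoc]
    abel
  have hT := hA.tendsto_sub (hA.tendsto_sub
    (A.isBundle.tendsto_mul (A.isBundle.tendsto_mul h1 (hLt h2 h2)) (A.isBundle.tendsto_star h1))
    (A.isBundle.tendsto_mul h1 (hLt h2 hξ')))
    (hA.tendsto_sub (A.isBundle.tendsto_mul (hLt hξ' h2) (A.isBundle.tendsto_star h1))
      (hLt hξ' hξ'))
  have hlt := hA.eventually_norm_lt hT (r := ε ^ 2) (by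
    refine lt_of_eq_of_lt (congrArg norm (e x a y (ξ x)).symm) ?_
    rw [(M x).norm_linner_self]
    exact pow_lt_pow_left₀ hn (norm_nonneg _) two_ne_zero)
  filter_upwards [hlt] with p hp
  refine (sq_lt_sq₀ (norm_nonneg _) hε.le).1 ?_
  rw [← (M p.base).norm_linner_self]
  exact lt_of_eq_of_lt (congrArg norm (e p.base p.fst p.snd (ξ p.base))) hp

/-- Continuity of the right action follows from continuity of the right inner product. -/
theorem continuous_rsmul_of_rinner (hY : IsUSCBanachBundle Y)
    (M : ∀ x, ImprimitivityBimodule (A.Fiber x) (B.Fiber x) (Y x))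
    (hR : Continuous (fun p : FibProd Y Y => (⟨p.base, (M p.base).rinner p.fst p.snd⟩ : Tot B.Fiber))) :
    Continuous (fun p : FibProd Y B.Fiber => (⟨p.base, (M p.base).rsmul p.fst p.snd⟩ : Tot Y)) := by
  have h := (continuous_lsmul_of_linner hY.conj (fun x => (M x).conj) hR).comp
    (f := fun p : FibProd Y B.Fiber =>
      (⟨p.base, star p.snd, Conj.mk p.fst⟩ : FibProd B.Fiber fun x => Conj (Y x)))
    (continuous_induced_rng.2 ((B.isBundle.continuous_star.comp (continuous_fibProd_snd _ _)).prodMk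
      (continuous_fibProd_fst _ _)))
  refine h.congr fun p => ?_
  change (⟨p.base, (M p.base).rsmul p.fst (star (star p.snd))⟩ : Tot Y) = _
  rw [star_star]

end TensorBundle

/-! ### Continuity of inner products in a single fibre -/

section ContinuousInner

theorem continuous_of_norm_bilinear_le {Y₁ Y₂ C : Type*} [NormedAddCommGroup Y₁] [NormedSpace ℂ Y₁]
    [NormedAddCommGroup Y₂] [NormedSpace ℂ Y₂] [NormedAddCommGroup C] [NormedSpace ℂ C]
    {σ : ℂ →+* ℂ} [RingHomIsometric σ] (N : Y₁ →ₛₗ[σ] Y₂ →ₗ[ℂ] C)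
    (h : ∀ z z', ‖N z z'‖ ≤ ‖z‖ * ‖z'‖) : Continuous (fun p : Y₁ × Y₂ => N p.1 p.2) := by
  obtain ⟨N', hN⟩ : ∃ N' : Y₁ →SL[σ] Y₂ →L[ℂ] C, ∀ z z', N' z z' = N z z' :=
    ⟨N.mkContinuous₂ 1 (by simpa using h), fun _ _ => rfl⟩
  simp only [← hN]
  fun_prop

variable {A B Z : Type w} [NonUnitalCStarAlgebra A] [NonUnitalCStarAlgebra B]
  [NormedAddCommGroup Z] [NormedSpace ℂ Z] (M : ImprimitivityBimodule A B Z)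

theorem ImprimitivityBimodule.continuous_linner :
    Continuous (fun p : Z × Z => M.linner p.1 p.2) :=
  (continuous_of_norm_bilinear_le M.linner.flip fun z z' => by
    rw [mul_comm]; exact M.norm_linner_le z' z).comp continuous_swap

theorem ImprimitivityBimodule.continuous_rinner :
    Continuous (fun p : Z × Z => M.rinner p.1 p.2) :=
  continuous_of_norm_bilinear_le _ M.norm_rinner_le

end ContinuousInner

/-! ### Sections spanned by elementary tensors -/

section TensorBundle

variable {X : Type u} [TopologicalSpace X] {Z W Y : X → Type w} [∀ x, NormedAddCommGroup (Z x)]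
  [∀ x, NormedSpace ℂ (Z x)] [TopologicalSpace (Tot Z)] [∀ x, NormedAddCommGroup (W x)]
  [∀ x, NormedSpace ℂ (W x)] [TopologicalSpace (Tot W)] [∀ x, NormedAddCommGroup (Y x)]
  [∀ x, NormedSpace ℂ (Y x)]

/-- The sections spanned by the images of tensor products of continuous sections. -/
def tensorSections (ι : ∀ x, Z x ⊗[ℂ] W x →ₗ[ℂ] Y x) : Submodule ℂ (∀ x, Y x) :=
  Submodule.span ℂ {ξ | ∃ (f : ∀ x, Z x) (h : ∀ x, W x),
    Continuous (fun x => (⟨x, f x⟩ : Tot Z)) ∧ Continuous (fun x => (⟨x, h x⟩ : Tot W)) ∧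
    ξ = fun x => ι x (f x ⊗ₜ h x)}

theorem tmul_mem_tensorSections (ι : ∀ x, Z x ⊗[ℂ] W x →ₗ[ℂ] Y x) {f : ∀ x, Z x} {h : ∀ x, W x}
    (hf : Continuous (fun x => (⟨x, f x⟩ : Tot Z))) (hh : Continuous (fun x => (⟨x, h x⟩ : Tot W))) :
    (fun x => ι x (f x ⊗ₜ h x)) ∈ tensorSections ι :=
  Submodule.subset_span ⟨f, h, hf, hh, rfl⟩

theorem exists_mem_tensorSections [T2Space X] [LocallyCompactSpace X] [SecondCountableTopology X]
    (hZ : IsUSCBanachBundle Z) (hW : IsUSCBanachBundle W) (ι : ∀ x, Z x ⊗[ℂ] W x →ₗ[ℂ] Y x) (x : X)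
    (e : Z x ⊗[ℂ] W x) : ∃ ξ ∈ tensorSections ι, ξ x = ι x e := by
  induction e using TensorProduct.induction_on with
  | zero => exact ⟨0, Submodule.zero_mem _, by simp⟩
  | tmul z w =>
    obtain ⟨f, hf, rfl⟩ := hZ.exists_section x z
    obtain ⟨h, hh, rfl⟩ := hW.exists_section x w
    exact ⟨_, tmul_mem_tensorSections ι hf hh, rfl⟩
  | add s t hs ht =>
    obtain ⟨ξ, hξ, hs⟩ := hs
    obtain ⟨ζ, hζ, ht⟩ := ht
    exact ⟨ξ + ζ, Submodule.add_mem _ hξ hζ, by simp [hs, ht]⟩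

/-- Sesquilinear forms preserve continuity of sections if they do so on tensor products. -/
theorem continuous_form_tensorSections {C : X → Type w} [∀ x, NormedAddCommGroup (C x)]
    [∀ x, NormedSpace ℂ (C x)] [TopologicalSpace (Tot C)] (hC : IsUSCBanachBundle C)
    {ι : ∀ x, Z x ⊗[ℂ] W x →ₗ[ℂ] Y x} {σ τ : ℂ →+* ℂ} (N : ∀ x, Y x →ₛₗ[σ] Y x →ₛₗ[τ] C x)
    (H : ∀ (f f' : ∀ x, Z x) (h h' : ∀ x, W x), Continuous (fun x => (⟨x, f x⟩ : Tot Z)) →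
      Continuous (fun x => (⟨x, f' x⟩ : Tot Z)) → Continuous (fun x => (⟨x, h x⟩ : Tot W)) →
      Continuous (fun x => (⟨x, h' x⟩ : Tot W)) →
      Continuous (fun x => (⟨x, N x (ι x (f x ⊗ₜ h x)) (ι x (f' x ⊗ₜ h' x))⟩ : Tot C)))
    {ξ ζ : ∀ x, Y x} (hξ : ξ ∈ tensorSections ι) (hζ : ζ ∈ tensorSections ι) :
    Continuous (fun x => (⟨x, N x (ξ x) (ζ x)⟩ : Tot C)) := by
  induction hξ, hζ using Submodule.span_induction₂ with
  | mem_mem ξ ζ hξ hζ =>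
    obtain ⟨f, h, hf, hh, rfl⟩ := hξ
    obtain ⟨f', h', hf', hh', rfl⟩ := hζ
    exact H f f' h h' hf hf' hh hh'
  | zero_left ζ => simpa using hC.continuous_zero_section
  | zero_right ξ => simpa using hC.continuous_zero_section
  | add_left ξ ξ' ζ _ _ _ h h' => simpa using hC.continuous_add_section h h'
  | add_right ξ ζ ζ' _ _ _ h h' => simpa using hC.continuous_add_section h h'
  | smul_left k ξ ζ _ _ h => simpa [Function.comp_def] using (hC.continuous_smul (σ k)).comp h
  | smul_right k ξ ζ _ _ h => simpa [Function.comp_def] using (hC.continuous_smul (τ k)).comp h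

end TensorBundle

/-! ### Equivariant bundles from completed tensor products -/

section Systems

variable {X : Type u} [Groupoid.{v} X] [TopologicalSpace X] [TopologicalSpace (Quiver.Total X)]
  [IsLCHGroupoid X] [T2Space X] [LocallyCompactSpace X] [SecondCountableTopology X]

/-- Completions of the fibrewise tensor products of two equivariant Banach bundles form an
equivariant imprimitivity bimodule bundle. -/
theorem moritaEquiv_of_tensor {A B : DynSystem.{u, v, w} X} {Z W Y : X → Type w}
    [∀ x, NormedAddCommGroup (Z x)] [∀ x, NormedSpace ℂ (Z x)] [TopologicalSpace (Tot Z)]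
    [∀ x, NormedAddCommGroup (W x)] [∀ x, NormedSpace ℂ (W x)] [TopologicalSpace (Tot W)]
    [∀ x, NormedAddCommGroup (Y x)] [∀ x, NormedSpace ℂ (Y x)]
    (hZ : IsUSCBanachBundle Z) (hW : IsUSCBanachBundle W)
    (VZ : ∀ {x y : X}, (x ⟶ y) → (Z x ≃ₗᵢ[ℂ] Z y)) (VW : ∀ {x y : X}, (x ⟶ y) → (W x ≃ₗᵢ[ℂ] W y))
    (hVZ : ∀ {x y z : X} (h : x ⟶ y) (g : y ⟶ z) (ξ : Z x), VZ (h ≫ g) ξ = VZ g (VZ h ξ))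
    (hVW : ∀ {x y z : X} (h : x ⟶ y) (g : y ⟶ z) (ξ : W x), VW (h ≫ g) ξ = VW g (VW h ξ))
    (cVZ : Continuous (fun p : ActProd Z => (⟨p.tgt, VZ p.hom p.val⟩ : Tot Z)))
    (cVW : Continuous (fun p : ActProd W => (⟨p.tgt, VW p.hom p.val⟩ : Tot W)))
    (M : ∀ x, ImprimitivityBimodule (A.Fiber x) (B.Fiber x) (Y x))
    (ι : ∀ x, Z x ⊗[ℂ] W x →ₗ[ℂ] Y x) (hι : ∀ x, DenseRange (ι x))
    (hn : ∀ x z w, ‖ι x (z ⊗ₜ w)‖ ≤ ‖z‖ * ‖w‖)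
    (hL : ∀ (f f' : ∀ x, Z x) (h h' : ∀ x, W x), Continuous (fun x => (⟨x, f x⟩ : Tot Z)) →
      Continuous (fun x => (⟨x, f' x⟩ : Tot Z)) → Continuous (fun x => (⟨x, h x⟩ : Tot W)) →
      Continuous (fun x => (⟨x, h' x⟩ : Tot W)) → Continuous (fun x =>
        (⟨x, (M x).linner (ι x (f x ⊗ₜ h x)) (ι x (f' x ⊗ₜ h' x))⟩ : Tot A.Fiber)))
    (hR : ∀ (f f' : ∀ x, Z x) (h h' : ∀ x, W x), Continuous (fun x => (⟨x, f x⟩ : Tot Z)) →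
      Continuous (fun x => (⟨x, f' x⟩ : Tot Z)) → Continuous (fun x => (⟨x, h x⟩ : Tot W)) →
      Continuous (fun x => (⟨x, h' x⟩ : Tot W)) → Continuous (fun x =>
        (⟨x, (M x).rinner (ι x (f x ⊗ₜ h x)) (ι x (f' x ⊗ₜ h' x))⟩ : Tot B.Fiber)))
    (eL : ∀ {x y : X} (g : x ⟶ y) (z z' : Z x) (w w' : W x),
      (M y).linner (ι y (VZ g z ⊗ₜ VW g w)) (ι y (VZ g z' ⊗ₜ VW g w')) =
        A.act g ((M x).linner (ι x (z ⊗ₜ w)) (ι x (z' ⊗ₜ w'))))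
    (eR : ∀ {x y : X} (g : x ⟶ y) (z z' : Z x) (w w' : W x),
      (M y).rinner (ι y (VZ g z ⊗ₜ VW g w)) (ι y (VZ g z' ⊗ₜ VW g w')) =
        B.act g ((M x).rinner (ι x (z ⊗ₜ w)) (ι x (z' ⊗ₜ w')))) :
    MoritaEquiv A B := by
  have hcompl := fun x => (M x).complete
  let T : ∀ {x y : X}, (x ⟶ y) → (Z x ⊗[ℂ] W x ≃ₗ[ℂ] Z y ⊗[ℂ] W y) := fun g =>
    TensorProduct.congr (VZ g).toLinearEquiv (VW g).toLinearEquiv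
  have hTt : ∀ {x y : X} (g : x ⟶ y) (z : Z x) (w : W x),
      T g (z ⊗ₜ w) = VZ g z ⊗ₜ VW g w := fun g z w => rfl
  have eL' : ∀ {x y : X} (g : x ⟶ y) (e e' : Z x ⊗[ℂ] W x),
      (M y).linner (ι y (T g e)) (ι y (T g e')) = A.act g ((M x).linner (ι x e) (ι x e')) := by
    intro x y g e e'
    induction e using TensorProduct.induction_on with
    | zero => simp
    | add s t hs ht => simp [hs, ht]
    | tmul z w =>
      induction e' using TensorProduct.induction_on with
      | zero => simp
      | add s t hs ht => simp only [map_add, hs, ht]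
      | tmul z' w' => exact eL g z z' w w'
  have eR' : ∀ {x y : X} (g : x ⟶ y) (e e' : Z x ⊗[ℂ] W x),
      (M y).rinner (ι y (T g e)) (ι y (T g e')) = B.act g ((M x).rinner (ι x e) (ι x e')) := by
    intro x y g e e'
    induction e using TensorProduct.induction_on with
    | zero => simp
    | add s t hs ht => simp [hs, ht]
    | tmul z w =>
      induction e' using TensorProduct.induction_on with
      | zero => simp
      | add s t hs ht => simp only [map_add, hs, ht]
      | tmul z' w' => exact eR g z z' w w'
  have hTn : ∀ {x y : X} (g : x ⟶ y) (e : Z x ⊗[ℂ] W x), ‖ι y (T g e)‖ = ‖ι x e‖ := fun g e => by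
    refine (sq_eq_sq₀ (norm_nonneg _) (norm_nonneg _)).1 ?_
    rw [← (M _).norm_linner_self, eL', norm_starEquiv, (M _).norm_linner_self]
  choose V hV using fun (x y : X) (g : x ⟶ y) =>
    exists_isometry_extension (hι x) (hι y) (T g) (hTn g)
  let := fellTopology (tensorSections ι)
  have hLΓ := fun {ξ ζ} => continuous_form_tensorSections (ξ := ξ) (ζ := ζ)
    A.isBundle.toIsUSCBanachBundle (fun x => (M x).linner) hL
  have hRΓ := fun {ξ ζ} => continuous_form_tensorSections (ξ := ξ) (ζ := ζ)
    B.isBundle.toIsUSCBanachBundle (fun x => (M x).rinner) hR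
  -- The squared norm of a section is the norm of its inner square, a continuous section of `A`;
  -- this supplies the upper semicontinuity needed to construct the bundle.
  obtain ⟨hY, hΓ⟩ := isUSCBanachBundle_fellTopology hcompl (tensorSections ι)
    (fun ξ hξ x r hr => by
      have hr0 : 0 ≤ r := (norm_nonneg _).trans hr.le
      have h := A.isBundle.eventually_norm_lt ((hLΓ hξ hξ).tendsto x) (r := r ^ 2) (by
        rw [(M x).norm_linner_self]
        exact pow_lt_pow_left₀ hr (norm_nonneg _) two_ne_zero)
      filter_upwards [h] with y hy
      rw [(M y).norm_linner_self] at hy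
      exact (sq_lt_sq₀ (norm_nonneg _) hr0).1 hy)
    (fun x v ε hε => by
      obtain ⟨_, ⟨e, rfl⟩, he⟩ := Metric.mem_closure_iff.1 (hι x v) ε hε
      obtain ⟨ξ, hξ, hx⟩ := exists_mem_tensorSections hZ hW ι x e
      exact ⟨ξ, hξ, by rwa [hx, ← dist_eq_norm]⟩)
  have hτ := hZ.continuous_bilinear hW hY (fun x z w => ι x (z ⊗ₜ w))
    (fun x z z' w => by rw [TensorProduct.sub_tmul, map_sub])
    (fun x z w w' => by rw [TensorProduct.tmul_sub, map_sub]) hn hZ.dense_continuous_sections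
    hW.dense_continuous_sections
    (fun f hf h hh => hΓ.continuous _ (tmul_mem_tensorSections ι hf hh))
  have hlin := hY.continuous_bilinear hY A.isBundle.toIsUSCBanachBundle
    (fun x z w => (M x).linner z w) (by simp) (by simp) (fun x => (M x).norm_linner_le) hΓ hΓ
    (fun ξ hξ ζ hζ => hLΓ hξ hζ)
  have hrin := hY.continuous_bilinear hY B.isBundle.toIsUSCBanachBundle
    (fun x z w => (M x).rinner z w) (by simp) (by simp) (fun x => (M x).norm_rinner_le) hΓ hΓ
    (fun ξ hξ ζ hζ => hRΓ hξ hζ)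
  have hp : Continuous (fun p : ActProd Y =>
      ((⟨p.src, p.tgt, p.hom⟩ : Quiver.Total X), (⟨p.src, p.val⟩ : Tot Y))) :=
    continuous_induced_dom
  have hE := continuous_fst.comp hp
  have hs : Continuous (fun p : ActProd Y => p.src) :=
    hY.continuous_proj.comp (continuous_snd.comp hp)
  have hVc : ∀ ξ ∈ tensorSections ι,
      Continuous (fun p : ActProd Y => (⟨p.tgt, V _ _ p.hom (ξ p.src)⟩ : Tot Y)) := by
    intro ξ hξ
    induction hξ using Submodule.span_induction with
    | mem ξ hξ =>
      obtain ⟨f, h, hf, hh, rfl⟩ := hξ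
      simp only [hV, hTt]
      exact hτ.comp (f := fun p : ActProd Y =>
        (⟨p.tgt, VZ p.hom (f p.src), VW p.hom (h p.src)⟩ : FibProd Z W))
        (continuous_induced_rng.2
          ((cVZ.comp (f := fun p : ActProd Y => (⟨p.src, p.tgt, p.hom, f p.src⟩ : ActProd Z))
            (continuous_induced_rng.2 (hE.prodMk (hf.comp hs)))).prodMk
          (cVW.comp (f := fun p : ActProd Y => (⟨p.src, p.tgt, p.hom, h p.src⟩ : ActProd W))
            (continuous_induced_rng.2 (hE.prodMk (hh.comp hs))))))
    | zero =>
      simp only [Pi.zero_apply, map_zero]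
      exact hY.continuous_zero_section.comp ((continuous_target X).comp hE)
    | add ξ ζ _ _ h1 h2 =>
      simp only [Pi.add_apply, map_add]
      exact hY.continuous_add.comp (f := fun p : ActProd Y =>
        (⟨p.tgt, V _ _ p.hom (ξ p.src), V _ _ p.hom (ζ p.src)⟩ : FibProd Y Y))
        (continuous_induced_rng.2 (h1.prodMk h2))
    | smul k ξ _ h1 =>
      simp only [Pi.smul_apply, map_smul]
      exact (hY.continuous_smul k).comp h1
  refine ⟨
    { Fiber := Y
      isBundle := hY
      bimod := M
      continuous_lsmul := continuous_lsmul_of_linner hY M hlin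
      continuous_rsmul := continuous_rsmul_of_rinner hY M hrin
      continuous_linner := hlin
      continuous_rinner := hrin
      V := fun g => V _ _ g
      V_comp := fun {x y z} h g => denseRange_ext (hι x) (g := V _ _ (h ≫ g))
        (h := fun ξ => V _ _ g (V _ _ h ξ)) (LinearIsometryEquiv.continuous _)
        ((LinearIsometryEquiv.continuous _).comp (LinearIsometryEquiv.continuous _)) fun e => by
          simp only [hV]
          congr 1
          induction e using TensorProduct.induction_on with
          | zero => simp
          | add s t hs ht => simp only [map_add, hs, ht]
          | tmul z w => simp only [hTt, hVZ, hVW]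
      continuous_V := hY.continuous_action (fun g => V _ _ g)
        (fun g u v => by rw [← map_sub, LinearIsometryEquiv.norm_map]) hΓ hVc
      linner_V := fun {x y} g => ?_
      rinner_V := fun {x y} g => ?_ }⟩
  · exact denseRange_ext₂ (hι x) (hι x) (F := fun ξ ζ => (M y).linner (V _ _ g ξ) (V _ _ g ζ))
      (G := fun ξ ζ => A.act g ((M x).linner ξ ζ))
      ((M y).continuous_linner.comp (by fun_prop : Continuous fun p : Y x × Y x =>
        (V _ _ g p.1, V _ _ g p.2)))
      ((continuous_starEquiv _).comp (M x).continuous_linner)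
      (fun e e' => by simp only [hV, eL'])
  · exact denseRange_ext₂ (hι x) (hι x) (F := fun ξ ζ => (M y).rinner (V _ _ g ξ) (V _ _ g ζ))
      (G := fun ξ ζ => B.act g ((M x).rinner ξ ζ))
      ((M y).continuous_rinner.comp (by fun_prop : Continuous fun p : Y x × Y x =>
        (V _ _ g p.1, V _ _ g p.2)))
      ((continuous_starEquiv _).comp (M x).continuous_rinner)
      (fun e e' => by simp only [hV, eR'])

end Systems

/-! ### Forms on tensor products -/

section TensorForm

variable {Z W Z' W' Z'' W'' G : Type*} [AddCommGroup Z] [Module ℂ Z] [AddCommGroup W] [Module ℂ W]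
  [AddCommGroup Z'] [Module ℂ Z'] [AddCommGroup W'] [Module ℂ W']
  [AddCommGroup Z''] [Module ℂ Z''] [AddCommGroup W''] [Module ℂ W''] [AddCommGroup G]

/-- The form on tensor products given by a map of four variables. -/
def tensorForm [Module ℂ G] {σ τ : ℂ →+* ℂ} (F : Z →ₛₗ[σ] W →ₛₗ[σ] Z' →ₛₗ[τ] W' →ₛₗ[τ] G) :
    Z ⊗[ℂ] W →ₛₗ[σ] Z' ⊗[ℂ] W' →ₛₗ[τ] G :=
  TensorProduct.lift (F.compr₂ₛₗ (TensorProduct.lift.equiv τ Z' W' G).toLinearMap)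

@[simp]
theorem tensorForm_tmul [Module ℂ G] {σ τ : ℂ →+* ℂ}
    (F : Z →ₛₗ[σ] W →ₛₗ[σ] Z' →ₛₗ[τ] W' →ₛₗ[τ] G) (z : Z) (w : W) (z' : Z') (w' : W') :
    tensorForm F (z ⊗ₜ w) (z' ⊗ₜ w') = F z w z' w' := rfl

theorem tensor_ext₁ {F F' : Z ⊗[ℂ] W → G} (hF : ∀ s t, F (s + t) = F s + F t)
    (hF' : ∀ s t, F' (s + t) = F' s + F' t) (H : ∀ z w, F (z ⊗ₜ w) = F' (z ⊗ₜ w))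
    (s : Z ⊗[ℂ] W) : F s = F' s := by
  induction s using TensorProduct.induction_on with
  | zero =>
    have h := hF 0 0
    have h' := hF' 0 0
    rw [add_zero] at h h'
    rw [left_eq_add.1 h, left_eq_add.1 h']
  | tmul z w => exact H z w
  | add s t hs ht => rw [hF, hF', hs, ht]

theorem tensor_ext₂ {F F' : Z ⊗[ℂ] W → Z' ⊗[ℂ] W' → G}
    (h1 : ∀ s t u, F (s + t) u = F s u + F t u) (h2 : ∀ s t u, F s (t + u) = F s t + F s u)
    (h1' : ∀ s t u, F' (s + t) u = F' s u + F' t u) (h2' : ∀ s t u, F' s (t + u) = F' s t + F' s u)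
    (H : ∀ z w z' w', F (z ⊗ₜ w) (z' ⊗ₜ w') = F' (z ⊗ₜ w) (z' ⊗ₜ w')) (s : Z ⊗[ℂ] W)
    (t : Z' ⊗[ℂ] W') : F s t = F' s t :=
  tensor_ext₁ (F := fun s => F s t) (F' := fun s => F' s t) (fun s s' => h1 s s' t) (fun s s' => h1' s s' t)
    (fun z w => tensor_ext₁ (h2 _) (h2' _) (H z w) t) s

theorem tensor_ext₃ {F F' : Z ⊗[ℂ] W → Z' ⊗[ℂ] W' → Z'' ⊗[ℂ] W'' → G}
    (h1 : ∀ s t u v, F (s + t) u v = F s u v + F t u v)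
    (h2 : ∀ s t u v, F s (t + u) v = F s t v + F s u v)
    (h3 : ∀ s t u v, F s t (u + v) = F s t u + F s t v)
    (h1' : ∀ s t u v, F' (s + t) u v = F' s u v + F' t u v)
    (h2' : ∀ s t u v, F' s (t + u) v = F' s t v + F' s u v)
    (h3' : ∀ s t u v, F' s t (u + v) = F' s t u + F' s t v)
    (H : ∀ z w z' w' z'' w'', F (z ⊗ₜ w) (z' ⊗ₜ w') (z'' ⊗ₜ w'') =
      F' (z ⊗ₜ w) (z' ⊗ₜ w') (z'' ⊗ₜ w'')) (s : Z ⊗[ℂ] W) (t : Z' ⊗[ℂ] W') (u : Z'' ⊗[ℂ] W'') :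
    F s t u = F' s t u :=
  tensor_ext₁ (F := fun s => F s t u) (F' := fun s => F' s t u) (fun s s' => h1 s s' t u)
    (fun s s' => h1' s s' t u)
    (fun z w => tensor_ext₂ (h2 _) (h3 _) (h2' _) (h3' _) (H z w) t u) s

end TensorForm

/-- Positivity of forms on tensor products can be checked on rank one Gram matrices. -/
theorem ImprimitivityBimodule.exists_gram_star_mul_self {A B Z : Type w} [NonUnitalCStarAlgebra A]
    [NonUnitalCStarAlgebra B] [NormedAddCommGroup Z] [NormedSpace ℂ Z]
    (M : ImprimitivityBimodule A B Z) {ι : Type*} (s : Finset ι) (z : ι → Z) {G : Type*}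
    [NonUnitalCStarAlgebra G] (N : ι → ι → B →ₗ[ℂ] G) (C : ι → ι → ℝ)
    (hN : ∀ i j b, ‖N i j b‖ ≤ C i j * ‖b‖)
    (H : ∀ t : ι → B, ∃ d, ∑ i ∈ s, ∑ j ∈ s, N i j (star (t i) * t j) = star d * d) :
    ∃ d, ∑ i ∈ s, ∑ j ∈ s, N i j (M.rinner (z i) (z j)) = star d * d := by
  refine exists_star_mul_self_of_approx fun ε hε => ?_
  let K := ∑ i ∈ s, ∑ j ∈ s, |C i j| + 1
  have hK : 0 < K := by positivity
  -- Replacing the Gram matrix by a sum of matrices `star (t k i) * t k j`, with entrywise error at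
  -- most `ε / K`, changes the double sum by at most `ε`. The approximating sum is positive by `H`,
  -- and the positive cone is closed.
  obtain ⟨t, ht⟩ := M.exists_gram s z (div_pos hε hK)
  choose d hd using fun k => H (t k)
  obtain ⟨b, hb⟩ := exists_star_mul_self_sum s (fun k => star (d k) * d k) fun k _ => ⟨d k, rfl⟩
  refine ⟨b, ?_⟩
  have e : ∑ k ∈ s, star (d k) * d k =
      ∑ i ∈ s, ∑ j ∈ s, N i j (∑ k ∈ s, star (t k i) * t k j) := by
    simp only [← hd, map_sum]
    rw [Finset.sum_comm]
    exact Finset.sum_congr rfl fun i _ => Finset.sum_comm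
  rw [← hb, e, ← Finset.sum_sub_distrib]
  simp only [← Finset.sum_sub_distrib, ← map_sub]
  calc _ ≤ ∑ i ∈ s, ∑ j ∈ s, |C i j| * (ε / K) :=
        norm_sum_le_of_le _ fun i hi => norm_sum_le_of_le _ fun j hj =>
          (hN i j _).trans (mul_le_mul (le_abs_self _) (ht i hi j hj) (norm_nonneg _) (abs_nonneg _))
    _ = (∑ i ∈ s, ∑ j ∈ s, |C i j|) * (ε / K) := by simp only [Finset.sum_mul]
    _ ≤ K * (ε / K) := by gcongr; exact le_add_of_nonneg_right zero_le_one
    _ = ε := by field_simp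

/-- Boundedness of the right action from boundedness of the left action on the conjugate. -/
theorem PreBimodule.rsmul_le_of_conj {A₀ B₀ E E' A B : Type*} [NonUnitalRing A₀] [Module ℂ A₀]
    [StarRing A₀] [NonUnitalRing B₀] [Module ℂ B₀] [StarRing B₀] [AddCommGroup E] [Module ℂ E]
    [AddCommGroup E'] [Module ℂ E'] [NonUnitalCStarAlgebra A] [NonUnitalCStarAlgebra B]
    {P : PreBimodule A₀ B₀ E} {P' : PreBimodule B₀ A₀ E'} {f : A₀ →⋆ₙₐ[ℂ] A} {g : B₀ →⋆ₙₐ[ℂ] B}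
    (c : E → E') (hR : ∀ s t, P'.rinner (c s) (c t) = P.linner s t)
    (hc : ∀ e b, c (P.rsmul e b) = P'.lsmul (star b) (c e))
    (hpos : ∀ z, ∃ b, f (P'.rinner z z) = star b * b)
    (hle : ∀ p : Seminorm ℂ E', IsFormSeminorm p (P'.rform f) →
      ∀ a z, p (P'.lsmul a z) ≤ ‖g a‖ * p z)
    (p : Seminorm ℂ E) (hp : IsFormSeminorm p (P.lform f)) (z : E) (b : B₀) :
    p (P.rsmul z b) ≤ ‖g b‖ * p z := by
  -- Since `c` intertwines the left form with the right form of the second bimodule, `p` is the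
  -- pullback of `q` along `c`; the estimate for the left action there is the desired one.
  obtain ⟨q, hq⟩ := P'.exists_rform_seminorm f hpos
  have h : ∀ e, p e = q (c e) := fun e => by
    refine (sq_eq_sq₀ (apply_nonneg _ _) (apply_nonneg _ _)).1 ?_
    rw [← hp.sq, ← hq.sq, lform_apply, rform_apply, hR]
  rw [h, h, hc]
  refine (hle q hq _ _).trans_eq ?_
  rw [map_star, norm_star]

/-! ### Composition of imprimitivity bimodules -/

namespace ImprimitivityBimodule

variable {A B C Z W : Type w} [NonUnitalCStarAlgebra A] [NonUnitalCStarAlgebra B]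
  [NonUnitalCStarAlgebra C] [NormedAddCommGroup Z] [NormedSpace ℂ Z] [NormedAddCommGroup W]
  [NormedSpace ℂ W]

/-- The left inner product on the algebraic balanced tensor product. -/
def compLinner (M : ImprimitivityBimodule A B Z) (N : ImprimitivityBimodule B C W) :
    Z ⊗[ℂ] W →ₗ[ℂ] Z ⊗[ℂ] W →ₗ⋆[ℂ] A :=
  tensorForm (LinearMap.mk₂'ₛₗ _ _ (fun z w => LinearMap.mk₂'ₛₗ _ _
      (fun z' w' => M.linner (M.rsmul z (N.linner w w')) z')
      (by simp) (by simp) (by simp) (by simp))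
    (by intros; ext; simp) (by intros; ext; simp) (by intros; ext; simp) (by intros; ext; simp))

@[simp]
theorem compLinner_tmul (M : ImprimitivityBimodule A B Z) (N : ImprimitivityBimodule B C W)
    (z z' : Z) (w w' : W) : compLinner M N (z ⊗ₜ w) (z' ⊗ₜ w') =
      M.linner (M.rsmul z (N.linner w w')) z' := rfl

/-- The right inner product on the algebraic balanced tensor product. -/
def compRinner (M : ImprimitivityBimodule A B Z) (N : ImprimitivityBimodule B C W) :
    Z ⊗[ℂ] W →ₗ⋆[ℂ] Z ⊗[ℂ] W →ₗ[ℂ] C :=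
  tensorForm (LinearMap.mk₂'ₛₗ _ _ (fun z w => LinearMap.mk₂'ₛₗ _ _
      (fun z' w' => N.rinner w (N.lsmul (M.rinner z z') w'))
      (by simp) (by simp) (by simp) (by simp))
    (by intros; ext; simp) (by intros; ext; simp) (by intros; ext; simp) (by intros; ext; simp))

@[simp]
theorem compRinner_tmul (M : ImprimitivityBimodule A B Z) (N : ImprimitivityBimodule B C W)
    (z z' : Z) (w w' : W) : compRinner M N (z ⊗ₜ w) (z' ⊗ₜ w') =
      N.rinner w (N.lsmul (M.rinner z z') w') := rfl

/-- The algebraic balanced tensor product of imprimitivity bimodules. -/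
def comp (M : ImprimitivityBimodule A B Z) (N : ImprimitivityBimodule B C W) :
    PreBimodule A C (Z ⊗[ℂ] W) where
  -- The tensor product is taken over `ℂ`. The differences `(z b) ⊗ w - z ⊗ (b w)` are null for the
  -- inner products, so completion imposes the balancing over `B`.
  lsmul := LinearMap.rTensorHom W ∘ₗ M.lsmul
  rsmul := (LinearMap.lTensorHom Z ∘ₗ N.rsmul.flip).flip
  linner := compLinner M N
  rinner := compRinner M N
  mul_lsmul a a' := tensor_ext₁ (by simp) (by simp) (by simp [M.mul_lsmul])
  rsmul_mul s b b' := by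
    induction s using TensorProduct.induction_on with
    | zero => simp
    | tmul z w => simp [N.rsmul_mul]
    | add s t hs ht => simp_all
  lsmul_rsmul a s b := by
    induction s using TensorProduct.induction_on with
    | zero => simp
    | tmul z w => simp
    | add s t hs ht => simp_all
  linner_lsmul a := tensor_ext₂ (by simp) (by simp) (by simp [mul_add]) (by simp [mul_add])
    (by simp [M.linner_lsmul, M.lsmul_rsmul])
  rinner_rsmul s t c := by
    revert s t
    exact tensor_ext₂ (by simp) (by simp) (by simp [add_mul])
      (by simp [add_mul]) (by simp [N.rinner_rsmul, ← N.lsmul_rsmul])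
  star_linner := tensor_ext₂ (by simp) (by simp) (by simp) (by simp)
    (by simp [M.star_linner, M.linner_rsmul, N.star_linner])
  star_rinner := tensor_ext₂ (by simp) (by simp) (by simp) (by simp)
    (by simp [N.star_rinner, N.rinner_lsmul, M.star_rinner])
  rinner_lsmul a := tensor_ext₂ (by simp) (by simp) (by simp) (by simp) (by simp [M.rinner_lsmul])
  linner_rsmul s c t := by
    revert s t
    exact tensor_ext₂ (by simp) (by simp) (by simp) (by simp) (by simp [N.linner_rsmul])
  rinner_lsmul_linner v s t u := by
    revert s t u
    induction v using TensorProduct.induction_on with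
    | zero => simp
    | tmul z₀ w₀ =>
      refine tensor_ext₃ (by simp) (by simp) (by simp) (by simp) (by simp) (by simp)
        (fun z w z' w' z'' w'' => ?_)
      simp [M.linner_lsmul_eq, M.rinner_rsmul, N.mul_lsmul, ← N.linner_lsmul_eq]
    | add s t hs ht => intro x y z; simp only [map_add, LinearMap.add_apply, hs, ht]
  linner_lsmul_linner s t u v := by
    revert s t u
    induction v using TensorProduct.induction_on with
    | zero => simp
    | tmul z₀ w₀ =>
      refine tensor_ext₃ (by simp) (by simp) (by simp) (by simp) (by simp) (by simp)
        (fun z w z' w' z'' w'' => ?_)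
      simp [M.linner_lsmul_eq, M.rsmul_mul, ← N.linner_lsmul_eq, N.linner_lsmul]
    | add s t hs ht => intro x y z; simp only [map_add, hs, ht]

end ImprimitivityBimodule

namespace ImprimitivityBimodule

variable {A B C Z W : Type w} [NonUnitalCStarAlgebra A] [NonUnitalCStarAlgebra B]
  [NonUnitalCStarAlgebra C] [NormedAddCommGroup Z] [NormedSpace ℂ Z] [NormedAddCommGroup W]
  [NormedSpace ℂ W] (M : ImprimitivityBimodule A B Z) (N : ImprimitivityBimodule B C W)

theorem comp_linner_tmul (z z' : Z) (w w' : W) :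
    (M.comp N).linner (z ⊗ₜ w) (z' ⊗ₜ w') = M.linner (M.rsmul z (N.linner w w')) z' := rfl

theorem comp_rinner_tmul (z z' : Z) (w w' : W) :
    (M.comp N).rinner (z ⊗ₜ w) (z' ⊗ₜ w') = N.rinner w (N.lsmul (M.rinner z z') w') := rfl

/-- The inner square of `∑ z_i ⊗ w_i` is `∑ ⟨w_i, ⟨z_i, z_j⟩ w_j⟩`. If the Gram matrix is replaced
by `star (t i) * t j`, this becomes the inner square of `∑ t_i w_i`, which is positive. -/
theorem comp_rinner_pos (e : Z ⊗[ℂ] W) : ∃ c, (M.comp N).rinner e e = star c * c := by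
  obtain ⟨S, rfl⟩ := TensorProduct.exists_finset e
  have e : (M.comp N).rinner (∑ i ∈ S, i.1 ⊗ₜ i.2) (∑ i ∈ S, i.1 ⊗ₜ i.2) =
      ∑ i ∈ S, ∑ j ∈ S, N.rinner i.2 (N.lsmul (M.rinner i.1 j.1) j.2) := by
    simp only [map_sum, LinearMap.sum_apply, comp_rinner_tmul]
    exact Finset.sum_comm
  rw [e]
  refine M.exists_gram_star_mul_self S (fun i => i.1)
    (fun i j => N.rinner i.2 ∘ₗ N.lsmul.flip j.2) (fun i j => ‖i.2‖ * ‖j.2‖) (fun i j b => ?_)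
    fun t => ?_
  · refine (N.norm_rinner_le _ _).trans ?_
    rw [mul_assoc, mul_comm ‖j.2‖]
    exact mul_le_mul_of_nonneg_left (N.norm_lsmul_le _ _) (norm_nonneg _)
  · obtain ⟨d, hd⟩ := N.rinner_self_nonneg (∑ i ∈ S, N.lsmul (t i) i.2)
    refine ⟨d, hd.symm.trans ?_ |>.symm⟩
    simp only [map_sum, LinearMap.sum_apply, N.rinner_lsmul, LinearMap.comp_apply,
      LinearMap.flip_apply, N.mul_lsmul]
    exact Finset.sum_comm

theorem comp_lsmul_le (p : Seminorm ℂ (Z ⊗[ℂ] W))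
    (hp : IsFormSeminorm p ((M.comp N).rform (NonUnitalStarAlgHom.id ℂ C))) (a : A) (e : Z ⊗[ℂ] W) :
    p ((M.comp N).lsmul a e) ≤ ‖a‖ * p e :=
  hp.action_le (M.comp N).lsmul (M.comp N).mul_lsmul (M.comp N).rinner_lsmul a e

/-- The flip from a balanced tensor product to the balanced tensor product of the conjugates. -/
def compConj : Z ⊗[ℂ] W →ₗ⋆[ℂ] Conj W ⊗[ℂ] Conj Z :=
  TensorProduct.lift (LinearMap.mk₂'ₛₗ _ _ (fun z w => Conj.mk w ⊗ₜ[ℂ] Conj.mk z)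
    (by simp [TensorProduct.tmul_add]) (by intros; rw [map_smulₛₗ, TensorProduct.tmul_smul])
    (by simp [TensorProduct.add_tmul])
    (by intros; rw [map_smulₛₗ, TensorProduct.smul_tmul']))

theorem compConj_tmul (z : Z) (w : W) : compConj (z ⊗ₜ[ℂ] w) = Conj.mk w ⊗ₜ[ℂ] Conj.mk z := rfl

/-- The conjugate of a composite is the composite of the conjugates in reverse order. Facts about
the right inner product thereby give those about the left one, and conversely. -/
theorem comp_conj_rinner : ∀ s t : Z ⊗[ℂ] W,
    (N.conj.comp M.conj).rinner (compConj s) (compConj t) = (M.comp N).linner s t :=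
  tensor_ext₂ (by simp) (by simp) (by simp) (by simp) fun z w z' w' => by
    rw [compConj_tmul, compConj_tmul, comp_rinner_tmul, comp_linner_tmul, conj_rinner, conj_lsmul,
      conj_rinner, M.linner_rsmul]
    rfl

theorem comp_conj_lsmul (e : Z ⊗[ℂ] W) (c : C) :
    compConj ((M.comp N).rsmul e c) = (N.conj.comp M.conj).lsmul (star c) (compConj e) := by
  induction e using TensorProduct.induction_on with
  | zero => simp
  | tmul z w =>
    change Conj.mk (N.rsmul w c) ⊗ₜ[ℂ] Conj.mk z =
      Conj.mk (N.rsmul w (star (star c))) ⊗ₜ[ℂ] Conj.mk z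
    rw [star_star]
  | add s t hs ht => simp only [map_add, LinearMap.add_apply, hs, ht]

/-- Fullness of `N` puts all `⟨z b, z'⟩` in the closed span. Taking for `b` an inner product turns
these into products of two left inner products of `M`; by fullness of `M` all products in `A`
follow, and they span a dense subspace. -/
theorem comp_linner_full :
    Dense (Submodule.span ℂ {a | ∃ s t, a = (M.comp N).linner s t} : Set A) := by
  set S := Submodule.span ℂ {a | ∃ s t, a = (M.comp N).linner s t}
  have h1 : ∀ (b : B) (z z' : Z), M.linner (M.rsmul z b) z' ∈ closure (S : Set A) := by
    intro b z z'
    have hc : Continuous fun b => M.linner (M.rsmul z b) z' :=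
      M.continuous_linner.comp ((AddMonoidHomClass.continuous_of_bound (M.rsmul z) ‖z‖
        (M.norm_rsmul_le z)).prodMk continuous_const)
    refine map_mem_closure (f := fun b => M.linner (M.rsmul z b) z') hc (N.linner_full b) fun b hb => ?_
    induction hb using Submodule.span_induction with
    | mem b hb =>
      obtain ⟨w, w', rfl⟩ := hb
      exact Submodule.subset_span ⟨z ⊗ₜ w, z' ⊗ₜ w', rfl⟩
    | zero => simp
    | add b b' _ _ h h' => simpa using S.add_mem h h'
    | smul k b _ h => simpa using S.smul_mem k h
  let T := S.topologicalClosure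
  have h2 : ∀ z z' y y', M.linner z z' * M.linner y y' ∈ T := fun z z' y y' => by
    have := h1 (M.rinner z' y) z y'
    rwa [← M.linner_lsmul_eq, M.linner_lsmul] at this
  have h3 : ∀ a a' : A, a * a' ∈ T := by
    have hT : IsClosed (T : Set A) := S.isClosed_topologicalClosure
    have hl : ∀ z z' (a' : A), M.linner z z' * a' ∈ T := fun z z' a' => by
      refine hT.closure_subset (map_mem_closure (continuous_const_mul _) (M.linner_full a')
        fun a ha => ?_)
      induction ha using Submodule.span_induction with
      | mem a ha => obtain ⟨y, y', rfl⟩ := ha; exact h2 z z' y y'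
      | zero => simp
      | add b b' _ _ h h' => simpa [mul_add] using T.add_mem h h'
      | smul k b _ h => rw [mul_smul_comm]; exact T.smul_mem k h
    intro a a'
    refine hT.closure_subset (map_mem_closure (f := fun x => x * a') (continuous_mul_const a') (M.linner_full a)
      fun a ha => ?_)
    induction ha using Submodule.span_induction with
    | mem a ha => obtain ⟨y, y', rfl⟩ := ha; exact hl y y' a'
    | zero => simp
    | add b b' _ _ h h' => simpa [add_mul] using T.add_mem h h'
    | smul k b _ h =>
      change k • b * a' ∈ T
      rw [smul_mul_assoc]
      exact T.smul_mem k h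
  have h4 : Submodule.span ℂ {x | ∃ a a' : A, x = a * a'} ≤ T :=
    Submodule.span_le.2 (by rintro _ ⟨a, a', rfl⟩; exact h3 a a')
  intro a
  have := closure_mono h4 (dense_span_mul {x : A | ∃ a a', x = a * a'} (fun a b => ⟨a, b, rfl⟩) a)
  rwa [S.isClosed_topologicalClosure.closure_eq] at this

theorem comp_linner_pos (e : Z ⊗[ℂ] W) : ∃ c, (M.comp N).linner e e = star c * c := by
  rw [← comp_conj_rinner]
  exact comp_rinner_pos _ _ _

theorem comp_rinner_full :
    Dense (Submodule.span ℂ {c | ∃ s t, c = (M.comp N).rinner s t} : Set C) := by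
  refine (N.conj.comp_linner_full M.conj).mono ?_
  refine Submodule.span_le.2 ?_
  rintro _ ⟨s, t, rfl⟩
  have h : ∀ (s t : Conj W ⊗[ℂ] Conj Z), (N.conj.comp M.conj).linner s t ∈
      Submodule.span ℂ {c | ∃ s t, c = (M.comp N).rinner s t} := by
    intro s t
    induction s using TensorProduct.induction_on with
    | zero => simp
    | add s s' h h' => simpa using add_mem h h'
    | tmul w z =>
      induction t using TensorProduct.induction_on with
      | zero => simp
      | add s s' h h' => simpa using add_mem h h'
      | tmul w' z' =>
        refine Submodule.subset_span ⟨Conj.mk.symm z ⊗ₜ Conj.mk.symm w,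
          Conj.mk.symm z' ⊗ₜ Conj.mk.symm w', ?_⟩
        rw [comp_linner_tmul, conj_linner, conj_rsmul, conj_linner, comp_rinner_tmul,
          LinearEquiv.symm_apply_apply, N.rinner_lsmul, star_star]
  exact h s t

theorem comp_isBounded : (M.comp N).IsBounded (NonUnitalStarAlgHom.id ℂ A)
    (NonUnitalStarAlgHom.id ℂ C) where
  dense_left := Function.surjective_id.denseRange
  dense_right := Function.surjective_id.denseRange
  linner_pos := M.comp_linner_pos N
  rinner_pos := M.comp_rinner_pos N
  linner_full := M.comp_linner_full N
  rinner_full := M.comp_rinner_full N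
  lsmul_le := M.comp_lsmul_le N
  rsmul_le := PreBimodule.rsmul_le_of_conj compConj (M.comp_conj_rinner N) (M.comp_conj_lsmul N)
    (N.conj.comp_rinner_pos M.conj) (N.conj.comp_lsmul_le M.conj)

end ImprimitivityBimodule

/-! ### Transitivity of equivariant Morita equivalence -/

section Systems

variable {X : Type u} [Groupoid.{v} X] [TopologicalSpace X] [TopologicalSpace (Quiver.Total X)]

/-- An equivariant bundle is only required to respect inner products. The difference of the two
sides is orthogonal to every `V_γ v`, hence to the whole fibre, so it vanishes. -/
theorem EquivariantBundle.rsmul_V {A B : DynSystem.{u, v, w} X} (Z : EquivariantBundle A B)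
    {x y : X} (g : x ⟶ y) (z : Z.Fiber x) (b : B.Fiber x) :
    (Z.bimod y).rsmul (Z.V g z) (B.act g b) = Z.V g ((Z.bimod x).rsmul z b) := by
  have h : ∀ v, (Z.bimod y).rinner v
      ((Z.bimod y).rsmul (Z.V g z) (B.act g b) - Z.V g ((Z.bimod x).rsmul z b)) = 0 := fun v => by
    obtain ⟨v, rfl⟩ := (Z.V g).surjective v
    rw [map_sub, (Z.bimod y).rinner_rsmul, Z.rinner_V, Z.rinner_V, (Z.bimod x).rinner_rsmul,
      map_mul, sub_self]
  refine sub_eq_zero.1 (norm_eq_zero.1 (pow_eq_zero_iff two_ne_zero |>.1 ?_))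
  rw [← (Z.bimod y).norm_rinner_self, h, norm_zero]

theorem EquivariantBundle.lsmul_V {A B : DynSystem.{u, v, w} X} (Z : EquivariantBundle A B)
    {x y : X} (g : x ⟶ y) (a : A.Fiber x) (z : Z.Fiber x) :
    (Z.bimod y).lsmul (A.act g a) (Z.V g z) = Z.V g ((Z.bimod x).lsmul a z) := by
  have h : (Z.bimod y).lsmul (star (A.act g (star a))) (Z.V g z) =
      Z.V g ((Z.bimod x).lsmul (star (star a)) z) := Z.conj.rsmul_V g (Conj.mk z) (star a)
  rwa [map_star (A.act g), star_star, star_star] at h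

variable [IsLCHGroupoid X] [T2Space X] [LocallyCompactSpace X] [SecondCountableTopology X]

/-- The fibre over `x` is the internal tensor product of the two given fibres, completed. Its inner
products of elementary tensors are built from continuous, equivariant operations of the given
bundles. -/
theorem MoritaEquiv.trans {A B C : DynSystem.{u, v, w} X} (h : MoritaEquiv A B)
    (h' : MoritaEquiv B C) : MoritaEquiv A C := by
  obtain ⟨Z⟩ := h
  obtain ⟨W⟩ := h'
  choose Y i₁ i₂ M ι hι hL hR using fun x =>
    ((Z.bimod x).comp_isBounded (W.bimod x)).exists_completion
  refine moritaEquiv_of_tensor Z.isBundle W.isBundle Z.V W.V Z.V_comp W.V_comp Z.continuous_V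
    W.continuous_V M ι hι (fun x z w => ?_) (fun f f' h h' hf hf' hh hh' => ?_)
    (fun f f' h h' hf hf' hh hh' => ?_) (fun g z z' w w' => ?_) (fun g z z' w w' => ?_)
  · refine (sq_le_sq₀ (norm_nonneg _) (by positivity)).1 ?_
    rw [← (M x).norm_rinner_self, hR]
    refine ((W.bimod x).norm_rinner_le _ _).trans ?_
    refine (mul_le_mul_of_nonneg_left ((W.bimod x).norm_lsmul_le _ _) (norm_nonneg _)).trans ?_
    rw [(Z.bimod x).norm_rinner_self]
    exact le_of_eq (by ring)
  · simp only [hL]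
    exact Z.continuous_linner.comp (f := fun x =>
      (⟨x, (Z.bimod x).rsmul (f x) ((W.bimod x).linner (h x) (h' x)), f' x⟩ : FibProd Z.Fiber Z.Fiber))
      (continuous_induced_rng.2 ((Z.continuous_rsmul.comp (f := fun x =>
        (⟨x, f x, (W.bimod x).linner (h x) (h' x)⟩ : FibProd Z.Fiber B.Fiber))
        (continuous_induced_rng.2 (hf.prodMk (W.continuous_linner.comp (f := fun x =>
          (⟨x, h x, h' x⟩ : FibProd W.Fiber W.Fiber))
          (continuous_induced_rng.2 (hh.prodMk hh')))))).prodMk hf'))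
  · simp only [hR]
    exact W.continuous_rinner.comp (f := fun x =>
      (⟨x, h x, (W.bimod x).lsmul ((Z.bimod x).rinner (f x) (f' x)) (h' x)⟩ :
        FibProd W.Fiber W.Fiber))
      (continuous_induced_rng.2 (hh.prodMk (W.continuous_lsmul.comp (f := fun x =>
        (⟨x, (Z.bimod x).rinner (f x) (f' x), h' x⟩ : FibProd B.Fiber W.Fiber))
        (continuous_induced_rng.2 ((Z.continuous_rinner.comp (f := fun x =>
          (⟨x, f x, f' x⟩ : FibProd Z.Fiber Z.Fiber))
          (continuous_induced_rng.2 (hf.prodMk hf'))).prodMk hh')))))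
  · rw [hL, hL]
    change (Z.bimod _).linner ((Z.bimod _).rsmul (Z.V g z)
      ((W.bimod _).linner (W.V g w) (W.V g w'))) (Z.V g z') =
        A.act g ((Z.bimod _).linner ((Z.bimod _).rsmul z ((W.bimod _).linner w w')) z')
    rw [W.linner_V, Z.rsmul_V, Z.linner_V]
  · rw [hR, hR]
    change (W.bimod _).rinner (W.V g w) ((W.bimod _).lsmul
      ((Z.bimod _).rinner (Z.V g z) (Z.V g z')) (W.V g w')) =
        C.act g ((W.bimod _).rinner w ((W.bimod _).lsmul ((Z.bimod _).rinner z z') w'))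
    rw [Z.rinner_V, W.lsmul_V, W.rinner_V]

end Systems

/-! ### External tensor products of imprimitivity bimodules -/

/-- The tensor product of two sesquilinear forms. -/
def tensorInner {Z W G G' : Type*} [AddCommGroup Z] [Module ℂ Z] [AddCommGroup W] [Module ℂ W]
    [AddCommGroup G] [Module ℂ G] [AddCommGroup G'] [Module ℂ G'] {σ τ : ℂ →+* ℂ}
    (P : Z →ₛₗ[σ] Z →ₛₗ[τ] G) (Q : W →ₛₗ[σ] W →ₛₗ[τ] G') :
    Z ⊗[ℂ] W →ₛₗ[σ] Z ⊗[ℂ] W →ₛₗ[τ] G ⊗[ℂ] G' :=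
  tensorForm (LinearMap.mk₂'ₛₗ _ _ (fun z w => LinearMap.mk₂'ₛₗ _ _
      (fun z' w' => P z z' ⊗ₜ Q w w')
      (by simp [TensorProduct.add_tmul]) (by simp [TensorProduct.smul_tmul'])
      (by simp [TensorProduct.tmul_add]) (by simp))
    (fun z₁ z₂ w => LinearMap.ext₂ fun z' w' => by
      change P (z₁ + z₂) z' ⊗ₜ[ℂ] Q w w' = P z₁ z' ⊗ₜ Q w w' + P z₂ z' ⊗ₜ Q w w'
      rw [map_add, LinearMap.add_apply, TensorProduct.add_tmul])
    (fun k z w => LinearMap.ext₂ fun z' w' => by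
      change P (k • z) z' ⊗ₜ[ℂ] Q w w' = σ k • P z z' ⊗ₜ Q w w'
      rw [map_smulₛₗ, LinearMap.smul_apply, TensorProduct.smul_tmul'])
    (fun z w₁ w₂ => LinearMap.ext₂ fun z' w' => by
      change P z z' ⊗ₜ[ℂ] Q (w₁ + w₂) w' = P z z' ⊗ₜ Q w₁ w' + P z z' ⊗ₜ Q w₂ w'
      rw [map_add, LinearMap.add_apply, TensorProduct.tmul_add])
    (fun k z w => LinearMap.ext₂ fun z' w' => by
      change P z z' ⊗ₜ[ℂ] Q (k • w) w' = σ k • P z z' ⊗ₜ Q w w'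
      rw [map_smulₛₗ, LinearMap.smul_apply, TensorProduct.tmul_smul]))

@[simp]
theorem tensorInner_tmul {Z W G G' : Type*} [AddCommGroup Z] [Module ℂ Z] [AddCommGroup W]
    [Module ℂ W] [AddCommGroup G] [Module ℂ G] [AddCommGroup G'] [Module ℂ G'] {σ τ : ℂ →+* ℂ}
    (P : Z →ₛₗ[σ] Z →ₛₗ[τ] G) (Q : W →ₛₗ[σ] W →ₛₗ[τ] G') (z z' : Z) (w w' : W) :
    tensorInner P Q (z ⊗ₜ w) (z' ⊗ₜ w') = P z z' ⊗ₜ Q w w' := rfl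

namespace ImprimitivityBimodule

variable {A B A' B' Z W : Type w} [NonUnitalCStarAlgebra A] [NonUnitalCStarAlgebra B]
  [NonUnitalCStarAlgebra A'] [NonUnitalCStarAlgebra B'] [NormedAddCommGroup Z] [NormedSpace ℂ Z]
  [NormedAddCommGroup W] [NormedSpace ℂ W] (M : ImprimitivityBimodule A B Z)
  (N : ImprimitivityBimodule A' B' W)

/-- The algebraic external tensor product of imprimitivity bimodules. -/
def tensor : PreBimodule (A ⊗[ℂ] A') (B ⊗[ℂ] B') (Z ⊗[ℂ] W) where
  lsmul := TensorProduct.map₂ M.lsmul N.lsmul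
  rsmul := TensorProduct.map₂ M.rsmul N.rsmul
  linner := tensorInner M.linner N.linner
  rinner := tensorInner M.rinner N.rinner
  mul_lsmul := tensor_ext₃ (by simp [add_mul]) (by simp [mul_add]) (by simp) (by simp) (by simp)
    (by simp) (by simp [M.mul_lsmul, N.mul_lsmul])
  rsmul_mul := tensor_ext₃ (by simp) (by simp [add_mul]) (by simp [mul_add]) (by simp) (by simp)
    (by simp) (by simp [M.rsmul_mul, N.rsmul_mul])
  lsmul_rsmul := tensor_ext₃ (by simp) (by simp) (by simp) (by simp) (by simp)
    (by simp) (by simp [M.lsmul_rsmul, N.lsmul_rsmul])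
  linner_lsmul := tensor_ext₃ (by simp) (by simp) (by simp) (by simp [add_mul]) (by simp [mul_add])
    (by simp [mul_add]) (by simp [M.linner_lsmul, N.linner_lsmul])
  rinner_rsmul := tensor_ext₃ (by simp) (by simp) (by simp) (by simp [add_mul]) (by simp [add_mul])
    (by simp [mul_add]) (by simp [M.rinner_rsmul, N.rinner_rsmul])
  star_linner := tensor_ext₂ (by simp) (by simp) (by simp) (by simp)
    (by simp [M.star_linner, N.star_linner])
  star_rinner := tensor_ext₂ (by simp) (by simp) (by simp) (by simp)
    (by simp [M.star_rinner, N.star_rinner])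
  rinner_lsmul := tensor_ext₃ (by simp) (by simp) (by simp) (by simp) (by simp)
    (by simp) (by simp [M.rinner_lsmul, N.rinner_lsmul])
  linner_rsmul := tensor_ext₃ (by simp) (by simp) (by simp) (by simp) (by simp)
    (by simp) (by simp [M.linner_rsmul, N.linner_rsmul])
  rinner_lsmul_linner v s t u := congrArg _ (by
    revert s t u
    exact tensor_ext₃ (by simp) (by simp) (by simp) (by simp) (by simp) (by simp)
      (by simp [M.linner_lsmul_eq, N.linner_lsmul_eq]))
  linner_lsmul_linner s t u v := congrArg (fun e => tensorInner M.linner N.linner e v) (by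
    revert s t u
    exact tensor_ext₃ (by simp) (by simp) (by simp) (by simp) (by simp) (by simp)
      (by simp [M.linner_lsmul_eq, N.linner_lsmul_eq]))

theorem tensor_linner_tmul (z z' : Z) (w w' : W) :
    (M.tensor N).linner (z ⊗ₜ w) (z' ⊗ₜ w') = M.linner z z' ⊗ₜ N.linner w w' := rfl

theorem tensor_rinner_tmul (z z' : Z) (w w' : W) :
    (M.tensor N).rinner (z ⊗ₜ w) (z' ⊗ₜ w') = M.rinner z z' ⊗ₜ N.rinner w w' := rfl

theorem tensor_lsmul_tmul (a : A) (a' : A') (z : Z) (w : W) :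
    (M.tensor N).lsmul (a ⊗ₜ a') (z ⊗ₜ w) = M.lsmul a z ⊗ₜ N.lsmul a' w := rfl

theorem tensor_rsmul_tmul (b : B) (b' : B') (z : Z) (w : W) :
    (M.tensor N).rsmul (z ⊗ₜ w) (b ⊗ₜ b') = M.rsmul z b ⊗ₜ N.rsmul w b' := rfl

/-- Gram approximation is applied in each factor. For the matrices `star (t i) * t j` and `star (t'
i) * t' j` the double sum is `star c * c` with `c = ∑ g (t i ⊗ t' i)`. -/
theorem tensor_rinner_pos {D : Type*} [NonUnitalCStarAlgebra D] (g : B ⊗[ℂ] B' →⋆ₙₐ[ℂ] D)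
    (e : Z ⊗[ℂ] W) : ∃ c, g ((M.tensor N).rinner e e) = star c * c := by
  obtain ⟨S, rfl⟩ := TensorProduct.exists_finset e
  have e : g ((M.tensor N).rinner (∑ i ∈ S, i.1 ⊗ₜ i.2) (∑ i ∈ S, i.1 ⊗ₜ i.2)) =
      ∑ i ∈ S, ∑ j ∈ S, g (M.rinner i.1 j.1 ⊗ₜ N.rinner i.2 j.2) := by
    simp only [map_sum, LinearMap.sum_apply, tensor_rinner_tmul]
    exact Finset.sum_comm
  rw [e]
  let G : B →ₗ[ℂ] B' →ₗ[ℂ] D := (TensorProduct.mk ℂ B B').compr₂ (g : B ⊗[ℂ] B' →ₗ[ℂ] D)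
  have hG : ∀ b b', G b b' = g (b ⊗ₜ b') := fun _ _ => rfl
  refine M.exists_gram_star_mul_self S (fun i => i.1) (fun i j => G.flip (N.rinner i.2 j.2))
    (fun i j => ‖N.rinner i.2 j.2‖) (fun i j b => ?_) fun t => ?_
  · rw [mul_comm]
    exact norm_starHom_tmul_le g b _
  · refine N.exists_gram_star_mul_self S (fun i => i.2) (fun i j => G (star (t i) * t j))
      (fun i j => ‖star (t i) * t j‖) (fun i j b => norm_starHom_tmul_le g _ b) fun t' => ?_
    refine ⟨∑ i ∈ S, g (t i ⊗ₜ t' i), ?_⟩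
    rw [star_sum, Finset.sum_mul]
    refine Finset.sum_congr rfl fun i _ => ?_
    rw [Finset.mul_sum]
    refine Finset.sum_congr rfl fun j _ => ?_
    rw [hG, ← map_star, ← map_mul, TensorProduct.star_tmul, Algebra.TensorProduct.tmul_mul_tmul]

/-- An elementary tensor acts as a composite of contractive actions of `A` and `A'`, so each element
of the algebraic tensor product acts boundedly. The enveloping property of `f` upgrades this to the
sharp bound by the maximal norm. -/
theorem tensor_lsmul_le {D D' : Type w} [NonUnitalCStarAlgebra D] [NonUnitalCStarAlgebra D']
    {f : A ⊗[ℂ] A' →⋆ₙₐ[ℂ] D} (hf : IsEnveloping f) (g : B ⊗[ℂ] B' →⋆ₙₐ[ℂ] D')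
    (p : Seminorm ℂ (Z ⊗[ℂ] W)) (hp : IsFormSeminorm p ((M.tensor N).rform g)) (a : A ⊗[ℂ] A')
    (e : Z ⊗[ℂ] W) : p ((M.tensor N).lsmul a e) ≤ ‖f a‖ * p e := by
  refine hp.action_le_of_isEnveloping hf (M.tensor N).lsmul (M.tensor N).mul_lsmul
    (fun a s t => by simp only [PreBimodule.rform_apply, (M.tensor N).rinner_lsmul]) (fun a => ?_) a e
  have h1 := hp.action_le (LinearMap.rTensorHom W ∘ₗ M.lsmul)
    (fun a b => tensor_ext₁ (by simp) (by simp) (by simp [M.mul_lsmul]))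
    (fun a => tensor_ext₂ (by simp) (by simp) (by simp) (by simp)
      (by simp [tensor_rinner_tmul, M.rinner_lsmul]))
  have h2 := hp.action_le (LinearMap.lTensorHom Z ∘ₗ N.lsmul)
    (fun a b => tensor_ext₁ (by simp) (by simp) (by simp [N.mul_lsmul]))
    (fun a => tensor_ext₂ (by simp) (by simp) (by simp) (by simp)
      (by simp [tensor_rinner_tmul, N.rinner_lsmul]))
  induction a using TensorProduct.induction_on with
  | zero => exact ⟨0, fun x => by simp⟩
  | add s t hs ht =>
    obtain ⟨C, hC⟩ := hs
    obtain ⟨C', hC'⟩ := ht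
    refine ⟨C + C', fun x => ?_⟩
    rw [map_add, LinearMap.add_apply, add_mul]
    exact (map_add_le_add p _ _).trans (add_le_add (hC x) (hC' x))
  | tmul a a' =>
    refine ⟨‖a‖ * ‖a'‖, fun x => ?_⟩
    have e : ∀ x, (M.tensor N).lsmul (a ⊗ₜ a') x =
        (LinearMap.rTensorHom W ∘ₗ M.lsmul) a ((LinearMap.lTensorHom Z ∘ₗ N.lsmul) a' x) :=
      tensor_ext₁ (by simp) (by simp) (by simp [tensor_lsmul_tmul])
    rw [e, mul_assoc]
    exact (h1 _ _).trans (mul_le_mul_of_nonneg_left (h2 _ _) (norm_nonneg _))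

/-- The conjugation map on an external tensor product. -/
def tensorConj : Z ⊗[ℂ] W →ₗ⋆[ℂ] Conj Z ⊗[ℂ] Conj W :=
  TensorProduct.lift (LinearMap.mk₂'ₛₗ _ _ (fun z w => Conj.mk z ⊗ₜ[ℂ] Conj.mk w)
    (by simp [TensorProduct.add_tmul]) (by intros; rw [map_smulₛₗ, TensorProduct.smul_tmul'])
    (by simp [TensorProduct.tmul_add]) (by intros; rw [map_smulₛₗ, TensorProduct.tmul_smul]))

theorem tensorConj_tmul (z : Z) (w : W) :
    tensorConj (z ⊗ₜ[ℂ] w) = Conj.mk z ⊗ₜ[ℂ] Conj.mk w := rfl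

theorem tensor_conj_rinner : ∀ s t : Z ⊗[ℂ] W,
    (M.conj.tensor N.conj).rinner (tensorConj s) (tensorConj t) = (M.tensor N).linner s t :=
  tensor_ext₂ (by simp) (by simp) (by simp) (by simp) fun z w z' w' => rfl

theorem tensor_conj_lsmul : ∀ (e : Z ⊗[ℂ] W) (b : B ⊗[ℂ] B'),
    tensorConj ((M.tensor N).rsmul e b) =
      (M.conj.tensor N.conj).lsmul (star b) (tensorConj e) :=
  tensor_ext₂ (by simp) (by simp) (by simp) (by simp) fun z w b b' => by
    rw [TensorProduct.star_tmul, tensor_rsmul_tmul, tensorConj_tmul, tensorConj_tmul,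
      tensor_lsmul_tmul, conj_lsmul, conj_lsmul, star_star, star_star]
    rfl

theorem tensor_rinner_full {D : Type w} [NonUnitalCStarAlgebra D] {g : B ⊗[ℂ] B' →⋆ₙₐ[ℂ] D}
    (hg : DenseRange g) :
    Dense (Submodule.span ℂ {c | ∃ s t, c = g ((M.tensor N).rinner s t)} : Set D) := by
  let T := (Submodule.span ℂ {c | ∃ s t, c = g ((M.tensor N).rinner s t)}).topologicalClosure
  have hT : IsClosed (T : Set D) := Submodule.isClosed_topologicalClosure _
  have hc1 : ∀ b' : B', Continuous fun b => g (b ⊗ₜ b') := fun b' =>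
    AddMonoidHomClass.continuous_of_bound
      ((g : B ⊗[ℂ] B' →ₗ[ℂ] D) ∘ₗ (TensorProduct.mk ℂ B B').flip b') ‖b'‖ fun b => by
        rw [mul_comm]; exact norm_starHom_tmul_le g b b'
  have hc2 : ∀ b : B, Continuous fun b' => g (b ⊗ₜ b') := fun b =>
    AddMonoidHomClass.continuous_of_bound
      ((g : B ⊗[ℂ] B' →ₗ[ℂ] D) ∘ₗ TensorProduct.mk ℂ B B' b) ‖b‖ fun b' =>
        norm_starHom_tmul_le g b b'
  have h1 : ∀ z z' b', g (M.rinner z z' ⊗ₜ b') ∈ T := fun z z' b' => by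
    refine hT.closure_subset (map_mem_closure (f := fun b' => g (M.rinner z z' ⊗ₜ b')) (hc2 _)
      (N.rinner_full b') fun b hb => ?_)
    change g (M.rinner z z' ⊗ₜ b) ∈ T
    induction hb using Submodule.span_induction with
    | mem b hb =>
      obtain ⟨w, w', rfl⟩ := hb
      exact Submodule.le_topologicalClosure _ (Submodule.subset_span ⟨z ⊗ₜ w, z' ⊗ₜ w', rfl⟩)
    | zero => simp
    | add b b' _ _ h h' => simpa [TensorProduct.tmul_add] using T.add_mem h h'
    | smul k b _ h => simpa using T.smul_mem k h
  have h2 : ∀ b b', g (b ⊗ₜ b') ∈ T := fun b b' => by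
    refine hT.closure_subset (map_mem_closure (f := fun b => g (b ⊗ₜ b')) (hc1 _)
      (M.rinner_full b) fun b hb => ?_)
    change g (b ⊗ₜ b') ∈ T
    induction hb using Submodule.span_induction with
    | mem b hb =>
      obtain ⟨z, z', rfl⟩ := hb
      exact h1 z z' b'
    | zero => simp
    | add b b' _ _ h h' => simpa [TensorProduct.add_tmul] using T.add_mem h h'
    | smul k b _ h => simpa [← TensorProduct.smul_tmul'] using T.smul_mem k h
  have h3 : ∀ t, g t ∈ T := fun t => by
    induction t using TensorProduct.induction_on with
    | zero => simp
    | add s t hs ht => simpa using T.add_mem hs ht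
    | tmul b b' => exact h2 b b'
  intro d
  exact hT.closure_subset (closure_mono (Set.range_subset_iff.2 h3) (hg d))

theorem tensor_isBounded {D D' : Type w} [NonUnitalCStarAlgebra D] [NonUnitalCStarAlgebra D']
    {f : A ⊗[ℂ] A' →⋆ₙₐ[ℂ] D} (hf : IsEnveloping f) {g : B ⊗[ℂ] B' →⋆ₙₐ[ℂ] D'}
    (hg : IsEnveloping g) : (M.tensor N).IsBounded f g where
  dense_left := hf.1
  dense_right := hg.1
  linner_pos e := by
    rw [← tensor_conj_rinner]
    exact M.conj.tensor_rinner_pos N.conj f _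
  rinner_pos := M.tensor_rinner_pos N g
  linner_full := by
    refine (M.conj.tensor_rinner_full N.conj hf.1).mono (Submodule.span_mono ?_)
    rintro _ ⟨s, t, rfl⟩
    have h : ∀ s : Conj Z ⊗[ℂ] Conj W, ∃ s', tensorConj s' = s := fun s => by
      induction s using TensorProduct.induction_on with
      | zero => exact ⟨0, map_zero _⟩
      | tmul z w => exact ⟨Conj.mk.symm z ⊗ₜ Conj.mk.symm w, rfl⟩
      | add s t hs ht =>
        obtain ⟨s', rfl⟩ := hs
        obtain ⟨t', rfl⟩ := ht
        exact ⟨s' + t', map_add _ _ _⟩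
    obtain ⟨s', rfl⟩ := h s
    obtain ⟨t', rfl⟩ := h t
    exact ⟨s', t', by rw [tensor_conj_rinner]⟩
  rinner_full := M.tensor_rinner_full N hg.1
  lsmul_le := M.tensor_lsmul_le N hf g
  rsmul_le := PreBimodule.rsmul_le_of_conj tensorConj (M.tensor_conj_rinner N)
    (M.tensor_conj_lsmul N) (M.conj.tensor_rinner_pos N.conj f) (M.conj.tensor_lsmul_le N.conj hg f)

end ImprimitivityBimodule

/-! ### Compatibility of tensor products with Morita equivalence -/

section Systems

variable {X : Type u} [Groupoid.{v} X] [TopologicalSpace X] [TopologicalSpace (Quiver.Total X)]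
  [IsLCHGroupoid X] [T2Space X] [LocallyCompactSpace X] [SecondCountableTopology X]

/-- The fibrewise external tensor products of the two bimodules, completed with respect to the
maximal tensor norms on the coefficient algebras, form an equivariant bundle between `C` and `C'`.
-/
theorem FiberTensor.moritaEquiv_of_moritaEquiv {A A' B B' C C' : DynSystem.{u, v, w} X}
    (T : FiberTensor A A' C) (T' : FiberTensor B B' C') (h : MoritaEquiv A B)
    (h' : MoritaEquiv A' B') : MoritaEquiv C C' := by
  obtain ⟨Z⟩ := h
  obtain ⟨W⟩ := h'
  choose Y i₁ i₂ M ι hι hL hR using fun x =>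
    ((Z.bimod x).tensor_isBounded (W.bimod x) (T.isEnveloping x)
      (T'.isEnveloping x)).exists_completion
  refine moritaEquiv_of_tensor Z.isBundle W.isBundle Z.V W.V Z.V_comp W.V_comp Z.continuous_V
    W.continuous_V M ι hι (fun x z w => ?_) (fun f f' h h' hf hf' hh hh' => ?_)
    (fun f f' h h' hf hf' hh hh' => ?_) (fun g z z' w w' => ?_) (fun g z z' w w' => ?_)
  · refine (sq_le_sq₀ (norm_nonneg _) (by positivity)).1 ?_
    rw [← (M x).norm_rinner_self, hR, ImprimitivityBimodule.tensor_rinner_tmul]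
    refine (norm_starHom_tmul_le _ _ _).trans ?_
    rw [(Z.bimod x).norm_rinner_self, (W.bimod x).norm_rinner_self, mul_pow]
  · simp only [hL, ImprimitivityBimodule.tensor_linner_tmul]
    exact T.continuous_tmul_section
      (Z.continuous_linner.comp (f := fun x => (⟨x, f x, f' x⟩ : FibProd Z.Fiber Z.Fiber))
        (continuous_induced_rng.2 (hf.prodMk hf')))
      (W.continuous_linner.comp (f := fun x => (⟨x, h x, h' x⟩ : FibProd W.Fiber W.Fiber))
        (continuous_induced_rng.2 (hh.prodMk hh')))
  · simp only [hR, ImprimitivityBimodule.tensor_rinner_tmul]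
    exact T'.continuous_tmul_section
      (Z.continuous_rinner.comp (f := fun x => (⟨x, f x, f' x⟩ : FibProd Z.Fiber Z.Fiber))
        (continuous_induced_rng.2 (hf.prodMk hf')))
      (W.continuous_rinner.comp (f := fun x => (⟨x, h x, h' x⟩ : FibProd W.Fiber W.Fiber))
        (continuous_induced_rng.2 (hh.prodMk hh')))
  · rw [hL, hL, T.act_tmul, ImprimitivityBimodule.tensor_linner_tmul,
      ImprimitivityBimodule.tensor_linner_tmul, tensorCongr_tmul, Z.linner_V, W.linner_V]
  · rw [hR, hR, T'.act_tmul, ImprimitivityBimodule.tensor_rinner_tmul,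
      ImprimitivityBimodule.tensor_rinner_tmul, tensorCongr_tmul, Z.rinner_V, W.rinner_V]

end Systems

end BrauerSemigroup

end

/-- Equivariant Morita equivalence of `E`-dynamical systems is an equivalence relation, every two
systems have a balanced tensor product with the diagonal action, and
`[A, α][B, β] = [A ⊗_{E⁽⁰⁾} B, α ⊗ β]` is a well defined operation which makes the set of
equivalence classes a commutative monoid with identity `[C₀(E⁽⁰⁾), lt]`. -/
theorem proposition4p3 (X : Type u) [CategoryTheory.Groupoid.{v} X] [TopologicalSpace X]
    [TopologicalSpace (Quiver.Total X)] [BrauerSemigroup.IsLCHGroupoid X] :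
    ∃ h : _root_.Equivalence (BrauerSemigroup.MoritaEquiv (X := X) :
        BrauerSemigroup.DynSystem.{u, v, w} X → BrauerSemigroup.DynSystem.{u, v, w} X → Prop),
      (∀ A B : BrauerSemigroup.DynSystem.{u, v, w} X,
        ∃ C : BrauerSemigroup.DynSystem.{u, v, w} X, BrauerSemigroup.IsBalancedTensor A B C) ∧
      ∃ M : CommMonoid (Quotient (Setoid.mk (BrauerSemigroup.MoritaEquiv (X := X)) h)),
        (∀ A B C : BrauerSemigroup.DynSystem.{u, v, w} X,
          BrauerSemigroup.IsBalancedTensor A B C →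
            M.mul (Quotient.mk _ A) (Quotient.mk _ B) = Quotient.mk _ C) ∧
        M.one = Quotient.mk _ (BrauerSemigroup.trivialSystem.{u, v, w} X) := by
  have := BrauerSemigroup.t2Space_unit X
  have := BrauerSemigroup.locallyCompact_unit X
  have := BrauerSemigroup.secondCountable_unit X
  have hE : _root_.Equivalence (BrauerSemigroup.MoritaEquiv (X := X) :
      BrauerSemigroup.DynSystem.{u, v, w} X → BrauerSemigroup.DynSystem.{u, v, w} X → Prop) :=
    ⟨BrauerSemigroup.MoritaEquiv.refl, BrauerSemigroup.MoritaEquiv.symm,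
      BrauerSemigroup.MoritaEquiv.trans⟩
  -- The operation is defined by a choice of fibrewise tensor products. Their compatibility with
  -- Morita equivalence makes it descend to classes, and the monoid laws are equivalences between
  -- such products.
  choose P hP using fun A B : BrauerSemigroup.DynSystem.{u, v, w} X =>
    BrauerSemigroup.FiberTensor.exists_fiberTensor A B
  have T := fun A B => (hP A B).some
  let S : Setoid (BrauerSemigroup.DynSystem.{u, v, w} X) := ⟨_, hE⟩
  let mul : Quotient S → Quotient S → Quotient S := Quotient.map₂ P
    fun A B h A' B' h' => (T A A').moritaEquiv_of_moritaEquiv (T B B') h h'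
  let one : Quotient S := Quotient.mk S (BrauerSemigroup.trivialSystem.{u, v, w} X)
  have mul_comm : ∀ a b, mul a b = mul b a := fun a b =>
    Quotient.inductionOn₂ a b fun A B => Quotient.sound ((T A B).moritaEquiv_comm (T B A))
  have one_mul : ∀ a, mul one a = a := fun a => Quotient.inductionOn a fun A =>
    Quotient.sound ((T _ A).moritaEquiv (BrauerSemigroup.trivialFiberTensor A))
  refine ⟨hE, BrauerSemigroup.exists_isBalancedTensor,
    { mul := mul
      one := one
      mul_assoc := fun a b c => Quotient.inductionOn₃ a b c fun A B C =>
        Quotient.sound ((T A B).moritaEquiv_assoc (T _ C) (T B C) (T A _))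
      mul_comm := mul_comm
      one_mul := one_mul
      mul_one := fun a => (mul_comm a one).trans (one_mul a) }, ?_, rfl⟩
  -- Any balanced tensor product is a fibrewise maximal one, and these are unique up to Morita
  -- equivalence, so the class does not depend on the realization.
  rintro A B C ⟨F⟩
  exact Quotient.sound ((T A B).moritaEquiv F.fiberTensor)
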